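/- **Notation.** Let $|n\rangle$, $n\ge 0$, be the standard orthonormal basis of $\mathcal F=\ell^2(\mathbb N_0)$, and on finite linear combinations of the $|n\rangle$ let $\mathbf a|n\rangle=\sqrt n\,|n-1\rangle$, $\mathbf a^*|n\rangle=\sqrt{n+1}\,|n+1\rangle$, $f(\mathbf N)|n\rangle=f(n)|n\rangle$. For a measure $\sigma$ on $\mathbb R$ with density $\varrho$ on an open interval $S$ (and $0$ outside) let $P_n$ be the orthonormal polynomials of $L^2(\sigma)$ ($\deg P_n=n$, positive leading coefficient), and $$\widehat\sigma(z)=\int e^{-iz\omega}d\sigma,\quad \widehat\sigma_n(z)=\int e^{-iz\omega}P_n\,d\sigma,\quad \widehat\sigma_{m,n}(z)=\int e^{-iz\omega}P_mP_n\,d\sigma .$$ The maximal strip of $\sigma$ is the largest open connected set, containing $\mathbb R$ and invariant under real translations, to which $\widehat\sigma|_{\mathbb R}$ extends holomorphically; $\Sigma=\{z: 2i\,\mathrm{Im}\,z \text{ is in the maximal strip}\}=\{\mathrm{Im}\,z\in J\}$. A function $w$ on $J$ *solves the weight equation* if $$\varrho(\omega)\int_J w(y)e^{2y\omega}\,dy=1\qquad(\omega\in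 S)$$ with absolutely convergent integrals. It is *the weight* if it also is continuous on $J$ except at finitely many points of each compact subset, with only discontinuities of the first kind, and any other such solution coincides with it at the common continuity points. It is *reproducing* if $w\ge 0$ on $J$ and, with $\Psi_\psi(z)=\int e^{-iz\omega}\overline{\psi(\omega)}\,d\sigma(\omega)$, $$\frac1{2\pi}\int_\Sigma \overline{\Psi_\varphi(z)}\Psi_\psi(z)\,w(y)\,dx\,dy=\int\overline\psi\varphi\,d\sigma,\qquad \frac1{2\pi}\int_\Sigma\widehat\sigma(v-\bar z)\Psi_\psi(z)\,w(y)\,dx\,dy=\Psi_\psi(v)$$ for all $\psi,\varphi\in L^2(\sigma)$, $v\in\Sigma$ ($z=x+iy$), the integrals being absolutely convergent. Let $C>0$ and let $a_0,a_1,b_0,b_1,b_2,a,b$ be real. In each of the three cases below, there is a unique strongly continuous unitary group $e^{-i\mathbf Ht}$ on $\mathcal F$ whose generator extends $-i\mathbf H$, and $\langle m|e^{-i\mathbf Ht}n\rangle=\widehat\sigma_{m,n}(t)$ for all $t\in\mathbb R$; all the integrals defining $\widehat\sigma,\widehat\sigma_n,\widehat\sigma_{m,n}$ converge absolutely, and the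 displayed formulas for them hold, on the maximal strip; the domain $\Sigma$ is as stated. **(H) Hermite**, $a_1/b_0<0$. $\mathbf H=-\frac{a_0}{a_1}+\sqrt{-\frac{b_0}{a_1}}(\mathbf a+\mathbf a^*)$, $\varrho(\omega)=Ce^{\frac{a_1}{2b_0}(\omega+\frac{a_0}{a_1})^2}$, $S=\mathbb R$, $\Sigma=\mathbb C$ (the maximal strip is also $\mathbb C$). $$\widehat\sigma^{Her}(z)=C\sqrt{-\tfrac{2\pi b_0}{a_1}}\,e^{\frac{a_0^2}{2a_1b_0}}e^{\frac{b_0}{2a_1}(z+i\frac{a_0}{b_0})^2},\qquad \widehat\sigma^{Her}_n(z)=c_n(ib_0z)^n\widehat\sigma^{Her}(z),$$ $$\widehat\sigma^{Her}_{m,n}(z)=e^{\frac{b_0}{2a_1}(z+i\frac{a_0}{b_0})^2}e^{\frac{a_0^2}{2a_1b_0}}(-i)^{m+n}\sqrt{\left(-\tfrac{b_0}{a_1}\right)^{m+n}}\sqrt{m!\,n!}\sum_{k=0}^{\min(m,n)}\frac{(a_1/b_0)^kz^{m+n-2k}}{(m-k)!(n-k)!k!},$$ where $c_n=(\mathrm{sgn}\,a_1)^n\left(C\,n!\,(-a_1b_0)^n\sqrt{-2\pi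 b_0/a_1}\right)^{-1/2}$. The weight, which is also reproducing, is $$\mu^{Her}(y)=\frac1Ce^{-\frac{a_0^2}{2b_0a_1}}\sqrt{-\frac{2b_0}{a_1\pi}}\;e^{\frac{2b_0}{a_1}(y+\frac{a_0}{2b_0})^2}.$$ **(L) Laguerre**, $a_1/b_1<0$, $\mu=\frac{a_0b_1-b_0a_1}{b_1^2}>0$. $\mathbf H=-\frac{b_1}{a_1}\mu-\frac{b_0}{b_1}-\frac{2b_1}{a_1}\mathbf N-\frac{b_1}{a_1}\left(\sqrt{\mathbf N+\mu}\,\mathbf a+\mathbf a^*\sqrt{\mathbf N+\mu}\right)$, $\varrho(\omega)=C(\omega+\frac{b_0}{b_1})^{\mu-1}e^{\frac{a_1}{b_1}\omega}$, $S=(-\frac{b_0}{b_1},\infty)$, $\Sigma=\{y<-\frac{a_1}{2b_1}\}$ (maximal strip $\{y<-\frac{a_1}{b_1}\}$). $$\widehat\sigma^{Lag}(z)=C\,\Gamma(\mu)e^{-\frac{b_0a_1}{b_1^2}}\left(iz-\tfrac{a_1}{b_1}\right)^{-\mu}e^{i\frac{b_0}{b_1}z},\qquad \widehat\sigma^{Lag}_n(z)=c_n\left(\frac{b_1z}{z+ia_1/b_1}\right)^n\frac{\Gamma(\mu+n)}{\Gamma(\mu)}\widehat\sigma^{Lag}(z),$$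 $$\widehat\sigma^{Lag}_{m,n}(z)=c_mc_nb_1^{m+n}\frac{\Gamma(\mu+m)\Gamma(\mu+n)}{\Gamma(\mu)^2}\widehat\sigma^{Lag}(z)\sum_{k=0}^m\binom mk\left(\frac{-ia_1}{b_1z+ia_1}\right)^k{}_2F_1\!\left(\mu+k,-n;\mu;\frac{ia_1}{ia_1+b_1z}\right)$$ (principal branch of the power), where $c_n=(\mathrm{sgn}\,a_1)^n\left(C\,n!\,(-a_1b_1)^n(-\tfrac{b_1}{a_1})^{\mu+n}\Gamma(\mu+n)e^{-a_1b_0/b_1^2}\right)^{-1/2}$. For $\mu>1$ the weight, which is also reproducing, is $$\mu^{Lag}(y)=\frac{2e^{b_0a_1/b_1^2}}{C\,\Gamma(\mu-1)}\left(-2y-\tfrac{a_1}{b_1}\right)^{\mu-2}e^{\frac{2b_0}{b_1}y}.$$ **(J) Jacobi**, $a<b$, $b_2>0$, $\mu=\frac{aa_1+a_0}{b_2(b-a)}>0$, $\nu=\frac{ba_1+a_0}{b_2(a-b)}>0$. $\mathbf H=h(\mathbf N)+(b-a)\left(F(\mathbf N)\mathbf a+\mathbf a^*F(\mathbf N)\right)$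 with $$h(n)=\frac{2n(a+b)(\mu+\nu-1)+2n^2(a+b)-2b\mu-2a\nu+\mu\nu(a+b)+b\mu^2+a\nu^2}{(\mu+\nu-2+2n)(\mu+\nu+2n)},$$ $$F(n)=\sqrt{\frac{(\mu+n)(\nu+n)(\mu+\nu+n-1)}{(\mu+\nu+2n-1)(\mu+\nu+2n)^2(\mu+\nu+2n+1)}},$$ where at $n=0$ the common factors are cancelled: $h(0)=\frac{b\mu+a\nu}{\mu+\nu}$, $F(0)=\sqrt{\frac{\mu\nu}{(\mu+\nu)^2(\mu+\nu+1)}}$. $\varrho(\omega)=C(\omega-a)^{\mu-1}(b-\omega)^{\nu-1}$, $S=(a,b)$, $\Sigma=\mathbb C$ (the maximal strip is also $\mathbb C$). $$\widehat\sigma^{Jac}(z)=\widehat\sigma_J(z;\mu,\nu)=C\frac{\Gamma(\mu)\Gamma(\nu)}{\Gamma(\mu+\nu)}(b-a)^{\mu+\nu-1}e^{-iaz}{}_1F_1(\mu;\mu+\nu;(a-b)iz),\quad \widehat\sigma_n^{Jac}(z)=c_n(ib_2z)^n\widehat\sigma_J(z;\mu+n,\nu+n),$$ $$\widehat\sigma^{Jac}_{m,n}(z)=c_mc_n(-b_2)^{m+n}\sum_{k=0}^m\sum_{l=0}^n\binom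 mk\binom nl(-1)^{k+l}\frac{\Gamma(\mu+m)\Gamma(\mu+n)}{\Gamma(\mu+m-k)\Gamma(\mu+n-l)}\frac{\Gamma(\nu+m)\Gamma(\nu+n)}{\Gamma(\nu+k)\Gamma(\nu+l)}\widehat\sigma_J(z;\mu+m+n-k-l,\nu+k+l),$$ where $c_n=(-1)^n\left(C\,n!\,b_2^{2n}(b-a)^{\mu+\nu+2n-1}\frac{\Gamma(\mu+n)\Gamma(\nu+n)}{(\mu+\nu+2n-1)\Gamma(\mu+\nu+n-1)}\right)^{-1/2}$, with $(\mu+\nu-1)\Gamma(\mu+\nu-1)$ read as $\Gamma(\mu+\nu)$ for $n=0$. For $\mu+\nu>3$ the weight is $$\mu^{Jac}(y)=\begin{cases}\displaystyle\frac2C\frac{(b-a)^{1-\frac{\mu+\nu}2}}{\Gamma(\nu-1)}e^{-(b+a)y}(2y)^{\frac{\mu+\nu}2-2}\,W_{\frac{\nu-\mu}2,\frac32-\frac{\mu+\nu}2}\big(2(b-a)y\big),&y>0,\\[2mm]\displaystyle\frac2C\frac{(b-a)^{1-\frac{\mu+\nu}2}}{\Gamma(\mu-1)}e^{-(b+a)y}(-2y)^{\frac{\mu+\nu}2-2}\,W_{\frac{\mu-\nu}2,\frac32-\frac{\mu+\nu}2}\big(-2(b-a)y\big),&y<0,\end{cases}$$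 and it is reproducing if moreover $\mu,\nu\ge1$. Here $1/\Gamma(0)=0$, and $W_{\kappa,\lambda}$ is Whittaker's function, i.e. the solution of $W''=\big(\frac14-\frac\kappa x+\frac{\lambda^2-1/4}{x^2}\big)W$ on $(0,\infty)$ with $W(x)\sim e^{-x/2}x^\kappa$ as $x\to\infty$. In the Gegenbauer case $\mu=\nu$, for all $\mu>1$, $$\mu^{Geg}(y)=\frac2C\left(\frac{2|y|}{b-a}\right)^{\mu-\frac32}e^{-(b+a)y}\frac1{\Gamma(\mu-1)\sqrt\pi}K_{\mu-\frac32}\big((b-a)|y|\big)$$ ($K_\alpha$ the modified Bessel function) solves the weight equation and is reproducing; for $\mu=\nu>\frac32$ and $y\ne0$ it equals $\mu^{Jac}(y)$. -/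

import Mathlib

open MeasureTheory Filter Topology

noncomputable section

namespace PolyHam

/-! ### Fock space, ladder operators, evolution groups -/

/-- The Fock space `ℓ²(ℕ)` with orthonormal basis `|0⟩, |1⟩, …`. -/
abbrev Fock : Type := lp (fun _ : ℕ => ℂ) 2

/-- The occupation number state `|n⟩`. -/
def ket (n : ℕ) : Fock := lp.single 2 n (1 : ℂ)

/-- Finite linear combinations of the `|n⟩`: the common domain of the operators below. -/
abbrev FinFock : Type := ℕ →₀ ℂ

/-- The inclusion of the finite linear combinations into the Fock space. -/
def toFock : FinFock →ₗ[ℂ] Fock :=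
  Finsupp.lsum ℂ fun n : ℕ => LinearMap.toSpanSingleton ℂ Fock (ket n)

/-- Annihilation operator, `a |n⟩ = √n |n-1⟩` (and `a |0⟩ = 0`). -/
def annih : Module.End ℂ FinFock :=
  Finsupp.lsum ℂ fun n : ℕ => ((√(n : ℝ) : ℝ) : ℂ) • Finsupp.lsingle (n - 1)

/-- Creation operator, `a* |n⟩ = √(n+1) |n+1⟩`. -/
def creat : Module.End ℂ FinFock :=
  Finsupp.lsum ℂ fun n : ℕ => ((√((n : ℝ) + 1) : ℝ) : ℂ) • Finsupp.lsingle (n + 1)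

/-- The function `f(N)` of the occupation number operator `N = a* a`, `f(N) |n⟩ = f(n) |n⟩`. -/
def numFn (f : ℕ → ℝ) : Module.End ℂ FinFock :=
  Finsupp.lsum ℂ fun n : ℕ => ((f n : ℝ) : ℂ) • Finsupp.lsingle n

/-- `U t = e^{-iHt}`: a strongly continuous one-parameter unitary group on the Fock space whose
(self-adjoint) generator extends the symmetric operator `H`. -/
structure IsEvolution (H : Module.End ℂ FinFock) (U : ℝ → (Fock ≃ₗᵢ[ℂ] Fock)) : Prop where
  map_zero : ∀ ψ, U 0 ψ = ψ
  map_add : ∀ s t ψ, U (s + t) ψ = U s (U t ψ)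
  continuous : ∀ ψ, Continuous fun t : ℝ => U t ψ
  generator : ∀ x : FinFock,
    HasDerivAt (fun t : ℝ => U t (toFock x)) (-Complex.I • toFock (H x)) 0

/-- Hermite Hamiltonian `-a₀/a₁ + √(-b₀/a₁) (a + a*)`. -/
def hermiteH (a₀ a₁ b₀ : ℝ) : Module.End ℂ FinFock :=
  numFn (fun _ => -(a₀ / a₁)) + ((√(-(b₀ / a₁)) : ℝ) : ℂ) • (annih + creat)

/-- Laguerre Hamiltonian
`-(b₁/a₁) μ - b₀/b₁ - 2 (b₁/a₁) N - (b₁/a₁) (√(N+μ) a + a* √(N+μ))`. -/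
def laguerreH (a₁ b₀ b₁ μ : ℝ) : Module.End ℂ FinFock :=
  numFn (fun n => -(b₁ / a₁) * μ - b₀ / b₁ - 2 * (b₁ / a₁) * n)
    + ((-(b₁ / a₁) : ℝ) : ℂ) •
      (numFn (fun n => √(n + μ)) * annih + creat * numFn (fun n => √(n + μ)))

/-- Diagonal coefficient of the Jacobi Hamiltonian. At `n = 0` the fraction of the second branch
reduces to that of the first one, which also makes sense when `μ + ν = 2`. -/
def jacobiDiag (a b μ ν : ℝ) (n : ℕ) : ℝ :=
  if n = 0 then (b * μ + a * ν) / (μ + ν)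
  else
    (2 * n * (a + b) * (μ + ν - 1) + 2 * (n : ℝ) ^ 2 * (a + b) - 2 * b * μ - 2 * a * ν
        + μ * ν * (a + b) + b * μ ^ 2 + a * ν ^ 2)
      / ((μ + ν - 2 + 2 * n) * (μ + ν + 2 * n))

/-- The function `F` in the off-diagonal part `(b - a) (F(N) a + a* F(N))` of the Jacobi
Hamiltonian. At `n = 0` the factor `μ + ν - 1` cancels, so that the first branch also makes sense
when `μ + ν = 1`. -/
def jacobiOff (μ ν : ℝ) (n : ℕ) : ℝ :=
  if n = 0 then √(μ * ν / ((μ + ν) ^ 2 * (μ + ν + 1)))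
  else
    √((μ + n) * (ν + n) * (μ + ν + n - 1)
      / ((μ + ν + 2 * n - 1) * (μ + ν + 2 * n) ^ 2 * (μ + ν + 2 * n + 1)))

/-- Jacobi Hamiltonian. -/
def jacobiH (a b μ ν : ℝ) : Module.End ℂ FinFock :=
  numFn (jacobiDiag a b μ ν)
    + ((b - a : ℝ) : ℂ) • (numFn (jacobiOff μ ν) * annih + creat * numFn (jacobiOff μ ν))

/-! ### Spectral measures, characteristic functions, orthonormal polynomials -/

/-- The measure with density `ρ` on `S` and zero outside `S`. -/
def weightMeasure (ρ : ℝ → ℝ) (S : Set ℝ) : Measure ℝ :=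
  (volume.restrict S).withDensity fun ω => ENNReal.ofReal (ρ ω)

/-- `σ̂(z) = ∫ e^{-izω} dσ(ω)`. -/
def charFn (σ : Measure ℝ) (z : ℂ) : ℂ :=
  ∫ ω : ℝ, Complex.exp (-Complex.I * z * ω) ∂σ

/-- `P` is the orthonormal polynomial system of `σ`, i.e. the result of the Gram-Schmidt
orthonormalization of `1, ω, ω², …` in `L²(ℝ, σ)`. -/
structure IsOrthonormalSystem (σ : Measure ℝ) (P : ℕ → Polynomial ℝ) : Prop where
  natDegree_eq : ∀ n, (P n).natDegree = n
  leadingCoeff_pos : ∀ n, 0 < (P n).leadingCoeff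
  integrable : ∀ m n, Integrable (fun ω => (P m).eval ω * (P n).eval ω) σ
  orthonormal : ∀ m n, ∫ ω, (P m).eval ω * (P n).eval ω ∂σ = if m = n then 1 else 0

/-- The statement that, for the Hamiltonian `H` with spectral measure `σ` (up to normalization):
* on the domain `D` the characteristic function `σ̂` is `s`;
* on `D`, `σ̂_n(z) = ∫ e^{-izω} P_n dσ` is `sn n z`;
* on `D`, `σ̂_{m,n}(z) = ∫ e^{-izω} P_m P_n dσ` is `smn m n z`;
* the evolution group `e^{-iHt}` exists, and it has the matrix elements
  `⟨m| e^{-iHt} n⟩ = σ̂_{m,n}(t)` (so that in particular it is unique). -/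
def IsSpectralSolution (H : Module.End ℂ FinFock) (σ : Measure ℝ) (D : Set ℂ)
    (s : ℂ → ℂ) (sn : ℕ → ℂ → ℂ) (smn : ℕ → ℕ → ℂ → ℂ) : Prop :=
  (∀ z ∈ D, Integrable (fun ω : ℝ => Complex.exp (-Complex.I * z * ω)) σ ∧ charFn σ z = s z) ∧
  ∃ P : ℕ → Polynomial ℝ, IsOrthonormalSystem σ P ∧
    (∀ n, ∀ z ∈ D,
      Integrable (fun ω : ℝ => Complex.exp (-Complex.I * z * ω) * ((P n).eval ω : ℝ)) σ ∧
      ∫ ω : ℝ, Complex.exp (-Complex.I * z * ω) * ((P n).eval ω : ℝ) ∂σ = sn n z) ∧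
    (∀ m n, ∀ z ∈ D,
      Integrable (fun ω : ℝ =>
        Complex.exp (-Complex.I * z * ω) * ((P m).eval ω * (P n).eval ω : ℝ)) σ ∧
      ∫ ω : ℝ, Complex.exp (-Complex.I * z * ω) * ((P m).eval ω * (P n).eval ω : ℝ) ∂σ
        = smn m n z) ∧
    (∃ U, IsEvolution H U) ∧
    ∀ U, IsEvolution H U → ∀ (t : ℝ) (m n : ℕ),
      inner ℂ (ket m) (U t (ket n)) =
        ∫ ω : ℝ, Complex.exp (-Complex.I * t * ω) * ((P m).eval ω * (P n).eval ω : ℝ) ∂σ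

/-- The maximal strip: the union of all open connected sets which contain the real axis, are
invariant under real translations, and to which `σ̂` extends holomorphically from the real axis. -/
def maximalStrip (σ : Measure ℝ) : Set ℂ :=
  ⋃₀ {V : Set ℂ | IsOpen V ∧ IsConnected V ∧ (∀ t : ℝ, (t : ℂ) ∈ V) ∧
    (∀ z ∈ V, ∀ t : ℝ, z + t ∈ V) ∧
    ∃ F : ℂ → ℂ, DifferentiableOn ℂ F V ∧ ∀ t : ℝ, F t = charFn σ t}

/-- The domain `Σ` of the coherent states, the half of the maximal strip:
`Σ = {r < Im z < s}` if the maximal strip is `{2r < Im z < 2s}`. -/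
def coherentDomain (σ : Measure ℝ) : Set ℂ :=
  {z | 2 * Complex.I * z.im ∈ maximalStrip σ}

/-! ### Reproducing weights -/

/-- `w` solves `(dσ/dω)(ω) ∫_J w(y) e^{2yω} dy = 1` for `ω ∈ S`, where `ρ = dσ/dω`. -/
def SolvesWeightEq (ρ : ℝ → ℝ) (S J : Set ℝ) (w : ℝ → ℝ) : Prop :=
  ∀ ω ∈ S, IntegrableOn (fun y => w y * Real.exp (2 * y * ω)) J ∧
    ρ ω * ∫ y in J, w y * Real.exp (2 * y * ω) = 1

/-- `w` is continuous on the open set `J` except at finitely many points of every compact subset,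
and its discontinuities in `J` are of the first kind. -/
def IsPiecewiseContinuous (w : ℝ → ℝ) (J : Set ℝ) : Prop :=
  (∀ K ⊆ J, IsCompact K → {y ∈ K | ¬ ContinuousAt w y}.Finite) ∧
  ∀ y ∈ J, (∃ l, Tendsto w (𝓝[<] y) (𝓝 l)) ∧ ∃ l, Tendsto w (𝓝[>] y) (𝓝 l)

/-- `w₀` is the solution of the weight equation in the class of piecewise continuous functions
(unique up to its values at discontinuities). -/
def IsTheWeight (ρ : ℝ → ℝ) (S J : Set ℝ) (w₀ : ℝ → ℝ) : Prop :=
  IsPiecewiseContinuous w₀ J ∧ SolvesWeightEq ρ S J w₀ ∧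
  ∀ w : ℝ → ℝ, IsPiecewiseContinuous w J → SolvesWeightEq ρ S J w →
    ∀ y ∈ J, ContinuousAt w y → ContinuousAt w₀ y → w y = w₀ y

/-- The holomorphic representation of `ψ ∈ L²(σ)`: `z ↦ ∫ e^{-izω} conj ψ(ω) dσ(ω)`. -/
def holoRep (σ : Measure ℝ) (ψ : ℝ → ℂ) (z : ℂ) : ℂ :=
  ∫ ω : ℝ, Complex.exp (-Complex.I * z * ω) * (starRingEnd ℂ) (ψ ω) ∂σ

/-- `(2π)⁻¹ w(y) dx dy` is a reproducing measure on `Sig`: it is a positive measure, the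
holomorphic representation is (anti-)isometric into `L²` of it, and `σ̂(v - z̄)` is a reproducing
kernel for the functions in the image. -/
def IsReproducing (σ : Measure ℝ) (Sig : Set ℂ) (w : ℝ → ℝ) : Prop :=
  (∀ z ∈ Sig, 0 ≤ w z.im) ∧
  (∀ ψ φ : ℝ → ℂ, MemLp ψ 2 σ → MemLp φ 2 σ →
    IntegrableOn (fun z : ℂ =>
      (starRingEnd ℂ) (holoRep σ φ z) * holoRep σ ψ z * (w z.im : ℂ)) Sig ∧
    (2 * Real.pi : ℂ)⁻¹ * ∫ z in Sig,
      (starRingEnd ℂ) (holoRep σ φ z) * holoRep σ ψ z * (w z.im : ℂ)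
      = ∫ ω, (starRingEnd ℂ) (ψ ω) * φ ω ∂σ) ∧
  ∀ ψ : ℝ → ℂ, MemLp ψ 2 σ → ∀ v ∈ Sig,
    IntegrableOn (fun z : ℂ =>
      charFn σ (v - (starRingEnd ℂ) z) * holoRep σ ψ z * (w z.im : ℂ)) Sig ∧
    (2 * Real.pi : ℂ)⁻¹ * ∫ z in Sig,
      charFn σ (v - (starRingEnd ℂ) z) * holoRep σ ψ z * (w z.im : ℂ)
      = holoRep σ ψ v

/-! ### Special functions -/

/-- Kummer's confluent hypergeometric function `₁F₁(a; c; z)`. -/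
def kummerF (a c z : ℂ) : ℂ :=
  Complex.Gamma c * Complex.regularizedHGFun {a} {c} z

/-- `w` is, on `(0, ∞)`, the solution of Whittaker's equation
`w'' = (1/4 - κ/x + (m² - 1/4)/x²) w` with `w(x) ∼ e^{-x/2} x^κ` as `x → ∞`. -/
def IsWhittakerW (κ m : ℝ) (w : ℝ → ℝ) : Prop :=
  (∃ w' : ℝ → ℝ, ∀ x > 0, HasDerivAt w (w' x) x ∧
    HasDerivAt w' ((1 / 4 - κ / x + (m ^ 2 - 1 / 4) / x ^ 2) * w x) x) ∧
  Tendsto (fun x => w x / (Real.exp (-x / 2) * x ^ κ)) atTop (𝓝 1)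

/-- Whittaker's function `W_{κ,m}(x)` for real parameters and `x > 0`: the solution (unique on
`(0, ∞)`) of Whittaker's equation which is asymptotic to `e^{-x/2} x^κ`. -/
def whittakerW (κ m : ℝ) : ℝ → ℝ := Classical.epsilon (IsWhittakerW κ m)

/-- The modified Bessel function `K_α(x)` for `x > 0`. -/
def besselK (α x : ℝ) : ℝ :=
  ∫ t in Set.Ioi (0 : ℝ), Real.exp (-x * Real.cosh t) * Real.cosh (α * t)

/-! ### Hermite case -/

def hermiteDensity (C a₀ a₁ b₀ ω : ℝ) : ℝ :=
  C * Real.exp (a₁ / (2 * b₀) * (ω + a₀ / a₁) ^ 2)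

def hermiteMeasure (C a₀ a₁ b₀ : ℝ) : Measure ℝ :=
  weightMeasure (hermiteDensity C a₀ a₁ b₀) Set.univ

def hermiteWeight (C a₀ a₁ b₀ y : ℝ) : ℝ :=
  1 / C * Real.exp (-(a₀ ^ 2 / (2 * b₀ * a₁))) * √(-(2 * b₀ / (a₁ * Real.pi)))
    * Real.exp (2 * b₀ / a₁ * (y + a₀ / (2 * b₀)) ^ 2)

/-- Normalizing constant of Rodrigues' formula; its sign makes the leading coefficient of the
`n`-th orthonormal polynomial positive. -/
def hermiteC (C a₁ b₀ : ℝ) (n : ℕ) : ℝ :=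
  Real.sign a₁ ^ n *
    (C * n.factorial * (-(a₁ * b₀)) ^ n * √(-(Real.pi * (2 * b₀ / a₁)))) ^ (-(1 / 2) : ℝ)

def hermiteS (C a₀ a₁ b₀ : ℝ) (z : ℂ) : ℂ :=
  C * (√(-(Real.pi * (2 * b₀ / a₁))) : ℝ) * Complex.exp (a₀ ^ 2 / (2 * a₁ * b₀))
    * Complex.exp (b₀ / (2 * a₁) * (z + Complex.I * (a₀ / b₀)) ^ 2)

def hermiteSn (C a₀ a₁ b₀ : ℝ) (n : ℕ) (z : ℂ) : ℂ :=
  hermiteC C a₁ b₀ n * (Complex.I * b₀ * z) ^ n * hermiteS C a₀ a₁ b₀ z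

def hermiteSmn (a₀ a₁ b₀ : ℝ) (m n : ℕ) (z : ℂ) : ℂ :=
  Complex.exp (b₀ / (2 * a₁) * (z + Complex.I * (a₀ / b₀)) ^ 2)
    * Complex.exp (a₀ ^ 2 / (2 * a₁ * b₀))
    * (-Complex.I) ^ (m + n) * (√((-(b₀ / a₁)) ^ (m + n)) : ℝ)
    * (√((m.factorial : ℝ) * n.factorial) : ℝ)
    * ∑ k ∈ Finset.range (min m n + 1),
        ((a₁ : ℂ) / b₀) ^ k * z ^ (m + n - 2 * k)
          / ((m - k).factorial * (n - k).factorial * k.factorial)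

/-! ### Laguerre case -/

def laguerreDensity (C a₁ b₀ b₁ μ ω : ℝ) : ℝ :=
  C * (ω + b₀ / b₁) ^ (μ - 1) * Real.exp (a₁ / b₁ * ω)

def laguerreMeasure (C a₁ b₀ b₁ μ : ℝ) : Measure ℝ :=
  weightMeasure (laguerreDensity C a₁ b₀ b₁ μ) (Set.Ioi (-(b₀ / b₁)))

def laguerreWeight (C a₁ b₀ b₁ μ y : ℝ) : ℝ :=
  2 * Real.exp (b₀ * a₁ / b₁ ^ 2) / (C * Real.Gamma (μ - 1))
    * (-(2 * y) - a₁ / b₁) ^ (μ - 2) * Real.exp (2 * b₀ / b₁ * y)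

/-- Normalizing constant of Rodrigues' formula; its sign makes the leading coefficient of the
`n`-th orthonormal polynomial positive. -/
def laguerreC (C a₁ b₀ b₁ μ : ℝ) (n : ℕ) : ℝ :=
  Real.sign a₁ ^ n *
    (C * n.factorial * (-(a₁ * b₁)) ^ n * (-(b₁ / a₁)) ^ (μ + n) * Real.Gamma (μ + n)
      * Real.exp (-(a₁ * b₀ / b₁ ^ 2))) ^ (-(1 / 2) : ℝ)

def laguerreS (C a₁ b₀ b₁ μ : ℝ) (z : ℂ) : ℂ :=
  C * Real.Gamma μ * Real.exp (-(b₀ * a₁ / b₁ ^ 2))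
    * (Complex.I * z - a₁ / b₁) ^ (-(μ : ℂ)) * Complex.exp (b₀ / b₁ * Complex.I * z)

def laguerreSn (C a₁ b₀ b₁ μ : ℝ) (n : ℕ) (z : ℂ) : ℂ :=
  laguerreC C a₁ b₀ b₁ μ n * (b₁ * z / (z + Complex.I * (a₁ / b₁))) ^ n
    * (Real.Gamma (μ + n) / Real.Gamma μ : ℝ) * laguerreS C a₁ b₀ b₁ μ z

def laguerreSmn (C a₁ b₀ b₁ μ : ℝ) (m n : ℕ) (z : ℂ) : ℂ :=
  laguerreC C a₁ b₀ b₁ μ m * laguerreC C a₁ b₀ b₁ μ n * b₁ ^ (m + n)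
    * (Real.Gamma (μ + m) * Real.Gamma (μ + n) / Real.Gamma μ ^ 2 : ℝ)
    * laguerreS C a₁ b₀ b₁ μ z
    * ∑ k ∈ Finset.range (m + 1),
        (m.choose k : ℂ) * (-(Complex.I * a₁ / (b₁ * z + Complex.I * a₁))) ^ k
          * ₂F₁ (μ + k : ℂ) (-n : ℂ) (μ : ℂ) (Complex.I * a₁ / (Complex.I * a₁ + b₁ * z))

/-! ### Jacobi case -/

def jacobiDensity (C a b μ ν ω : ℝ) : ℝ :=
  C * (ω - a) ^ (μ - 1) * (b - ω) ^ (ν - 1)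

def jacobiMeasure (C a b μ ν : ℝ) : Measure ℝ :=
  weightMeasure (jacobiDensity C a b μ ν) (Set.Ioo a b)

/-- Here `1 / Γ(0)` is `0`. The value at `y = 0` is immaterial. -/
def jacobiWeight (C a b μ ν y : ℝ) : ℝ :=
  if 0 < y then
    2 / C * ((b - a) ^ (1 - (μ + ν) / 2) / Real.Gamma (ν - 1)) * Real.exp (-((b + a) * y))
      * (2 * y) ^ ((μ + ν) / 2 - 2)
      * whittakerW ((ν - μ) / 2) (3 / 2 - (μ + ν) / 2) (2 * (b - a) * y)
  else if y < 0 then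
    2 / C * ((b - a) ^ (1 - (μ + ν) / 2) / Real.Gamma (μ - 1)) * Real.exp (-((b + a) * y))
      * (-(2 * y)) ^ ((μ + ν) / 2 - 2)
      * whittakerW ((μ - ν) / 2) (3 / 2 - (μ + ν) / 2) (-(2 * (b - a) * y))
  else 0

def gegenbauerWeight (C a b μ y : ℝ) : ℝ :=
  2 / C * (2 * |y| / (b - a)) ^ (μ - 3 / 2) * Real.exp (-((b + a) * y))
    * (1 / (Real.Gamma (μ - 1) * √Real.pi)) * besselK (μ - 3 / 2) ((b - a) * |y|)

/-- Normalizing constant of Rodrigues' formula; its sign makes the leading coefficient of the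
`n`-th orthonormal polynomial positive. At `n = 0` the factor
`(μ + ν - 1) Γ(μ + ν - 1)` is `Γ(μ + ν)`. -/
def jacobiC (C a b b₂ μ ν : ℝ) (n : ℕ) : ℝ :=
  (-1) ^ n *
    (if n = 0 then
      C * (b - a) ^ (μ + ν - 1) * (Real.Gamma μ * Real.Gamma ν / Real.Gamma (μ + ν))
    else
      C * n.factorial * b₂ ^ (2 * n) * (b - a) ^ (μ + ν + 2 * n - 1)
        * (Real.Gamma (μ + n) * Real.Gamma (ν + n)
          / ((μ + ν + 2 * n - 1) * Real.Gamma (μ + ν + n - 1)))) ^ (-(1 / 2) : ℝ)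

def jacobiS (C a b μ ν : ℝ) (z : ℂ) : ℂ :=
  C * (Real.Gamma μ * Real.Gamma ν / Real.Gamma (μ + ν) : ℝ)
    * ((b - a) ^ (μ + ν - 1) : ℝ) * Complex.exp (-Complex.I * a * z)
    * kummerF μ (μ + ν) ((a - b) * Complex.I * z)

def jacobiSn (C a b b₂ μ ν : ℝ) (n : ℕ) (z : ℂ) : ℂ :=
  jacobiC C a b b₂ μ ν n * (Complex.I * b₂ * z) ^ n * jacobiS C a b (μ + n) (ν + n) z

def jacobiSmn (C a b b₂ μ ν : ℝ) (m n : ℕ) (z : ℂ) : ℂ :=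
  jacobiC C a b b₂ μ ν m * jacobiC C a b b₂ μ ν n * (-b₂) ^ (m + n)
    * ∑ k ∈ Finset.range (m + 1), ∑ l ∈ Finset.range (n + 1),
        (m.choose k : ℂ) * (n.choose l : ℂ) * (-1) ^ (k + l)
          * (Real.Gamma (μ + m) * Real.Gamma (μ + n)
              / (Real.Gamma (μ + m - k) * Real.Gamma (μ + n - l)) : ℝ)
          * (Real.Gamma (ν + m) * Real.Gamma (ν + n)
              / (Real.Gamma (ν + k) * Real.Gamma (ν + l)) : ℝ)
          * jacobiS C a b (μ + m + n - k - l) (ν + k + l) z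

end PolyHam

end

open PolyHam

open PolyHam

/-! All three families come from Pearson's equation `(s ρ)' = τ ρ` with `s` of degree at most two
and `τ` of degree one: `s = b₀` for Hermite, `s = b₀ + b₁ω` for Laguerre, `s = b₂(ω - a)(b - ω)` for
Jacobi. Integrated against `e^{-izω}` it becomes an algebraic identity for the functional `L p = ∫
e^{-izω} p dσ`, in which `d/dω` acts as `p ↦ p' - iz p`. The Rodrigues polynomials `Q_n` are built
so that `n` integrations by parts give `L (p Q_n) = (-1)^n L (D^n p · s^n)`, where `D` is this
twisted derivative (`IsPearson.apply_mul_rodrigues_mul_pow`). For `z = 0` this is orthogonality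
together with the norm; for `p = 1` it is the formula for `σ̂_n`. The products behind `σ̂_{m,n}`
follow either from the same identity (Hermite) or from an explicit expansion of `Q_n` in powers of
the factors of `s` (Laguerre, Jacobi), because multiplying `ρ` by such powers only shifts its
parameters.

The two highest coefficients of `Q_n` determine the three-term recurrence, and its coefficients are
the matrix entries of `H`. Hence `H` is multiplication by `ω` on polynomials, and multiplication by
`e^{-itω}` is an evolution group with the stated matrix elements. Exponential moments of `σ` make
the polynomials dense in `L²(σ)` and make every finite vector analytic for `H` with one common
radius; this forces uniqueness of the group (`evolution_of_threeTerm`, `IsEvolution.unique`).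

The weight equation prescribes a two-sided Laplace transform on an interval, so its solution is
unique (`isTheWeight_of_solves`). A nonnegative solution is reproducing: on the line `Im z = y` the
representation of `ψ` is the Fourier transform of `ρ e^{yω} conj ψ`, so Plancherel and Tonelli yield
`∫ |ψ|² ρ² ∫ w e^{2yω} dy dω`, and the weight equation cancels one factor `ρ`. Polarization gives
the isometry, and taking `φ = e^{-ivω}` gives the reproducing kernel (`isReproducing_of_solves`).

It remains to solve the weight equation. For Hermite and Laguerre this is a Gaussian and a Gamma
integral. For Jacobi the reciprocal `s^{-D}(1-s)^{-A}` of a beta density, with `A = μ - 1` and `D =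
ν - 1`, has to be a two-sided Laplace transform. For `A, D > 0` the transforms of two Tricomi
functions are incomplete beta integrals over complementary intervals, whose sum is the complete one;
nonpositive `A` or `D` is reached by a difference identity (`isBetaLaplacePair_tricomiKernel`).
Whittaker's function is characterized by its equation and its behaviour at infinity, which
identifies it with Tricomi's function and, when `κ = 0`, with a modified Bessel function. -/

open ProbabilityTheory in
theorem MeasureTheory.Measure.eq_of_mgf_eventuallyEq {μ ν : Measure ℝ} [IsFiniteMeasure μ]
    [IsFiniteMeasure ν] (hμ : 0 ∈ interior (integrableExpSet id μ))
    (hν : 0 ∈ interior (integrableExpSet id ν)) (h : mgf id μ =ᶠ[𝓝 0] mgf id ν) : μ = ν := by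
  set D : Set ℂ := {z | z.re ∈ interior (integrableExpSet id μ) ∩ interior (integrableExpSet id ν)}
  have hA : AnalyticOnNhd ℂ (complexMGF id μ) D :=
    analyticOnNhd_complexMGF.mono fun z hz => hz.1
  have hB : AnalyticOnNhd ℂ (complexMGF id ν) D :=
    analyticOnNhd_complexMGF.mono fun z hz => hz.2
  have hD : IsPreconnected D :=
    ((convex_integrableExpSet.interior.inter convex_integrableExpSet.interior).linear_preimage
      Complex.reLm).isPreconnected
  -- Both transforms are analytic on a vertical strip and agree on a real neighbourhood of `0`, so
  -- they agree throughout. The strip contains the imaginary axis, where they are the characteristic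
  -- functions.
  have key : Set.EqOn (complexMGF id μ) (complexMGF id ν) D := by
    refine hA.eqOn_of_preconnected_of_frequently_eq hB hD (z₀ := 0) ⟨by simpa, by simpa⟩ ?_
    have h1 : ∃ᶠ x : ℝ in 𝓝[≠] 0, complexMGF id μ x = complexMGF id ν x := by
      refine Eventually.frequently ?_
      filter_upwards [h.filter_mono nhdsWithin_le_nhds] with x hx
      rw [complexMGF_ofReal, complexMGF_ofReal, hx]
    have h2 : Tendsto (fun x : ℝ => (x : ℂ)) (𝓝[≠] 0) (𝓝[≠] 0) := by
      refine tendsto_nhdsWithin_iff.2 ⟨?_, ?_⟩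
      · exact (Complex.continuous_ofReal.tendsto' 0 0 (by simp)).mono_left nhdsWithin_le_nhds
      · filter_upwards [self_mem_nhdsWithin] with x hx
        simpa using hx
    exact h2.frequently h1
  refine Measure.ext_of_charFun (funext fun t => ?_)
  rw [← complexMGF_id_mul_I, ← complexMGF_id_mul_I]
  exact key ⟨by simpa using hμ, by simpa using hν⟩

/-! ### Uniqueness for Laplace transforms and for moments -/

section Uniqueness

open ProbabilityTheory

variable {μ : Measure ℝ} {g : ℝ → ℝ} {δ : ℝ}

theorem aemeasurable_of_integrable_mul_exp {t : ℝ}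
    (h : Integrable (fun y => g y * Real.exp (t * y)) μ) : AEMeasurable g μ := by
  have := h.aemeasurable.mul (f := fun y => g y * Real.exp (t * y))
    (g := fun y => Real.exp (-(t * y))) (by fun_prop)
  refine this.congr (ae_of_all _ fun y => ?_)
  simp [mul_assoc, ← Real.exp_add]

theorem integrable_smul_ofReal (hg : AEMeasurable g μ) {k : ℝ → ℝ} (hk : AEMeasurable k μ)
    (h : Integrable (fun y => g y * k y) μ) :
    Integrable (fun y => (ENNReal.ofReal (g y)).toReal • k y) μ := by
  refine h.mono ?_ (ae_of_all _ fun y => ?_)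
  · exact (hg.ennreal_ofReal.ennreal_toReal.mul hk).aestronglyMeasurable
  · simp only [ENNReal.toReal_ofReal', smul_eq_mul, norm_mul]
    gcongr
    rw [Real.norm_eq_abs, Real.norm_eq_abs, abs_of_nonneg (le_max_right _ _)]
    exact max_le (le_abs_self _) (abs_nonneg _)

theorem mem_integrableExpSet_withDensity_ofReal {t : ℝ}
    (h : Integrable (fun y => g y * Real.exp (t * y)) μ) :
    t ∈ integrableExpSet id (μ.withDensity fun y => ENNReal.ofReal (g y)) := by
  have hg := aemeasurable_of_integrable_mul_exp h
  change Integrable _ _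
  rw [integrable_withDensity_iff_integrable_smul₀' hg.ennreal_ofReal (by simp)]
  exact integrable_smul_ofReal hg (by fun_prop) h

/-- Since `ENNReal.ofReal` truncates at zero, the two measures carry the positive and negative parts
of `g`. A signed density is thereby treated as a difference of genuine measures. -/
theorem integral_withDensity_ofReal_sub (hg : AEMeasurable g μ) {k : ℝ → ℝ}
    (hk : AEMeasurable k μ) (h : Integrable (fun y => g y * k y) μ) :
    ∫ y, k y ∂(μ.withDensity fun y => ENNReal.ofReal (g y))
      - ∫ y, k y ∂(μ.withDensity fun y => ENNReal.ofReal (-g y)) = ∫ y, g y * k y ∂μ := by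
  have hg' : AEMeasurable (fun y => -g y) μ := hg.neg
  rw [integral_withDensity_eq_integral_toReal_smul₀ hg.ennreal_ofReal (by simp),
    integral_withDensity_eq_integral_toReal_smul₀ hg'.ennreal_ofReal (by simp),
    ← integral_sub]
  · refine integral_congr_ae (ae_of_all _ fun y => ?_)
    simp only [ENNReal.toReal_ofReal', smul_eq_mul, ← sub_mul, max_zero_sub_max_neg_zero_eq_self]
  · exact integrable_smul_ofReal hg hk h
  · exact integrable_smul_ofReal hg' hk (by simpa using h.neg)

/-- Equal generating functions make the measures with densities `g⁺` and `g⁻` equal; then `g⁺ = g⁻`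
almost everywhere, and their difference is `g`. -/
theorem ae_eq_zero_of_mgf_pos_neg (hδ : 0 < δ)
    (hint : ∀ t ∈ Set.Ioo (-δ) δ, Integrable (fun y => g y * Real.exp (t * y)) μ)
    (h : mgf id (μ.withDensity fun y => ENNReal.ofReal (g y)) =ᶠ[𝓝 0]
      mgf id (μ.withDensity fun y => ENNReal.ofReal (-g y))) : g =ᵐ[μ] 0 := by
  have h0 : Integrable g μ := by simpa using hint 0 (by simp [hδ])
  have : IsFiniteMeasure (μ.withDensity fun y => ENNReal.ofReal (g y)) :=
    isFiniteMeasure_withDensity_ofReal h0.2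
  have : IsFiniteMeasure (μ.withDensity fun y => ENNReal.ofReal (-g y)) :=
    isFiniteMeasure_withDensity_ofReal h0.neg.2
  have hnhds : Set.Ioo (-δ) δ ∈ 𝓝 (0 : ℝ) := Ioo_mem_nhds (by linarith) hδ
  have heq := Measure.eq_of_mgf_eventuallyEq
    (mem_interior_iff_mem_nhds.2 (mem_of_superset hnhds fun t ht =>
      mem_integrableExpSet_withDensity_ofReal (hint t ht)))
    (mem_interior_iff_mem_nhds.2 (mem_of_superset hnhds fun t ht =>
      mem_integrableExpSet_withDensity_ofReal (g := fun y => -g y)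
        (by simpa using (hint t ht).neg))) h
  have hg := h0.aemeasurable
  have hg' : AEMeasurable (fun y => -g y) μ := hg.neg
  have := (withDensity_eq_iff hg.ennreal_ofReal hg'.ennreal_ofReal
    (by simpa [hasFiniteIntegral_iff_norm] using (h0.pos_part.lintegral_lt_top.ne))).1 heq
  filter_upwards [this] with y hy
  have := congrArg ENNReal.toReal hy
  simp only [ENNReal.toReal_ofReal'] at this
  have h2 := max_zero_sub_max_neg_zero_eq_self (g y)
  rw [this, sub_self] at h2
  exact h2.symm

/-- A function whose bilateral Laplace transform vanishes on an interval vanishes. -/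
theorem ae_eq_zero_of_laplace_eq_zero {c : ℝ} (hδ : 0 < δ)
    (hint : ∀ t ∈ Set.Ioo (c - δ) (c + δ), Integrable (fun y => g y * Real.exp (t * y)) μ)
    (h : ∀ t ∈ Set.Ioo (c - δ) (c + δ), ∫ y, g y * Real.exp (t * y) ∂μ = 0) : g =ᵐ[μ] 0 := by
  -- Tilting by `e^{cy}` moves the centre of the interval from `c` to `0`.
  set k : ℝ → ℝ := fun y => g y * Real.exp (c * y) with hk
  have hkt : ∀ t y, k y * Real.exp (t * y) = g y * Real.exp ((c + t) * y) := fun t y => by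
    rw [hk, mul_assoc, ← Real.exp_add, add_mul]
  have hint' : ∀ t ∈ Set.Ioo (-δ) δ, Integrable (fun y => k y * Real.exp (t * y)) μ := by
    intro t ht
    simp_rw [hkt]
    exact hint _ ⟨by linarith [ht.1], by linarith [ht.2]⟩
  have hkm : AEMeasurable k μ :=
    aemeasurable_of_integrable_mul_exp (hint' 0 (by simp [hδ]))
  have key : k =ᵐ[μ] 0 := by
    refine ae_eq_zero_of_mgf_pos_neg hδ hint' ?_
    filter_upwards [Ioo_mem_nhds (by linarith : -δ < 0) hδ] with t ht
    refine sub_eq_zero.1 ((integral_withDensity_ofReal_sub hkm (k := fun y => Real.exp (t * y))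
      (by fun_prop) (hint' t ht)).trans ?_)
    simp_rw [hkt]
    exact h _ ⟨by linarith [ht.1], by linarith [ht.2]⟩
  filter_upwards [key] with y hy
  simpa [hk] using hy

/-- A function with exponential moments all of whose moments vanish is zero. -/
theorem ae_eq_zero_of_moments_eq_zero (hδ : 0 < δ)
    (hint : ∀ t ∈ Set.Ioo (-δ) δ, Integrable (fun y => g y * Real.exp (t * y)) μ)
    (h : ∀ n : ℕ, ∫ y, g y * y ^ n ∂μ = 0) : g =ᵐ[μ] 0 := by
  have hnhds : Set.Ioo (-δ) δ ∈ 𝓝 (0 : ℝ) := Ioo_mem_nhds (by linarith) hδ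
  have hint' : ∀ t ∈ Set.Ioo (-δ) δ, Integrable (fun y => -g y * Real.exp (t * y)) μ :=
    fun t ht => by simpa using (hint t ht).neg
  have h1 := mem_interior_iff_mem_nhds.2 (mem_of_superset hnhds fun t ht =>
      mem_integrableExpSet_withDensity_ofReal (hint t ht))
  have h2 := mem_interior_iff_mem_nhds.2 (mem_of_superset hnhds fun t ht =>
      mem_integrableExpSet_withDensity_ofReal (hint' t ht))
  have hg : AEMeasurable g μ := aemeasurable_of_integrable_mul_exp (hint 0 (by simp [hδ]))
  have hg' : AEMeasurable (fun y => -g y) μ := hg.neg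
  refine ae_eq_zero_of_mgf_pos_neg hδ hint ?_
  have hp : ∀ n : ℕ, ∫ y, y ^ n ∂(μ.withDensity fun y => ENNReal.ofReal (g y))
      = ∫ y, y ^ n ∂(μ.withDensity fun y => ENNReal.ofReal (-g y)) := by
    intro n
    have hi : Integrable (fun y => g y * y ^ n) μ := by
      have e1 := integrable_pow_of_mem_interior_integrableExpSet h1 n
      have e2 := integrable_pow_of_mem_interior_integrableExpSet h2 n
      rw [integrable_withDensity_iff_integrable_smul₀' hg.ennreal_ofReal (by simp)] at e1
      rw [integrable_withDensity_iff_integrable_smul₀' hg'.ennreal_ofReal (by simp)] at e2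
      refine (e1.sub e2).congr (ae_of_all _ fun y => ?_)
      simp only [ENNReal.toReal_ofReal', smul_eq_mul, ← sub_mul, id, Pi.sub_apply,
        max_zero_sub_max_neg_zero_eq_self]
    exact sub_eq_zero.1 ((integral_withDensity_ofReal_sub hg (k := fun y => y ^ n)
      (by fun_prop) hi).trans (h n))
  -- Near `0` a generating function is the sum of its Taylor series, whose coefficients are the
  -- moments; these agree by `hp`.
  have f1 := (hasFPowerSeriesAt_mgf h1).eventually_hasSum
  have f2 := (hasFPowerSeriesAt_mgf h2).eventually_hasSum
  simp only [id, zero_mul, Real.exp_zero, mul_one, hp, zero_add] at f1 f2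
  filter_upwards [f1, f2] with t ht1 ht2 using ht1.unique ht2

/-- Complex-valued version of `ae_eq_zero_of_moments_eq_zero`. -/
theorem ae_eq_zero_of_complex_moments_eq_zero {f : ℝ → ℂ} (hδ : 0 < δ)
    (hint : ∀ t ∈ Set.Ioo (-δ) δ, Integrable (fun y => f y * Real.exp (t * y)) μ)
    (hpow : ∀ n : ℕ, Integrable (fun y => f y * (y : ℂ) ^ n) μ)
    (h : ∀ n : ℕ, ∫ y, f y * (y : ℂ) ^ n ∂μ = 0) : f =ᵐ[μ] 0 := by
  have hre : (fun y => (f y).re) =ᵐ[μ] 0 := by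
    refine ae_eq_zero_of_moments_eq_zero hδ (fun t ht => ?_) fun n => ?_
    · refine (hint t ht).re.congr (ae_of_all _ fun y => ?_)
      exact Complex.re_mul_ofReal _ _
    · have := congrArg Complex.re (h n)
      rw [← RCLike.re_eq_complex_re, ← integral_re (hpow n)] at this
      simpa [← Complex.ofReal_pow] using this
  have him : (fun y => (f y).im) =ᵐ[μ] 0 := by
    refine ae_eq_zero_of_moments_eq_zero hδ (fun t ht => ?_) fun n => ?_
    · refine (hint t ht).im.congr (ae_of_all _ fun y => ?_)
      exact Complex.im_mul_ofReal _ _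
    · have := congrArg Complex.im (h n)
      rw [← RCLike.im_eq_complex_im, ← integral_im (hpow n)] at this
      simpa [← Complex.ofReal_pow] using this
  filter_upwards [hre, him] with y h1 h2
  exact Complex.ext h1 h2

end Uniqueness

/-! ### Measures with a density -/

section WeightMeasure

variable {ρ : ℝ → ℝ} {S : Set ℝ} {E : Type*} [NormedAddCommGroup E] [NormedSpace ℝ E]

theorem integral_weightMeasure (hm : Measurable ρ) (hS : MeasurableSet S) (hρ : ∀ ω ∈ S, 0 ≤ ρ ω)
    (f : ℝ → E) : ∫ ω, f ω ∂(weightMeasure ρ S) = ∫ ω in S, ρ ω • f ω := by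
  rw [weightMeasure, integral_withDensity_eq_integral_toReal_smul₀
    hm.ennreal_ofReal.aemeasurable (by simp)]
  refine setIntegral_congr_fun hS fun ω hω => ?_
  simp only [ENNReal.toReal_ofReal (hρ ω hω)]

theorem integrable_weightMeasure_iff (hm : Measurable ρ) (hS : MeasurableSet S)
    (hρ : ∀ ω ∈ S, 0 ≤ ρ ω) (f : ℝ → E) :
    Integrable f (weightMeasure ρ S) ↔ IntegrableOn (fun ω => ρ ω • f ω) S := by
  rw [weightMeasure, integrable_withDensity_iff_integrable_smul₀'
    hm.ennreal_ofReal.aemeasurable (by simp)]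
  refine integrableOn_congr_fun (fun ω hω => ?_) hS
  simp only [ENNReal.toReal_ofReal (hρ ω hω)]

theorem ae_weightMeasure_mem (hS : MeasurableSet S) : ∀ᵐ ω ∂(weightMeasure ρ S), ω ∈ S :=
  (withDensity_absolutelyContinuous _ _).ae_le (ae_restrict_mem hS)

end WeightMeasure

/-! ### Characteristic functions and maximal strips -/

theorem charFn_eq_complexMGF (σ : Measure ℝ) (z : ℂ) :
    charFn σ z = ProbabilityTheory.complexMGF id σ (-Complex.I * z) := rfl

theorem maximalStrip_eq_univ {σ : Measure ℝ}
    (h : ∀ t : ℝ, Integrable (fun ω => Real.exp (t * ω)) σ) : maximalStrip σ = Set.univ := by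
  refine Set.eq_univ_of_univ_subset (Set.subset_sUnion_of_mem ?_)
  refine ⟨isOpen_univ, isConnected_univ, by simp, by simp, charFn σ, ?_, fun _ => rfl⟩
  have hu : ProbabilityTheory.integrableExpSet id σ = Set.univ := Set.eq_univ_of_forall h
  have := ProbabilityTheory.differentiableOn_complexMGF (X := id) (μ := σ)
  simp only [hu, interior_univ, Set.mem_univ, Set.ofPred_true] at this
  refine this.comp (f := fun z => -Complex.I * z) ?_ (fun _ _ => Set.mem_univ _)
  fun_prop

theorem coherentDomain_eq_univ {σ : Measure ℝ}
    (h : ∀ t : ℝ, Integrable (fun ω => Real.exp (t * ω)) σ) : coherentDomain σ = Set.univ := by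
  simp [coherentDomain, maximalStrip_eq_univ h]

/-! ### Uniqueness of the weight -/

theorem eq_zero_of_ae_eq_zero_of_continuousAt {f : ℝ → ℝ} {J : Set ℝ} (hJ : IsOpen J)
    (hf : f =ᵐ[volume.restrict J] 0) {y : ℝ} (hy : y ∈ J) (hc : ContinuousAt f y) : f y = 0 := by
  by_contra hne
  have h1 : ∀ᶠ u in 𝓝 y, u ∈ J ∧ f u ≠ 0 :=
    (hJ.eventually_mem hy).and (hc.eventually_ne hne)
  obtain ⟨U, hU, hUo, hyU⟩ := eventually_nhds_iff.1 h1
  have h2 : volume U = 0 := by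
    have h3 := (ae_restrict_iff' hJ.measurableSet).1 hf
    refine measure_mono_null (fun u hu => ?_) h3
    exact fun h => (hU u hu).2 (h (hU u hu).1)
  exact (hUo.measure_pos volume ⟨y, hyU⟩).ne' h2

/-- With `t = 2ω` the equation fixes the Laplace transform of `w` on an interval of length `4δ`,
since `ρ` cannot vanish where a product with it equals `1`. The difference of two solutions has zero
transform, hence vanishes almost everywhere on `J`, and therefore at each point of continuity. -/
theorem isTheWeight_of_solves {ρ w₀ : ℝ → ℝ} {S J : Set ℝ} {c δ : ℝ} (hδ : 0 < δ)
    (hS : Set.Ioo (c - δ) (c + δ) ⊆ S) (hJ : IsOpen J) (hp : IsPiecewiseContinuous w₀ J)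
    (hw : SolvesWeightEq ρ S J w₀) : IsTheWeight ρ S J w₀ := by
  refine ⟨hp, hw, fun w _ hw' y hy hc hc₀ => ?_⟩
  have key : (fun y => w y - w₀ y) =ᵐ[volume.restrict J] 0 := by
    have hmem : ∀ t ∈ Set.Ioo (2 * c - 2 * δ) (2 * c + 2 * δ), t / 2 ∈ S := fun t ht =>
      hS ⟨by linarith [ht.1], by linarith [ht.2]⟩
    have hexp : ∀ t y : ℝ, 2 * y * (t / 2) = t * y := fun t y => by ring
    refine ae_eq_zero_of_laplace_eq_zero (c := 2 * c) (δ := 2 * δ) (by linarith) ?_ ?_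
    · intro t ht
      have h1 := (hw _ (hmem t ht)).1
      have h2 := (hw' _ (hmem t ht)).1
      simp only [hexp] at h1 h2
      simpa [sub_mul] using! h2.sub h1
    · intro t ht
      have h1 := hw _ (hmem t ht)
      have h2 := hw' _ (hmem t ht)
      simp only [hexp] at h1 h2
      simp only [sub_mul]
      rw [integral_sub h2.1 h1.1, sub_eq_zero]
      have hne : ρ (t / 2) ≠ 0 := left_ne_zero_of_mul_eq_one h1.2
      exact mul_left_cancel₀ hne (h2.2.trans h1.2.symm)
  exact sub_eq_zero.1 (eq_zero_of_ae_eq_zero_of_continuousAt hJ key hy (hc.sub hc₀))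

/-! ### Plancherel's theorem for integrable functions -/

section Plancherel

open FourierTransform SchwartzMap

/-- Links the abstract transform on `L²` with the Fourier integral. Both are tested against smooth
compactly supported functions: the former through tempered distributions, the latter by moving the
integral onto the test function. -/
theorem fourier_toLp_ae_eq {f : ℝ → ℂ} (hf : Integrable f) (hf2 : MemLp f 2) :
    (𝓕 (hf2.toLp f) : Lp ℂ 2 (volume : Measure ℝ)) =ᵐ[volume] 𝓕 f := by
  have hc : Continuous (𝓕 f) := VectorFourier.fourierIntegral_continuous
    Real.continuous_fourierChar (by fun_prop) hf
  refine ae_eq_of_integral_contDiff_smul_eq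
    ((Lp.memLp _).locallyIntegrable (by norm_num)) hc.locallyIntegrable fun g hg hgc => ?_
  have hg₁ : HasCompactSupport (Complex.ofRealCLM ∘ g) := hgc.comp_left rfl
  have hg₂ : ContDiff ℝ (⊤ : ℕ∞) (Complex.ofRealCLM ∘ g) := by fun_prop
  set G : 𝓢(ℝ, ℂ) := hg₁.toSchwartzMap hg₂
  have hG : ∀ x, G x = (g x : ℂ) := fun x => rfl
  have h1 := congrArg (fun T => T G) (Lp.fourier_toTemperedDistribution_eq (hf2.toLp f))
  simp only [TemperedDistribution.fourier_apply, Lp.toTemperedDistribution_apply] at h1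
  have h2 : ∫ x, 𝓕 f x * G x = ∫ x, f x * 𝓕 (G : ℝ → ℂ) x := by
    simpa using! VectorFourier.integral_fourierIntegral_smul_eq_flip (L := innerₗ ℝ)
      Real.continuous_fourierChar continuous_inner hf G.integrable
  simp only [← Complex.coe_smul, ← hG]
  rw [← h1]
  simp only [smul_eq_mul]
  simp only [mul_comm (G _)]
  rw [h2]
  refine integral_congr_ae ?_
  filter_upwards [hf2.coeFn_toLp] with x hx
  rw [hx, SchwartzMap.fourier_coe, mul_comm]

theorem lintegral_enorm_sq_fourier {f : ℝ → ℂ} (hf : Integrable f) (hf2 : MemLp f 2) :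
    ∫⁻ x, ‖𝓕 f x‖ₑ ^ 2 = ∫⁻ x, ‖f x‖ₑ ^ 2 := by
  have h1 := Lp.norm_fourier_eq (hf2.toLp f)
  have h3 : eLpNorm (𝓕 f) 2 volume = eLpNorm f 2 volume := by
    rw [← eLpNorm_congr_ae (fourier_toLp_ae_eq hf hf2), ← eLpNorm_congr_ae hf2.coeFn_toLp]
    rw [Lp.norm_def, Lp.norm_def] at h1
    exact (ENNReal.toReal_eq_toReal_iff' (Lp.eLpNorm_ne_top _) (Lp.eLpNorm_ne_top _)).1 h1
  have h4 := eLpNorm_nnreal_pow_eq_lintegral (f := 𝓕 f) (μ := volume) (p := 2) (by norm_num)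
  have h5 := eLpNorm_nnreal_pow_eq_lintegral (f := f) (μ := volume) (p := 2) (by norm_num)
  simp only [NNReal.coe_ofNat, ENNReal.coe_ofNat, ENNReal.rpow_ofNat] at h4 h5
  rw [← h4, ← h5, h3]

end Plancherel

/-! ### Plancherel on horizontal lines and the reproducing property -/

section Reproducing

open FourierTransform

variable {ρ w : ℝ → ℝ} {S J : Set ℝ} {ψ : ℝ → ℂ}

theorem PolyHam.SolvesWeightEq.aemeasurable (hw : SolvesWeightEq ρ S J w) (hne : S.Nonempty) :
    AEMeasurable w (volume.restrict J) := by
  obtain ⟨ω, hω⟩ := hne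
  refine aemeasurable_of_integrable_mul_exp (t := 2 * ω) (((hw ω hω).1).congr ?_)
  exact ae_of_all _ fun y => by ring_nf

theorem PolyHam.SolvesWeightEq.lintegral (hρ : ∀ ω ∈ S, 0 ≤ ρ ω) (hw : SolvesWeightEq ρ S J w)
    (hJ : MeasurableSet J) (hw0 : ∀ y ∈ J, 0 ≤ w y) {ω : ℝ} (hω : ω ∈ S) :
    ENNReal.ofReal (ρ ω) *
      ∫⁻ y in J, ENNReal.ofReal (w y) * ENNReal.ofReal (Real.exp (2 * y * ω)) = 1 := by
  obtain ⟨h1, h2⟩ := hw ω hω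
  have : ∫⁻ y in J, ENNReal.ofReal (w y) * ENNReal.ofReal (Real.exp (2 * y * ω))
      = ENNReal.ofReal (∫ y in J, w y * Real.exp (2 * y * ω)) := by
    rw [ofReal_integral_eq_lintegral_ofReal h1]
    · refine setLIntegral_congr_fun hJ fun y hy => ?_
      simp only [ENNReal.ofReal_mul (hw0 y hy)]
    · filter_upwards [ae_restrict_mem hJ] with y hy
      exact mul_nonneg (hw0 y hy) (Real.exp_pos _).le
  rw [this, ← ENNReal.ofReal_mul (hρ ω hω), h2, ENNReal.ofReal_one]

/-- The function whose Fourier transform is the restriction of the holomorphic representation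
of `ψ` to the line `Im z = y`. -/
noncomputable def lineFn (ρ : ℝ → ℝ) (S : Set ℝ) (ψ : ℝ → ℂ) (y : ℝ) : ℝ → ℂ :=
  S.indicator fun ω => ((ρ ω * Real.exp (y * ω) : ℝ) : ℂ) * (starRingEnd ℂ) (ψ ω)

theorem memLp_two_exp {σ : Measure ℝ} {y : ℝ} (h : Integrable (fun ω => Real.exp (2 * y * ω)) σ) :
    MemLp (fun ω : ℝ => (Real.exp (y * ω) : ℂ)) 2 σ := by
  rw [memLp_two_iff_integrable_sq_norm (by fun_prop)]
  refine h.congr (ae_of_all _ fun ω => ?_)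
  simp only [Complex.norm_real, Real.norm_eq_abs, Real.abs_exp, ← Real.exp_nat_mul]
  push_cast; ring_nf

theorem MemLp.star_two {σ : Measure ℝ} (hψ : MemLp ψ 2 σ) :
    MemLp (fun ω => (starRingEnd ℂ) (ψ ω)) 2 σ := hψ.star

theorem integrable_lineFn (hm : Measurable ρ) (hS : MeasurableSet S) (hρ : ∀ ω ∈ S, 0 ≤ ρ ω)
    {y : ℝ} (h : Integrable (fun ω => Real.exp (2 * y * ω)) (weightMeasure ρ S))
    (hψ : MemLp ψ 2 (weightMeasure ρ S)) : Integrable (lineFn ρ S ψ y) := by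
  have h1 := (memLp_two_exp h).integrable_mul (MemLp.star_two hψ)
  rw [integrable_weightMeasure_iff hm hS hρ] at h1
  refine (integrable_indicator_iff hS).2 (h1.congr (ae_of_all _ fun ω => ?_))
  simp [mul_assoc]

/-- For `z = x + iy` the kernel splits as `e^{yω} e^{-ixω}`. The Fourier transform is normalized
with `e^{-2πiξω}`, so `ξ = x / 2π`. -/
theorem holoRep_eq_fourier (hm : Measurable ρ) (hS : MeasurableSet S) (hρ : ∀ ω ∈ S, 0 ≤ ρ ω)
    (z : ℂ) :
    holoRep (weightMeasure ρ S) ψ z = 𝓕 (lineFn ρ S ψ z.im) (z.re / (2 * Real.pi)) := by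
  rw [holoRep, integral_weightMeasure hm hS hρ, Real.fourier_real_eq_integral_exp_smul,
    ← integral_indicator hS]
  congr 1
  ext ω
  by_cases hω : ω ∈ S
  · simp only [Set.indicator_of_mem hω, lineFn, smul_eq_mul, Complex.real_smul]
    push_cast
    have : Complex.exp (-Complex.I * z * ω) = Complex.exp (z.im * ω)
        * Complex.exp (-2 * Real.pi * ω * (z.re / (2 * Real.pi)) * Complex.I) := by
      rw [← Complex.exp_add]
      congr 1
      have hpi : (Real.pi : ℂ) ≠ 0 := by exact_mod_cast Real.pi_ne_zero
      conv_lhs => rw [← Complex.re_add_im z]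
      field_simp
      linear_combination (-(ω : ℂ) * z.im) * Complex.I_sq
    rw [this]
    ring
  · simp [Set.indicator_of_notMem hω, lineFn]

/-- Plancherel on one line; the factor `2π` is the Jacobian of `x = 2πξ`. Square integrability of
the line function has to be assumed: `ψ ∈ L²(σ)` controls `ρ |ψ|²`, whereas the line function
involves `ρ² e^{2yω} |ψ|²`. -/
theorem lintegral_holoRep_line (hm : Measurable ρ) (hS : MeasurableSet S)
    (hρ : ∀ ω ∈ S, 0 ≤ ρ ω) {y : ℝ}
    (h : Integrable (fun ω => Real.exp (2 * y * ω)) (weightMeasure ρ S))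
    (hψ : MemLp ψ 2 (weightMeasure ρ S)) (hfin : ∫⁻ ω, ‖lineFn ρ S ψ y ω‖ₑ ^ 2 < ⊤) :
    ∫⁻ x : ℝ, ‖holoRep (weightMeasure ρ S) ψ ⟨x, y⟩‖ₑ ^ 2
      = ENNReal.ofReal (2 * Real.pi) * ∫⁻ ω, ‖lineFn ρ S ψ y ω‖ₑ ^ 2 := by
  have hint := integrable_lineFn hm hS hρ h hψ
  have h2 : MemLp (lineFn ρ S ψ y) 2 := by
    refine ⟨hint.1, ?_⟩
    have h5 := eLpNorm_nnreal_pow_eq_lintegral (f := lineFn ρ S ψ y) (μ := volume) (p := 2)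
      (by norm_num)
    simp only [NNReal.coe_ofNat, ENNReal.coe_ofNat, ENNReal.rpow_ofNat] at h5
    rw [← h5] at hfin
    by_contra hcon
    rw [not_lt_top_iff] at hcon
    simp [hcon] at hfin
  rw [← lintegral_enorm_sq_fourier hint h2]
  simp_rw [holoRep_eq_fourier hm hS hρ]
  have hpi : (2 * Real.pi)⁻¹ ≠ 0 := by positivity
  have hc : Continuous (𝓕 (lineFn ρ S ψ y)) := VectorFourier.fourierIntegral_continuous
    Real.continuous_fourierChar (by fun_prop) hint
  have hcm : Measurable fun x => ‖𝓕 (lineFn ρ S ψ y) x‖ₑ ^ 2 := hc.measurable.enorm.pow_const 2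
  conv_rhs => rw [← Real.smul_map_volume_mul_left hpi]
  rw [lintegral_smul_measure, lintegral_map hcm (by fun_prop), smul_eq_mul, ← mul_assoc,
    ← ENNReal.ofReal_mul (by positivity), abs_of_pos (by positivity),
    mul_inv_cancel₀ (by positivity), ENNReal.ofReal_one, one_mul]
  simp only [div_eq_inv_mul]

/-- After Tonelli the `y`-integral of `w e^{2yω}` stands against `ρ²|ψ|²`, and the weight equation
replaces one of the two factors `ρ` by `1`. -/
theorem lintegral_lineFn (hm : Measurable ρ) (hS : MeasurableSet S) (hρ : ∀ ω ∈ S, 0 ≤ ρ ω)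
    (hJ : MeasurableSet J) (hw : SolvesWeightEq ρ S J w) (hne : S.Nonempty)
    (hw0 : ∀ y ∈ J, 0 ≤ w y) (hψ : StronglyMeasurable ψ) :
    ∫⁻ y in J, ENNReal.ofReal (w y) * ∫⁻ ω, ‖lineFn ρ S ψ y ω‖ₑ ^ 2
      = ∫⁻ ω, ‖ψ ω‖ₑ ^ 2 ∂(weightMeasure ρ S) := by
  have hwm := hw.aemeasurable hne
  have h1 : ∀ y ω, ‖lineFn ρ S ψ y ω‖ₑ ^ 2 = S.indicator (fun ω => ENNReal.ofReal (ρ ω) ^ 2 *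
      ENNReal.ofReal (Real.exp (2 * y * ω)) * ‖ψ ω‖ₑ ^ 2) ω := by
    intro y ω
    by_cases hω : ω ∈ S
    · simp only [Set.indicator_of_mem hω, lineFn, enorm_mul, mul_pow, RCLike.enorm_conj]
      congr 1
      rw [← ofReal_norm, Complex.norm_real, Real.norm_eq_abs,
        abs_of_nonneg (mul_nonneg (hρ ω hω) (Real.exp_pos _).le), ENNReal.ofReal_mul (hρ ω hω),
        mul_pow, ← ENNReal.ofReal_pow (Real.exp_pos _).le, ← Real.exp_nat_mul]
      push_cast; ring_nf
    · simp [Set.indicator_of_notMem hω, lineFn]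
  simp_rw [h1, lintegral_indicator hS]
  have hψm : Measurable ψ := hψ.measurable
  calc _ = ∫⁻ y in J, ∫⁻ ω in S, ENNReal.ofReal (w y) * (ENNReal.ofReal (ρ ω) ^ 2 *
      ENNReal.ofReal (Real.exp (2 * y * ω)) * ‖ψ ω‖ₑ ^ 2) := by
        congr 1; ext y
        rw [lintegral_const_mul]
        fun_prop
    _ = ∫⁻ ω in S, ∫⁻ y in J, ENNReal.ofReal (w y) * (ENNReal.ofReal (ρ ω) ^ 2 *
      ENNReal.ofReal (Real.exp (2 * y * ω)) * ‖ψ ω‖ₑ ^ 2) := by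
        refine lintegral_lintegral_swap ?_
        refine AEMeasurable.mul (hwm.ennreal_ofReal.comp_fst) ?_
        fun_prop
    _ = ∫⁻ ω in S, ENNReal.ofReal (ρ ω) * ‖ψ ω‖ₑ ^ 2 := by
        refine setLIntegral_congr_fun hS fun ω hω => ?_
        have h2 := hw.lintegral hρ hJ hw0 hω
        calc _ = ∫⁻ y in J, (ENNReal.ofReal (ρ ω) ^ 2 * ‖ψ ω‖ₑ ^ 2) * (ENNReal.ofReal (w y) *
              ENNReal.ofReal (Real.exp (2 * y * ω))) := by
              congr 1; ext y; ring
          _ = (ENNReal.ofReal (ρ ω) ^ 2 * ‖ψ ω‖ₑ ^ 2) * ∫⁻ y in J, (ENNReal.ofReal (w y) *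
              ENNReal.ofReal (Real.exp (2 * y * ω))) := by
              exact lintegral_const_mul'' _ (hwm.ennreal_ofReal.mul (by fun_prop))
          _ = ENNReal.ofReal (ρ ω) * ‖ψ ω‖ₑ ^ 2 * (ENNReal.ofReal (ρ ω) *
              ∫⁻ y in J, (ENNReal.ofReal (w y) *
              ENNReal.ofReal (Real.exp (2 * y * ω)))) := by ring
          _ = _ := by rw [h2, mul_one]
    _ = _ := by
        rw [weightMeasure, lintegral_withDensity_eq_lintegral_mul _ hm.ennreal_ofReal
          (by fun_prop)]
        rfl

theorem measurePreserving_strip (hJ : MeasurableSet J) :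
    MeasurePreserving Complex.measurableEquivRealProd.symm
      ((volume : Measure ℝ).prod (volume.restrict J)) (volume.restrict {z : ℂ | z.im ∈ J}) := by
  have h := Complex.volume_preserving_equiv_real_prod.symm.restrict_preimage
    (s := {z : ℂ | z.im ∈ J}) (Complex.measurable_im hJ)
  have h2 : Set.univ ×ˢ J = Complex.measurableEquivRealProd.symm ⁻¹' {z : ℂ | z.im ∈ J} := by
    ext p
    simp
  rw [← h2] at h
  have h3 : (volume : Measure ℝ).prod (volume.restrict J)
      = (volume : Measure (ℝ × ℝ)).restrict (Set.univ ×ˢ J) := by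
    have h4 := Measure.prod_restrict (μ := (volume : Measure ℝ)) (ν := (volume : Measure ℝ))
      Set.univ J
    rwa [Measure.restrict_univ] at h4
  rw [h3]
  exact h

theorem lintegral_strip (hJ : MeasurableSet J) {F : ℂ → ENNReal}
    (hF : AEMeasurable F (volume.restrict {z : ℂ | z.im ∈ J})) :
    ∫⁻ z in {z : ℂ | z.im ∈ J}, F z = ∫⁻ y in J, ∫⁻ x : ℝ, F ⟨x, y⟩ := by
  have hmp := measurePreserving_strip hJ
  have hF' := hF.comp_quasiMeasurePreserving hmp.quasiMeasurePreserving
  rw [← hmp.map_eq, lintegral_map_equiv]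
  exact lintegral_prod_symm _ hF'

theorem aemeasurable_comp_im (hJ : MeasurableSet J) (hw : AEMeasurable w (volume.restrict J)) :
    AEMeasurable (fun z : ℂ => w z.im) (volume.restrict {z : ℂ | z.im ∈ J}) :=
  (hw.comp_snd (μ := (volume : Measure ℝ))).comp_quasiMeasurePreserving
    (measurePreserving_strip hJ).symm.quasiMeasurePreserving

theorem stronglyMeasurable_holoRep {σ : Measure ℝ} [SFinite σ] (hψ : StronglyMeasurable ψ) :
    StronglyMeasurable (holoRep σ ψ) := by
  have hψm := hψ.measurable
  refine StronglyMeasurable.integral_prod_right' (f := fun p : ℂ × ℝ =>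
    Complex.exp (-Complex.I * p.1 * p.2) * (starRingEnd ℂ) (ψ p.2)) ?_
  refine Measurable.stronglyMeasurable (Measurable.mul (by fun_prop) ?_)
  exact Complex.continuous_conj.measurable.comp (hψm.comp measurable_snd)

theorem holoRep_congr {σ : Measure ℝ} {ψ' : ℝ → ℂ} (h : ψ =ᵐ[σ] ψ') :
    holoRep σ ψ = holoRep σ ψ' := by
  funext z
  refine integral_congr_ae ?_
  filter_upwards [h] with ω hω
  rw [hω]

instance (ρ : ℝ → ℝ) (S : Set ℝ) : SFinite (weightMeasure ρ S) := by
  unfold weightMeasure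
  infer_instance

variable (hm : Measurable ρ) (hS : MeasurableSet S) (hρ : ∀ ω ∈ S, 0 ≤ ρ ω)
  (hJ : MeasurableSet J) (hw : SolvesWeightEq ρ S J w) (hne : S.Nonempty)
  (hw0 : ∀ y ∈ J, 0 ≤ w y)
  (hexp : ∀ y ∈ J, Integrable (fun ω => Real.exp (2 * y * ω)) (weightMeasure ρ S))

include hm hS hρ hJ hw hne hw0 hexp

theorem lintegral_holoRep_strip (hψ : MemLp ψ 2 (weightMeasure ρ S)) :
    ∫⁻ z in {z : ℂ | z.im ∈ J}, ENNReal.ofReal (w z.im) * ‖holoRep (weightMeasure ρ S) ψ z‖ₑ ^ 2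
      = ENNReal.ofReal (2 * Real.pi) * ∫⁻ ω, ‖ψ ω‖ₑ ^ 2 ∂(weightMeasure ρ S) := by
  wlog hψm : StronglyMeasurable ψ generalizing ψ
  · have h := hψ.1.ae_eq_mk
    rw [holoRep_congr h, this (hψ.ae_eq h) hψ.1.stronglyMeasurable_mk]
    congr 1
    refine lintegral_congr_ae ?_
    filter_upwards [h] with ω hω
    rw [hω]
  have hwm := hw.aemeasurable hne
  have hfin : ∫⁻ ω, ‖ψ ω‖ₑ ^ 2 ∂(weightMeasure ρ S) < ⊤ := by
    have h5 := eLpNorm_nnreal_pow_eq_lintegral (f := ψ) (μ := weightMeasure ρ S) (p := 2)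
      (by norm_num)
    simp only [NNReal.coe_ofNat, ENNReal.coe_ofNat, ENNReal.rpow_ofNat] at h5
    rw [← h5]
    exact ENNReal.pow_lt_top hψ.2
  have hT := lintegral_lineFn hm hS hρ hJ hw hne hw0 hψm
  have hmeas : AEMeasurable (fun y => ENNReal.ofReal (w y) * ∫⁻ ω, ‖lineFn ρ S ψ y ω‖ₑ ^ 2)
      (volume.restrict J) := by
    refine hwm.ennreal_ofReal.mul (Measurable.aemeasurable ?_)
    refine Measurable.lintegral_prod_right' (f := fun p : ℝ × ℝ => ‖lineFn ρ S ψ p.1 p.2‖ₑ ^ 2) ?_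
    refine (Measurable.enorm ?_).pow_const 2
    have : (fun p : ℝ × ℝ => lineFn ρ S ψ p.1 p.2) = (Prod.snd ⁻¹' S).indicator
        (fun p => ((ρ p.2 * Real.exp (p.1 * p.2) : ℝ) : ℂ) * (starRingEnd ℂ) (ψ p.2)) := by
      ext p
      by_cases h : p.2 ∈ S <;> simp [lineFn, h]
    rw [this]
    refine Measurable.indicator (Measurable.mul (by fun_prop) ?_) (measurable_snd hS)
    exact Complex.continuous_conj.measurable.comp (hψm.measurable.comp measurable_snd)
  -- The total being finite, for almost every `y` either the weight vanishes or the line function is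
  -- square integrable. So Plancherel is available on every line that counts, up to a null set.
  have hae := ae_lt_top' hmeas (by rw [hT]; exact hfin.ne)
  rw [lintegral_strip hJ, ← hT, ← lintegral_const_mul'' _ hmeas]
  · refine lintegral_congr_ae ?_
    filter_upwards [hae, ae_restrict_mem hJ] with y hy hyJ
    rw [lintegral_const_mul' _ _ ENNReal.ofReal_ne_top]
    by_cases h0 : ENNReal.ofReal (w y) = 0
    · simp [h0]
    · have : ∫⁻ ω, ‖lineFn ρ S ψ y ω‖ₑ ^ 2 < ⊤ := by
        by_contra hcon
        rw [not_lt_top_iff] at hcon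
        rw [hcon, ENNReal.mul_top h0] at hy
        exact lt_irrefl _ hy
      rw [lintegral_holoRep_line hm hS hρ (hexp y hyJ) hψ this]
      ring
  · refine (aemeasurable_comp_im hJ hwm).ennreal_ofReal.mul (Measurable.aemeasurable ?_)
    exact (stronglyMeasurable_holoRep hψm).measurable.enorm.pow_const 2

theorem integrable_norm_sq_holoRep (hψ : MemLp ψ 2 (weightMeasure ρ S)) :
    IntegrableOn (fun z => w z.im * ‖holoRep (weightMeasure ρ S) ψ z‖ ^ 2) {z : ℂ | z.im ∈ J} ∧
    ∫ z in {z : ℂ | z.im ∈ J}, w z.im * ‖holoRep (weightMeasure ρ S) ψ z‖ ^ 2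
      = 2 * Real.pi * ∫ ω, ‖ψ ω‖ ^ 2 ∂(weightMeasure ρ S) := by
  have hL := lintegral_holoRep_strip hm hS hρ hJ hw hne hw0 hexp hψ
  have hJ' : MeasurableSet {z : ℂ | z.im ∈ J} := Complex.measurable_im hJ
  have hae : AEStronglyMeasurable (fun z => w z.im * ‖holoRep (weightMeasure ρ S) ψ z‖ ^ 2)
      (volume.restrict {z : ℂ | z.im ∈ J}) := by
    rw [holoRep_congr hψ.1.ae_eq_mk]
    refine ((aemeasurable_comp_im hJ (hw.aemeasurable hne)).mul
      (Measurable.aemeasurable ?_)).aestronglyMeasurable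
    exact (stronglyMeasurable_holoRep hψ.1.stronglyMeasurable_mk).measurable.norm.pow_const 2
  have hnn : 0 ≤ᵐ[volume.restrict {z : ℂ | z.im ∈ J}]
      fun z => w z.im * ‖holoRep (weightMeasure ρ S) ψ z‖ ^ 2 := by
    filter_upwards [ae_restrict_mem hJ'] with z hz
    exact mul_nonneg (hw0 _ hz) (by positivity)
  have hψ2 : Integrable (fun ω => ‖ψ ω‖ ^ 2) (weightMeasure ρ S) :=
    (memLp_two_iff_integrable_sq_norm hψ.1).1 hψ
  have e1 : ∫⁻ z in {z : ℂ | z.im ∈ J},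
      ENNReal.ofReal (w z.im * ‖holoRep (weightMeasure ρ S) ψ z‖ ^ 2)
      = ENNReal.ofReal (2 * Real.pi) * ENNReal.ofReal (∫ ω, ‖ψ ω‖ ^ 2 ∂(weightMeasure ρ S)) := by
    rw [ofReal_integral_eq_lintegral_ofReal hψ2 (ae_of_all _ fun _ => by positivity)]
    simp only [ENNReal.ofReal_pow (norm_nonneg _), ofReal_norm]
    rw [← hL]
    refine setLIntegral_congr_fun hJ' fun z hz => ?_
    simp only [ENNReal.ofReal_mul (hw0 _ hz), ENNReal.ofReal_pow (norm_nonneg _), ofReal_norm]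
  have hpos : 0 ≤ ∫ ω, ‖ψ ω‖ ^ 2 ∂(weightMeasure ρ S) := integral_nonneg fun _ => by positivity
  constructor
  · refine ⟨hae, ?_⟩
    rw [hasFiniteIntegral_iff_ofReal hnn, e1]
    exact ENNReal.mul_lt_top ENNReal.ofReal_lt_top ENNReal.ofReal_lt_top
  · rw [integral_eq_lintegral_of_nonneg_ae hnn hae, e1, ← ENNReal.ofReal_mul (by positivity),
      ENNReal.toReal_ofReal (by positivity)]

/-- Polarization of the norm identity over `ψ + cφ` with `c ∈ {1, -1, i, -i}`. The representation is
antilinear in `ψ`, so the conjugate of `c` appears on the holomorphic side. -/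
theorem integrable_star_holoRep_mul {φ : ℝ → ℂ} (hψ : MemLp ψ 2 (weightMeasure ρ S))
    (hφ : MemLp φ 2 (weightMeasure ρ S)) :
    IntegrableOn (fun z : ℂ => (starRingEnd ℂ) (holoRep (weightMeasure ρ S) φ z)
      * holoRep (weightMeasure ρ S) ψ z * (w z.im : ℂ)) {z : ℂ | z.im ∈ J} ∧
    ∫ z in {z : ℂ | z.im ∈ J}, (starRingEnd ℂ) (holoRep (weightMeasure ρ S) φ z)
      * holoRep (weightMeasure ρ S) ψ z * (w z.im : ℂ)
      = 2 * Real.pi * ∫ ω, (starRingEnd ℂ) (ψ ω) * φ ω ∂(weightMeasure ρ S) := by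
  set σ := weightMeasure ρ S
  have hJ' : MeasurableSet {z : ℂ | z.im ∈ J} := Complex.measurable_im hJ
  have pol : ∀ α β : ℂ, (starRingEnd ℂ) β * α = (1 / 4 : ℂ) * ((‖α + β‖ ^ 2 : ℝ)
      - (‖α - β‖ ^ 2 : ℝ) + Complex.I * (‖α + Complex.I * β‖ ^ 2 : ℝ)
      - Complex.I * (‖α - Complex.I * β‖ ^ 2 : ℝ)) := by
    intro α β
    apply Complex.ext <;>
    simp [← Complex.normSq_eq_norm_sq, Complex.normSq_apply] <;> ring
  have hm' : ∀ c : ℂ, MemLp (fun ω => ψ ω + c * φ ω) 2 σ := fun c => hψ.add (hφ.const_mul c)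
  have hrep : ∀ c : ℂ, ∀ z ∈ {z : ℂ | z.im ∈ J}, holoRep σ (fun ω => ψ ω + c * φ ω) z
      = holoRep σ ψ z + (starRingEnd ℂ) c * holoRep σ φ z := by
    intro c z hz
    have hi : ∀ χ : ℝ → ℂ, MemLp χ 2 σ →
        Integrable (fun ω : ℝ => Complex.exp (-Complex.I * z * ω) * (starRingEnd ℂ) (χ ω)) σ := by
      intro χ hχ
      have h1 : MemLp (fun ω : ℝ => Complex.exp (-Complex.I * z * ω)) 2 σ := by
        refine (memLp_two_exp (hexp z.im hz)).congr_norm (by fun_prop) (ae_of_all _ fun ω => ?_)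
        simp [Complex.norm_exp]
      exact h1.integrable_mul (MemLp.star_two hχ)
    rw [holoRep, holoRep, holoRep, ← integral_const_mul, ← integral_add (hi ψ hψ)
      ((hi φ hφ).const_mul _)]
    congr 1; ext ω
    simp only [map_add, map_mul]
    ring
  have hq : ∀ c : ℂ, _ := fun c =>
    integrable_norm_sq_holoRep hm hS hρ hJ hw hne hw0 hexp (hm' c)
  have hI : ∀ c : ℂ, IntegrableOn (fun z : ℂ =>
      ((w z.im * ‖holoRep σ ψ z + c * holoRep σ φ z‖ ^ 2 : ℝ) : ℂ)) {z : ℂ | z.im ∈ J} := by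
    intro c
    have h : IntegrableOn (fun z : ℂ => w z.im * ‖holoRep σ ψ z + c * holoRep σ φ z‖ ^ 2)
        {z : ℂ | z.im ∈ J} := by
      refine IntegrableOn.congr_fun (hq ((starRingEnd ℂ) c)).1 (fun z hz => ?_) hJ'
      simp only [hrep _ z hz, Complex.conj_conj, σ]
    exact h.ofReal
  have hV : ∀ c : ℂ, ∫ z in {z : ℂ | z.im ∈ J},
      ((w z.im * ‖holoRep σ ψ z + c * holoRep σ φ z‖ ^ 2 : ℝ) : ℂ)
      = 2 * Real.pi * ∫ ω, ((‖(starRingEnd ℂ) (ψ ω) + c * (starRingEnd ℂ) (φ ω)‖ ^ 2 : ℝ) : ℂ)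
        ∂σ := by
    intro c
    have h := (hq ((starRingEnd ℂ) c)).2
    rw [integral_complex_ofReal, integral_complex_ofReal]
    norm_cast
    rw [← setIntegral_congr_fun hJ' (fun z hz => ?_), h]
    · congr 2; ext ω
      rw [← RCLike.norm_conj]
      simp
    · simp only [hrep _ z hz, Complex.conj_conj, σ]
  have hK : ∀ c : ℂ, Integrable (fun ω =>
      ((‖(starRingEnd ℂ) (ψ ω) + c * (starRingEnd ℂ) (φ ω)‖ ^ 2 : ℝ) : ℂ)) σ := by
    intro c
    have := (memLp_two_iff_integrable_sq_norm (hm' ((starRingEnd ℂ) c)).1).1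
      (hm' ((starRingEnd ℂ) c))
    have h : Integrable (fun ω => ‖(starRingEnd ℂ) (ψ ω) + c * (starRingEnd ℂ) (φ ω)‖ ^ 2) σ := by
      refine this.congr (ae_of_all _ fun ω => ?_)
      dsimp only
      rw [← RCLike.norm_conj]
      simp
    exact h.ofReal
  have hfun : (fun z : ℂ => (starRingEnd ℂ) (holoRep σ φ z) * holoRep σ ψ z * (w z.im : ℂ))
      = fun z : ℂ => (1 / 4 : ℂ) * (((w z.im * ‖holoRep σ ψ z + 1 * holoRep σ φ z‖ ^ 2 : ℝ) : ℂ)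
        - ((w z.im * ‖holoRep σ ψ z + (-1) * holoRep σ φ z‖ ^ 2 : ℝ) : ℂ)
        + Complex.I * ((w z.im * ‖holoRep σ ψ z + Complex.I * holoRep σ φ z‖ ^ 2 : ℝ) : ℂ)
        - Complex.I *
          ((w z.im * ‖holoRep σ ψ z + (-Complex.I) * holoRep σ φ z‖ ^ 2 : ℝ) : ℂ)) := by
    ext z
    rw [pol]
    push_cast
    simp only [one_mul, neg_mul, ← sub_eq_add_neg]
    ring
  have hfun2 : (fun ω => (starRingEnd ℂ) (ψ ω) * φ ω)
      = fun ω => (1 / 4 : ℂ) *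
        (((‖(starRingEnd ℂ) (ψ ω) + 1 * (starRingEnd ℂ) (φ ω)‖ ^ 2 : ℝ) : ℂ)
        - ((‖(starRingEnd ℂ) (ψ ω) + (-1) * (starRingEnd ℂ) (φ ω)‖ ^ 2 : ℝ) : ℂ)
        + Complex.I *
          ((‖(starRingEnd ℂ) (ψ ω) + Complex.I * (starRingEnd ℂ) (φ ω)‖ ^ 2 : ℝ) : ℂ)
        - Complex.I *
          ((‖(starRingEnd ℂ) (ψ ω) + (-Complex.I) * (starRingEnd ℂ) (φ ω)‖ ^ 2 : ℝ) : ℂ)) := by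
    ext ω
    have := pol ((starRingEnd ℂ) (ψ ω)) ((starRingEnd ℂ) (φ ω))
    rw [Complex.conj_conj, mul_comm] at this
    rw [this]
    simp only [one_mul, neg_mul, ← sub_eq_add_neg]
  constructor
  · rw [hfun]
    exact ((((hI 1).sub (hI (-1))).add ((hI Complex.I).const_mul _)).sub
      ((hI (-Complex.I)).const_mul _)).const_mul _
  · rw [hfun, hfun2, integral_const_mul, integral_const_mul, integral_sub, integral_add,
      integral_sub, integral_sub, integral_add, integral_sub]
    · simp only [integral_const_mul, hV]
      ring
    · exact hK _
    · exact hK _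
    · exact (hK _).sub (hK _)
    · exact (hK _).const_mul _
    · exact ((hK _).sub (hK _)).add ((hK _).const_mul _)
    · exact (hK _).const_mul _
    · exact hI _
    · exact hI _
    · exact (hI _).sub (hI _)
    · exact (hI _).const_mul _
    · exact ((hI _).sub (hI _)).add ((hI _).const_mul _)
    · exact (hI _).const_mul _

/-- A nonnegative solution of the weight equation is reproducing. -/
theorem isReproducing_of_solves : IsReproducing (weightMeasure ρ S) {z : ℂ | z.im ∈ J} w := by
  have hpi : (2 * Real.pi : ℂ) ≠ 0 := by exact_mod_cast (by positivity : 2 * Real.pi ≠ 0)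
  refine ⟨fun z hz => hw0 _ hz, fun ψ φ hψ hφ => ?_, fun ψ hψ v hv => ?_⟩
  · obtain ⟨h1, h2⟩ := integrable_star_holoRep_mul hm hS hρ hJ hw hne hw0 hexp hψ hφ
    exact ⟨h1, by rw [h2, inv_mul_cancel_left₀ hpi]⟩
  -- The kernel `σ̂(v - z̄)` is the complex conjugate of the representation of `φ`, so the second
  -- identity is the isometry tested against this `φ`. It lies in `L²(σ)` because `Im v ∈ J`.
  · set φ : ℝ → ℂ := fun ω => Complex.exp (-Complex.I * v * ω) with hφd
    have hφ : MemLp φ 2 (weightMeasure ρ S) := by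
      refine (memLp_two_exp (hexp v.im hv)).congr_norm (by fun_prop) (ae_of_all _ fun ω => ?_)
      simp [hφd, Complex.norm_exp]
    obtain ⟨h1, h2⟩ := integrable_star_holoRep_mul hm hS hρ hJ hw hne hw0 hexp hψ hφ
    have h3 : ∀ z, charFn (weightMeasure ρ S) (v - (starRingEnd ℂ) z)
        = (starRingEnd ℂ) (holoRep (weightMeasure ρ S) φ z) := by
      intro z
      rw [holoRep, ← integral_conj, charFn]
      congr 1; ext ω
      rw [map_mul, Complex.conj_conj, ← Complex.exp_conj, hφd, ← Complex.exp_add]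
      simp only [map_mul, map_neg, Complex.conj_I, Complex.conj_ofReal]
      congr 1; ring
    simp only [h3]
    refine ⟨h1, ?_⟩
    rw [h2, inv_mul_cancel_left₀ hpi, holoRep]
    congr 1; ext ω
    rw [mul_comm]

end Reproducing

/-! ### Uniqueness of the evolution group -/

section EvolutionUnique

variable {H : Module.End ℂ FinFock} {U U' : ℝ → (Fock ≃ₗᵢ[ℂ] Fock)}

theorem toFock_single (n : ℕ) (c : ℂ) : toFock (Finsupp.single n c) = c • ket n := by
  simp [toFock]

theorem dense_range_toFock : DenseRange toFock := by
  set b : HilbertBasis ℕ ℂ Fock := HilbertBasis.ofRepr (LinearIsometryEquiv.refl ℂ Fock)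
  have hb : ∀ n, b n = ket n := fun n => by
    rw [← b.repr_symm_single]
    rfl
  have h := b.dense_span
  rw [Submodule.dense_iff_topologicalClosure_eq_top.symm] at h
  refine h.mono ?_
  have : Submodule.span ℂ (Set.range b) ≤ LinearMap.range toFock := by
    refine Submodule.span_le.2 ?_
    rintro _ ⟨n, rfl⟩
    exact ⟨Finsupp.single n 1, by rw [toFock_single, one_smul, hb]⟩
  exact this

theorem PolyHam.IsEvolution.hasDerivAt (hU : IsEvolution H U) (x : FinFock) (t : ℝ) :
    HasDerivAt (fun s : ℝ => U s (toFock x)) (U t (toFock (-Complex.I • H x))) t := by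
  have h1 : (fun s : ℝ => U s (toFock x)) = fun s => U t (U (s - t) (toFock x)) := by
    funext s
    rw [← hU.map_add, add_sub_cancel]
  rw [h1, map_smul]
  have h2 : HasDerivAt (fun s : ℝ => U (s - t) (toFock x)) (-Complex.I • toFock (H x)) t := by
    refine HasDerivAt.comp_sub_const (f := fun s : ℝ => U s (toFock x)) t t ?_
    rw [sub_self]
    exact hU.generator x
  exact ((U t).toContinuousLinearEquiv.toContinuousLinearMap.restrictScalars ℝ).hasFDerivAt.comp_hasDerivAt
    t h2

/-- Functions all of whose derivatives are controlled like those of an analytic function and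
vanish at the origin are zero near the origin. -/
theorem eq_zero_of_deriv_chain {E : Type*} [NormedAddCommGroup E] [NormedSpace ℝ E]
    {F : ℕ → ℝ → E} {K C : ℝ} (hF : ∀ k t, HasDerivAt (F k) (F (k + 1) t) t)
    (h0 : ∀ k, F k 0 = 0) (hb : ∀ k t, ‖F k t‖ ≤ K * C ^ k * k.factorial)
    {t : ℝ} (ht : 0 ≤ t) (hC : 0 ≤ C) (htC : C * t < 1) : F 0 t = 0 := by
  have hK : 0 ≤ K := by simpa using (norm_nonneg _).trans (hb 0 0)
  -- Each integration from the origin trades one order of derivative for one power of `s`. At `k =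
  -- 0` the factorials cancel and the bound is `K (C s)^n`, which tends to zero.
  have key : ∀ n k, ∀ s ∈ Set.Icc 0 t, ‖F k s‖ ≤
      K * C ^ (k + n) * (k + n).factorial / n.factorial * s ^ n := by
    intro n
    induction n with
    | zero => intro k s _; simpa using hb k s
    | succ n ih =>
      intro k
      refine image_norm_le_of_norm_deriv_right_le_deriv_boundary (f' := F (k + 1))
        (B' := fun s => K * C ^ (k + 1 + n) * (k + 1 + n).factorial / n.factorial * s ^ n)
        (fun s _ => (hF k s).continuousAt.continuousWithinAt)
        (fun s _ => (hF k s).hasDerivWithinAt) (by simp [h0]) (fun s => ?_)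
        (fun s hs => ih (k + 1) s ⟨hs.1, hs.2.le⟩)
      have h := (hasDerivAt_pow (n + 1) s).const_mul
        (K * C ^ (k + (n + 1)) * (k + (n + 1)).factorial / (n + 1).factorial)
      convert! h using 1
      rw [Nat.factorial_succ n, show k + (n + 1) = k + 1 + n by ring]
      push_cast
      have : (n.factorial : ℝ) ≠ 0 := by positivity
      field_simp
  have hlim : Tendsto (fun n : ℕ => K * (C * t) ^ n) atTop (𝓝 0) := by
    simpa using (tendsto_pow_atTop_nhds_zero_of_lt_one (by positivity) htC).const_mul K
  have : ‖F 0 t‖ ≤ 0 := by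
    refine ge_of_tendsto hlim (Eventually.of_forall fun n => ?_)
    have h := key n 0 t ⟨ht, le_rfl⟩
    rw [zero_add, mul_div_assoc, div_self (by positivity), mul_one, mul_assoc, ← mul_pow] at h
    exact h
  exact norm_le_zero_iff.1 this

theorem PolyHam.IsEvolution.map_nsmul (hU : IsEvolution H U) (hU' : IsEvolution H U') {s : ℝ}
    (h : ∀ ψ, U s ψ = U' s ψ) (n : ℕ) (ψ : Fock) : U (n * s) ψ = U' (n * s) ψ := by
  induction n generalizing ψ with
  | zero => simp [hU.map_zero, hU'.map_zero]
  | succ n ih =>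
    push_cast
    rw [add_mul, one_mul, hU.map_add, hU'.map_add, h, ih]

theorem PolyHam.IsEvolution.eq_neg (hU : IsEvolution H U) (hU' : IsEvolution H U') {s : ℝ}
    (h : ∀ ψ, U s ψ = U' s ψ) (ψ : Fock) : U (-s) ψ = U' (-s) ψ := by
  apply (U s).injective
  rw [← hU.map_add, h, ← hU'.map_add]
  simp [hU.map_zero, hU'.map_zero]

/-- If all finite vectors are analytic for `H`, with a common radius, then the evolution group is
unique. -/
theorem PolyHam.IsEvolution.unique {C : ℝ} (hC : 0 < C)
    (hgrowth : ∀ x : FinFock, ∃ K : ℝ, ∀ n : ℕ, ‖toFock ((H ^ n) x)‖ ≤ K * C ^ n * n.factorial)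
    (hU : IsEvolution H U) (hU' : IsEvolution H U') (t : ℝ) (ψ : Fock) : U t ψ = U' t ψ := by
  -- Analyticity gives coincidence only within the radius `1 / C`. The group law then extends it to
  -- multiples and to negative times, which is possible because the radius is common to all finite
  -- vectors.
  have small : ∀ t : ℝ, 0 ≤ t → C * t < 1 → ∀ ψ, U t ψ = U' t ψ := by
    intro t ht htC
    have : (fun ψ => U t ψ) = fun ψ => U' t ψ := by
      refine dense_range_toFock.equalizer (U t).continuous (U' t).continuous (funext fun x => ?_)
      obtain ⟨K, hK⟩ := hgrowth x
      -- The `k`-th derivative of `U s x` is `U s (y k)`; unitarity makes its norm independent of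
      -- `s`, so one growth bound controls all times.
      let y : ℕ → FinFock := fun k => (-Complex.I) ^ k • (H ^ k) x
      have hy : ∀ k, -Complex.I • H (y k) = y (k + 1) := by
        intro k
        simp only [y, map_smul, smul_smul, pow_succ' _ k, Module.End.mul_apply]
      have hyn : ∀ k, ‖toFock (y k)‖ ≤ K * C ^ k * k.factorial := by
        intro k
        simp only [y, map_smul, norm_smul, norm_pow, norm_neg, Complex.norm_I, one_pow, one_mul]
        exact hK k
      have h0 := eq_zero_of_deriv_chain (K := 2 * K) (C := C)
        (F := fun k s => U s (toFock (y k)) - U' s (toFock (y k))) (fun k s => ?_) (fun k => ?_)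
        (fun k s => ?_) ht hC.le htC
      · simpa [y, sub_eq_zero] using h0
      · rw [← hy]
        exact (hU.hasDerivAt (y k) s).sub (hU'.hasDerivAt (y k) s)
      · simp [hU.map_zero, hU'.map_zero]
      · refine (norm_sub_le _ _).trans ?_
        rw [LinearIsometryEquiv.norm_map, LinearIsometryEquiv.norm_map]
        linarith [hyn k]
    exact fun ψ => congrFun this ψ
  have nonneg : ∀ t : ℝ, 0 ≤ t → ∀ ψ, U t ψ = U' t ψ := by
    intro t ht ψ
    obtain ⟨n, hn⟩ := exists_nat_gt (C * t)
    have hn0 : (0 : ℝ) < n := lt_of_le_of_lt (by positivity) hn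
    have h := hU.map_nsmul hU' (small (t / n) (by positivity) (by
      rw [← mul_div_assoc, div_lt_one hn0]; exact hn)) n ψ
    rwa [mul_div_cancel₀ _ hn0.ne'] at h
  rcases le_total 0 t with h | h
  · exact nonneg t h ψ
  · have := hU.eq_neg hU' (nonneg (-t) (by linarith)) ψ
    rwa [neg_neg] at this

end EvolutionUnique

/-! ### Polynomials in `L²` of a measure with exponential moments -/

section PolyLp

variable {σ : Measure ℝ} {δ : ℝ}

theorem exists_norm_eval_le_exp (q : Polynomial ℂ) {c : ℝ} (hc : 0 < c) :
    ∃ K, 0 ≤ K ∧ ∀ ω : ℝ, ‖q.eval (ω : ℂ)‖ ≤ K * Real.exp (c * |ω|) := by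
  induction q using Polynomial.induction_on' with
  | add p q hp hq =>
    obtain ⟨K, hK0, hK⟩ := hp
    obtain ⟨L, hL0, hL⟩ := hq
    refine ⟨K + L, by positivity, fun ω => ?_⟩
    rw [Polynomial.eval_add, add_mul]
    exact (norm_add_le _ _).trans (add_le_add (hK ω) (hL ω))
  | monomial n a =>
    refine ⟨‖a‖ * (n.factorial / c ^ n), by positivity, fun ω => ?_⟩
    have h := Real.pow_div_factorial_le_exp (c * |ω|) (by positivity) n
    rw [div_le_iff₀ (by positivity), mul_pow] at h
    rw [Polynomial.eval_monomial, norm_mul, norm_pow, Complex.norm_real, Real.norm_eq_abs,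
      mul_assoc]
    gcongr
    rw [div_mul_eq_mul_div, le_div_iff₀ (by positivity)]
    linarith

/-- The inequality `(c|ω|)^n / n! ≤ e^{c|ω|}` gives factorial growth with ratio `1 / c`, the rate
needed for polynomials to be analytic vectors of multiplication by `ω`. A second factor `e^{c|ω|}`
absorbs `q`. -/
theorem pow_norm_eval_le_exp (q : Polynomial ℂ) {c : ℝ} (hc : 0 < c) :
    ∃ K, ∀ (ω : ℝ) (n : ℕ), ‖(ω : ℂ) ^ n * q.eval (ω : ℂ)‖ ≤
      K * (1 / c) ^ n * n.factorial * Real.exp (2 * c * |ω|) := by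
  obtain ⟨K, hK0, hK⟩ := exists_norm_eval_le_exp q hc
  refine ⟨K, fun ω n => ?_⟩
  have h := Real.pow_div_factorial_le_exp (c * |ω|) (by positivity) n
  rw [div_le_iff₀ (by positivity), mul_pow] at h
  have h2 : |ω| ^ n ≤ (1 / c) ^ n * n.factorial * Real.exp (c * |ω|) := by
    rw [one_div, inv_pow, mul_assoc, inv_mul_eq_div, le_div_iff₀ (by positivity)]
    linarith
  rw [norm_mul, norm_pow, Complex.norm_real, Real.norm_eq_abs]
  calc _ ≤ ((1 / c) ^ n * n.factorial * Real.exp (c * |ω|)) * (K * Real.exp (c * |ω|)) :=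
        mul_le_mul h2 (hK ω) (norm_nonneg _) (by positivity)
    _ = _ := by
        rw [show 2 * c * |ω| = c * |ω| + c * |ω| by ring, Real.exp_add]
        ring

theorem integrable_exp_add_abs {y c : ℝ}
    (h : ∀ t ∈ Set.Icc (y - c) (y + c), Integrable (fun ω => Real.exp (t * ω)) σ) (hc : 0 ≤ c) :
    Integrable (fun ω => Real.exp (y * ω + c * |ω|)) σ := by
  refine ((h (y + c) ⟨by linarith, le_rfl⟩).add (h (y - c) ⟨le_rfl, by linarith⟩)).mono'
    (by fun_prop) (ae_of_all _ fun ω => ?_)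
  rw [Real.norm_eq_abs, Real.abs_exp, Pi.add_apply]
  rcases abs_cases ω with h | h
  · rw [h.1, ← add_mul]
    linarith [Real.exp_pos ((y - c) * ω)]
  · rw [h.1, show y * ω + c * -ω = (y - c) * ω by ring]
    linarith [Real.exp_pos ((y + c) * ω)]

theorem integrable_cexp_mul_eval {z : ℂ} (hδ : 0 < δ)
    (h : ∀ t ∈ Set.Ioo (z.im - δ) (z.im + δ), Integrable (fun ω => Real.exp (t * ω)) σ)
    (q : Polynomial ℂ) :
    Integrable (fun ω : ℝ => Complex.exp (-Complex.I * z * ω) * q.eval (ω : ℂ)) σ := by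
  obtain ⟨K, hK0, hK⟩ := exists_norm_eval_le_exp q (half_pos hδ)
  have h1 := integrable_exp_add_abs (σ := σ) (y := z.im) (c := δ / 2)
    (fun t ht => h t ⟨by linarith [ht.1], by linarith [ht.2]⟩) (by linarith)
  refine (h1.const_mul K).mono' ?_ (ae_of_all _ fun ω => ?_)
  · exact (Continuous.mul (by fun_prop) (q.continuous.comp Complex.continuous_ofReal)).aestronglyMeasurable
  · rw [norm_mul, Complex.norm_exp, Real.exp_add]
    have : (-Complex.I * z * ω).re = z.im * ω := by simp
    rw [this]
    nlinarith [hK ω, Real.exp_pos (z.im * ω)]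

variable (hδ : 0 < δ) (hexp : ∀ t ∈ Set.Ioo (-δ) δ, Integrable (fun ω => Real.exp (t * ω)) σ)

include hδ hexp

/-- Squaring doubles the rate to `δ / 2`, still inside the interval of exponential integrability. -/
theorem memLp_exp_abs : MemLp (fun ω => Real.exp (δ / 4 * |ω|)) 2 σ := by
  rw [memLp_two_iff_integrable_sq (by fun_prop)]
  have h1 := integrable_exp_add_abs (σ := σ) (y := 0) (c := δ / 2)
    (fun t ht => hexp t ⟨by linarith [ht.1], by linarith [ht.2]⟩) (by linarith)
  refine h1.congr (ae_of_all _ fun ω => ?_)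
  simp only [← Real.exp_nat_mul]
  push_cast; ring_nf

theorem memLp_eval (q : Polynomial ℂ) : MemLp (fun ω : ℝ => q.eval (ω : ℂ)) 2 σ := by
  obtain ⟨K, hK0, hK⟩ := exists_norm_eval_le_exp q (by linarith : 0 < δ / 4)
  refine ((memLp_exp_abs hδ hexp).const_mul K).mono'
    (q.continuous.comp Complex.continuous_ofReal).aestronglyMeasurable (ae_of_all _ hK)

/-- Polynomials as elements of `L²`. -/
noncomputable def polyLp : Polynomial ℂ →ₗ[ℂ] Lp ℂ 2 σ where
  toFun q := (memLp_eval hδ hexp q).toLp _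
  map_add' p q := by
    rw [← MemLp.toLp_add]
    simp [Polynomial.eval_add]
    rfl
  map_smul' c q := by
    rw [RingHom.id_apply, ← MemLp.toLp_const_smul]
    simp [Polynomial.eval_smul]
    rfl

theorem coeFn_polyLp (q : Polynomial ℂ) :
    polyLp hδ hexp q =ᵐ[σ] fun ω : ℝ => q.eval (ω : ℂ) :=
  MemLp.coeFn_toLp (memLp_eval hδ hexp q)

theorem exists_norm_polyLp_X_pow_mul_le (q : Polynomial ℂ) :
    ∃ K : ℝ, ∀ n : ℕ, ‖polyLp hδ hexp (Polynomial.X ^ n * q)‖ ≤ K * (8 / δ) ^ n * n.factorial := by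
  -- With `c = δ / 8` the majorant carries `e^{δ|ω|/4}`, which is square integrable, and the growth
  -- ratio is `1 / c = 8 / δ`.
  obtain ⟨K, hK⟩ := pow_norm_eval_le_exp q (by linarith : 0 < δ / 8)
  refine ⟨K * ‖(memLp_exp_abs hδ hexp).toLp _‖, fun n => ?_⟩
  have := Lp.norm_le_mul_norm_of_ae_le_mul (c := K * (8 / δ) ^ n * n.factorial)
    (f := polyLp hδ hexp (Polynomial.X ^ n * q)) (g := (memLp_exp_abs hδ hexp).toLp _) ?_
  · linarith
  · filter_upwards [coeFn_polyLp hδ hexp (Polynomial.X ^ n * q),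
      (memLp_exp_abs hδ hexp).coeFn_toLp] with ω h1 h2
    rw [h1, h2, Real.norm_eq_abs, Real.abs_exp, Polynomial.eval_mul, Polynomial.eval_pow,
      Polynomial.eval_X]
    convert! hK ω n using 2
    · ring_nf
    · ring_nf

/-- Density of the polynomials. By Cauchy–Schwarz, `f` times a small exponential is integrable, so
the complex density `f` is determined by its moments, and these are the given inner products. -/
theorem polyLp_orthogonal_eq_zero {f : Lp ℂ 2 σ}
    (h : ∀ n : ℕ, inner ℂ (polyLp hδ hexp (Polynomial.X ^ n)) f = 0) : f = 0 := by
  have hint : ∀ g : ℝ → ℂ, MemLp g 2 σ → Integrable (fun ω => f ω * g ω) σ :=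
    fun g hg => (Lp.memLp f).integrable_mul hg
  refine (Lp.eq_zero_iff_ae_eq_zero).2 (ae_eq_zero_of_complex_moments_eq_zero
    (δ := δ / 4) (by linarith) ?_ ?_ ?_)
  · intro t ht
    refine hint _ ((memLp_exp_abs hδ hexp).mono (by fun_prop) (ae_of_all _ fun ω => ?_))
    rw [Complex.norm_real, Real.norm_eq_abs, Real.norm_eq_abs, Real.abs_exp, Real.abs_exp,
      Real.exp_le_exp]
    refine (le_abs_self _).trans ?_
    rw [abs_mul]
    gcongr
    exact (abs_lt.2 ht).le
  · intro n
    exact hint _ (by simpa using memLp_eval hδ hexp (Polynomial.X ^ n))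
  · intro n
    rw [← h n, L2.inner_def]
    refine integral_congr_ae ?_
    filter_upwards [coeFn_polyLp hδ hexp (Polynomial.X ^ n)] with ω hω
    rw [hω]
    simp [RCLike.inner_apply]

end PolyLp

/-! ### Multiplication by `e^{-itω}` as a unitary group -/

section MulLp

variable {σ : Measure ℝ}

theorem memLp_expMul (t : ℝ) (f : Lp ℂ 2 σ) :
    MemLp (fun ω : ℝ => Complex.exp (-Complex.I * t * ω) * f ω) 2 σ := by
  refine (Lp.memLp f).congr_norm ?_ (ae_of_all _ fun ω => ?_)
  · exact AEStronglyMeasurable.mul (by fun_prop) (Lp.aestronglyMeasurable f)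
  · simp [Complex.norm_exp]

theorem coeFn_expMul (t : ℝ) (f : Lp ℂ 2 σ) : (memLp_expMul t f).toLp _ =ᵐ[σ]
    fun ω : ℝ => Complex.exp (-Complex.I * t * ω) * f ω := MemLp.coeFn_toLp _

theorem expMul_add (s t : ℝ) (f : Lp ℂ 2 σ) : (memLp_expMul (s + t) f).toLp _ =
    (memLp_expMul s ((memLp_expMul t f).toLp _)).toLp _ := by
  ext1
  filter_upwards [coeFn_expMul (s + t) f, coeFn_expMul s ((memLp_expMul t f).toLp _),
    coeFn_expMul t f] with ω h1 h2 h3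
  rw [h1, h2, h3, ← mul_assoc, ← Complex.exp_add]
  push_cast; ring_nf

theorem expMul_zero (f : Lp ℂ 2 σ) : (memLp_expMul 0 f).toLp _ = f := by
  simp

/-- Multiplication by `e^{-itω}` on `L²`. -/
noncomputable def expMul (t : ℝ) : Lp ℂ 2 σ ≃ₗᵢ[ℂ] Lp ℂ 2 σ where
  toFun f := (memLp_expMul t f).toLp _
  invFun f := (memLp_expMul (-t) f).toLp _
  left_inv f := (expMul_add (-t) t f).symm.trans (by simp_rw [neg_add_cancel]; exact expMul_zero f)
  right_inv f := (expMul_add t (-t) f).symm.trans (by simp_rw [add_neg_cancel]; exact expMul_zero f)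
  map_add' f g := by
    ext1
    filter_upwards [coeFn_expMul t f, coeFn_expMul t g, coeFn_expMul t (f + g), Lp.coeFn_add f g,
      Lp.coeFn_add ((memLp_expMul t f).toLp _) ((memLp_expMul t g).toLp _)] with ω h1 h2 h3 h4 h5
    rw [h3, h5, h4, Pi.add_apply, Pi.add_apply, h1, h2, mul_add]
  map_smul' c f := by
    ext1
    filter_upwards [coeFn_expMul t f, coeFn_expMul t (c • f), Lp.coeFn_smul c f,
      Lp.coeFn_smul c ((memLp_expMul t f).toLp _)] with ω h1 h2 h3 h4
    rw [RingHom.id_apply, h2, h3, h4, Pi.smul_apply, Pi.smul_apply, h1, smul_eq_mul, smul_eq_mul]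
    ring
  norm_map' f := by
    rw [Lp.norm_def, Lp.norm_def]
    congr 1
    refine eLpNorm_congr_norm_ae ?_
    filter_upwards [coeFn_expMul t f] with ω h
    exact (congrArg norm h).trans (by simp [Complex.norm_exp])

theorem coeFn_expMul' (t : ℝ) (f : Lp ℂ 2 σ) : expMul t f =ᵐ[σ]
    fun ω : ℝ => Complex.exp (-Complex.I * t * ω) * f ω := coeFn_expMul t f

/-- For `|θ| ≤ 1` this is Taylor's estimate; beyond that the crude bound `2 + |θ| ≤ 3θ²` suffices,
which explains the constant. -/
theorem norm_exp_sub_one_sub_le (θ : ℝ) :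
    ‖Complex.exp (-Complex.I * θ) - 1 + Complex.I * θ‖ ≤ 3 * θ ^ 2 := by
  rcases le_or_gt |θ| 1 with h | h
  · have := Complex.norm_exp_sub_one_sub_id_le (x := -Complex.I * θ) (by simpa using h)
    rw [neg_mul, sub_neg_eq_add] at this
    rw [neg_mul]
    refine this.trans ?_
    simp only [norm_neg, norm_mul, Complex.norm_I, one_mul, Complex.norm_real, Real.norm_eq_abs,
      sq_abs]
    nlinarith [sq_nonneg θ]
  · have h1 : ‖Complex.exp (-Complex.I * θ)‖ = 1 := by simp [Complex.norm_exp]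
    have h2 : ‖Complex.I * (θ : ℂ)‖ = |θ| := by simp
    have := norm_add_le (Complex.exp (-Complex.I * θ) - 1) (Complex.I * θ)
    have h3 := norm_sub_le (Complex.exp (-Complex.I * θ)) 1
    rw [norm_one] at h3
    nlinarith [sq_abs θ]

variable {δ : ℝ} (hδ : 0 < δ)
  (hexp : ∀ t ∈ Set.Ioo (-δ) δ, Integrable (fun ω => Real.exp (t * ω)) σ)

/-- The remainder of the exponential is pointwise at most `3 t² |ω² q|`, and `ω² q` is again a
polynomial, hence in `L²`. So the derivative exists in norm. -/
theorem hasDerivAt_expMul_polyLp (q : Polynomial ℂ) :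
    HasDerivAt (fun t : ℝ => expMul t (polyLp hδ hexp q))
      (-Complex.I • polyLp hδ hexp (Polynomial.X * q)) 0 := by
  rw [hasDerivAt_iff_isLittleO]
  refine Asymptotics.IsBigO.trans_isLittleO (g := fun t : ℝ => t ^ 2) ?_ ?_
  · refine Asymptotics.IsBigO.of_bound (3 * ‖polyLp hδ hexp (Polynomial.X ^ 2 * q)‖)
      (Eventually.of_forall fun t => ?_)
    have h := Lp.norm_le_mul_norm_of_ae_le_mul (c := 3 * t ^ 2)
      (f := expMul t (polyLp hδ hexp q) - polyLp hδ hexp q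
        - ((t : ℂ) * -Complex.I) • polyLp hδ hexp (Polynomial.X * q))
      (g := polyLp hδ hexp (Polynomial.X ^ 2 * q)) ?_
    · have h0 : expMul (0 : ℝ) (polyLp hδ hexp q) = polyLp hδ hexp q := expMul_zero _
      have hs : t • -Complex.I • polyLp hδ hexp (Polynomial.X * q)
          = ((t : ℂ) * -Complex.I) • polyLp hδ hexp (Polynomial.X * q) := by
        rw [← smul_assoc, Complex.real_smul]
      rw [h0, sub_zero, hs, Real.norm_eq_abs, abs_of_nonneg (sq_nonneg t)]
      linarith
    · filter_upwards [coeFn_polyLp hδ hexp q, coeFn_polyLp hδ hexp (Polynomial.X * q),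
        coeFn_polyLp hδ hexp (Polynomial.X ^ 2 * q), coeFn_expMul' t (polyLp hδ hexp q),
        Lp.coeFn_sub (expMul t (polyLp hδ hexp q) - polyLp hδ hexp q)
          (((t : ℂ) * -Complex.I) • polyLp hδ hexp (Polynomial.X * q)),
        Lp.coeFn_sub (expMul t (polyLp hδ hexp q)) (polyLp hδ hexp q),
        Lp.coeFn_smul ((t : ℂ) * -Complex.I) (polyLp hδ hexp (Polynomial.X * q))]
        with ω h1 h2 h3 h4 h5 h6 h7
      rw [h5, Pi.sub_apply, h6, h7, Pi.sub_apply, Pi.smul_apply, h4, h2, h1, h3]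
      simp only [Polynomial.eval_mul, Polynomial.eval_X, Polynomial.eval_pow, smul_eq_mul]
      have := norm_exp_sub_one_sub_le (t * ω)
      calc _ = ‖(Complex.exp (-Complex.I * (t * ω : ℝ)) - 1 + Complex.I * (t * ω : ℝ))
            * q.eval (ω : ℂ)‖ := by
            congr 1; push_cast; ring_nf
        _ ≤ 3 * (t * ω) ^ 2 * ‖q.eval (ω : ℂ)‖ := by
            rw [norm_mul]; gcongr
        _ = _ := by
            rw [norm_mul, norm_pow, Complex.norm_real, Real.norm_eq_abs, sq_abs]; ring
  · simpa using Asymptotics.isLittleO_pow_id (𝕜 := ℝ) (n := 2) (by norm_num)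

end MulLp

/-! ### Jacobi operators as multiplication by `ω` -/

section Evolution

variable {σ : Measure ℝ} {δ : ℝ} {P : ℕ → Polynomial ℝ}

theorem eval_map_ofReal (p : Polynomial ℝ) (ω : ℝ) :
    (p.map Complex.ofRealHom).eval (ω : ℂ) = ((p.eval ω : ℝ) : ℂ) := by
  rw [Polynomial.eval_map]
  exact Polynomial.eval₂_at_apply Complex.ofRealHom ω

theorem PolyHam.IsOrthonormalSystem.span_eq_top (hP : IsOrthonormalSystem σ P) :
    Submodule.span ℝ (Set.range P) = ⊤ := by
  have hne : ∀ n, P n ≠ 0 := fun n h => by simpa [h] using hP.leadingCoeff_pos n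
  let S : Polynomial.Sequence ℝ := ⟨P, fun n => by
    rw [Polynomial.degree_eq_natDegree (hne n), hP.natDegree_eq]⟩
  exact S.span fun n => isUnit_iff_ne_zero.2 (hP.leadingCoeff_pos n).ne'

variable (hδ : 0 < δ)
  (hexp : ∀ t ∈ Set.Ioo (-δ) δ, Integrable (fun ω => Real.exp (t * ω)) σ)

theorem inner_polyLp_mul (t : ℝ) (m n : ℕ) :
    inner ℂ (polyLp hδ hexp ((P m).map Complex.ofRealHom))
      (expMul t (polyLp hδ hexp ((P n).map Complex.ofRealHom))) =
    ∫ ω : ℝ, Complex.exp (-Complex.I * t * ω) * ((P m).eval ω * (P n).eval ω : ℝ) ∂σ := by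
  rw [L2.inner_def]
  refine integral_congr_ae ?_
  filter_upwards [coeFn_polyLp hδ hexp ((P m).map Complex.ofRealHom),
    coeFn_polyLp hδ hexp ((P n).map Complex.ofRealHom),
    coeFn_expMul' t (polyLp hδ hexp ((P n).map Complex.ofRealHom))] with ω h1 h2 h3
  rw [h3, h1, h2, eval_map_ofReal, eval_map_ofReal, RCLike.inner_apply, Complex.conj_ofReal]
  push_cast; ring

variable (hP : IsOrthonormalSystem σ P)

include hP in
theorem orthonormal_polyLp :
    Orthonormal ℂ fun n => polyLp hδ hexp ((P n).map Complex.ofRealHom) := by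
  rw [orthonormal_iff_ite]
  intro m n
  have h := inner_polyLp_mul (P := P) hδ hexp 0 m n
  have h0 : ∀ f : Lp ℂ 2 σ, expMul 0 f = f := expMul_zero
  rw [h0] at h
  rw [h]
  simp only [Complex.ofReal_zero, mul_zero, zero_mul, Complex.exp_zero, one_mul]
  rw [integral_complex_ofReal, hP.orthonormal m n]
  split_ifs <;> simp

include hP in
theorem span_polyLp_orthogonal : (Submodule.span ℂ (Set.range fun n =>
    polyLp hδ hexp ((P n).map Complex.ofRealHom)))ᗮ = ⊥ := by
  rw [Submodule.eq_bot_iff]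
  intro f hf
  refine polyLp_orthogonal_eq_zero hδ hexp fun n => ?_
  -- The `P n` span the real polynomials over `ℝ`, so orthogonality to all `P n` is carried over to
  -- the monomials by a real-linear functional.
  let L : Polynomial ℝ →ₗ[ℝ] ℂ :=
    { toFun := fun q => inner ℂ (polyLp hδ hexp (q.map Complex.ofRealHom)) f
      map_add' := fun p q => by rw [Polynomial.map_add, map_add, inner_add_left]
      map_smul' := fun c q => by
        have : (c • q).map Complex.ofRealHom = (c : ℂ) • q.map Complex.ofRealHom := by
          rw [Polynomial.map_smul]; rfl
        rw [this, map_smul, inner_smul_left, RingHom.id_apply, Complex.conj_ofReal,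
          Complex.real_smul] }
  have hL : L = 0 := by
    refine LinearMap.ext_on_range hP.span_eq_top fun n => ?_
    exact (Submodule.mem_orthogonal _ _).1 hf _ (Submodule.subset_span ⟨n, rfl⟩)
  have := congrArg (fun L => L (Polynomial.X ^ n)) hL
  simpa [L] using this

/-- The Jacobi operator with diagonal `d` and off-diagonal `o`. -/
structure IsJacobiOperator (H : Module.End ℂ FinFock) (d o : ℕ → ℝ) : Prop where
  zero : H (Finsupp.single 0 1) = (o 0 : ℂ) • Finsupp.single 1 1 + (d 0 : ℂ) • Finsupp.single 0 1
  succ : ∀ n, H (Finsupp.single (n + 1) 1) = (o (n + 1) : ℂ) • Finsupp.single (n + 2) 1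
    + (d (n + 1) : ℂ) • Finsupp.single (n + 1) 1 + (o n : ℂ) • Finsupp.single n 1

/-- The three-term recurrence with coefficients `d` and `o`. -/
structure IsThreeTerm (P : ℕ → Polynomial ℝ) (d o : ℕ → ℝ) : Prop where
  zero : Polynomial.X * P 0 = Polynomial.C (o 0) * P 1 + Polynomial.C (d 0) * P 0
  succ : ∀ n, Polynomial.X * P (n + 1) = Polynomial.C (o (n + 1)) * P (n + 2)
    + Polynomial.C (d (n + 1)) * P (n + 1) + Polynomial.C (o n) * P n

/-- Finite vectors as polynomials. -/
noncomputable def finPoly (P : ℕ → Polynomial ℝ) : FinFock →ₗ[ℂ] Polynomial ℂ :=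
  Finsupp.lsum ℂ fun n : ℕ => LinearMap.toSpanSingleton ℂ _ ((P n).map Complex.ofRealHom)

theorem finPoly_single (n : ℕ) : finPoly P (Finsupp.single n 1) = (P n).map Complex.ofRealHom := by
  simp [finPoly]

/-- On basis vectors the matrix of `H` and the recurrence of the `P n` are the same formula; hence
powers of `H` become powers of `X`. -/
theorem finPoly_map {H : Module.End ℂ FinFock} {d o : ℕ → ℝ} (hH : IsJacobiOperator H d o)
    (hd : IsThreeTerm P d o) (x : FinFock) : finPoly P (H x) = Polynomial.X * finPoly P x := by
  have : finPoly P ∘ₗ H = LinearMap.mulLeft ℂ Polynomial.X ∘ₗ finPoly P := by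
    refine Finsupp.lhom_ext' fun n => LinearMap.ext_ring ?_
    simp only [LinearMap.comp_apply, Finsupp.lsingle_apply, LinearMap.mulLeft_apply, finPoly_single]
    have hX : (Polynomial.X : Polynomial ℂ) = (Polynomial.X : Polynomial ℝ).map Complex.ofRealHom := by
      simp
    cases n with
    | zero =>
      rw [hH.zero, hX, ← Polynomial.map_mul, hd.zero]
      simp only [map_add, map_smul, finPoly_single, Polynomial.smul_eq_C_mul, Polynomial.map_add,
        Polynomial.map_mul, Polynomial.map_C, Complex.ofRealHom_eq_coe]
    | succ n =>
      rw [hH.succ, hX, ← Polynomial.map_mul, hd.succ]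
      simp only [map_add, map_smul, finPoly_single, Polynomial.smul_eq_C_mul, Polynomial.map_add,
        Polynomial.map_mul, Polynomial.map_C, Complex.ofRealHom_eq_coe]
  exact congrArg (fun L => L x) this

theorem finPoly_pow {H : Module.End ℂ FinFock} {d o : ℕ → ℝ} (hH : IsJacobiOperator H d o)
    (hd : IsThreeTerm P d o) (n : ℕ) (x : FinFock) :
    finPoly P ((H ^ n) x) = Polynomial.X ^ n * finPoly P x := by
  induction n with
  | zero => simp
  | succ n ih =>
    rw [pow_succ', Module.End.mul_apply, finPoly_map hH hd, ih, pow_succ', mul_assoc]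

include hδ hexp hP in
/-- Orthonormal polynomials satisfying the three-term recurrence diagonalize the corresponding
Jacobi operator; its evolution group is multiplication by `e^{-itω}`. -/
theorem evolution_of_threeTerm {H : Module.End ℂ FinFock} {d o : ℕ → ℝ}
    (hH : IsJacobiOperator H d o) (hd : IsThreeTerm P d o) :
    (∃ U, IsEvolution H U) ∧
    ∀ U, IsEvolution H U → ∀ (t : ℝ) (m n : ℕ),
      inner ℂ (ket m) (U t (ket n)) =
        ∫ ω : ℝ, Complex.exp (-Complex.I * t * ω) * ((P m).eval ω * (P n).eval ω : ℝ) ∂σ := by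
  set b : HilbertBasis ℕ ℂ (Lp ℂ 2 σ) := HilbertBasis.mkOfOrthogonalEqBot
    (orthonormal_polyLp hδ hexp hP) (span_polyLp_orthogonal hδ hexp hP) with hb
  have hbn : ∀ n, b n = polyLp hδ hexp ((P n).map Complex.ofRealHom) := fun n => by
    rw [hb, HilbertBasis.coe_mkOfOrthogonalEqBot]
  have hket : ∀ n, b.repr.symm (ket n) = polyLp hδ hexp ((P n).map Complex.ofRealHom) :=
    fun n => (b.repr_symm_single n).trans (hbn n)
  have hfin : ∀ x, b.repr.symm (toFock x) = polyLp hδ hexp (finPoly P x) := by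
    intro x
    have : b.repr.symm.toLinearEquiv.toLinearMap ∘ₗ toFock = polyLp hδ hexp ∘ₗ finPoly P := by
      refine Finsupp.lhom_ext' fun n => LinearMap.ext_ring ?_
      simp only [LinearMap.comp_apply, Finsupp.lsingle_apply, finPoly_single, toFock_single,
        one_smul]
      exact hket n
    exact congrArg (fun L => L x) this
  -- The orthonormal polynomials form a Hilbert basis, so sending `|n⟩` to `P n` is unitary; the
  -- group is multiplication by `e^{-itω}` transported along it.
  let U₀ : ℝ → (Fock ≃ₗᵢ[ℂ] Fock) := fun t => (b.repr.symm.trans (expMul t)).trans b.repr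
  have hU₀ : ∀ t ψ, U₀ t ψ = b.repr (expMul t (b.repr.symm ψ)) := fun _ _ => rfl
  have hgen : ∀ x : FinFock,
      HasDerivAt (fun t : ℝ => U₀ t (toFock x)) (-Complex.I • toFock (H x)) 0 := by
    intro x
    have h1 := hasDerivAt_expMul_polyLp hδ hexp (finPoly P x)
    rw [← finPoly_map hH hd, ← hfin, ← hfin] at h1
    have h2 := (b.repr.toContinuousLinearEquiv.toContinuousLinearMap.restrictScalars
      ℝ).hasFDerivAt.comp_hasDerivAt 0 h1
    convert! h2 using 1
    change _ = b.repr (-Complex.I • b.repr.symm (toFock (H x)))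
    rw [map_smul, LinearIsometryEquiv.apply_symm_apply]
  have hadd : ∀ s t ψ, U₀ (s + t) ψ = U₀ s (U₀ t ψ) := by
    intro s t ψ
    simp only [hU₀, LinearIsometryEquiv.symm_apply_apply]
    congr 1
    exact expMul_add s t _
  have hzero : ∀ ψ, U₀ 0 ψ = ψ := by
    intro ψ
    have h0 : ∀ f : Lp ℂ 2 σ, expMul 0 f = f := expMul_zero
    rw [hU₀, h0, LinearIsometryEquiv.apply_symm_apply]
  -- On finite vectors continuity at `0` follows from differentiability there, and the group law
  -- moves it to any time. Isometry and density extend it to all vectors by an `ε/3` argument.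
  have hcont : ∀ ψ, Continuous fun t : ℝ => U₀ t ψ := by
    intro ψ
    rw [Metric.continuous_iff]
    intro t ε hε
    obtain ⟨x, hx⟩ := dense_range_toFock.exists_dist_lt ψ (by positivity : 0 < ε / 3)
    obtain ⟨η, hη, hη'⟩ := Metric.continuousAt_iff.1 (hgen x).continuousAt (ε / 3) (by positivity)
    refine ⟨η, hη, fun s hs => ?_⟩
    have e1 : dist (U₀ s ψ) (U₀ s (toFock x)) < ε / 3 := by
      rwa [LinearIsometryEquiv.dist_map]
    have e2 : dist (U₀ t (toFock x)) (U₀ t ψ) < ε / 3 := by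
      rwa [LinearIsometryEquiv.dist_map, dist_comm]
    have e3 : dist (U₀ s (toFock x)) (U₀ t (toFock x)) < ε / 3 := by
      have h3 : U₀ s (toFock x) = U₀ t (U₀ (s - t) (toFock x)) := by
        rw [← hadd, add_sub_cancel]
      have h4 : U₀ t (toFock x) = U₀ t (U₀ 0 (toFock x)) := by rw [hzero]
      rw [h3, h4, LinearIsometryEquiv.dist_map]
      refine hη' ?_
      rwa [Real.dist_eq, sub_zero, ← Real.dist_eq]
    calc dist (U₀ s ψ) (U₀ t ψ) ≤ dist (U₀ s ψ) (U₀ s (toFock x))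
          + dist (U₀ s (toFock x)) (U₀ t (toFock x)) + dist (U₀ t (toFock x)) (U₀ t ψ) :=
          dist_triangle4 _ _ _ _
      _ < ε := by linarith
  have hev : IsEvolution H U₀ := ⟨hzero, hadd, hcont, hgen⟩
  refine ⟨⟨U₀, hev⟩, fun U hU t m n => ?_⟩
  -- The powers of `H` applied to a finite vector are `X^n` times a polynomial, for which the growth
  -- ratio `8 / δ` was obtained.
  have huniq := hU.unique (C := 8 / δ) (by positivity) (fun x => ?_) hev t (ket n)
  · rw [huniq, ← inner_polyLp_mul hδ hexp t m n, hU₀, ← hket m, ← hket n,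
      ← b.repr.inner_map_map, LinearIsometryEquiv.apply_symm_apply]
  · obtain ⟨K, hK⟩ := exists_norm_polyLp_X_pow_mul_le hδ hexp (finPoly P x)
    refine ⟨K, fun n => ?_⟩
    rw [← b.repr.symm.norm_map, hfin, finPoly_pow hH hd]
    exact hK n

end Evolution

/-! ### Matrix entries of the Hamiltonians -/

section Operators

theorem annih_single (n : ℕ) : annih (Finsupp.single n 1)
    = ((√(n : ℝ) : ℝ) : ℂ) • Finsupp.single (n - 1) 1 := by
  simp [annih]

theorem creat_single (n : ℕ) : creat (Finsupp.single n 1)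
    = ((√((n : ℝ) + 1) : ℝ) : ℂ) • Finsupp.single (n + 1) 1 := by
  simp [creat]

theorem numFn_single (f : ℕ → ℝ) (n : ℕ) : numFn f (Finsupp.single n 1)
    = ((f n : ℝ) : ℂ) • Finsupp.single n 1 := by
  simp [numFn]

/-- For `n = 0` the truncated index `0 - 1 = 0` in the annihilation operator does no harm, since its
coefficient is `√0`. -/
theorem isJacobiOperator_hermiteH (a₀ a₁ b₀ : ℝ) : IsJacobiOperator (hermiteH a₀ a₁ b₀)
    (fun _ => -(a₀ / a₁)) (fun n => √(-(b₀ / a₁)) * √((n : ℝ) + 1)) := by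
  constructor
  · simp only [hermiteH, LinearMap.add_apply, LinearMap.smul_apply, annih_single, creat_single,
      numFn_single]
    simp [add_comm]
  · intro n
    simp only [hermiteH, LinearMap.add_apply, LinearMap.smul_apply, annih_single, creat_single,
      numFn_single, smul_add, smul_smul]
    push_cast
    abel

/-- Lowering reaches level `n` before `g` is applied, raising applies `g` at level `n` first. Both
off-diagonal entries are therefore `c g(n) √(n+1)`, and the matrix is symmetric. -/
theorem isJacobiOperator_ladder (f g : ℕ → ℝ) (c : ℝ) :
    IsJacobiOperator (numFn f + ((c : ℝ) : ℂ) • (numFn g * annih + creat * numFn g))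
    f (fun n => c * (g n * √((n : ℝ) + 1))) := by
  constructor
  · simp only [LinearMap.add_apply, LinearMap.smul_apply, Module.End.mul_apply, annih_single,
      creat_single, numFn_single, map_smul]
    simp [add_comm]
  · intro n
    simp only [LinearMap.add_apply, LinearMap.smul_apply, Module.End.mul_apply, annih_single,
      creat_single, numFn_single, map_smul, smul_add, smul_smul]
    push_cast
    rw [mul_comm (√((n : ℝ) + 1) : ℂ)]
    abel

end Operators

/-! ### Rodrigues polynomials -/

section Rodrigues

open Polynomial

variable {A : Type*} [CommRing A]

/-- The raising operator `p ↦ s p' + (τ + k s') p`. -/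
noncomputable def raising (s τ : A[X]) (k : ℕ) (p : A[X]) : A[X] :=
  s * derivative p + (τ + (k : A[X]) * derivative s) * p

/-- `rodrigues s τ n k` is `(s ^ k ρ)⁻¹ (d/dω)ⁿ (s ^ (n + k) ρ)` if `(s ρ)' = τ ρ`. -/
noncomputable def rodrigues (s τ : A[X]) : ℕ → ℕ → A[X]
  | 0, _ => 1
  | n + 1, k => raising s τ k (rodrigues s τ n (k + 1))

theorem rodrigues_map {B : Type*} [CommRing B] (f : A →+* B) (s τ : A[X]) (n k : ℕ) :
    (rodrigues s τ n k).map f = rodrigues (s.map f) (τ.map f) n k := by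
  induction n generalizing k with
  | zero => simp [rodrigues]
  | succ n ih => simp [rodrigues, raising, ← ih, derivative_map]

/-- The operator `p ↦ p' + κ p`, which is `d/dω` on `p e^{κω}`. -/
noncomputable def twistedDeriv (κ : A) : Module.End A A[X] := derivative + κ • LinearMap.id

theorem twistedDeriv_apply (κ : A) (p : A[X]) :
    twistedDeriv κ p = derivative p + C κ * p := by
  simp [twistedDeriv, smul_eq_C_mul]

variable {s τ : A[X]} {κ : A} {L : A[X] →ₗ[A] A}

/-- A linear functional which is, in the weak sense, integration against `e^{κω} ρ` with
`(s ρ)' = τ ρ`. -/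
def IsPearson (s τ : A[X]) (κ : A) (L : A[X] →ₗ[A] A) : Prop :=
  ∀ p : A[X], L (s * twistedDeriv κ p + τ * p) = 0

/-- A single integration by parts: Pearson's identity is applied to `p q s^k`, and the derivative of
`s^k` supplies the term `k s'` in the raising operator. -/
theorem IsPearson.apply_mul_raising (hL : IsPearson s τ κ L) (k : ℕ) (p q : A[X]) :
    L (p * raising s τ k q * s ^ k) = -L (twistedDeriv κ p * q * s ^ (k + 1)) := by
  rw [← add_eq_zero_iff_eq_neg, ← map_add, ← hL (p * q * s ^ k)]
  congr 1
  have h : s * derivative (s ^ k) = (k : A[X]) * s ^ k * derivative s := by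
    cases k with
    | zero => simp
    | succ k => rw [derivative_pow_succ]; simp; ring
  simp only [raising, twistedDeriv_apply, derivative_mul]
  linear_combination (-p * q) * h

/-- Each raising step in `rodrigues` is moved onto `p`, costing a sign and one further factor `s`.
-/
theorem IsPearson.apply_mul_rodrigues_mul_pow (hL : IsPearson s τ κ L) (n k : ℕ) (p : A[X]) :
    L (p * rodrigues s τ n k * s ^ k) = (-1) ^ n * L ((twistedDeriv κ ^ n) p * s ^ (n + k)) := by
  induction n generalizing k p with
  | zero => simp [rodrigues]
  | succ n ih =>
    rw [rodrigues, hL.apply_mul_raising, ih, pow_succ (twistedDeriv κ), Module.End.mul_apply]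
    rw [show n + (k + 1) = n + 1 + k by ring]
    ring

theorem twistedDeriv_pow_one (n : ℕ) : (twistedDeriv κ ^ n) (1 : A[X]) = C (κ ^ n) := by
  induction n with
  | zero => simp
  | succ n ih =>
    rw [pow_succ', Module.End.mul_apply, ih, twistedDeriv_apply, derivative_C, zero_add, ← C_mul,
      pow_succ']

theorem IsPearson.apply_rodrigues (hL : IsPearson s τ κ L) (n : ℕ) :
    L (rodrigues s τ n 0) = (-κ) ^ n * L (s ^ n) := by
  have h := hL.apply_mul_rodrigues_mul_pow n 0 1
  rw [one_mul, pow_zero, mul_one, twistedDeriv_pow_one, add_zero, ← smul_eq_C_mul, map_smul,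
    smul_eq_mul, ← mul_assoc, ← mul_pow, neg_one_mul] at h
  exact h

/-- For `κ = 0` the twisted derivative is the ordinary one, and the `n`-th derivative of `p` is the
constant `n!` times its coefficient of degree `n`. This contains orthogonality to lower degrees as
well as the norm. -/
theorem IsPearson.apply_mul_rodrigues (hL : IsPearson s τ 0 L) (n : ℕ) {p : A[X]}
    (hp : p.natDegree ≤ n) :
    L (p * rodrigues s τ n 0) = (-1) ^ n * (n.factorial * p.coeff n * L (s ^ n)) := by
  have h := hL.apply_mul_rodrigues_mul_pow n 0 p
  have h0 : twistedDeriv (0 : A) = derivative := by simp [twistedDeriv]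
  have h1 : (derivative^[n]) p = C (n.factorial * p.coeff n) := by
    have hd : ((derivative^[n]) p).natDegree ≤ 0 :=
      (natDegree_iterate_derivative p n).trans (by omega)
    rw [eq_C_of_natDegree_le_zero hd, coeff_iterate_derivative]
    simp [Nat.descFactorial_self]
  rw [pow_zero, mul_one, add_zero, h0, Module.End.pow_apply, h1, ← smul_eq_C_mul, map_smul,
    smul_eq_mul] at h
  exact h

/-! ### Coefficients -/

variable (s₀ s₁ s₂ t₀ t₁ : A)

theorem coeff_raising (k j : ℕ) (p : A[X]) :
    (raising (C s₀ + C s₁ * X + C s₂ * X ^ 2) (C t₀ + C t₁ * X) k p).coeff (j + 1)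
      = s₀ * (j + 2) * p.coeff (j + 2) + (s₁ * (j + 1) + t₀ + k * s₁) * p.coeff (j + 1)
        + (s₂ * j + t₁ + 2 * k * s₂) * p.coeff j := by
  have e : raising (C s₀ + C s₁ * X + C s₂ * X ^ 2) (C t₀ + C t₁ * X) k p
      = C s₀ * derivative p + C s₁ * (derivative p * X) + C s₂ * (derivative p * X ^ 2)
        + C (t₀ + k * s₁) * p + C (t₁ + 2 * k * s₂) * (p * X) := by
    simp only [raising, derivative_C, derivative_mul, derivative_X,
      derivative_X_pow, map_add, map_mul, map_natCast, map_ofNat]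
    push_cast
    ring
  rw [e]
  simp only [coeff_add, coeff_C_mul, coeff_derivative, coeff_mul_X]
  cases j with
  | zero =>
    have : (derivative p * X ^ 2).coeff (0 + 1) = 0 := by
      rw [coeff_mul_X_pow']; simp
    rw [this]
    push_cast; ring_nf
  | succ j =>
    rw [show j + 1 + 1 = j + 2 by ring, coeff_mul_X_pow, coeff_derivative]
    push_cast; ring_nf

theorem coeff_zero_raising_one (k : ℕ) :
    (raising (C s₀ + C s₁ * X + C s₂ * X ^ 2) (C t₀ + C t₁ * X) k 1).coeff 0 = t₀ + k * s₁ := by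
  simp [raising]

theorem coeff_rodrigues_of_lt (n k : ℕ) {j : ℕ} (hj : n < j) :
    (rodrigues (C s₀ + C s₁ * X + C s₂ * X ^ 2) (C t₀ + C t₁ * X) n k).coeff j = 0 := by
  induction n generalizing k j with
  | zero => rw [rodrigues, coeff_one, if_neg (by omega)]
  | succ n ih =>
    obtain ⟨j, rfl⟩ : ∃ i, j = i + 1 := ⟨j - 1, by omega⟩
    rw [rodrigues, coeff_raising, ih _ (by omega), ih _ (by omega), ih _ (by omega)]
    ring

theorem natDegree_rodrigues_le (n k : ℕ) :
    (rodrigues (C s₀ + C s₁ * X + C s₂ * X ^ 2) (C t₀ + C t₁ * X) n k).natDegree ≤ n :=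
  natDegree_le_iff_coeff_eq_zero.2 fun _ h => coeff_rodrigues_of_lt s₀ s₁ s₂ t₀ t₁ n k h

/-- Leading coefficient of the Rodrigues polynomials. -/
def rodriguesLead (s₂ t₁ : A) : ℕ → ℕ → A
  | 0, _ => 1
  | n + 1, k => (t₁ + (n + 2 * k) * s₂) * rodriguesLead s₂ t₁ n (k + 1)

theorem rodriguesLead_eq_prod (n k : ℕ) :
    rodriguesLead s₂ t₁ n k = ∏ j ∈ Finset.range n, (t₁ + (2 * k + n + j - 1) * s₂) := by
  induction n generalizing k with
  | zero => simp [rodriguesLead]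
  | succ n ih =>
    rw [rodriguesLead, ih, Finset.prod_range_succ', mul_comm]
    congr 1
    · refine Finset.prod_congr rfl fun j _ => ?_
      push_cast; ring
    · push_cast; ring

theorem coeff_rodrigues_self (n k : ℕ) :
    (rodrigues (C s₀ + C s₁ * X + C s₂ * X ^ 2) (C t₀ + C t₁ * X) n k).coeff n
      = rodriguesLead s₂ t₁ n k := by
  induction n generalizing k with
  | zero => simp [rodrigues, rodriguesLead]
  | succ n ih =>
    rw [rodrigues, coeff_raising, coeff_rodrigues_of_lt _ _ _ _ _ _ _ (by omega),
      coeff_rodrigues_of_lt _ _ _ _ _ _ _ (by omega), ih, rodriguesLead]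
    ring

/-- The ratio of the two highest coefficients, cleared of its denominator; it produces the diagonal
of the recurrence. The induction uses the case `k + 1`, whose prefactor must be cancelled, hence the
nonvanishing condition. -/
theorem coeff_rodrigues_sub [IsDomain A] (h : ∀ j : ℕ, t₁ + j * s₂ ≠ 0) (n k : ℕ) :
    (t₁ + (2 * k + 2 * n) * s₂) *
      (rodrigues (C s₀ + C s₁ * X + C s₂ * X ^ 2) (C t₀ + C t₁ * X) (n + 1) k).coeff n
      = (n + 1) * (t₀ + (k + n) * s₁) * rodriguesLead s₂ t₁ (n + 1) k := by
  induction n generalizing k with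
  | zero =>
    rw [rodrigues, rodrigues, coeff_zero_raising_one, rodriguesLead, rodriguesLead]
    push_cast; ring
  | succ n ih =>
    have hne := h (2 * (k + 1) + 2 * n)
    push_cast at hne
    have ih' := ih (k + 1)
    rw [rodrigues, coeff_raising, coeff_rodrigues_of_lt _ _ _ _ _ _ _ (by omega),
      coeff_rodrigues_self]
    refine mul_left_cancel₀ hne ?_
    have e : rodriguesLead s₂ t₁ (n + 1 + 1) k
      = (t₁ + ((n + 1 : ℕ) + 2 * k) * s₂) * rodriguesLead s₂ t₁ (n + 1) (k + 1) := rfl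
    rw [e]
    push_cast at ih' ⊢
    linear_combination (t₁ + (2 * k + 2 * (n + 1)) * s₂) * (s₂ * n + t₁ + 2 * k * s₂) * ih'

end Rodrigues

/-! ### Three-term recurrence of orthonormal polynomials -/

section ThreeTerm

open Polynomial

variable {σ : Measure ℝ} {P : ℕ → ℝ[X]}

theorem PolyHam.IsOrthonormalSystem.sum_repr (hP : IsOrthonormalSystem σ P) (n : ℕ) {q : ℝ[X]}
    (hq : q.natDegree < n) : ∃ a : ℕ → ℝ, q = ∑ i ∈ Finset.range n, C (a i) * P i := by
  induction n generalizing q with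
  | zero => omega
  | succ n ih =>
    have hl := (hP.leadingCoeff_pos n).ne'
    set r := q - C (q.coeff n / (P n).leadingCoeff) * P n with hr
    have hrc : r.coeff n = 0 := by
      rw [hr, coeff_sub, coeff_C_mul, leadingCoeff, hP.natDegree_eq]
      rw [leadingCoeff, hP.natDegree_eq] at hl
      field_simp
      ring
    have hrd : r.natDegree ≤ n := by
      refine (natDegree_sub_le _ _).trans (max_le (by omega) ?_)
      exact (natDegree_C_mul_le _ _).trans (hP.natDegree_eq n).le
    rcases Nat.eq_zero_or_pos n with rfl | hn
    · refine ⟨fun _ => q.coeff 0 / (P 0).leadingCoeff, ?_⟩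
      have : r = 0 := by
        rw [eq_C_of_natDegree_le_zero hrd, hrc, C_0]
      rw [Finset.sum_range_one]
      exact sub_eq_zero.1 this
    · have hrd' : r.natDegree < n := by
        rcases hrd.lt_or_eq with h | h
        · exact h
        · have : r.leadingCoeff = 0 := by rw [leadingCoeff, h, hrc]
          rw [leadingCoeff_eq_zero] at this
          rw [this]
          simpa
      obtain ⟨a, ha⟩ := ih hrd'
      refine ⟨fun i => if i = n then q.coeff n / (P n).leadingCoeff else a i, ?_⟩
      rw [Finset.sum_range_succ]
      beta_reduce
      rw [if_pos rfl]
      have : ∑ i ∈ Finset.range n, C (if i = n then q.coeff n / (P n).leadingCoeff else a i) * P i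
          = r := by
        rw [ha]
        refine Finset.sum_congr rfl fun i hi => ?_
        rw [if_neg (Finset.mem_range.1 hi).ne]
      rw [this, hr]
      ring

end ThreeTerm

section ThreeTerm

open Polynomial

variable {σ : Measure ℝ} {P : ℕ → ℝ[X]}

theorem PolyHam.IsOrthonormalSystem.integral_mul_sum (hP : IsOrthonormalSystem σ P) (n : ℕ)
    (a : ℕ → ℝ) {j : ℕ} (hj : j < n) :
    ∫ ω, (∑ i ∈ Finset.range n, C (a i) * P i).eval ω * (P j).eval ω ∂σ = a j := by
  have e : ∀ ω, (∑ i ∈ Finset.range n, C (a i) * P i).eval ω * (P j).eval ω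
      = ∑ i ∈ Finset.range n, a i * ((P i).eval ω * (P j).eval ω) := fun ω => by
    rw [eval_finsetSum, Finset.sum_mul]
    exact Finset.sum_congr rfl fun i _ => by rw [eval_mul, eval_C]; ring
  simp_rw [e]
  rw [integral_finsetSum _ fun i _ => (hP.integrable i j).const_mul _]
  simp_rw [integral_const_mul, hP.orthonormal]
  simp [hj]

theorem PolyHam.IsOrthonormalSystem.integrable_eval_mul (hP : IsOrthonormalSystem σ P) (q : ℝ[X])
    (j : ℕ) : Integrable (fun ω => q.eval ω * (P j).eval ω) σ := by
  obtain ⟨a, ha⟩ := hP.sum_repr (q.natDegree + 1) (q := q) (by omega)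
  have e : (fun ω => q.eval ω * (P j).eval ω)
      = fun ω => ∑ i ∈ Finset.range (q.natDegree + 1), a i * ((P i).eval ω * (P j).eval ω) := by
    funext ω
    conv_lhs => rw [ha]
    rw [eval_finsetSum, Finset.sum_mul]
    exact Finset.sum_congr rfl fun i _ => by rw [eval_mul, eval_C]; ring
  rw [e]
  exact integrable_finsetSum _ fun i _ => (hP.integrable i j).const_mul _

theorem PolyHam.IsOrthonormalSystem.eq_zero_of_orthogonal (hP : IsOrthonormalSystem σ P) (n : ℕ)
    {q : ℝ[X]} (hq : q.natDegree < n) (h : ∀ j < n, ∫ ω, q.eval ω * (P j).eval ω ∂σ = 0) :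
    q = 0 := by
  obtain ⟨a, rfl⟩ := hP.sum_repr n hq
  refine Finset.sum_eq_zero fun i hi => ?_
  rw [← hP.integral_mul_sum n a (Finset.mem_range.1 hi), h i (Finset.mem_range.1 hi), C_0, zero_mul]

theorem PolyHam.IsOrthonormalSystem.integral_mul_eq_zero (hP : IsOrthonormalSystem σ P) {n : ℕ}
    {q : ℝ[X]} (hq : q.natDegree < n) : ∫ ω, q.eval ω * (P n).eval ω ∂σ = 0 := by
  obtain ⟨a, rfl⟩ := hP.sum_repr n hq
  have h := hP.integral_mul_sum (n + 1) (fun i => if i = n then 0 else a i) (j := n) (by omega)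
  rw [if_pos rfl, Finset.sum_range_succ, if_pos rfl, C_0, zero_mul, add_zero] at h
  rw [← h]
  refine integral_congr_ae (ae_of_all _ fun ω => ?_)
  beta_reduce
  congr 2
  exact Finset.sum_congr rfl fun i hi => by rw [if_neg (Finset.mem_range.1 hi).ne]

/-- The coefficient of `P n` in `X * P (n + 1)`. -/
theorem PolyHam.IsOrthonormalSystem.integral_X_mul (hP : IsOrthonormalSystem σ P) {o : ℝ} {n : ℕ}
    (ho : o * (P (n + 1)).leadingCoeff = (P n).leadingCoeff) :
    ∫ ω, (X * P n).eval ω * (P (n + 1)).eval ω ∂σ = o := by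
  have hd : (X * P n - C o * P (n + 1)).natDegree < n + 1 := by
    refine Nat.lt_succ_of_le (natDegree_le_iff_coeff_eq_zero.2 fun k hk => ?_)
    obtain ⟨k, rfl⟩ : ∃ i, k = i + 1 := ⟨k - 1, by omega⟩
    rw [coeff_sub, coeff_X_mul, coeff_C_mul]
    rcases (show n ≤ k by omega).eq_or_lt with rfl | hk
    · rw [leadingCoeff, leadingCoeff, hP.natDegree_eq, hP.natDegree_eq] at ho
      rw [ho, sub_self]
    · rw [coeff_eq_zero_of_natDegree_lt (by rw [hP.natDegree_eq]; omega),
        coeff_eq_zero_of_natDegree_lt (by rw [hP.natDegree_eq]; omega), mul_zero, sub_zero]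
  have h := hP.integral_mul_eq_zero hd
  have e : ∀ ω, (X * P n - C o * P (n + 1)).eval ω * (P (n + 1)).eval ω
      = (X * P n).eval ω * (P (n + 1)).eval ω - o * ((P (n + 1)).eval ω * (P (n + 1)).eval ω) :=
    fun ω => by rw [eval_sub, eval_mul (p := C o), eval_C]; ring
  simp_rw [e] at h
  rw [integral_sub (hP.integrable_eval_mul _ _) ((hP.integrable _ _).const_mul _),
    integral_const_mul, hP.orthonormal, if_pos rfl, mul_one] at h
  linarith

/-- The conditions on `o` and `d` cancel the two highest coefficients of the difference of both
sides, which then has degree at most `n`. It is orthogonal to `P j` for `j < n` because `X * P j`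
has degree below `n + 1`, and to `P n` by symmetry of multiplication by `X`. So it is zero, and no
lower coefficient needs to be known. -/
theorem PolyHam.IsOrthonormalSystem.isThreeTerm (hP : IsOrthonormalSystem σ P) {d o : ℕ → ℝ}
    (ho : ∀ n, o n * (P (n + 1)).leadingCoeff = (P n).leadingCoeff)
    (hd0 : d 0 * (P 0).coeff 0 = -(o 0 * (P 1).coeff 0))
    (hd : ∀ n, d (n + 1) * (P (n + 1)).leadingCoeff
      = (P (n + 1)).coeff n - o (n + 1) * (P (n + 2)).coeff (n + 1)) :
    IsThreeTerm P d o := by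
  have hc : ∀ n k, n < k → (P n).coeff k = 0 := fun n k h =>
    coeff_eq_zero_of_natDegree_lt (by rw [hP.natDegree_eq]; exact h)
  have hl : ∀ n, (P n).leadingCoeff = (P n).coeff n := fun n => by
    rw [leadingCoeff, hP.natDegree_eq]
  simp only [hl] at ho hd
  constructor
  · ext k
    rcases k with _ | _ | k
    · simp [hd0]
    · simp [hc 0 1, ho 0]
    · simp [hc 0 (k + 1), hc 0 (k + 2), hc 1 (k + 2)]
  · intro n
    rw [← sub_eq_zero]
    have hdeg : (X * P (n + 1) - (C (o (n + 1)) * P (n + 2)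
        + C (d (n + 1)) * P (n + 1) + C (o n) * P n)).natDegree < n + 1 := by
      refine Nat.lt_succ_of_le (natDegree_le_iff_coeff_eq_zero.2 fun k hk => ?_)
      obtain ⟨k, rfl⟩ : ∃ i, k = i + 1 := ⟨k - 1, by omega⟩
      simp only [coeff_sub, coeff_add, coeff_X_mul, coeff_C_mul]
      rcases (show n ≤ k by omega).eq_or_lt with rfl | hk
      · rw [hc n (n + 1) (by omega)]; linear_combination -hd n
      rcases (show n + 1 ≤ k by omega).eq_or_lt with rfl | hk
      · rw [hc n _ (by omega), hc (n + 1) (n + 1 + 1) (by omega)]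
        have := ho (n + 1)
        linear_combination -this
      · rw [hc n _ (by omega), hc (n + 1) k (by omega), hc (n + 1) (k + 1) (by omega),
          hc (n + 2) _ (by omega)]
        ring
    refine hP.eq_zero_of_orthogonal _ hdeg fun j hj => ?_
    have e : ∀ ω, (X * P (n + 1) - (C (o (n + 1)) * P (n + 2)
        + C (d (n + 1)) * P (n + 1) + C (o n) * P n)).eval ω * (P j).eval ω
        = (X * P j).eval ω * (P (n + 1)).eval ω - (o (n + 1) * ((P (n + 2)).eval ω * (P j).eval ω)
        + d (n + 1) * ((P (n + 1)).eval ω * (P j).eval ω)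
        + o n * ((P n).eval ω * (P j).eval ω)) := fun ω => by
      simp only [eval_sub, eval_add, eval_mul, eval_X, eval_C]; ring
    simp_rw [e]
    have i1 := (hP.integrable (n + 2) j).const_mul (o (n + 1))
    have i2 := (hP.integrable (n + 1) j).const_mul (d (n + 1))
    have i3 := (hP.integrable n j).const_mul (o n)
    have i12 : Integrable (fun ω => o (n + 1) * ((P (n + 2)).eval ω * (P j).eval ω)
        + d (n + 1) * ((P (n + 1)).eval ω * (P j).eval ω)) σ := i1.add i2
    have i123 : Integrable (fun ω => o (n + 1) * ((P (n + 2)).eval ω * (P j).eval ω)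
        + d (n + 1) * ((P (n + 1)).eval ω * (P j).eval ω)
        + o n * ((P n).eval ω * (P j).eval ω)) σ := i12.add i3
    rw [integral_sub (hP.integrable_eval_mul _ _) i123, integral_add i12 i3, integral_add i1 i2]
    simp only [integral_const_mul, hP.orthonormal]
    rw [if_neg (by omega), if_neg (by omega)]
    rcases (show j ≤ n by omega).eq_or_lt with rfl | hj
    · rw [hP.integral_X_mul (by rw [hl, hl, ho]), if_pos rfl]
      ring
    · rw [if_neg (by omega), hP.integral_mul_eq_zero ((natDegree_mul_le.trans (by rw [natDegree_X])).trans_lt (by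
        rw [hP.natDegree_eq]; omega))]
      ring

end ThreeTerm

/-! ### From Pearson's equation to the spectral solution -/

section Pearson

open Polynomial

variable {σ : Measure ℝ} {D : Set ℂ} {s₀ s₁ s₂ t₀ t₁ : ℝ} {c d o I : ℕ → ℝ}

/-- The quadratic polynomial with given coefficients. -/
noncomputable abbrev quadPoly {A : Type*} [CommRing A] (s₀ s₁ s₂ : A) : A[X] :=
  C s₀ + C s₁ * X + C s₂ * X ^ 2

/-- The linear polynomial with given coefficients. -/
noncomputable abbrev linPoly {A : Type*} [CommRing A] (t₀ t₁ : A) : A[X] := C t₀ + C t₁ * X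

theorem quadPoly_map : (quadPoly s₀ s₁ s₂).map Complex.ofRealHom
    = quadPoly (s₀ : ℂ) (s₁ : ℂ) (s₂ : ℂ) := by simp

theorem linPoly_map : (linPoly t₀ t₁).map Complex.ofRealHom = linPoly (t₀ : ℂ) (t₁ : ℂ) := by simp

/-- The functional `p ↦ ∫ e^{-izω} p(ω) dσ(ω)`. -/
noncomputable def expFunctional (σ : Measure ℝ) (z : ℂ) (h : ∀ q : ℂ[X],
    Integrable (fun ω : ℝ => Complex.exp (-Complex.I * z * ω) * q.eval (ω : ℂ)) σ) :
    ℂ[X] →ₗ[ℂ] ℂ where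
  toFun q := ∫ ω : ℝ, Complex.exp (-Complex.I * z * ω) * q.eval (ω : ℂ) ∂σ
  map_add' p q := by
    rw [← integral_add (h p) (h q)]
    simp only [eval_add, mul_add]
  map_smul' a p := by
    simp only [eval_smul, smul_eq_mul, RingHom.id_apply, ← integral_const_mul]
    exact integral_congr_ae (ae_of_all _ fun ω => by ring)

/-- `(s ρ)' = τ ρ` in the weak sense, for the density `ρ` of `σ`. -/
def SatisfiesPearson (σ : Measure ℝ) (D : Set ℂ) (s τ : ℂ[X]) : Prop :=
  ∀ z ∈ D, ∀ p : ℂ[X], ∫ ω : ℝ, Complex.exp (-Complex.I * z * ω)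
    * (s * twistedDeriv (-Complex.I * z) p + τ * p).eval (ω : ℂ) ∂σ = 0

/-- The squared norm of the unnormalized polynomial is `(-1)^n n!` times its leading coefficient
times `∫ s^n dσ`; `hcI` scales it to one and `hc` fixes the sign. By symmetry only `m ≤ n` needs
computation. -/
theorem isOrthonormalSystem_rodrigues (hi : ∀ q : ℂ[X], Integrable (fun ω : ℝ =>
      Complex.exp (-Complex.I * (0 : ℂ) * ω) * q.eval (ω : ℂ)) σ)
    (hp : IsPearson (quadPoly (s₀ : ℂ) s₁ s₂) (linPoly (t₀ : ℂ) t₁) 0 (expFunctional σ 0 hi))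
    (hI : ∀ n, ∫ ω, ((quadPoly s₀ s₁ s₂) ^ n).eval ω ∂σ = I n)
    (hc : ∀ n, 0 < c n * rodriguesLead s₂ t₁ n 0)
    (hcI : ∀ n, c n ^ 2 * ((-1) ^ n * n.factorial * rodriguesLead s₂ t₁ n 0 * I n) = 1) :
    IsOrthonormalSystem σ fun n =>
      C (c n) * rodrigues (quadPoly s₀ s₁ s₂) (linPoly t₀ t₁) n 0 := by
  set Q := fun n => rodrigues (quadPoly s₀ s₁ s₂) (linPoly t₀ t₁) n 0 with hQ
  have hcoeff : ∀ n, (C (c n) * Q n).coeff n = c n * rodriguesLead s₂ t₁ n 0 := fun n => by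
    rw [coeff_C_mul, hQ]
    exact congrArg _ (coeff_rodrigues_self _ _ _ _ _ _ _)
  have hle : ∀ n, (C (c n) * Q n).natDegree ≤ n := fun n =>
    (natDegree_C_mul_le _ _).trans (natDegree_rodrigues_le _ _ _ _ _ _ _)
  have hdeg : ∀ n, (C (c n) * Q n).natDegree = n := fun n =>
    natDegree_eq_of_le_of_coeff_ne_zero (hle n) (by rw [hcoeff]; exact (hc n).ne')
  have hint : ∀ q : ℝ[X], Integrable (fun ω => q.eval ω) σ := fun q => by
    have := (hi (q.map Complex.ofRealHom)).re
    simpa [eval_map_ofReal] using! this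
  have hL : ∀ q : ℝ[X], expFunctional σ 0 hi (q.map Complex.ofRealHom)
      = ((∫ ω, q.eval ω ∂σ : ℝ) : ℂ) := fun q => by
    rw [← integral_complex_ofReal]
    simp [expFunctional, eval_map_ofReal]
  have horth : ∀ m n, m ≤ n → ∫ ω, (C (c m) * Q m * (C (c n) * Q n)).eval ω ∂σ
      = if m = n then 1 else 0 := by
    intro m n hmn
    have e : C (c m) * Q m * (C (c n) * Q n) = C (c n) * (C (c m) * Q m) * Q n := by ring
    have hd : ((C (c n) * (C (c m) * Q m)).map Complex.ofRealHom).natDegree ≤ n :=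
      natDegree_map_le.trans ((natDegree_C_mul_le _ _).trans ((hle m).trans hmn))
    have h := hp.apply_mul_rodrigues n hd
    rw [← quadPoly_map, ← linPoly_map, ← rodrigues_map, ← Polynomial.map_mul, ← Polynomial.map_pow,
      hL, hL, hI, coeff_map] at h
    rw [e]
    have h' : ∫ ω, (C (c n) * (C (c m) * Q m) * Q n).eval ω ∂σ
        = (-1) ^ n * (n.factorial * (C (c n) * (C (c m) * Q m)).coeff n * I n) := by
      have : Complex.ofRealHom ((C (c n) * (C (c m) * Q m)).coeff n)
        = (((C (c n) * (C (c m) * Q m)).coeff n : ℝ) : ℂ) := rfl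
      rw [this] at h
      exact_mod_cast h
    rw [h', coeff_C_mul]
    split_ifs with hmn'
    · subst hmn'
      rw [hcoeff]
      linear_combination hcI m
    · rw [coeff_eq_zero_of_natDegree_lt (by rw [hdeg]; omega)]
      ring
  refine ⟨hdeg, fun n => ?_, fun m n => ?_, fun m n => ?_⟩
  · change 0 < (C (c n) * Q n).leadingCoeff
    rw [leadingCoeff, hdeg, hcoeff]
    exact hc n
  · simpa [eval_mul] using hint (C (c m) * Q m * (C (c n) * Q n))
  · rcases le_total m n with h | h
    · simpa [eval_mul] using horth m n h
    · rw [← (show (if n = m then (1 : ℝ) else 0) = if m = n then 1 else 0 by simp [eq_comm]),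
        ← horth n m h]
      exact integral_congr_ae (ae_of_all _ fun ω => by simp only [eval_mul]; ring)

/-- The engine common to the three cases. In an orthonormal recurrence the off-diagonal entry is the
quotient of consecutive leading coefficients and the diagonal entry is the difference of consecutive
ratios of subleading to leading coefficient; `ho2` and `hd` express this through `s`, `τ` and the
integrals `I n`. -/
theorem isSpectralSolution_of_pearson {H : Module.End ℂ FinFock} {s : ℂ → ℂ} {sn : ℕ → ℂ → ℂ}
    {smn : ℕ → ℕ → ℂ → ℂ} (h0 : (0 : ℂ) ∈ D)
    (hD : ∀ z ∈ D, ∃ δ > 0, ∀ t ∈ Set.Ioo (z.im - δ) (z.im + δ),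
      Integrable (fun ω => Real.exp (t * ω)) σ)
    (hp : SatisfiesPearson σ D (quadPoly (s₀ : ℂ) s₁ s₂) (linPoly (t₀ : ℂ) t₁))
    (ht : ∀ j : ℕ, t₁ + j * s₂ ≠ 0)
    (hI : ∀ n, ∫ ω, ((quadPoly s₀ s₁ s₂) ^ n).eval ω ∂σ = I n)
    (hc : ∀ n, 0 < c n * rodriguesLead s₂ t₁ n 0)
    (hcI : ∀ n, c n ^ 2 * ((-1) ^ n * n.factorial * rodriguesLead s₂ t₁ n 0 * I n) = 1)
    (hH : IsJacobiOperator H d o)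
    (ho : ∀ n, 0 ≤ o n)
    (ho2 : ∀ n, o n ^ 2 * (rodriguesLead s₂ t₁ (n + 1) 0 * I n)
      = -((n + 1) * rodriguesLead s₂ t₁ n 0 * I (n + 1)))
    (hd : ∀ n : ℕ, d n = n * (t₀ + (n - 1) * s₁) / (t₁ + (2 * n - 2) * s₂)
      - (n + 1) * (t₀ + n * s₁) / (t₁ + 2 * n * s₂))
    (hs : ∀ z ∈ D, charFn σ z = s z)
    (hsn : ∀ n, ∀ z ∈ D, c n * (Complex.I * z) ^ n * ∫ ω : ℝ, Complex.exp (-Complex.I * z * ω)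
      * ((quadPoly (s₀ : ℂ) s₁ s₂) ^ n).eval (ω : ℂ) ∂σ = sn n z)
    (hsmn : ∀ m n, ∀ z ∈ D, c m * c n * ∫ ω : ℝ, Complex.exp (-Complex.I * z * ω)
      * (rodrigues (quadPoly (s₀ : ℂ) s₁ s₂) (linPoly (t₀ : ℂ) t₁) m 0
        * rodrigues (quadPoly (s₀ : ℂ) s₁ s₂) (linPoly (t₀ : ℂ) t₁) n 0).eval (ω : ℂ) ∂σ
      = smn m n z) :
    IsSpectralSolution H σ D s sn smn := by
  have hi : ∀ z ∈ D, ∀ q : ℂ[X], Integrable (fun ω : ℝ =>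
      Complex.exp (-Complex.I * z * ω) * q.eval (ω : ℂ)) σ := fun z hz q => by
    obtain ⟨δ, hδ, h⟩ := hD z hz
    exact integrable_cexp_mul_eval hδ h q
  have hP := isOrthonormalSystem_rodrigues (hi 0 h0)
    (fun p => by simpa [expFunctional] using hp 0 h0 p) hI hc hcI
  set Q : ℕ → ℝ[X] := fun n => rodrigues (quadPoly s₀ s₁ s₂) (linPoly t₀ t₁) n 0 with hQ
  set l : ℕ → ℝ := fun n => rodriguesLead s₂ t₁ n 0 with hl
  have hne : ∀ n, l n ≠ 0 := fun n h => (hc n).ne' (by change c n * l n = 0; rw [h, mul_zero])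
  have hQs : ∀ n, (Q n).coeff n = l n := fun n => coeff_rodrigues_self _ _ _ _ _ _ _
  have hQsub : ∀ n, (t₁ + 2 * n * s₂) * (Q (n + 1)).coeff n
      = (n + 1) * (t₀ + n * s₁) * l (n + 1) := fun n => by
    simpa using coeff_rodrigues_sub s₀ s₁ s₂ t₀ t₁ ht n 0
  have hlc : ∀ n, (C (c n) * Q n).leadingCoeff = c n * l n := fun n => by
    rw [leadingCoeff, show (C (c n) * Q n).natDegree = n from hP.natDegree_eq n, coeff_C_mul, hQs]
  have hInz : ∀ n, I n ≠ 0 := fun n h => by have := hcI n; rw [h] at this; simp at this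
  -- The square of this identity is `ho2` combined with the two normalizations. Both sides are
  -- nonnegative, so the square root may be taken.
  have hoc : ∀ n, o n * (c (n + 1) * l (n + 1)) = c n * l n := by
    intro n
    have e : (o n * (c (n + 1) * l (n + 1))) ^ 2 = (c n * l n) ^ 2 := by
      have h1 := hcI n
      have h2 := hcI (n + 1)
      have h3 := ho2 n
      change c n ^ 2 * ((-1) ^ n * n.factorial * l n * I n) = 1 at h1
      change c (n + 1) ^ 2 * ((-1) ^ (n + 1) * (n + 1).factorial * l (n + 1) * I (n + 1)) = 1 at h2
      change o n ^ 2 * (l (n + 1) * I n) = -((n + 1) * l n * I (n + 1)) at h3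
      rw [Nat.factorial_succ, pow_succ] at h2
      push_cast at h2
      have hf : ((-1) ^ n * (n.factorial : ℝ)) ≠ 0 := by positivity
      have h4 : o n ^ 2 * c (n + 1) ^ 2 * (l (n + 1) * I n) * ((-1) ^ n * n.factorial * l (n + 1))
          = l n := by
        linear_combination c (n + 1) ^ 2 * ((-1) ^ n * n.factorial * l (n + 1)) * h3 + l n * h2
      have h5 : (-1) ^ n * n.factorial * I n ≠ 0 := mul_ne_zero hf (hInz n)
      refine mul_right_cancel₀ h5 ?_
      linear_combination h4 - l n * h1
    have hnn : 0 ≤ o n * (c (n + 1) * l (n + 1)) := mul_nonneg (ho n) (hc (n + 1)).le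
    exact (pow_left_inj₀ hnn (hc n).le two_ne_zero).1 e
  have ht' : ∀ n : ℕ, t₁ + 2 * n * s₂ ≠ 0 := fun n => by
    have := ht (2 * n); push_cast at this; exact this
  have hcs : ∀ n, (C (c (n + 1)) * Q (n + 1)).coeff n
      = (n + 1) * (t₀ + n * s₁) / (t₁ + 2 * n * s₂) * (c (n + 1) * l (n + 1)) := fun n => by
    rw [coeff_C_mul]
    rw [div_mul_eq_mul_div, eq_div_iff (ht' n)]
    linear_combination c (n + 1) * hQsub n
  have h3 : IsThreeTerm (fun n => C (c n) * Q n) d o := by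
    refine hP.isThreeTerm (fun n => ?_) ?_ fun n => ?_
    · change o n * (C (c (n + 1)) * Q (n + 1)).leadingCoeff = (C (c n) * Q n).leadingCoeff
      rw [hlc, hlc, hoc]
    · change d 0 * (C (c 0) * Q 0).coeff 0 = -(o 0 * (C (c (0 + 1)) * Q (0 + 1)).coeff 0)
      rw [hcs, coeff_C_mul, hQs, hd]
      have := hoc 0
      push_cast
      linear_combination (1 * (t₀ + 0 * s₁) / (t₁ + 2 * 0 * s₂)) * this
    · change d (n + 1) * (C (c (n + 1)) * Q (n + 1)).leadingCoeff
        = (C (c (n + 1)) * Q (n + 1)).coeff n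
          - o (n + 1) * (C (c (n + 1 + 1)) * Q (n + 1 + 1)).coeff (n + 1)
      rw [hlc, hcs, hcs, hd]
      have := hoc (n + 1)
      push_cast
      rw [show (2 * ((n : ℝ) + 1) - 2) = 2 * n by ring, show ((n : ℝ) + 1 - 1) = n by ring]
      linear_combination ((n + 1 + 1) * (t₀ + (n + 1) * s₁) / (t₁ + 2 * (n + 1) * s₂)) * this
  have hQC : ∀ n (ω : ℝ), (((Q n).eval ω : ℝ) : ℂ)
      = (rodrigues (quadPoly (s₀ : ℂ) s₁ s₂) (linPoly (t₀ : ℂ) t₁) n 0).eval (ω : ℂ) := fun n ω => by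
    rw [← eval_map_ofReal, hQ, rodrigues_map, quadPoly_map, linPoly_map]
  refine ⟨fun z hz => ⟨by simpa using hi z hz 1, hs z hz⟩, fun n => C (c n) * Q n, hP,
    fun n z hz => ?_, fun m n z hz => ?_, ?_⟩
  · have hpz : IsPearson _ _ _ (expFunctional σ z (hi z hz)) := fun p => hp z hz p
    have h := hpz.apply_rodrigues n
    refine ⟨?_, ?_⟩
    · have := hi z hz ((C (c n) * Q n).map Complex.ofRealHom)
      simpa only [eval_map_ofReal] using! this
    · rw [← hsn n z hz]
      have e : ∀ ω : ℝ, Complex.exp (-Complex.I * z * ω) * (((C (c n) * Q n).eval ω : ℝ) : ℂ)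
          = c n * (Complex.exp (-Complex.I * z * ω)
            * (rodrigues (quadPoly (s₀ : ℂ) s₁ s₂) (linPoly (t₀ : ℂ) t₁) n 0).eval (ω : ℂ)) :=
        fun ω => by
          rw [eval_mul, eval_C, Complex.ofReal_mul, hQC]; ring
      simp_rw [e]
      rw [integral_const_mul, mul_assoc]
      congr 1
      refine h.trans ?_
      rw [show -(-Complex.I * z) = Complex.I * z by ring]
      rfl
  · refine ⟨?_, ?_⟩
    · have := hi z hz ((C (c m) * Q m * (C (c n) * Q n)).map Complex.ofRealHom)
      simpa only [eval_map_ofReal, eval_mul (p := C (c m) * Q m)] using! this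
    · rw [← hsmn m n z hz, ← integral_const_mul]
      refine integral_congr_ae (ae_of_all _ fun ω => ?_)
      simp only [eval_mul, eval_C, Complex.ofReal_mul, ← hQC]
      ring
  · obtain ⟨δ, hδ, h⟩ := hD 0 h0
    simp only [Complex.zero_im, zero_sub, zero_add] at h
    exact evolution_of_threeTerm hδ h hP hH h3

end Pearson

/-! ### Normalizing constants and the total derivative behind Pearson's equation -/

section Common

open Polynomial

theorem sq_mul_rpow_neg_half {ε x : ℝ} (hε : ε ^ 2 = 1) (hx : 0 < x) (n : ℕ) :
    (ε ^ n * x ^ (-(1 / 2) : ℝ)) ^ 2 * x = 1 := by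
  rw [mul_pow, ← pow_mul, mul_comm n, pow_mul, hε, one_pow, one_mul, ← Real.rpow_natCast,
    ← Real.rpow_mul hx.le]
  norm_num
  rw [Real.rpow_neg_one, inv_mul_cancel₀ hx.ne']

theorem rpow_neg_half_eq {x : ℝ} (hx : 0 ≤ x) : x ^ (-(1 / 2) : ℝ) = (√x)⁻¹ := by
  rw [Real.sqrt_eq_rpow, Real.rpow_neg hx]

/-- Here `r` stands for `ρ(ω)`, `u` for `s ρ` and `v` for `(s ρ)' = τ ρ`. It exhibits the integrand
of the Pearson condition as a derivative, so that only boundary terms remain. -/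
theorem hasDerivAt_cexp_mul_eval_mul {s τ : ℂ[X]} {u : ℝ → ℝ} {r ω : ℝ} {v : ℂ}
    (hu : HasDerivAt u v.re ω) (hv : v = τ.eval (ω : ℂ) * r) (hs : (u ω : ℂ) = s.eval (ω : ℂ) * r)
    (hv' : v.im = 0) (z : ℂ) (p : ℂ[X]) :
    HasDerivAt (fun ω : ℝ => Complex.exp (-Complex.I * z * ω) * p.eval (ω : ℂ) * u ω)
      (r * (Complex.exp (-Complex.I * z * ω)
        * (s * twistedDeriv (-Complex.I * z) p + τ * p).eval (ω : ℂ))) ω := by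
  have h1 : HasDerivAt (fun ω : ℝ => Complex.exp (-Complex.I * z * ω))
      (Complex.exp (-Complex.I * z * ω) * (-Complex.I * z)) ω := by
    have := ((hasDerivAt_id (ω : ℂ)).const_mul (-Complex.I * z)).cexp.comp_ofReal
    simpa using this
  have h2 : HasDerivAt (fun ω : ℝ => p.eval (ω : ℂ)) (p.derivative.eval (ω : ℂ)) ω :=
    (p.hasDerivAt (ω : ℂ)).comp_ofReal
  refine ((h1.mul h2).mul hu.ofReal_comp).congr_deriv ?_
  rw [show ((v.re : ℝ) : ℂ) = v from Complex.ext rfl (by simp [hv']), hv, hs, twistedDeriv_apply]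
  simp only [eval_add, eval_mul, eval_C, Pi.mul_apply]
  ring

end Common

/-! ### Hermite case: Gaussian integrals and Rodrigues polynomials -/

section Hermite

open Polynomial

variable {C₀ a₀ a₁ b₀ : ℝ}

theorem measurable_hermiteDensity : Measurable (hermiteDensity C₀ a₀ a₁ b₀) := by
  unfold hermiteDensity; fun_prop

theorem hermiteDensity_nonneg (hC : 0 < C₀) (ω : ℝ) : 0 ≤ hermiteDensity C₀ a₀ a₁ b₀ ω := by
  unfold hermiteDensity; positivity

theorem ofReal_hermiteDensity_mul_cexp (h : a₁ / b₀ < 0) (z : ℂ) (ω : ℝ) :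
    (hermiteDensity C₀ a₀ a₁ b₀ ω : ℂ) * Complex.exp (-Complex.I * z * ω)
      = C₀ * Complex.exp (a₁ / (2 * b₀) * (ω : ℂ) ^ 2 + (a₀ / b₀ - Complex.I * z) * ω
        + a₀ ^ 2 / (2 * a₁ * b₀)) := by
  have hb : (b₀ : ℂ) ≠ 0 := by rintro h'; simp_all
  have ha : (a₁ : ℂ) ≠ 0 := by rintro h'; simp_all
  rw [hermiteDensity]
  push_cast
  rw [mul_assoc, ← Complex.exp_add]
  congr 2
  field_simp
  ring

theorem hermite_re_neg (h : a₁ / b₀ < 0) : ((a₁ : ℂ) / (2 * b₀)).re < 0 := by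
  rw [show (a₁ : ℂ) / (2 * b₀) = ((a₁ / b₀ / 2 : ℝ) : ℂ) by push_cast; ring, Complex.ofReal_re]
  linarith

theorem charFn_hermiteMeasure (hC : 0 < C₀) (h : a₁ / b₀ < 0) (z : ℂ) :
    charFn (hermiteMeasure C₀ a₀ a₁ b₀) z = hermiteS C₀ a₀ a₁ b₀ z := by
  have hb : (b₀ : ℂ) ≠ 0 := by rintro h'; simp_all
  have ha : (a₁ : ℂ) ≠ 0 := by rintro h'; simp_all
  rw [charFn, hermiteMeasure, integral_weightMeasure measurable_hermiteDensity .univ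
    fun ω _ => hermiteDensity_nonneg hC ω, setIntegral_univ]
  simp_rw [Complex.real_smul, ofReal_hermiteDensity_mul_cexp h]
  rw [integral_const_mul, integral_cexp_quadratic (hermite_re_neg h), hermiteS]
  have hpos : 0 ≤ -(Real.pi * (2 * b₀ / a₁)) := by
    have : b₀ / a₁ < 0 := by rw [← inv_div]; exact inv_lt_zero.2 h
    have := mul_pos Real.pi_pos (neg_pos.2 this)
    rw [mul_div_assoc]
    linarith
  rw [Real.sqrt_eq_rpow, Complex.ofReal_cpow hpos, mul_assoc, mul_assoc, mul_assoc,
    ← Complex.exp_add]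
  congr 3
  · push_cast
    field_simp
  · push_cast
    norm_num
  · have e : z + Complex.I * (a₀ / b₀) = Complex.I * (a₀ / b₀ - Complex.I * z) := by
      linear_combination z * Complex.I_sq
    rw [e, mul_pow, Complex.I_sq]
    field_simp
    ring

theorem integrable_exp_hermiteMeasure (hC : 0 < C₀) (h : a₁ / b₀ < 0) (t : ℝ) :
    Integrable (fun ω => Real.exp (t * ω)) (hermiteMeasure C₀ a₀ a₁ b₀) := by
  rw [hermiteMeasure, integrable_weightMeasure_iff measurable_hermiteDensity .univ
    fun ω _ => hermiteDensity_nonneg hC ω, integrableOn_univ]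
  have h1 := ((integrable_cexp_quadratic' (hermite_re_neg h) (a₀ / b₀ - Complex.I * (Complex.I * t))
    (a₀ ^ 2 / (2 * a₁ * b₀))).const_mul (C₀ : ℂ)).re
  refine h1.congr (ae_of_all _ fun ω => ?_)
  beta_reduce
  rw [← ofReal_hermiteDensity_mul_cexp h (Complex.I * t) ω,
    show -Complex.I * (Complex.I * t) * ω = ((t * ω : ℝ) : ℂ) by
      push_cast; linear_combination -(t * ω) * Complex.I_sq, ← Complex.ofReal_exp,
    ← Complex.ofReal_mul]
  exact Complex.ofReal_re _

/-- Here `s = b₀` is constant and `ρ'/ρ = (a₀ + a₁ω)/b₀`. The integral of a derivative over the line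
is zero because the function and its derivative are both integrable. -/
theorem satisfiesPearson_hermite (hC : 0 < C₀) (h : a₁ / b₀ < 0) :
    SatisfiesPearson (hermiteMeasure C₀ a₀ a₁ b₀) Set.univ
      (quadPoly (b₀ : ℂ) ((0 : ℝ) : ℂ) ((0 : ℝ) : ℂ)) (linPoly (a₀ : ℂ) a₁) := by
  have hb : b₀ ≠ 0 := by rintro h'; simp_all
  have ha : a₁ ≠ 0 := by rintro h'; simp_all
  intro z _ p
  have hi : ∀ q : ℂ[X], Integrable (fun ω : ℝ => (hermiteDensity C₀ a₀ a₁ b₀ ω : ℂ)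
      * (Complex.exp (-Complex.I * z * ω) * q.eval (ω : ℂ))) := fun q => by
    have := integrable_cexp_mul_eval (z := z) one_pos
      (fun t _ => integrable_exp_hermiteMeasure (a₀ := a₀) hC h t) q
    rw [hermiteMeasure, integrable_weightMeasure_iff measurable_hermiteDensity .univ
      fun ω _ => hermiteDensity_nonneg hC ω, integrableOn_univ] at this
    simpa only [Complex.real_smul] using this
  rw [hermiteMeasure, integral_weightMeasure measurable_hermiteDensity .univ
    fun ω _ => hermiteDensity_nonneg hC ω, setIntegral_univ]
  simp_rw [Complex.real_smul]
  refine integral_eq_zero_of_hasDerivAt_of_integrable (f := fun ω : ℝ =>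
    Complex.exp (-Complex.I * z * ω) * p.eval (ω : ℂ) *
      ((b₀ * hermiteDensity C₀ a₀ a₁ b₀ ω : ℝ) : ℂ)) (fun ω => ?_) (hi _) ?_
  · refine hasDerivAt_cexp_mul_eval_mul
      (v := (((a₀ + a₁ * ω) * hermiteDensity C₀ a₀ a₁ b₀ ω : ℝ) : ℂ)) ?_ (by simp) (by simp)
      (Complex.ofReal_im _) z p
    rw [Complex.ofReal_re]
    have h1 : HasDerivAt (fun ω : ℝ => a₁ / (2 * b₀) * (ω + a₀ / a₁) ^ 2)
        (a₁ / (2 * b₀) * (2 * (ω + a₀ / a₁))) ω := by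
      have := (((hasDerivAt_id ω).add_const (a₀ / a₁)).pow 2).const_mul (a₁ / (2 * b₀))
      simpa using this
    refine ((h1.exp.const_mul C₀).const_mul b₀).congr_deriv ?_
    rw [hermiteDensity]
    field_simp
    ring
  · refine ((hi p).const_mul (b₀ : ℂ)).congr (ae_of_all _ fun ω => ?_)
    push_cast
    ring

theorem integral_hermiteMeasure (hC : 0 < C₀) (h : a₁ / b₀ < 0) (n : ℕ) :
    ∫ ω, ((quadPoly b₀ 0 0) ^ n).eval ω ∂(hermiteMeasure C₀ a₀ a₁ b₀)
      = b₀ ^ n * (C₀ * √(-(Real.pi * (2 * b₀ / a₁)))) := by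
  have hb : (b₀ : ℂ) ≠ 0 := by rintro h'; simp_all
  have ha : (a₁ : ℂ) ≠ 0 := by rintro h'; simp_all
  have h1 := charFn_hermiteMeasure (a₀ := a₀) hC h 0
  have h2 : ((∫ _ : ℝ, (1 : ℝ) ∂(hermiteMeasure C₀ a₀ a₁ b₀) : ℝ) : ℂ)
      = ((C₀ * √(-(Real.pi * (2 * b₀ / a₁))) : ℝ) : ℂ) := by
    rw [← integral_complex_ofReal]
    simp only [charFn, mul_zero, zero_mul, Complex.exp_zero] at h1
    simp only [Complex.ofReal_one]
    rw [h1, hermiteS, mul_assoc, ← Complex.exp_add]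
    rw [show (a₀ : ℂ) ^ 2 / (2 * a₁ * b₀) + b₀ / (2 * a₁) * (0 + Complex.I * (a₀ / b₀)) ^ 2 = 0 by
      rw [zero_add, mul_pow, Complex.I_sq]; field_simp; ring]
    simp
  have h3 := Complex.ofReal_injective h2
  rw [← h3, ← integral_const_mul]
  simp

theorem rodrigues_hermite_succ_left (n k : ℕ) : rodrigues (quadPoly (b₀ : ℂ) ((0 : ℝ) : ℂ)
    ((0 : ℝ) : ℂ)) (linPoly (a₀ : ℂ) a₁) n k
    = rodrigues (quadPoly (b₀ : ℂ) ((0 : ℝ) : ℂ) ((0 : ℝ) : ℂ)) (linPoly (a₀ : ℂ) a₁) n 0 := by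
  induction n generalizing k with
  | zero => rfl
  | succ n ih =>
    rw [rodrigues, rodrigues, ih (k + 1), ih (0 + 1)]
    simp [raising, quadPoly]

/-- For constant `s` the recursion reads `Q_{n+1} = b₀ Q_n' + τ Q_n` with `τ' = a₁`, and
differentiating it reproduces the claim by induction (an Appell sequence). For `n = 0` the truncated
index is multiplied by zero. -/
theorem derivative_rodrigues_hermite (n : ℕ) : derivative (rodrigues (quadPoly (b₀ : ℂ)
      ((0 : ℝ) : ℂ) ((0 : ℝ) : ℂ)) (linPoly (a₀ : ℂ) a₁) n 0)
    = C ((n : ℂ) * a₁) * rodrigues (quadPoly (b₀ : ℂ) ((0 : ℝ) : ℂ) ((0 : ℝ) : ℂ))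
      (linPoly (a₀ : ℂ) a₁) (n - 1) 0 := by
  have hs : ∀ n, rodrigues (quadPoly (b₀ : ℂ) ((0 : ℝ) : ℂ) ((0 : ℝ) : ℂ)) (linPoly (a₀ : ℂ) a₁)
      (n + 1) 0 = C (b₀ : ℂ) * derivative (rodrigues (quadPoly (b₀ : ℂ) ((0 : ℝ) : ℂ)
        ((0 : ℝ) : ℂ)) (linPoly (a₀ : ℂ) a₁) n 0) + linPoly (a₀ : ℂ) a₁
        * rodrigues (quadPoly (b₀ : ℂ) ((0 : ℝ) : ℂ) ((0 : ℝ) : ℂ)) (linPoly (a₀ : ℂ) a₁) n 0 :=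
    fun n => by
      conv_lhs => rw [rodrigues, rodrigues_hermite_succ_left]
      simp [raising, quadPoly]
  induction n with
  | zero => simp [rodrigues]
  | succ n ih =>
    rw [hs n, Nat.add_sub_cancel, derivative_add, derivative_mul, derivative_mul, ih]
    simp only [derivative_C, derivative_add, derivative_mul, derivative_X, zero_mul, mul_one,
      zero_add]
    rcases n with _ | n
    · simp
    · rw [Nat.add_sub_cancel, hs n]
      push_cast
      simp only [C_add, C_mul, C_1, map_natCast]
      ring

theorem iterate_derivative_rodrigues_hermite (m j : ℕ) : derivative^[j] (rodrigues (quadPoly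
      (b₀ : ℂ) ((0 : ℝ) : ℂ) ((0 : ℝ) : ℂ)) (linPoly (a₀ : ℂ) a₁) m 0)
    = C ((m.descFactorial j : ℂ) * (a₁ : ℂ) ^ j) * rodrigues (quadPoly (b₀ : ℂ) ((0 : ℝ) : ℂ)
      ((0 : ℝ) : ℂ)) (linPoly (a₀ : ℂ) a₁) (m - j) 0 := by
  induction j with
  | zero => simp
  | succ j ih =>
    rw [Function.iterate_succ_apply', ih, derivative_C_mul, derivative_rodrigues_hermite,
      ← mul_assoc, ← C_mul, Nat.descFactorial_succ, Nat.sub_sub]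
    congr 2
    push_cast
    ring

theorem twistedDeriv_pow_apply {κ : ℂ} (n : ℕ) (p : ℂ[X]) : (twistedDeriv κ ^ n) p
    = ∑ j ∈ Finset.range (n + 1), C (κ ^ (n - j) * (n.choose j : ℂ)) * derivative^[j] p := by
  have hc : Commute (derivative : Module.End ℂ ℂ[X]) (κ • LinearMap.id) := by
    exact LinearMap.ext fun q => by simp [Module.End.mul_apply]
  rw [twistedDeriv, hc.add_pow, LinearMap.sum_apply]
  refine Finset.sum_congr rfl fun j _ => ?_
  rw [Module.End.mul_apply, Module.End.mul_apply, show (κ • LinearMap.id : Module.End ℂ ℂ[X])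
    = κ • 1 from rfl, _root_.smul_pow, one_pow, Module.End.pow_apply]
  have : ((n.choose j : ℕ) : Module.End ℂ ℂ[X]) p = (n.choose j : ℂ) • p := by
    rw [Module.End.natCast_apply, Nat.cast_smul_eq_nsmul]
  rw [this, LinearMap.smul_apply, Module.End.one_apply, smul_smul, smul_eq_C_mul,
    iterate_derivative_C_mul]

end Hermite

/-! ### Hermite case: matrix elements and weight -/

section Hermite

open Polynomial

variable {C₀ a₀ a₁ b₀ : ℝ}

theorem sum_range_min_factorial (m n : ℕ) (f : ℕ → ℂ) :
    ∑ j ∈ Finset.range (n + 1), (n.choose j : ℂ) * (m.descFactorial j : ℂ) * f j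
      = (m.factorial : ℂ) * n.factorial * ∑ j ∈ Finset.range (min m n + 1),
        f j / ((m - j).factorial * (n - j).factorial * j.factorial) := by
  rw [Finset.mul_sum, ← Finset.sum_subset (s₁ := Finset.range (min m n + 1))
    (Finset.range_mono (by omega))]
  · refine Finset.sum_congr rfl fun j hj => ?_
    have hj' := Finset.mem_range.1 hj
    rw [Nat.cast_choose ℂ (by omega : j ≤ n)]
    have h1 : ((m - j).factorial : ℂ) * m.descFactorial j = m.factorial := by
      exact_mod_cast Nat.factorial_mul_descFactorial (by omega : j ≤ m)
    have h2 : ((m - j).factorial : ℂ) ≠ 0 := by exact_mod_cast Nat.factorial_ne_zero _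
    have h3 : ((n - j).factorial : ℂ) ≠ 0 := by exact_mod_cast Nat.factorial_ne_zero _
    have h4 : (j.factorial : ℂ) ≠ 0 := by exact_mod_cast Nat.factorial_ne_zero _
    field_simp
    linear_combination f j * n.factorial * h1
  · intro j hj hj'
    rw [Finset.mem_range] at hj hj'
    rw [Nat.descFactorial_eq_zero_iff_lt.2 (by omega)]
    simp

/-- Move `n` twisted derivatives onto `Q_m` and expand them binomially. The `j`-th derivative of
`Q_m` is a multiple of `Q_{m-j}`, whose transform is a power of `z` times `σ̂`; terms with `j > m`
vanish. -/
theorem integral_rodrigues_hermite_mul (hC : 0 < C₀) (h : a₁ / b₀ < 0) (m n : ℕ) (z : ℂ) :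
    ∫ ω : ℝ, Complex.exp (-Complex.I * z * ω)
      * (rodrigues (quadPoly (b₀ : ℂ) ((0 : ℝ) : ℂ) ((0 : ℝ) : ℂ)) (linPoly (a₀ : ℂ) a₁) m 0
        * rodrigues (quadPoly (b₀ : ℂ) ((0 : ℝ) : ℂ) ((0 : ℝ) : ℂ)) (linPoly (a₀ : ℂ) a₁) n 0).eval
          (ω : ℂ) ∂(hermiteMeasure C₀ a₀ a₁ b₀)
    = (m.factorial : ℂ) * n.factorial * (Complex.I * b₀) ^ (m + n)
      * (∑ k ∈ Finset.range (min m n + 1), ((a₁ : ℂ) / b₀) ^ k * z ^ (m + n - 2 * k)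
          / ((m - k).factorial * (n - k).factorial * k.factorial))
      * hermiteS C₀ a₀ a₁ b₀ z := by
  have hb : (b₀ : ℂ) ≠ 0 := by rintro h'; simp_all
  have hi := integrable_cexp_mul_eval (z := z) one_pos
      (fun t _ => integrable_exp_hermiteMeasure (a₀ := a₀) hC h t)
  set L := expFunctional _ z hi with hLdef
  have hp : IsPearson (quadPoly (b₀ : ℂ) ((0 : ℝ) : ℂ) ((0 : ℝ) : ℂ)) (linPoly (a₀ : ℂ) a₁)
    (-Complex.I * z) L := fun p => satisfiesPearson_hermite hC h z trivial p
  have hq : quadPoly (b₀ : ℂ) ((0 : ℝ) : ℂ) ((0 : ℝ) : ℂ) = C (b₀ : ℂ) := by simp [quadPoly]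
  have hL1 : L 1 = hermiteS C₀ a₀ a₁ b₀ z := by
    rw [← charFn_hermiteMeasure hC h]
    simp [L, expFunctional, charFn]
  have hLC : ∀ (x : ℂ) q, L (C x * q) = x * L q := fun x q => by
    rw [← smul_eq_C_mul, map_smul, smul_eq_mul]
  have hLQ : ∀ i, L (rodrigues (quadPoly (b₀ : ℂ) ((0 : ℝ) : ℂ) ((0 : ℝ) : ℂ))
      (linPoly (a₀ : ℂ) a₁) i 0) = (Complex.I * b₀ * z) ^ i * hermiteS C₀ a₀ a₁ b₀ z := fun i => by
    rw [hp.apply_rodrigues, hq, ← C_pow, ← mul_one (C _), hLC, hL1, ← mul_assoc, ← mul_pow]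
    ring
  have h1 := hp.apply_mul_rodrigues_mul_pow n 0 (rodrigues (quadPoly (b₀ : ℂ) ((0 : ℝ) : ℂ)
    ((0 : ℝ) : ℂ)) (linPoly (a₀ : ℂ) a₁) m 0)
  rw [pow_zero, mul_one, add_zero, twistedDeriv_pow_apply] at h1
  refine h1.trans ?_
  rw [hq, ← C_pow, mul_comm _ (C _), hLC, map_sum]
  simp_rw [hLC, ← hq, iterate_derivative_rodrigues_hermite, hLC, hLQ]
  have e : ∀ j ∈ Finset.range (n + 1), (-Complex.I * z) ^ (n - j) * (n.choose j : ℂ)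
      * ((m.descFactorial j : ℂ) * (a₁ : ℂ) ^ j
        * ((Complex.I * b₀ * z) ^ (m - j) * hermiteS C₀ a₀ a₁ b₀ z))
      = (n.choose j : ℂ) * (m.descFactorial j : ℂ) * ((-Complex.I * z) ^ (n - j) * (a₁ : ℂ) ^ j
        * (Complex.I * b₀ * z) ^ (m - j) * hermiteS C₀ a₀ a₁ b₀ z) := fun j _ => by ring
  rw [Finset.sum_congr rfl e, sum_range_min_factorial, mul_assoc _ (∑ _ ∈ _, _) (hermiteS _ _ _ _ _),
    Finset.sum_mul, ← mul_assoc, ← mul_assoc, Finset.mul_sum, Finset.mul_sum]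
  refine Finset.sum_congr rfl fun j hj => ?_
  have hj' := Finset.mem_range.1 hj
  obtain ⟨m, rfl⟩ : ∃ i, m = j + i := ⟨m - j, by omega⟩
  obtain ⟨n, rfl⟩ : ∃ i, n = j + i := ⟨n - j, by omega⟩
  rw [Nat.add_sub_cancel_left, Nat.add_sub_cancel_left,
    show j + m + (j + n) - 2 * j = m + n by omega]
  have hI : (-1 : ℂ) ^ j * (Complex.I ^ j * Complex.I ^ j) = 1 := by
    rw [← mul_pow, ← mul_pow, Complex.I_mul_I]; simp
  have hn : (-1 : ℂ) ^ n * (-1) ^ n = 1 := by rw [← mul_pow]; simp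
  have hbj : ((a₁ : ℂ) / b₀) ^ j * b₀ ^ j = a₁ ^ j := by rw [← mul_pow, div_mul_cancel₀ _ hb]
  rw [← hbj]
  generalize ((a₁ : ℂ) / b₀) ^ j = A
  rw [show -Complex.I * z = (-1) * Complex.I * z by ring]
  simp only [mul_pow, pow_add]
  generalize ((j + m).factorial : ℂ) = F1
  generalize ((j + n).factorial : ℂ) = F2
  simp only [mul_div_assoc]
  simp only [div_eq_mul_inv]
  generalize ((m.factorial : ℂ) * n.factorial * j.factorial)⁻¹ = F3
  have key : (-1 : ℂ) ^ j * (-1) ^ n * (-1) ^ n = Complex.I ^ j * Complex.I ^ j := by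
    rw [mul_assoc, hn, mul_one, ← mul_pow, Complex.I_mul_I]
  linear_combination (F1 * F2 * A * z ^ n * z ^ m * Complex.I ^ n * Complex.I ^ m * b₀ ^ j * b₀ ^ j
    * b₀ ^ m * b₀ ^ n * F3 * hermiteS C₀ a₀ a₁ b₀ z) * key

theorem rodriguesLead_zero_left (t : ℝ) (n : ℕ) : rodriguesLead (0 : ℝ) t n 0 = t ^ n := by
  rw [rodriguesLead_eq_prod]; simp

theorem hermite_sign (h : a₁ / b₀ < 0) : a₁ ≠ 0 ∧ b₀ ≠ 0 ∧ 0 < -(a₁ * b₀) ∧ 0 < -(b₀ / a₁) ∧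
    0 < √(-(Real.pi * (2 * b₀ / a₁))) := by
  have hb : b₀ ≠ 0 := by rintro rfl; simp at h
  have ha : a₁ ≠ 0 := by rintro rfl; simp at h
  have h1 : 0 < -(b₀ / a₁) := by
    rw [← inv_div]; exact neg_pos.2 (inv_lt_zero.2 h)
  refine ⟨ha, hb, ?_, h1, Real.sqrt_pos.2 ?_⟩
  · have : a₁ * b₀ = a₁ / b₀ * b₀ ^ 2 := by field_simp
    rw [this]
    nlinarith [sq_pos_of_ne_zero hb]
  · have := mul_pos Real.pi_pos h1
    rw [mul_div_assoc]
    linarith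

theorem sign_mul_self_pow_pos {x : ℝ} (hx : x ≠ 0) (n : ℕ) : 0 < Real.sign x ^ n * x ^ n := by
  rw [← mul_pow]
  refine pow_pos ?_ n
  rcases lt_or_gt_of_ne hx with h | h
  · rw [Real.sign_of_neg h]; linarith
  · rw [Real.sign_of_pos h]; linarith

theorem sign_sq {x : ℝ} (hx : x ≠ 0) : Real.sign x ^ 2 = 1 := by
  rcases Real.sign_apply_eq_of_ne_zero x hx with h | h <;> rw [h] <;> norm_num

theorem sqrt_pow_eq {x : ℝ} (hx : 0 ≤ x) (n : ℕ) : √(x ^ n) = √x ^ n := by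
  induction n with
  | zero => simp
  | succ n ih => rw [pow_succ, Real.sqrt_mul (by positivity), ih, pow_succ]

/-- The sign `(-1)^{m+n}` arises because `a₁` and `b₀` have opposite signs: `√(-b₀/a₁) √(-a₁b₀) =
|b₀| = -sgn(a₁) b₀`. -/
theorem hermiteC_mul (hC : 0 < C₀) (h : a₁ / b₀ < 0) (m n : ℕ) :
    hermiteC C₀ a₁ b₀ m * hermiteC C₀ a₁ b₀ n * (m.factorial * n.factorial * b₀ ^ (m + n))
        * (C₀ * √(-(Real.pi * (2 * b₀ / a₁))))
      = (-1) ^ (m + n) * √((-(b₀ / a₁)) ^ (m + n)) * √(m.factorial * n.factorial) := by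
  obtain ⟨ha, hb, h1, h2, h3⟩ := hermite_sign h
  set K := √(-(Real.pi * (2 * b₀ / a₁))) with hK
  have hc : ∀ n, hermiteC C₀ a₁ b₀ n
      = Real.sign a₁ ^ n * (√(C₀ * K) * √(n.factorial) * √(-(a₁ * b₀)) ^ n)⁻¹ := fun n => by
    rw [hermiteC, ← hK, rpow_neg_half_eq (by positivity), ← sqrt_pow_eq h1.le,
      ← Real.sqrt_mul (by positivity), ← Real.sqrt_mul (by positivity)]
    congr 3
    ring
  have hs : √(-(b₀ / a₁)) * √(-(a₁ * b₀)) = -Real.sign a₁ * b₀ := by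
    rw [← Real.sqrt_mul h2.le, show -(b₀ / a₁) * -(a₁ * b₀) = b₀ ^ 2 by field_simp,
      Real.sqrt_sq_eq_abs]
    rcases lt_or_gt_of_ne ha with h | h
    · rw [Real.sign_of_neg h, abs_of_pos (by nlinarith)]; ring
    · rw [Real.sign_of_pos h, abs_of_neg (by nlinarith)]; ring
  have hg : √(-(a₁ * b₀)) ≠ 0 := (Real.sqrt_pos.2 h1).ne'
  have hs' : Real.sign a₁ * b₀ * (√(-(a₁ * b₀)))⁻¹ = -√(-(b₀ / a₁)) := by
    rw [← div_eq_mul_inv, div_eq_iff hg]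
    linarith
  have hf : ∀ n : ℕ, (n.factorial : ℝ) = √(n.factorial) * √(n.factorial) := fun n =>
    (Real.mul_self_sqrt (by positivity)).symm
  have hf' : ∀ n : ℕ, √(n.factorial : ℝ) ≠ 0 := fun n => (Real.sqrt_pos.2 (by positivity)).ne'
  have hCK : C₀ * K = √(C₀ * K) * √(C₀ * K) := (Real.mul_self_sqrt (by positivity)).symm
  have hCK' : √(C₀ * K) ≠ 0 := (Real.sqrt_pos.2 (by positivity)).ne'
  rw [sqrt_pow_eq h2.le, Real.sqrt_mul (by positivity), ← mul_pow, neg_one_mul, ← hs', hc, hc]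
  calc _ = Real.sign a₁ ^ m * (√(C₀ * K) * √(m.factorial) * √(-(a₁ * b₀)) ^ m)⁻¹
        * (Real.sign a₁ ^ n * (√(C₀ * K) * √(n.factorial) * √(-(a₁ * b₀)) ^ n)⁻¹)
        * (√(m.factorial) * √(m.factorial) * (√(n.factorial) * √(n.factorial)) * b₀ ^ (m + n))
        * (√(C₀ * K) * √(C₀ * K)) := by rw [← hf, ← hf, ← hCK]
    _ = _ := by
      have := hf' m
      have := hf' n
      rw [mul_pow, mul_pow, inv_pow]
      field_simp
      ring

theorem isSpectralSolution_hermite (hC : 0 < C₀) (h : a₁ / b₀ < 0) :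
    IsSpectralSolution (hermiteH a₀ a₁ b₀) (hermiteMeasure C₀ a₀ a₁ b₀) Set.univ
      (hermiteS C₀ a₀ a₁ b₀) (hermiteSn C₀ a₀ a₁ b₀) (hermiteSmn a₀ a₁ b₀) := by
  obtain ⟨ha, hb, h1, h2, h3⟩ := hermite_sign h
  refine isSpectralSolution_of_pearson (s₀ := b₀) (s₁ := 0) (s₂ := 0) (t₀ := a₀) (t₁ := a₁)
    (c := hermiteC C₀ a₁ b₀) (I := fun n => b₀ ^ n * (C₀ * √(-(Real.pi * (2 * b₀ / a₁)))))
    trivial (fun z _ => ⟨1, one_pos, fun t _ => integrable_exp_hermiteMeasure hC h t⟩)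
    (satisfiesPearson_hermite hC h) (by simpa using ha) (integral_hermiteMeasure hC h)
    (fun n => ?_) (fun n => ?_) (isJacobiOperator_hermiteH a₀ a₁ b₀) (fun n => by positivity)
    (fun n => ?_) (fun n => ?_) (fun z _ => charFn_hermiteMeasure hC h z) (fun n z _ => ?_)
    fun m n z _ => ?_
  · rw [rodriguesLead_zero_left, hermiteC, mul_right_comm]
    exact mul_pos (sign_mul_self_pow_pos ha n) (Real.rpow_pos_of_pos (by positivity) _)
  · rw [rodriguesLead_zero_left, hermiteC]
    refine Eq.trans ?_ (sq_mul_rpow_neg_half (sign_sq ha) (x := C₀ * n.factorial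
      * (-(a₁ * b₀)) ^ n * √(-(Real.pi * (2 * b₀ / a₁)))) (by positivity) n)
    congr 1
    rw [neg_pow (a₁ * b₀), mul_pow]
    ring
  · rw [rodriguesLead_zero_left, rodriguesLead_zero_left, mul_pow, Real.sq_sqrt h2.le,
      Real.sq_sqrt (by positivity)]
    field_simp
    ring
  · simp only [mul_zero, add_zero]
    ring
  · rw [hermiteSn, ← charFn_hermiteMeasure hC h]
    simp only [quadPoly, eval_pow, Complex.ofReal_zero, C_0, zero_mul, add_zero, eval_C,
      integral_mul_const, charFn]
    ring
  · have e := congrArg (fun x : ℝ => (x : ℂ)) (hermiteC_mul hC h m n)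
    push_cast at e
    rw [integral_rodrigues_hermite_mul hC h, hermiteSmn, hermiteS, neg_pow Complex.I, mul_pow]
    linear_combination (Complex.I ^ (m + n) * (∑ k ∈ Finset.range (min m n + 1),
      ((a₁ : ℂ) / b₀) ^ k * z ^ (m + n - 2 * k)
          / ((m - k).factorial * (n - k).factorial * k.factorial))
      * Complex.exp (a₀ ^ 2 / (2 * a₁ * b₀))
      * Complex.exp (b₀ / (2 * a₁) * (z + Complex.I * (a₀ / b₀)) ^ 2)) * e

theorem solvesWeightEq_hermite (hC : 0 < C₀) (h : a₁ / b₀ < 0) :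
    SolvesWeightEq (hermiteDensity C₀ a₀ a₁ b₀) Set.univ Set.univ (hermiteWeight C₀ a₀ a₁ b₀) := by
  obtain ⟨ha, hb, h1, h2, h3⟩ := hermite_sign h
  intro ω _
  -- Completing the square in `y`; the Gaussian is centred at `-(a₀ + a₁ω)/(2b₀)`, and its mass does
  -- not depend on this centre.
  have e : ∀ y, hermiteWeight C₀ a₀ a₁ b₀ y * Real.exp (2 * y * ω)
      = 1 / C₀ * Real.exp (-(a₀ ^ 2 / (2 * b₀ * a₁))) * √(-(2 * b₀ / (a₁ * Real.pi)))
        * Real.exp (-(a₁ / (2 * b₀) * ω ^ 2 + a₀ / b₀ * ω))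
        * Real.exp (-(-(2 * b₀ / a₁)) * (y + (a₀ / (2 * b₀) + ω * a₁ / (2 * b₀))) ^ 2) := by
    intro y
    rw [hermiteWeight, mul_assoc, ← Real.exp_add, mul_assoc _ (Real.exp (-(_ + _))), ← Real.exp_add]
    congr 2
    field_simp
    ring
  have hv : 0 < -(2 * b₀ / a₁) := by rw [mul_div_assoc]; linarith
  simp_rw [e]
  rw [integrableOn_univ, setIntegral_univ, integral_const_mul,
    integral_add_right_eq_self (fun y => Real.exp (-(-(2 * b₀ / a₁)) * y ^ 2)), integral_gaussian]
  refine ⟨((integrable_exp_neg_mul_sq hv).comp_add_right _).const_mul _, ?_⟩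
  have hsq : √(-(2 * b₀ / (a₁ * Real.pi))) * √(Real.pi / -(2 * b₀ / a₁)) = 1 := by
    rw [← Real.sqrt_mul (by
      rw [← div_div, ← neg_div]; positivity), Real.sqrt_eq_one]
    have := Real.pi_ne_zero
    field_simp
  have hexp : Real.exp (a₁ / (2 * b₀) * (ω + a₀ / a₁) ^ 2) * Real.exp (-(a₀ ^ 2 / (2 * b₀ * a₁)))
      * Real.exp (-(a₁ / (2 * b₀) * ω ^ 2 + a₀ / b₀ * ω)) = 1 := by
    rw [← Real.exp_add, ← Real.exp_add, Real.exp_eq_one_iff]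
    field_simp
    ring
  rw [hermiteDensity]
  calc _ = (C₀ * (1 / C₀)) * (√(-(2 * b₀ / (a₁ * Real.pi))) * √(Real.pi / -(2 * b₀ / a₁)))
        * (Real.exp (a₁ / (2 * b₀) * (ω + a₀ / a₁) ^ 2) * Real.exp (-(a₀ ^ 2 / (2 * b₀ * a₁)))
      * Real.exp (-(a₁ / (2 * b₀) * ω ^ 2 + a₀ / b₀ * ω))) := by ring
    _ = 1 := by rw [hsq, hexp]; field_simp

theorem PolyHam.IsPiecewiseContinuous.of_continuousOn {w : ℝ → ℝ} {J : Set ℝ} (hJ : IsOpen J)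
    (h : ContinuousOn w J) : IsPiecewiseContinuous w J := by
  have h' : ∀ y ∈ J, ContinuousAt w y := fun y hy => h.continuousAt (hJ.mem_nhds hy)
  refine ⟨fun K hK _ => ?_, fun y hy => ⟨⟨w y, (h' y hy).mono_left nhdsWithin_le_nhds⟩,
    ⟨w y, (h' y hy).mono_left nhdsWithin_le_nhds⟩⟩⟩
  convert! Set.finite_empty
  ext y
  simp only [Set.mem_ofPred_eq, Set.mem_empty_iff_false, iff_false, not_and, not_not]
  exact fun hy => h' y (hK hy)

theorem hermite_case (hC : 0 < C₀) (h : a₁ / b₀ < 0) :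
    IsSpectralSolution (hermiteH a₀ a₁ b₀) (hermiteMeasure C₀ a₀ a₁ b₀) Set.univ
        (hermiteS C₀ a₀ a₁ b₀) (hermiteSn C₀ a₀ a₁ b₀) (hermiteSmn a₀ a₁ b₀) ∧
      coherentDomain (hermiteMeasure C₀ a₀ a₁ b₀) = Set.univ ∧
      IsTheWeight (hermiteDensity C₀ a₀ a₁ b₀) Set.univ Set.univ (hermiteWeight C₀ a₀ a₁ b₀) ∧
      IsReproducing (hermiteMeasure C₀ a₀ a₁ b₀) Set.univ (hermiteWeight C₀ a₀ a₁ b₀) := by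
  have hw := solvesWeightEq_hermite (a₀ := a₀) hC h
  refine ⟨isSpectralSolution_hermite hC h,
    coherentDomain_eq_univ (integrable_exp_hermiteMeasure hC h),
    isTheWeight_of_solves (c := 0) one_pos (Set.subset_univ _) isOpen_univ
      (.of_continuousOn isOpen_univ ?_) hw, ?_⟩
  · unfold hermiteWeight; fun_prop
  · have := isReproducing_of_solves measurable_hermiteDensity .univ
      (fun ω _ => hermiteDensity_nonneg hC ω) .univ hw ⟨0, trivial⟩
      (fun y _ => by unfold hermiteWeight; positivity)
      (fun y _ => integrable_exp_hermiteMeasure hC h (2 * y))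
    simpa [hermiteMeasure] using this

end Hermite

/-! ### Affine changes of variables -/

section Affine

variable {E : Type*} [NormedAddCommGroup E] [NormedSpace ℝ E] {c d : ℝ} {s : Set ℝ}

theorem setIntegral_image_affine (hc : c ≠ 0) (hs : MeasurableSet s) (g : ℝ → E) :
    ∫ x in (fun u => c * u + d) '' s, g x = ∫ u in s, |c| • g (c * u + d) := by
  refine integral_image_eq_integral_abs_deriv_smul hs (fun x _ => ?_) (fun x _ y _ h => ?_) g
  · simpa using (((hasDerivAt_id x).const_mul c).add_const d).hasDerivWithinAt
  · exact mul_left_cancel₀ hc (add_right_cancel h)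

theorem integrableOn_image_affine (hc : c ≠ 0) (hs : MeasurableSet s) (g : ℝ → E) :
    IntegrableOn g ((fun u => c * u + d) '' s) ↔ IntegrableOn (fun u => g (c * u + d)) s := by
  have h := integrableOn_image_iff_integrableOn_abs_deriv_smul (f := fun u => c * u + d)
    (f' := fun _ => c) hs
    (fun x _ => by simpa using (((hasDerivAt_id x).const_mul c).add_const d).hasDerivWithinAt)
    (fun x _ y _ h => mul_left_cancel₀ hc (add_right_cancel h)) g
  rw [h]
  exact integrable_smul_iff (abs_ne_zero.2 hc) _

theorem image_affine_Ioi_zero_of_pos (hc : 0 < c) :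
    (fun u => c * u + d) '' Set.Ioi 0 = Set.Ioi d := by
  ext x
  simp only [Set.mem_image, Set.mem_Ioi]
  exact ⟨fun ⟨u, hu, h⟩ => by rw [← h]; nlinarith [mul_pos hc hu],
    fun h => ⟨(x - d) / c, div_pos (by linarith) hc, by field_simp; ring⟩⟩

theorem image_affine_Ioi_zero_of_neg (hc : c < 0) :
    (fun u => c * u + d) '' Set.Ioi 0 = Set.Iio d := by
  ext x
  simp only [Set.mem_image, Set.mem_Ioi, Set.mem_Iio]
  exact ⟨fun ⟨u, hu, h⟩ => by rw [← h]; nlinarith [mul_neg_of_neg_of_pos hc hu],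
    fun h => ⟨(x - d) / c, div_pos_of_neg_of_neg (by linarith) hc, by
      have := hc.ne
      field_simp; ring⟩⟩

end Affine

/-! ### A singularity bounding the maximal strip -/

section Strip

/-- If the characteristic function is unbounded near a point on the line `Im z = lam`, then the
maximal strip is bounded by this line. -/
theorem maximalStrip_eq_of_tendsto {σ : Measure ℝ} {lam : ℝ} (hlam : 0 < lam) {G : ℂ → ℂ}
    (hG : DifferentiableOn ℂ G {z | z.im < lam}) (hGr : ∀ t : ℝ, G t = charFn σ t)
    (hlim : Tendsto (fun y : ℝ => ‖G (Complex.I * y)‖) (𝓝[<] lam) atTop) :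
    maximalStrip σ = {z | z.im < lam} := by
  have hopen : IsOpen {z : ℂ | z.im < lam} := isOpen_lt Complex.continuous_im continuous_const
  have hconv : Convex ℝ {z : ℂ | z.im < lam} := convex_halfSpace_im_lt lam
  refine Set.Subset.antisymm (Set.sUnion_subset ?_) (Set.subset_sUnion_of_mem
    ⟨hopen, ⟨⟨0, by simpa using hlam⟩, hconv.isPreconnected⟩, fun t => by simpa using hlam,
      fun z hz t => by simpa using hz, G, hG, hGr⟩)
  rintro V ⟨hVo, hVc, hVr, hVt, F, hF, hFr⟩ p hp
  by_contra hlt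
  simp only [Set.mem_ofPred_eq, not_lt] at hlt
  have him : ∀ z w : ℂ, z ∈ V → z.im = w.im → w ∈ V := fun z w hz h => by
    have := hVt z hz (w.re - z.re)
    convert this using 1
    apply Complex.ext <;> simp [h]
  -- Translation invariance makes `V` a union of horizontal lines, and connectedness makes the set
  -- of its heights an interval. A competitor reaching height `lam` thus contains the segment from
  -- `0` to `i·lam`.
  have hpre : (Complex.im '' V).OrdConnected :=
    (hVc.isPreconnected.image _ Complex.continuous_im.continuousOn).ordConnected
  have hmem : ∀ y : ℝ, 0 ≤ y → y ≤ lam → Complex.I * y ∈ V := fun y h0 h1 => by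
    obtain ⟨z, hz, hzy⟩ := hpre.out ⟨0, by simpa using hVr 0, Complex.zero_im⟩ ⟨p, hp, rfl⟩
      ⟨h0, h1.trans hlt⟩
    exact him z _ hz (by simp [hzy])
  have hU : V ∩ {z | z.im < lam} = Complex.im ⁻¹' (Complex.im '' V ∩ Set.Iio lam) := by
    ext z
    constructor
    · rintro ⟨h1, h2⟩
      exact ⟨⟨z, h1, rfl⟩, h2⟩
    · rintro ⟨⟨w, hw, h1⟩, h2⟩
      exact ⟨him w z hw h1, h2⟩
  have hUc : IsPreconnected (V ∩ {z | z.im < lam}) := by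
    rw [hU]
    exact ((hpre.inter Set.ordConnected_Iio).convex.is_linear_preimage
      Complex.imLm.isLinear).isPreconnected
  have hUo : IsOpen (V ∩ {z | z.im < lam}) := hVo.inter hopen
  -- Identity theorem from the real axis; the intersection is connected, being again a horizontal
  -- strip.
  have heq : Set.EqOn F G (V ∩ {z | z.im < lam}) := by
    refine ((hF.mono Set.inter_subset_left).analyticOnNhd hUo).eqOn_of_preconnected_of_frequently_eq
      ((hG.mono Set.inter_subset_right).analyticOnNhd hUo) hUc (z₀ := 0)
      ⟨by simpa using hVr 0, by simpa using hlam⟩ ?_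
    have ht : Tendsto (fun t : ℝ => (t : ℂ)) (𝓝[≠] 0) (𝓝[≠] (0 : ℂ)) := by
      refine tendsto_nhdsWithin_of_tendsto_nhds_of_eventually_within _ ?_ ?_
      · exact (Complex.continuous_ofReal.tendsto' 0 0 (by simp)).mono_left nhdsWithin_le_nhds
      · filter_upwards [self_mem_nhdsWithin] with t ht
        simpa using ht
    exact ht.frequently (Eventually.of_forall fun t => by rw [hFr, hGr]).frequently
  -- The competitor is continuous at `i·lam`, so its norm has a finite limit there, against the
  -- blow-up of `G`.
  have hFc : Tendsto (fun y : ℝ => ‖F (Complex.I * y)‖) (𝓝[<] lam)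
      (𝓝 ‖F (Complex.I * lam)‖) := by
    have h1 : ContinuousAt F (Complex.I * lam) :=
      (hF.continuousOn.continuousAt (hVo.mem_nhds (hmem lam hlam.le le_rfl)))
    have h2 : ContinuousAt (fun y : ℝ => F (Complex.I * y)) lam :=
      ContinuousAt.comp (f := fun y : ℝ => Complex.I * y) h1 (by fun_prop)
    exact (h2.norm.tendsto).mono_left nhdsWithin_le_nhds
  refine not_tendsto_atTop_of_tendsto_nhds hFc (hlim.congr' ?_)
  filter_upwards [Ioo_mem_nhdsLT hlam] with y hy
  rw [heq ⟨hmem y hy.1.le hy.2.le, by simpa using hy.2⟩]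

end Strip

/-! ### Laguerre case: characteristic function and domain -/

section Laguerre

variable {C₀ a₀ a₁ b₀ b₁ μ : ℝ}

theorem measurable_laguerreDensity : Measurable (laguerreDensity C₀ a₁ b₀ b₁ μ) := by
  unfold laguerreDensity; fun_prop

theorem laguerreDensity_nonneg (hC : 0 < C₀) {ω : ℝ} (hω : ω ∈ Set.Ioi (-(b₀ / b₁))) :
    0 ≤ laguerreDensity C₀ a₁ b₀ b₁ μ ω := by
  have : 0 < ω + b₀ / b₁ := by have := Set.mem_Ioi.1 hω; linarith
  unfold laguerreDensity; positivity

theorem laguerreDensity_affine (u t : ℝ) :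
    laguerreDensity C₀ a₁ b₀ b₁ μ (1 * u + -(b₀ / b₁)) * Real.exp (t * (1 * u + -(b₀ / b₁)))
      = C₀ * Real.exp (-((a₁ / b₁ + t) * (b₀ / b₁)))
        * (u ^ (μ - 1) * Real.exp (-((-(a₁ / b₁) - t) * u))) := by
  rw [laguerreDensity, one_mul, neg_add_cancel_right, mul_assoc, ← Real.exp_add]
  rw [show C₀ * Real.exp (-((a₁ / b₁ + t) * (b₀ / b₁)))
        * (u ^ (μ - 1) * Real.exp (-((-(a₁ / b₁) - t) * u)))
    = C₀ * u ^ (μ - 1) * (Real.exp (-((a₁ / b₁ + t) * (b₀ / b₁)))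
        * Real.exp (-((-(a₁ / b₁) - t) * u))) by ring, ← Real.exp_add]
  congr 2
  ring

theorem integrable_exp_laguerreMeasure (hC : 0 < C₀) (hμ : 0 < μ) {t : ℝ} (ht : t < -(a₁ / b₁)) :
    Integrable (fun ω => Real.exp (t * ω)) (laguerreMeasure C₀ a₁ b₀ b₁ μ) := by
  rw [laguerreMeasure, integrable_weightMeasure_iff measurable_laguerreDensity measurableSet_Ioi
    fun ω hω => laguerreDensity_nonneg hC hω, ← image_affine_Ioi_zero_of_pos one_pos,
    integrableOn_image_affine one_ne_zero measurableSet_Ioi]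
  simp_rw [smul_eq_mul, laguerreDensity_affine]
  have := integrableOn_rpow_mul_exp_neg_mul_rpow (p := 1) (s := μ - 1) (b := -(a₁ / b₁) - t)
    (by linarith) one_pos (by linarith)
  simp only [Real.rpow_one, neg_mul] at this
  exact Integrable.const_mul this _

theorem integral_exp_laguerreMeasure (hC : 0 < C₀) (hμ : 0 < μ) {t : ℝ} (ht : t < -(a₁ / b₁)) :
    ∫ ω, Real.exp (t * ω) ∂(laguerreMeasure C₀ a₁ b₀ b₁ μ)
      = C₀ * Real.exp (-((a₁ / b₁ + t) * (b₀ / b₁))) * ((-(a₁ / b₁) - t) ^ (-μ) * Real.Gamma μ) := by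
  rw [laguerreMeasure, integral_weightMeasure measurable_laguerreDensity measurableSet_Ioi
    fun ω hω => laguerreDensity_nonneg hC hω, ← image_affine_Ioi_zero_of_pos one_pos,
    setIntegral_image_affine one_ne_zero measurableSet_Ioi]
  simp_rw [smul_eq_mul, laguerreDensity_affine, abs_one, one_mul]
  have h : 0 < -(a₁ / b₁) - t := by linarith
  rw [integral_const_mul, Real.integral_rpow_mul_exp_neg_mul_Ioi hμ h, one_div,
    Real.inv_rpow h.le, Real.rpow_neg h.le]

theorem re_laguerre_pos {z : ℂ} (hz : z.im < -(a₁ / b₁)) :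
    0 < (Complex.I * z - a₁ / b₁ : ℂ).re := by
  have : (Complex.I * z - a₁ / b₁ : ℂ).re = -z.im - a₁ / b₁ := by
    rw [← Complex.ofReal_div]; simp
  rw [this]; linarith

theorem differentiableOn_laguerreS :
    DifferentiableOn ℂ (laguerreS C₀ a₁ b₀ b₁ μ) {z | z.im < -(a₁ / b₁)} := by
  intro z hz
  unfold laguerreS
  refine DifferentiableAt.differentiableWithinAt ?_
  have h1 : DifferentiableAt ℂ (fun z : ℂ => (Complex.I * z - a₁ / b₁) ^ (-(μ : ℂ))) z :=
    DifferentiableAt.cpow_const (by fun_prop) (Or.inl (re_laguerre_pos hz))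
  exact (h1.const_mul _).mul (by fun_prop)

theorem laguerreS_I_mul {y : ℝ} (hy : y < -(a₁ / b₁)) :
    laguerreS C₀ a₁ b₀ b₁ μ (Complex.I * y) = ((C₀ * Real.exp (-((a₁ / b₁ + y) * (b₀ / b₁)))
      * ((-(a₁ / b₁) - y) ^ (-μ) * Real.Gamma μ) : ℝ) : ℂ) := by
  have e1 : Complex.I * (Complex.I * y) - a₁ / b₁ = ((-(a₁ / b₁) - y : ℝ) : ℂ) := by
    push_cast
    linear_combination (y : ℂ) * Complex.I_sq
  have e2 : (b₀ / b₁ * Complex.I * (Complex.I * y) : ℂ) = ((-(b₀ / b₁ * y) : ℝ) : ℂ) := by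
    push_cast
    linear_combination (b₀ / b₁ * y : ℂ) * Complex.I_sq
  have h : 0 ≤ -(a₁ / b₁) - y := by linarith
  have e3 : Real.exp (-((a₁ / b₁ + y) * (b₀ / b₁)))
      = Real.exp (-(b₀ * a₁ / b₁ ^ 2)) * Real.exp (-(b₀ / b₁ * y)) := by
    rw [← Real.exp_add]
    congr 1
    rw [sq, ← div_mul_div_comm]
    ring
  rw [laguerreS, e1, e2, e3, ← Complex.ofReal_neg, ← Complex.ofReal_cpow h]
  push_cast
  ring

/-- Both sides are holomorphic in the half plane. On the imaginary axis the claim is the real Gamma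
integral, and the identity theorem does the rest. -/
theorem charFn_laguerreMeasure (hC : 0 < C₀) (hμ : 0 < μ) (h : a₁ / b₁ < 0) {z : ℂ}
    (hz : z.im < -(a₁ / b₁)) :
    charFn (laguerreMeasure C₀ a₁ b₀ b₁ μ) z = laguerreS C₀ a₁ b₀ b₁ μ z := by
  have hopen : IsOpen {z : ℂ | z.im < -(a₁ / b₁)} := isOpen_lt Complex.continuous_im continuous_const
  have hd : DifferentiableOn ℂ (charFn (laguerreMeasure C₀ a₁ b₀ b₁ μ)) {z | z.im < -(a₁ / b₁)} := by
    intro z hz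
    have h1 : charFn (laguerreMeasure C₀ a₁ b₀ b₁ μ)
      = fun z => ProbabilityTheory.complexMGF id (laguerreMeasure C₀ a₁ b₀ b₁ μ) (-Complex.I * z) :=
      funext fun z => charFn_eq_complexMGF _ z
    rw [h1]
    have h2 : (-Complex.I * z).re ∈ interior (ProbabilityTheory.integrableExpSet id
        (laguerreMeasure C₀ a₁ b₀ b₁ μ)) := by
      have h3 : Set.Iio (-(a₁ / b₁)) ⊆ ProbabilityTheory.integrableExpSet id
        (laguerreMeasure C₀ a₁ b₀ b₁ μ) := fun t ht => integrable_exp_laguerreMeasure hC hμ ht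
      refine interior_mono h3 ?_
      rw [interior_Iio]
      simpa using hz
    exact ((ProbabilityTheory.hasDerivAt_complexMGF h2).differentiableAt.comp z
      (by fun_prop)).differentiableWithinAt
  refine (hd.analyticOnNhd hopen).eqOn_of_preconnected_of_frequently_eq
      (differentiableOn_laguerreS.analyticOnNhd hopen) (convex_halfSpace_im_lt _).isPreconnected
      (z₀ := 0) (by simpa using h) ?_ hz
  have ht : Tendsto (fun t : ℝ => Complex.I * t) (𝓝[≠] 0) (𝓝[≠] (0 : ℂ)) := by
    refine tendsto_nhdsWithin_of_tendsto_nhds_of_eventually_within _ ?_ ?_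
    · exact (Continuous.tendsto' (by fun_prop) 0 0 (by simp)).mono_left nhdsWithin_le_nhds
    · filter_upwards [self_mem_nhdsWithin] with t ht
      simpa using ht
  refine ht.frequently (Eventually.frequently ?_)
  have : ∀ᶠ y in 𝓝[≠] (0 : ℝ), y < -(a₁ / b₁) :=
    nhdsWithin_le_nhds (Iio_mem_nhds (by linarith))
  filter_upwards [this] with y hy
  rw [laguerreS_I_mul hy, ← integral_exp_laguerreMeasure hC hμ hy, charFn, ← integral_complex_ofReal]
  refine integral_congr_ae (ae_of_all _ fun ω => ?_)
  beta_reduce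
  rw [Complex.ofReal_exp]
  congr 1
  push_cast
  linear_combination -(y * ω : ℂ) * Complex.I_sq

/-- Along `z = iy` the closed form contains `(-a₁/b₁ - y)^{-μ}`, which blows up as `y` increases to
`-a₁/b₁`; so the maximal strip ends there, and the domain is half of it. -/
theorem coherentDomain_laguerre (hC : 0 < C₀) (hμ : 0 < μ) (h : a₁ / b₁ < 0) :
    coherentDomain (laguerreMeasure C₀ a₁ b₀ b₁ μ) = {z : ℂ | z.im < -(a₁ / (2 * b₁))} := by
  have hs : maximalStrip (laguerreMeasure C₀ a₁ b₀ b₁ μ) = {z | z.im < -(a₁ / b₁)} := by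
    refine maximalStrip_eq_of_tendsto (by linarith) differentiableOn_laguerreS
      (fun t => (charFn_laguerreMeasure hC hμ h (by simpa using h)).symm) ?_
    have h1 : Tendsto (fun y : ℝ => (-(a₁ / b₁) - y) ^ (-μ)) (𝓝[<] (-(a₁ / b₁))) atTop := by
      refine (tendsto_rpow_neg_nhdsGT_zero (by linarith)).comp ?_
      refine tendsto_nhdsWithin_of_tendsto_nhds_of_eventually_within _ ?_ ?_
      · exact (Continuous.tendsto' (by fun_prop) _ _ (by ring)).mono_left nhdsWithin_le_nhds
      · filter_upwards [self_mem_nhdsWithin] with y hy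
        simpa using hy
    have h2 : Tendsto (fun y : ℝ => C₀ * Real.exp (-((a₁ / b₁ + y) * (b₀ / b₁))))
        (𝓝[<] (-(a₁ / b₁))) (𝓝 (C₀ * Real.exp (-((a₁ / b₁ + -(a₁ / b₁)) * (b₀ / b₁))))) :=
      (Continuous.tendsto (by fun_prop) _).mono_left nhdsWithin_le_nhds
    have h3 := h2.pos_mul_atTop (by positivity)
      (h1.atTop_mul_const (Real.Gamma_pos_of_pos hμ))
    refine h3.congr' ?_
    filter_upwards [self_mem_nhdsWithin] with y hy
    have hy' : 0 < -(a₁ / b₁) - y := by have := Set.mem_Iio.1 hy; linarith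
    have := Real.Gamma_pos_of_pos hμ
    rw [laguerreS_I_mul hy, Complex.norm_real, Real.norm_of_nonneg (by positivity)]
  ext z
  rw [coherentDomain, Set.mem_ofPred_eq, hs]
  have e : (2 * Complex.I * z.im : ℂ).im = 2 * z.im := by simp
  rw [Set.mem_ofPred_eq, e, Set.mem_ofPred_eq, mul_comm 2 b₁, ← div_div]
  constructor <;> intro h <;> linarith

end Laguerre

/-! ### Explicit Rodrigues polynomials and terminating series -/

section Rodrigues

open Polynomial

variable {A : Type*} [CommRing A] {s τ : A[X]}

theorem raising_sum {ι : Type*} (t : Finset ι) (c : ι → ℕ) (f : ι → A[X]) (k : ℕ) :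
    raising s τ k (∑ i ∈ t, (c i : A[X]) * f i) = ∑ i ∈ t, (c i : A[X]) * raising s τ k (f i) := by
  simp only [raising, derivative_sum, derivative_natCast_mul, Finset.mul_sum,
    ← Finset.sum_add_distrib]
  exact Finset.sum_congr rfl fun i _ => by ring

/-- If raising sends each term to the sum of its two neighbours, the multiplicities obey Pascal's
rule. -/
theorem rodrigues_eq_sum {F : ℕ → ℕ → ℕ → A[X]} (h0 : ∀ k, F k 0 0 = 1)
    (h : ∀ k j i, raising s τ k (F (k + 1) j i) = F k j (i + 1) + F k (j + 1) i) (n k : ℕ) :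
    rodrigues s τ n k
      = ∑ ij ∈ Finset.HasAntidiagonal.antidiagonal n, (n.choose ij.1 : A[X]) * F k ij.1 ij.2 := by
  induction n generalizing k with
  | zero => simp [rodrigues, h0]
  | succ n ih =>
    rw [rodrigues, ih, raising_sum, Finset.sum_antidiagonal_choose_succ_mul, ←
      Finset.sum_add_distrib]
    refine Finset.sum_congr rfl fun ij hij => ?_
    rw [h, mul_add, ← Finset.HasAntidiagonal.mem_antidiagonal.1 hij, Nat.choose_symm_add]

theorem Gamma_mul_shift {x : ℝ} (hx : 0 < x) (y : ℝ) :
    x * (Real.Gamma y / Real.Gamma (x + 1)) = Real.Gamma y / Real.Gamma x := by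
  rw [Real.Gamma_add_one hx.ne']
  have := (Real.Gamma_pos_of_pos hx).ne'
  field_simp

theorem eval_ascPochhammer_ofReal {x : ℝ} (hx : 0 < x) (n : ℕ) :
    (ascPochhammer ℂ n).eval (x : ℂ) = ((Real.Gamma (x + n) / Real.Gamma x : ℝ) : ℂ) := by
  have := (Real.Gamma_pos_of_pos hx).ne'
  induction n with
  | zero => simp [this]
  | succ n ih =>
    rw [ascPochhammer_succ_eval, ih]
    push_cast
    rw [← add_assoc, Real.Gamma_add_one (by positivity)]
    push_cast
    ring

/-- The Pochhammer symbol of `-n` is `(-1)^l l! (n choose l)`, so the series terminates after `l =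
n`; the remaining symbols are quotients of Gamma values. -/
theorem ordinaryHypergeometric_neg_natCast {μ : ℝ} (hμ : 0 < μ) (k n : ℕ) (w : ℂ) :
    ₂F₁ (μ + k : ℂ) (-n : ℂ) (μ : ℂ) w = ∑ l ∈ Finset.range (n + 1), (n.choose l : ℂ) * (-w) ^ l
      * (Real.Gamma (μ + k + l) * Real.Gamma μ / (Real.Gamma (μ + k) * Real.Gamma (μ + l)) : ℝ) := by
  rw [ordinaryHypergeometric_eq_tsum]
  beta_reduce
  rw [tsum_eq_sum (s := Finset.range (n + 1))]
  · refine Finset.sum_congr rfl fun l hl => ?_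
    have h1 : (μ + k : ℂ) = ((μ + k : ℝ) : ℂ) := by push_cast; ring
    have h2 : (Real.Gamma μ : ℂ) ≠ 0 := by exact_mod_cast (Real.Gamma_pos_of_pos hμ).ne'
    have h3 : (l.factorial : ℂ) ≠ 0 := by exact_mod_cast l.factorial_ne_zero
    rw [h1, eval_ascPochhammer_ofReal (by positivity), eval_ascPochhammer_ofReal hμ,
      ascPochhammer_eval_neg_eq_descPochhammer, descPochhammer_eval_eq_descFactorial,
      Nat.descFactorial_eq_factorial_mul_choose, smul_eq_mul, neg_pow w]
    push_cast
    field_simp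
  · intro l hl
    rw [Finset.mem_range, not_lt] at hl
    rw [ascPochhammer_eval_neg_coe_nat_of_lt (by omega)]
    simp

end Rodrigues

/-! ### Laguerre case: Pearson's equation and Rodrigues polynomials -/

section Laguerre

open Polynomial

variable {C₀ a₀ a₁ b₀ b₁ μ : ℝ}

/-- Powers of `ω + b₀/b₁` shift the parameter `μ`, so moments and their transforms reduce to the
mass and the characteristic function of the same family. -/
theorem integral_mul_pow_laguerreMeasure (hC : 0 < C₀) {E : Type*} [NormedAddCommGroup E]
    [NormedSpace ℝ E] (n : ℕ) (g : ℝ → E) :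
    ∫ ω, (ω + b₀ / b₁) ^ n • g ω ∂(laguerreMeasure C₀ a₁ b₀ b₁ μ)
      = ∫ ω, g ω ∂(laguerreMeasure C₀ a₁ b₀ b₁ (μ + n)) := by
  rw [laguerreMeasure, laguerreMeasure, integral_weightMeasure measurable_laguerreDensity
    measurableSet_Ioi fun ω hω => laguerreDensity_nonneg hC hω, integral_weightMeasure
    measurable_laguerreDensity measurableSet_Ioi fun ω hω => laguerreDensity_nonneg hC hω]
  refine setIntegral_congr_fun measurableSet_Ioi fun ω hω => ?_
  have : 0 < ω + b₀ / b₁ := by have := Set.mem_Ioi.1 hω; linarith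
  rw [smul_smul, laguerreDensity, laguerreDensity, show μ + n - 1 = μ - 1 + n by ring,
    Real.rpow_add this, Real.rpow_natCast]
  congr 1
  ring

theorem laguerre_strip_integrable (hC : 0 < C₀) (hμ : 0 < μ) {z : ℂ} (hz : z.im < -(a₁ / b₁)) :
    ∃ δ > 0, ∀ t ∈ Set.Ioo (z.im - δ) (z.im + δ),
      Integrable (fun ω => Real.exp (t * ω)) (laguerreMeasure C₀ a₁ b₀ b₁ μ) :=
  ⟨-(a₁ / b₁) - z.im, by linarith, fun t ht =>
    integrable_exp_laguerreMeasure hC hμ (by linarith [ht.2])⟩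

/-- The relation defining `μ` amounts to `a₀ = b₁μ + a₁b₀/b₁`, which is what `(s ρ)' = τ ρ`
requires. The boundary term at the finite endpoint vanishes because `μ > 0`, and the one at infinity
by integrability. -/
theorem satisfiesPearson_laguerre (hC : 0 < C₀) (h : a₁ / b₁ < 0)
    (hμ : μ = (a₀ * b₁ - b₀ * a₁) / b₁ ^ 2) (hμ0 : 0 < μ) :
    SatisfiesPearson (laguerreMeasure C₀ a₁ b₀ b₁ μ) {z | z.im < -(a₁ / b₁)}
      (quadPoly (b₀ : ℂ) b₁ ((0 : ℝ) : ℂ)) (linPoly (a₀ : ℂ) a₁) := by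
  have hb : b₁ ≠ 0 := by rintro h'; simp_all
  have ha₀ : a₀ = b₁ * μ + a₁ * (b₀ / b₁) := by rw [hμ]; field_simp; ring
  intro z hz p
  have hi : ∀ q : ℂ[X], IntegrableOn (fun ω : ℝ => (laguerreDensity C₀ a₁ b₀ b₁ μ ω : ℂ)
      * (Complex.exp (-Complex.I * z * ω) * q.eval (ω : ℂ))) (Set.Ioi (-(b₀ / b₁))) := fun q => by
    obtain ⟨δ, hδ, hi⟩ := laguerre_strip_integrable (b₀ := b₀) hC hμ0 hz
    have := integrable_cexp_mul_eval (z := z) hδ hi q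
    rw [laguerreMeasure, integrable_weightMeasure_iff measurable_laguerreDensity measurableSet_Ioi
      fun ω hω => laguerreDensity_nonneg hC hω] at this
    simpa only [Complex.real_smul] using this
  rw [laguerreMeasure, integral_weightMeasure measurable_laguerreDensity measurableSet_Ioi
    fun ω hω => laguerreDensity_nonneg hC hω]
  simp_rw [Complex.real_smul]
  -- On `S` this is `s ρ`. Written with the exponent `μ > 0`, it is visibly continuous up to the
  -- endpoint and zero there.
  set u : ℝ → ℝ := fun ω => b₁ * (C₀ * (ω + b₀ / b₁) ^ μ * Real.exp (a₁ / b₁ * ω)) with hu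
  have hus : ∀ ω ∈ Set.Ioi (-(b₀ / b₁)),
      u ω = (b₀ + b₁ * ω) * laguerreDensity C₀ a₁ b₀ b₁ μ ω := fun ω hω => by
    have hx : 0 < ω + b₀ / b₁ := by have := Set.mem_Ioi.1 hω; linarith
    simp only [hu, laguerreDensity]
    rw [show μ = μ - 1 + 1 by ring, Real.rpow_add hx, Real.rpow_one, add_sub_cancel_right]
    field_simp
    ring
  have hder : ∀ ω ∈ Set.Ioi (-(b₀ / b₁)), HasDerivAt (fun ω : ℝ =>
      Complex.exp (-Complex.I * z * ω) * p.eval (ω : ℂ) * u ω)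
      (laguerreDensity C₀ a₁ b₀ b₁ μ ω * (Complex.exp (-Complex.I * z * ω)
        * (quadPoly (b₀ : ℂ) b₁ ((0 : ℝ) : ℂ) * twistedDeriv (-Complex.I * z) p
          + linPoly (a₀ : ℂ) a₁ * p).eval (ω : ℂ))) ω := fun ω hω => by
    have hx : 0 < ω + b₀ / b₁ := by have := Set.mem_Ioi.1 hω; linarith
    refine hasDerivAt_cexp_mul_eval_mul
      (v := (((a₀ + a₁ * ω) * laguerreDensity C₀ a₁ b₀ b₁ μ ω : ℝ) : ℂ)) ?_ (by simp)
      (by rw [hus ω hω]; simp) (Complex.ofReal_im _) z p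
    rw [Complex.ofReal_re]
    have h1 : HasDerivAt (fun ω : ℝ => (ω + b₀ / b₁) ^ μ)
        (μ * (ω + b₀ / b₁) ^ (μ - 1)) ω := by
      have := ((hasDerivAt_id ω).add_const (b₀ / b₁)).rpow_const (p := μ) (Or.inl hx.ne')
      simpa using this
    have h2 : HasDerivAt (fun ω : ℝ => Real.exp (a₁ / b₁ * ω))
        (Real.exp (a₁ / b₁ * ω) * (a₁ / b₁)) ω := by
      simpa using ((hasDerivAt_id ω).const_mul (a₁ / b₁)).exp
    refine (((h1.const_mul C₀).mul h2).const_mul b₁).congr_deriv ?_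
    rw [laguerreDensity, ha₀]
    have : (ω + b₀ / b₁) ^ μ = (ω + b₀ / b₁) ^ (μ - 1) * (ω + b₀ / b₁) := by
      rw [show μ = μ - 1 + 1 by ring, Real.rpow_add hx, Real.rpow_one, add_sub_cancel_right]
    rw [this]
    field_simp
    ring
  rw [integral_Ioi_of_hasDerivAt_of_tendsto (m := 0) ?_ hder (hi _)
    (tendsto_zero_of_hasDerivAt_of_integrableOn_Ioi hder (hi _) ?_)]
  · have : u (-(b₀ / b₁)) = 0 := by simp [hu, Real.zero_rpow hμ0.ne']
    rw [this]
    simp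
  · refine ((Continuous.mul (by fun_prop) (p.continuous.comp Complex.continuous_ofReal)).mul
      (Complex.continuous_ofReal.comp ?_)).continuousWithinAt
    have : Continuous fun ω : ℝ => (ω + b₀ / b₁) ^ μ :=
      (by fun_prop : Continuous fun ω : ℝ => ω + b₀ / b₁).rpow_const fun _ => Or.inr hμ0.le
    fun_prop
  · refine (hi (quadPoly (b₀ : ℂ) b₁ ((0 : ℝ) : ℂ) * p)).congr_fun (fun ω hω => ?_)
      measurableSet_Ioi
    beta_reduce
    rw [hus ω hω]
    simp only [quadPoly, eval_mul, eval_add, eval_C, eval_X, eval_pow]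
    push_cast
    ring

theorem quadPoly_laguerre_eval (hb : b₁ ≠ 0) (ω : ℝ) :
    (quadPoly b₀ b₁ 0).eval ω = b₁ * (ω + b₀ / b₁) := by
  simp [quadPoly]
  field_simp
  ring

theorem integral_laguerreMeasure (hC : 0 < C₀) (h : a₁ / b₁ < 0) (hμ : 0 < μ) (n : ℕ) :
    ∫ ω, ((quadPoly b₀ b₁ 0) ^ n).eval ω ∂(laguerreMeasure C₀ a₁ b₀ b₁ μ)
      = b₁ ^ n * (C₀ * Real.exp (-(a₁ * b₀ / b₁ ^ 2))
        * ((-(b₁ / a₁)) ^ (μ + n) * Real.Gamma (μ + n))) := by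
  have hb : b₁ ≠ 0 := by rintro h'; simp_all
  simp_rw [eval_pow, quadPoly_laguerre_eval hb, mul_pow]
  rw [integral_const_mul]
  congr 1
  have h1 := integral_mul_pow_laguerreMeasure (a₁ := a₁) (b₀ := b₀) (b₁ := b₁) (μ := μ) hC n
    fun _ => (1 : ℝ)
  have h2 := integral_exp_laguerreMeasure (b₀ := b₀) hC (by positivity : 0 < μ + n)
    (by linarith : 0 < -(a₁ / b₁))
  simp only [smul_eq_mul, mul_one] at h1
  simp only [zero_mul, Real.exp_zero, add_zero, sub_zero] at h2
  rw [h1, h2, Real.rpow_neg (by linarith), ← Real.inv_rpow (by linarith), inv_neg, inv_div,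
    div_mul_div_comm, sq]

theorem integral_cexp_mul_pow_laguerre (hC : 0 < C₀) (h : a₁ / b₁ < 0) (hμ : 0 < μ) (n : ℕ) {z : ℂ}
    (hz : z.im < -(a₁ / b₁)) :
    ∫ ω : ℝ, Complex.exp (-Complex.I * z * ω) * ((ω : ℂ) + b₀ / b₁) ^ n
      ∂(laguerreMeasure C₀ a₁ b₀ b₁ μ)
      = (Real.Gamma (μ + n) / Real.Gamma μ : ℝ) * ((Complex.I * z - a₁ / b₁) ^ n)⁻¹
        * laguerreS C₀ a₁ b₀ b₁ μ z := by
  have h1 := integral_mul_pow_laguerreMeasure (a₁ := a₁) (b₀ := b₀) (b₁ := b₁) (μ := μ) hC n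
    fun ω => Complex.exp (-Complex.I * z * ω)
  have h2 := charFn_laguerreMeasure (b₀ := b₀) hC (by positivity : 0 < μ + n) h hz
  have h3 := (Real.Gamma_pos_of_pos hμ).ne'
  have hr : (Complex.I * z - a₁ / b₁ : ℂ) ≠ 0 := fun h0 => by
    have := re_laguerre_pos hz
    rw [h0] at this
    simp at this
  rw [charFn, ← h1] at h2
  simp_rw [Complex.real_smul] at h2
  push_cast at h2
  simp_rw [mul_comm (Complex.exp _)]
  rw [h2, laguerreS, laguerreS]
  push_cast
  rw [neg_add, Complex.cpow_add _ _ hr, Complex.cpow_neg _ (n : ℂ), Complex.cpow_natCast]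
  have h4 : (Real.Gamma μ : ℂ) ≠ 0 := by exact_mod_cast h3
  field_simp

/-- The terms in the explicit formula for the Rodrigues polynomials of the Laguerre case. -/
noncomputable def laguerreTerm (a₁ b₀ b₁ μ : ℝ) (k j i : ℕ) : ℂ[X] :=
  C ((Real.Gamma (μ + k + j + i) / Real.Gamma (μ + k + j) * (b₁ ^ (j + i) * (a₁ / b₁) ^ j) : ℝ) : ℂ)
    * (X + C (b₀ / b₁ : ℂ)) ^ j

/-- With `x = ω + b₀/b₁` one has `s = b₁x` and `τ = b₁μ + a₁x`, so raising sends `x^j` to `b₁(μ + k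
+ j) x^j + a₁ x^{j+1}`. The Gamma quotients in the terms absorb these factors. -/
theorem rodrigues_laguerre (hb : b₁ ≠ 0) (hμ : μ = (a₀ * b₁ - b₀ * a₁) / b₁ ^ 2) (hμ0 : 0 < μ)
    (n k : ℕ) : rodrigues (quadPoly (b₀ : ℂ) b₁ ((0 : ℝ) : ℂ)) (linPoly (a₀ : ℂ) a₁) n k
      = ∑ ij ∈ Finset.HasAntidiagonal.antidiagonal n,
        (n.choose ij.1 : ℂ[X]) * laguerreTerm a₁ b₀ b₁ μ k ij.1 ij.2 := by
  have hbC : (b₁ : ℂ) ≠ 0 := by exact_mod_cast hb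
  have ha₀ : (a₀ : ℂ) = b₁ * μ + a₁ * (b₀ / b₁) := by
    rw [hμ]; push_cast; field_simp; ring
  refine rodrigues_eq_sum (fun k => ?_) (fun k j i => ?_) n k
  · have := (Real.Gamma_pos_of_pos (by positivity : 0 < μ + k)).ne'
    simp [laguerreTerm, this]
  · have e1 : b₁ * (μ + k + j) * (Real.Gamma (μ + (k + 1 : ℕ) + j + i)
        / Real.Gamma (μ + (k + 1 : ℕ) + j) * (b₁ ^ (j + i) * (a₁ / b₁) ^ j))
        = Real.Gamma (μ + k + j + (i + 1 : ℕ)) / Real.Gamma (μ + k + j)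
          * (b₁ ^ (j + (i + 1)) * (a₁ / b₁) ^ j) := by
      have := Gamma_mul_shift (by positivity : 0 < μ + k + j) (Real.Gamma (μ + k + j + (i + 1 : ℕ)))
      rw [← Gamma_mul_shift (by positivity : 0 < μ + k + j)]
      push_cast
      rw [show μ + (k + 1) + j + i = μ + k + j + (i + 1) by ring,
        show μ + (k + 1) + (j : ℝ) = μ + k + j + 1 by ring]
      ring
    have e2 : a₁ * (Real.Gamma (μ + (k + 1 : ℕ) + j + i)
        / Real.Gamma (μ + (k + 1 : ℕ) + j) * (b₁ ^ (j + i) * (a₁ / b₁) ^ j))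
        = Real.Gamma (μ + k + (j + 1 : ℕ) + i) / Real.Gamma (μ + k + (j + 1 : ℕ))
          * (b₁ ^ (j + 1 + i) * (a₁ / b₁) ^ (j + 1)) := by
      push_cast
      rw [show μ + (k + 1) + (j : ℝ) + i = μ + k + (j + 1) + i by ring,
        show μ + (k + 1) + (j : ℝ) = μ + k + (j + 1) by ring, pow_succ (a₁ / b₁)]
      field_simp
      ring
    have e1' := congrArg (fun x : ℝ => (C (x : ℂ) : ℂ[X])) e1
    have e2' := congrArg (fun x : ℝ => (C (x : ℂ) : ℂ[X])) e2
    simp only [Complex.ofReal_mul _ (_ / _ * _), C_mul (a := ((b₁ * _ : ℝ) : ℂ)),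
      C_mul (a := (a₁ : ℂ))] at e1' e2'
    rw [laguerreTerm, laguerreTerm, laguerreTerm, ← e1', ← e2']
    generalize (Real.Gamma (μ + (k + 1 : ℕ) + j + i)
        / Real.Gamma (μ + (k + 1 : ℕ) + j) * (b₁ ^ (j + i) * (a₁ / b₁) ^ j)) = G
    have hs : quadPoly (b₀ : ℂ) b₁ ((0 : ℝ) : ℂ) = C (b₁ : ℂ) * (X + C (b₀ / b₁ : ℂ)) := by
      rw [mul_add, ← C_mul, mul_div_cancel₀ _ hbC]
      simp [quadPoly]
      ring
    have hτ : linPoly (a₀ : ℂ) a₁ = C (b₁ * μ : ℂ) + C (a₁ : ℂ) * (X + C (b₀ / b₁ : ℂ)) := by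
      rw [linPoly, ha₀, C_add, C_mul (a := (a₁ : ℂ))]
      ring
    have hd : (X + C (b₀ / b₁ : ℂ)) * derivative ((X + C (b₀ / b₁ : ℂ)) ^ j)
        = (j : ℂ[X]) * (X + C (b₀ / b₁ : ℂ)) ^ j := by
      cases j with
      | zero => simp
      | succ j => rw [derivative_pow_succ]; simp; ring
    rw [raising, hs, hτ, derivative_C_mul, derivative_C_mul]
    have hx : derivative (X + C (b₀ / b₁ : ℂ)) = 1 := by simp
    generalize X + C (b₀ / b₁ : ℂ) = x at *
    rw [hx]
    push_cast
    simp only [C_mul, C_add, map_natCast]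
    linear_combination C (b₁ : ℂ) * C (G : ℂ) * hd

end Laguerre

/-! ### Laguerre case: matrix elements and weight -/

section Laguerre

open Polynomial

variable {C₀ a₀ a₁ b₀ b₁ μ : ℝ}

theorem rodrigues_laguerre_eval (hb : b₁ ≠ 0) (hμ : μ = (a₀ * b₁ - b₀ * a₁) / b₁ ^ 2)
    (hμ0 : 0 < μ) (n : ℕ) (x : ℂ) :
    (rodrigues (quadPoly (b₀ : ℂ) b₁ ((0 : ℝ) : ℂ)) (linPoly (a₀ : ℂ) a₁) n 0).eval x
      = ∑ l ∈ Finset.range (n + 1), ((n.choose l : ℂ) * (b₁ : ℂ) ^ n * ((a₁ : ℂ) / b₁) ^ l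
        * (Real.Gamma (μ + n) / Real.Gamma (μ + l) : ℝ)) * (x + b₀ / b₁) ^ l := by
  rw [rodrigues_laguerre hb hμ hμ0, Finset.Nat.sum_antidiagonal_eq_sum_range_succ
    (fun j i => (n.choose j : ℂ[X]) * laguerreTerm a₁ b₀ b₁ μ 0 j i), eval_finsetSum]
  refine Finset.sum_congr rfl fun l hl => ?_
  have hl' : l ≤ n := by have := Finset.mem_range.1 hl; omega
  rw [laguerreTerm]
  simp only [eval_mul, eval_natCast, eval_C, eval_pow, eval_add, eval_X]
  rw [Nat.add_sub_cancel' hl', Nat.cast_zero, add_zero, Nat.cast_sub hl', add_assoc,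
    add_sub_cancel]
  push_cast
  ring

/-- Isolates the rearrangement of factors in `laguerreSmn_eq`. Here `g` stands for `Γ(μ)`, and the
only cancellation is `g / g² = 1 / g`. -/
theorem laguerre_term_identity {g : ℂ} (hg : g ≠ 0)
    (x₁ x₂ x₃ x₄ x₅ x₆ x₇ x₈ x₉ y₁ y₂ y₃ y₄ y₅ y₆ y₇ : ℂ) :
    x₁ * x₂ * (x₃ * x₄ * x₅ * (x₆ / x₇) * (x₈ * x₉ * y₁ * (y₂ / y₃)) * (y₄ / g * (y₅ * y₆) * y₇))
      = x₁ * x₂ * (x₄ * x₉) * (x₆ * y₂ / g ^ 2) * y₇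
        * (x₃ * (x₅ * y₅) * (x₈ * (y₁ * y₆) * (y₄ * g / (x₇ * y₃)))) := by
  have h : g * (g ^ 2)⁻¹ = g⁻¹ := by field_simp
  linear_combination (-(x₁ * x₂ * x₃ * x₄ * x₅ * x₆ * x₇⁻¹ * x₈ * x₉ * y₁ * y₂ * y₃⁻¹ * y₄ * y₅ * y₆
    * y₇)) * h

/-- Expanding both polynomials in powers of `ω + b₀/b₁` gives a double sum of shifted characteristic
functions; for each `k` the sum over `l` is the terminating hypergeometric series. -/
theorem laguerreSmn_eq (hC : 0 < C₀) (h : a₁ / b₁ < 0)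
    (hμ : μ = (a₀ * b₁ - b₀ * a₁) / b₁ ^ 2) (hμ0 : 0 < μ) (m n : ℕ) {z : ℂ}
    (hz : z.im < -(a₁ / b₁)) :
    laguerreC C₀ a₁ b₀ b₁ μ m * laguerreC C₀ a₁ b₀ b₁ μ n * ∫ ω : ℝ, Complex.exp (-Complex.I * z * ω)
      * (rodrigues (quadPoly (b₀ : ℂ) b₁ ((0 : ℝ) : ℂ)) (linPoly (a₀ : ℂ) a₁) m 0
        * rodrigues (quadPoly (b₀ : ℂ) b₁ ((0 : ℝ) : ℂ)) (linPoly (a₀ : ℂ) a₁) n 0).eval (ω : ℂ)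
        ∂(laguerreMeasure C₀ a₁ b₀ b₁ μ)
      = laguerreSmn C₀ a₁ b₀ b₁ μ m n z := by
  have hb : b₁ ≠ 0 := by rintro h'; simp_all
  have hbC : (b₁ : ℂ) ≠ 0 := by exact_mod_cast hb
  obtain ⟨δ, hδ, hexp⟩ := laguerre_strip_integrable (b₀ := b₀) hC hμ0 hz
  have hi : ∀ p : ℕ, Integrable (fun ω : ℝ => Complex.exp (-Complex.I * z * ω)
      * ((ω : ℂ) + b₀ / b₁) ^ p) (laguerreMeasure C₀ a₁ b₀ b₁ μ) := fun p => by
    have := integrable_cexp_mul_eval (z := z) hδ hexp ((X + C (b₀ / b₁ : ℂ)) ^ p)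
    simp only [eval_pow, eval_add, eval_X, eval_C] at this
    exact this
  set A : ℕ → ℕ → ℂ := fun n l => (n.choose l : ℂ) * (b₁ : ℂ) ^ n * ((a₁ : ℂ) / b₁) ^ l
        * (Real.Gamma (μ + n) / Real.Gamma (μ + l) : ℝ) with hA
  have e : ∀ ω : ℝ, Complex.exp (-Complex.I * z * ω)
      * (rodrigues (quadPoly (b₀ : ℂ) b₁ ((0 : ℝ) : ℂ)) (linPoly (a₀ : ℂ) a₁) m 0
        * rodrigues (quadPoly (b₀ : ℂ) b₁ ((0 : ℝ) : ℂ)) (linPoly (a₀ : ℂ) a₁) n 0).eval (ω : ℂ)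
      = ∑ k ∈ Finset.range (m + 1), ∑ l ∈ Finset.range (n + 1), (A m k * A n l)
        * (Complex.exp (-Complex.I * z * ω) * ((ω : ℂ) + b₀ / b₁) ^ (k + l)) := fun ω => by
    rw [eval_mul, rodrigues_laguerre_eval hb hμ hμ0, rodrigues_laguerre_eval hb hμ hμ0,
      Finset.sum_mul_sum, Finset.mul_sum]
    refine Finset.sum_congr rfl fun k _ => ?_
    rw [Finset.mul_sum]
    refine Finset.sum_congr rfl fun l _ => ?_
    simp only [hA, pow_add]
    ring
  simp_rw [e]
  rw [integral_finsetSum _ fun k _ => integrable_finsetSum _ fun l _ => (hi _).const_mul _]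
  simp_rw [integral_finsetSum (Finset.range (n + 1)) fun l _ => (hi _).const_mul _,
    integral_const_mul, integral_cexp_mul_pow_laguerre hC h hμ0 _ hz]
  have hr : (Complex.I * z - a₁ / b₁ : ℂ) ≠ 0 := fun h0 => by
    have := re_laguerre_pos hz
    rw [h0] at this
    simp at this
  have hw : Complex.I * a₁ / (b₁ * z + Complex.I * a₁)
      = -(a₁ / b₁ * (Complex.I * z - a₁ / b₁ : ℂ)⁻¹) := by
    have : (b₁ * z + Complex.I * a₁ : ℂ) = -Complex.I * b₁ * (Complex.I * z - a₁ / b₁) := by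
      field_simp
      linear_combination (b₁ * z) * Complex.I_sq
    rw [this]
    have := Complex.I_ne_zero
    field_simp
  rw [laguerreSmn, add_comm (Complex.I * (a₁ : ℂ)) (b₁ * z), hw]
  simp_rw [ordinaryHypergeometric_neg_natCast hμ0]
  rw [Finset.mul_sum, Finset.mul_sum]
  refine Finset.sum_congr rfl fun k _ => ?_
  rw [Finset.mul_sum, Finset.mul_sum, Finset.mul_sum]
  refine Finset.sum_congr rfl fun l _ => ?_
  have g0 : (Real.Gamma μ : ℂ) ≠ 0 := by exact_mod_cast (Real.Gamma_pos_of_pos hμ0).ne'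
  simp only [hA]
  push_cast
  rw [neg_neg, mul_pow, mul_pow, inv_pow, inv_pow, pow_add (Complex.I * z - a₁ / b₁ : ℂ), mul_inv,
    ← add_assoc, pow_add (b₁ : ℂ)]
  exact laguerre_term_identity g0 _ _ _ _ _ _ _ _ _ _ _ _ _ _ _ _

theorem isSpectralSolution_laguerre (hC : 0 < C₀) (h : a₁ / b₁ < 0)
    (hμ : μ = (a₀ * b₁ - b₀ * a₁) / b₁ ^ 2) (hμ0 : 0 < μ) :
    IsSpectralSolution (laguerreH a₁ b₀ b₁ μ) (laguerreMeasure C₀ a₁ b₀ b₁ μ)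
      {z : ℂ | z.im < -(a₁ / b₁)}
      (laguerreS C₀ a₁ b₀ b₁ μ) (laguerreSn C₀ a₁ b₀ b₁ μ) (laguerreSmn C₀ a₁ b₀ b₁ μ) := by
  obtain ⟨ha, hb, h1, h2, h3⟩ := hermite_sign h
  have hG : ∀ n : ℕ, 0 < Real.Gamma (μ + n) := fun n => Real.Gamma_pos_of_pos (by positivity)
  refine isSpectralSolution_of_pearson (s₀ := b₀) (s₁ := b₁) (s₂ := 0) (t₀ := a₀) (t₁ := a₁)
    (c := laguerreC C₀ a₁ b₀ b₁ μ) (I := fun n => b₁ ^ n * (C₀ * Real.exp (-(a₁ * b₀ / b₁ ^ 2))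
        * ((-(b₁ / a₁)) ^ (μ + n) * Real.Gamma (μ + n))))
    (by simpa using h) (fun z hz => laguerre_strip_integrable hC hμ0 hz)
    (satisfiesPearson_laguerre hC h hμ hμ0) (by simpa using ha) (integral_laguerreMeasure hC h hμ0)
    (fun n => ?_) (fun n => ?_) (isJacobiOperator_ladder _ _ _) (fun n => by positivity)
    (fun n => ?_) (fun n => ?_) (fun z hz => charFn_laguerreMeasure hC hμ0 h hz) (fun n z hz => ?_)
    fun m n z hz => laguerreSmn_eq hC h hμ hμ0 m n hz
  · have := hG n
    rw [rodriguesLead_zero_left, laguerreC, mul_right_comm]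
    exact mul_pos (sign_mul_self_pow_pos ha n) (Real.rpow_pos_of_pos (by positivity) _)
  · have := hG n
    rw [rodriguesLead_zero_left, laguerreC]
    refine Eq.trans ?_ (sq_mul_rpow_neg_half (sign_sq ha) (x := C₀ * n.factorial
      * (-(a₁ * b₁)) ^ n * (-(b₁ / a₁)) ^ (μ + n) * Real.Gamma (μ + n)
      * Real.exp (-(a₁ * b₀ / b₁ ^ 2))) (by positivity) n)
    congr 1
    rw [neg_pow (a₁ * b₁), mul_pow]
    ring
  · rw [rodriguesLead_zero_left, rodriguesLead_zero_left, mul_pow, mul_pow,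
      Real.sq_sqrt (by positivity), Real.sq_sqrt (by positivity)]
    push_cast
    rw [← add_assoc, Real.Gamma_add_one (by positivity), Real.rpow_add_one h2.ne']
    field_simp
    ring
  · rw [hμ]
    simp only [mul_zero, add_zero]
    field_simp
    ring
  · have hbC : (b₁ : ℂ) ≠ 0 := by exact_mod_cast hb
    have hs : ∀ ω : ℝ, (quadPoly (b₀ : ℂ) b₁ ((0 : ℝ) : ℂ)).eval (ω : ℂ)
        = b₁ * ((ω : ℂ) + b₀ / b₁) := fun ω => by
      simp [quadPoly]
      field_simp
      ring
    have hr : (Complex.I * z - a₁ / b₁ : ℂ) ≠ 0 := fun h0 => by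
      have := re_laguerre_pos hz
      rw [h0] at this
      simp at this
    have hz' : z + Complex.I * (a₁ / b₁) = -Complex.I * (Complex.I * z - a₁ / b₁) := by
      linear_combination z * Complex.I_sq
    have hq : b₁ * z / (z + Complex.I * (a₁ / b₁))
        = Complex.I * z * b₁ * (Complex.I * z - a₁ / b₁)⁻¹ := by
      rw [hz', div_eq_iff (mul_ne_zero (neg_ne_zero.2 Complex.I_ne_zero) hr), mul_assoc,
        mul_comm (-Complex.I), ← mul_assoc _ _ (-Complex.I), inv_mul_cancel₀ hr]
      linear_combination (b₁ * z) * Complex.I_sq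
    simp_rw [eval_pow, hs, mul_pow, mul_left_comm _ ((b₁ : ℂ) ^ n)]
    rw [integral_const_mul, integral_cexp_mul_pow_laguerre hC h hμ0 _ hz, laguerreSn, hq, mul_pow,
      mul_pow, mul_pow, inv_pow]
    ring

/-- The substitution `y = -u/2 - a₁/(2b₁)` maps `(0, ∞)` onto `J` and leaves a Gamma integral of
order `μ - 1`, convergent because `μ > 1`. -/
theorem solvesWeightEq_laguerre (hC : 0 < C₀) (hμ : 1 < μ) :
    SolvesWeightEq (laguerreDensity C₀ a₁ b₀ b₁ μ) (Set.Ioi (-(b₀ / b₁)))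
      (Set.Iio (-(a₁ / (2 * b₁)))) (laguerreWeight C₀ a₁ b₀ b₁ μ) := by
  intro ω hω
  have hx : 0 < ω + b₀ / b₁ := by have := Set.mem_Ioi.1 hω; linarith
  have hG := Real.Gamma_pos_of_pos (by linarith : 0 < μ - 1)
  have e : ∀ u, laguerreWeight C₀ a₁ b₀ b₁ μ (-(1 / 2) * u + -(a₁ / (2 * b₁)))
      * Real.exp (2 * (-(1 / 2) * u + -(a₁ / (2 * b₁))) * ω)
      = 2 / (C₀ * Real.Gamma (μ - 1)) * Real.exp (-(a₁ / b₁ * ω))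
        * (u ^ (μ - 1 - 1) * Real.exp (-((ω + b₀ / b₁) * u))) := fun u => by
    have : Real.exp (b₀ * a₁ / b₁ ^ 2)
      * Real.exp (2 * b₀ / b₁ * (-(1 / 2) * u + -(a₁ / (2 * b₁))))
      * Real.exp (2 * (-(1 / 2) * u + -(a₁ / (2 * b₁))) * ω)
      = Real.exp (-(a₁ / b₁ * ω)) * Real.exp (-((ω + b₀ / b₁) * u)) := by
      rw [← Real.exp_add, ← Real.exp_add, ← Real.exp_add]
      congr 1
      rw [sq, mul_comm b₀, ← div_mul_div_comm, ← div_div]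
      ring
    rw [laguerreWeight, show -(2 * (-(1 / 2) * u + -(a₁ / (2 * b₁)))) - a₁ / b₁ = u by
      rw [mul_comm 2 b₁, ← div_div]; ring, show μ - 2 = μ - 1 - 1 by ring]
    linear_combination (2 / (C₀ * Real.Gamma (μ - 1)) * u ^ (μ - 1 - 1)) * this
  rw [← image_affine_Ioi_zero_of_neg (c := -(1 / 2)) (by norm_num),
    integrableOn_image_affine (by norm_num) measurableSet_Ioi,
    setIntegral_image_affine (by norm_num) measurableSet_Ioi]
  simp_rw [e]
  constructor
  · have := integrableOn_rpow_mul_exp_neg_mul_rpow (p := 1) (s := μ - 1 - 1) (b := ω + b₀ / b₁)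
      (by linarith) one_pos hx
    simp only [Real.rpow_one, neg_mul] at this
    exact Integrable.const_mul this _
  · rw [integral_smul, integral_const_mul, Real.integral_rpow_mul_exp_neg_mul_Ioi (by linarith) hx,
      one_div (ω + b₀ / b₁), Real.inv_rpow hx.le, laguerreDensity, Real.exp_neg, smul_eq_mul, abs_neg,
      abs_of_pos (by norm_num)]
    have := Real.exp_pos (a₁ / b₁ * ω)
    have := Real.rpow_pos_of_pos hx (μ - 1)
    field_simp

theorem laguerre_case (hC : 0 < C₀) (h : a₁ / b₁ < 0)
    (hμ : μ = (a₀ * b₁ - b₀ * a₁) / b₁ ^ 2) (hμ0 : 0 < μ) :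
    IsSpectralSolution (laguerreH a₁ b₀ b₁ μ) (laguerreMeasure C₀ a₁ b₀ b₁ μ)
        {z : ℂ | z.im < -(a₁ / b₁)}
        (laguerreS C₀ a₁ b₀ b₁ μ) (laguerreSn C₀ a₁ b₀ b₁ μ) (laguerreSmn C₀ a₁ b₀ b₁ μ) ∧
      coherentDomain (laguerreMeasure C₀ a₁ b₀ b₁ μ) = {z : ℂ | z.im < -(a₁ / (2 * b₁))} ∧
      (1 < μ →
        IsTheWeight (laguerreDensity C₀ a₁ b₀ b₁ μ) (Set.Ioi (-(b₀ / b₁)))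
          (Set.Iio (-(a₁ / (2 * b₁)))) (laguerreWeight C₀ a₁ b₀ b₁ μ) ∧
        IsReproducing (laguerreMeasure C₀ a₁ b₀ b₁ μ) {z : ℂ | z.im < -(a₁ / (2 * b₁))}
          (laguerreWeight C₀ a₁ b₀ b₁ μ)) := by
  refine ⟨isSpectralSolution_laguerre hC h hμ hμ0, coherentDomain_laguerre hC hμ0 h, fun h1 => ?_⟩
  have hw := solvesWeightEq_laguerre (a₁ := a₁) (b₀ := b₀) (b₁ := b₁) hC h1
  have h2 : -(a₁ / (2 * b₁)) = -(a₁ / b₁) / 2 := by rw [mul_comm 2 b₁, ← div_div]; ring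
  have hpos : ∀ y ∈ Set.Iio (-(a₁ / (2 * b₁))), 0 < -(2 * y) - a₁ / b₁ := fun y hy => by
    have := Set.mem_Iio.1 hy; linarith
  have hG := Real.Gamma_pos_of_pos (by linarith : 0 < μ - 1)
  refine ⟨isTheWeight_of_solves (c := -(b₀ / b₁) + 1) one_pos (fun x hx => ?_) isOpen_Iio
    (.of_continuousOn isOpen_Iio ?_) hw, ?_⟩
  · have := hx.1; simp only [Set.mem_Ioi]; linarith
  · unfold laguerreWeight
    refine ((continuousOn_const.mul (ContinuousOn.rpow_const (by fun_prop) fun y hy =>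
      Or.inl (hpos y hy).ne')).mul (by fun_prop))
  · exact isReproducing_of_solves measurable_laguerreDensity measurableSet_Ioi
      (fun ω hω => laguerreDensity_nonneg hC hω) measurableSet_Iio hw ⟨-(b₀ / b₁) + 1, by simp⟩
      (fun y hy => by have := hpos y hy; unfold laguerreWeight; positivity)
      (fun y hy => integrable_exp_laguerreMeasure hC hμ0 (by linarith [hpos y hy]))

end Laguerre

/-! ### The beta integral -/

section Beta

variable {μ ν : ℝ}

theorem beta_integrand_ofReal {x : ℝ} (hx : x ∈ Set.Ioo (0 : ℝ) 1) :
    (x : ℂ) ^ ((μ : ℂ) - 1) * (1 - x) ^ ((ν : ℂ) - 1)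
      = ((x ^ (μ - 1) * (1 - x) ^ (ν - 1) : ℝ) : ℂ) := by
  have h1 : (0 : ℝ) ≤ 1 - x := by linarith [hx.2]
  push_cast [Complex.ofReal_cpow hx.1.le, Complex.ofReal_cpow h1]
  rfl

theorem integrableOn_beta (hμ : 0 < μ) (hν : 0 < ν) :
    IntegrableOn (fun x : ℝ => x ^ (μ - 1) * (1 - x) ^ (ν - 1)) (Set.Ioo 0 1) := by
  have h := (Complex.betaIntegral_convergent (u := μ) (v := ν) (by simpa) (by simpa))
  rw [intervalIntegrable_iff_integrableOn_Ioo_of_le zero_le_one] at h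
  have h' := h.congr_fun (fun x hx => beta_integrand_ofReal hx) measurableSet_Ioo
  have h2 := Integrable.re h'
  simp only [RCLike.re_eq_complex_re, Complex.ofReal_re] at h2
  exact h2

theorem integral_beta (hμ : 0 < μ) (hν : 0 < ν) :
    ∫ x in Set.Ioo (0 : ℝ) 1, x ^ (μ - 1) * (1 - x) ^ (ν - 1)
      = Real.Gamma μ * Real.Gamma ν / Real.Gamma (μ + ν) := by
  have h := Complex.Gamma_mul_Gamma_eq_betaIntegral (s := μ) (t := ν) (by simpa) (by simpa)
  rw [Complex.betaIntegral, intervalIntegral.integral_of_le zero_le_one, integral_Ioc_eq_integral_Ioo,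
    setIntegral_congr_fun measurableSet_Ioo (fun x hx => beta_integrand_ofReal hx),
    integral_complex_ofReal, ← Complex.ofReal_add, Complex.Gamma_ofReal, Complex.Gamma_ofReal,
    Complex.Gamma_ofReal] at h
  rw [eq_div_iff (Real.Gamma_pos_of_pos (by positivity)).ne', mul_comm]
  exact_mod_cast h.symm

end Beta

/-! ### Jacobi case: moments and characteristic function -/

section Jacobi

variable {C₀ a b μ ν : ℝ}

theorem measurable_jacobiDensity : Measurable (jacobiDensity C₀ a b μ ν) := by
  unfold jacobiDensity; fun_prop

theorem jacobiDensity_nonneg (hC : 0 < C₀) {ω : ℝ} (hω : ω ∈ Set.Ioo a b) :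
    0 ≤ jacobiDensity C₀ a b μ ν ω := by
  have h1 : 0 < ω - a := by linarith [hω.1]
  have h2 : 0 < b - ω := by linarith [hω.2]
  unfold jacobiDensity; positivity

theorem Ioo_eq_image_affine (hab : a < b) :
    Set.Ioo a b = (fun u => (b - a) * u + a) '' Set.Ioo 0 1 := by
  rw [Set.image_affine_Ioo (by linarith)]
  congr 1 <;> ring

theorem jacobiDensity_affine (hab : a < b) {u : ℝ} (hu : u ∈ Set.Ioo (0 : ℝ) 1) :
    jacobiDensity C₀ a b μ ν ((b - a) * u + a)
      = C₀ * (b - a) ^ (μ + ν - 2) * (u ^ (μ - 1) * (1 - u) ^ (ν - 1)) := by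
  have h : 0 < b - a := by linarith
  rw [jacobiDensity, add_sub_cancel_right, show b - ((b - a) * u + a) = (b - a) * (1 - u) by ring,
    Real.mul_rpow h.le hu.1.le, Real.mul_rpow h.le (by linarith [hu.2]),
    show μ + ν - 2 = (μ - 1) + (ν - 1) by ring, Real.rpow_add h]
  ring

theorem integrableOn_jacobiDensity (hab : a < b) (hμ : 0 < μ) (hν : 0 < ν) :
    IntegrableOn (jacobiDensity C₀ a b μ ν) (Set.Ioo a b) := by
  rw [Ioo_eq_image_affine hab, integrableOn_image_affine (by linarith) measurableSet_Ioo]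
  exact IntegrableOn.congr_fun (Integrable.const_mul (integrableOn_beta hμ hν) _)
    (fun u hu => (jacobiDensity_affine hab hu).symm) measurableSet_Ioo

theorem integral_jacobiDensity (hab : a < b) (hμ : 0 < μ) (hν : 0 < ν) :
    ∫ ω in Set.Ioo a b, jacobiDensity C₀ a b μ ν ω
      = C₀ * (b - a) ^ (μ + ν - 1) * (Real.Gamma μ * Real.Gamma ν / Real.Gamma (μ + ν)) := by
  have h : 0 < b - a := by linarith
  rw [Ioo_eq_image_affine hab, setIntegral_image_affine h.ne' measurableSet_Ioo, integral_smul,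
    setIntegral_congr_fun measurableSet_Ioo (fun u hu => jacobiDensity_affine hab hu),
    integral_const_mul, integral_beta hμ hν, abs_of_pos h, show μ + ν - 1 = 1 + (μ + ν - 2) by ring,
    Real.rpow_add h, Real.rpow_one, smul_eq_mul]
  ring

theorem integral_jacobiMeasure_eq (hC : 0 < C₀) {E : Type*} [NormedAddCommGroup E]
    [NormedSpace ℝ E] (f : ℝ → E) : ∫ ω, f ω ∂(jacobiMeasure C₀ a b μ ν)
      = ∫ ω in Set.Ioo a b, jacobiDensity C₀ a b μ ν ω • f ω :=
  integral_weightMeasure measurable_jacobiDensity measurableSet_Ioo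
    (fun _ hω => jacobiDensity_nonneg hC hω) f

theorem isFiniteMeasure_jacobiMeasure (hC : 0 < C₀) (hab : a < b) (hμ : 0 < μ) (hν : 0 < ν) :
    IsFiniteMeasure (jacobiMeasure C₀ a b μ ν) := by
  rw [← integrable_const_iff_isFiniteMeasure (one_ne_zero (α := ℝ)), jacobiMeasure,
    integrable_weightMeasure_iff measurable_jacobiDensity measurableSet_Ioo
      fun ω hω => jacobiDensity_nonneg hC hω]
  simpa using integrableOn_jacobiDensity hab hμ hν

theorem ae_jacobiMeasure_mem : ∀ᵐ ω ∂(jacobiMeasure C₀ a b μ ν), ω ∈ Set.Ioo a b :=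
  ae_weightMeasure_mem measurableSet_Ioo

theorem integrable_jacobiMeasure (hC : 0 < C₀) (hab : a < b) (hμ : 0 < μ) (hν : 0 < ν)
    {E : Type*} [NormedAddCommGroup E] {f : ℝ → E} (hf : Continuous f) :
    Integrable f (jacobiMeasure C₀ a b μ ν) := by
  have := isFiniteMeasure_jacobiMeasure (C₀ := C₀) hC hab hμ hν
  obtain ⟨K, hK⟩ := (isCompact_Icc (a := a) (b := b)).exists_bound_of_continuousOn hf.continuousOn
  exact .of_bound hf.aestronglyMeasurable K (ae_jacobiMeasure_mem.mono fun ω hω => hK ω ⟨hω.1.le, hω.2.le⟩)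

theorem integral_mul_pow_jacobiMeasure (hC : 0 < C₀) {E : Type*} [NormedAddCommGroup E]
    [NormedSpace ℝ E] (i j : ℕ) (g : ℝ → E) :
    ∫ ω, ((ω - a) ^ i * (b - ω) ^ j) • g ω ∂(jacobiMeasure C₀ a b μ ν)
      = ∫ ω, g ω ∂(jacobiMeasure C₀ a b (μ + i) (ν + j)) := by
  rw [integral_jacobiMeasure_eq hC, integral_jacobiMeasure_eq hC]
  refine setIntegral_congr_fun measurableSet_Ioo fun ω hω => ?_
  have h1 : 0 < ω - a := by linarith [hω.1]
  have h2 : 0 < b - ω := by linarith [hω.2]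
  rw [smul_smul, jacobiDensity, jacobiDensity, show μ + i - 1 = μ - 1 + i by ring,
    show ν + j - 1 = ν - 1 + j by ring, Real.rpow_add h1, Real.rpow_natCast, Real.rpow_add h2,
    Real.rpow_natCast]
  congr 1
  ring

theorem integral_pow_jacobiMeasure (hC : 0 < C₀) (hab : a < b) (hμ : 0 < μ) (hν : 0 < ν) (i j : ℕ) :
    ∫ ω, (ω - a) ^ i * (b - ω) ^ j ∂(jacobiMeasure C₀ a b μ ν)
      = C₀ * (b - a) ^ (μ + i + (ν + j) - 1)
        * (Real.Gamma (μ + i) * Real.Gamma (ν + j) / Real.Gamma (μ + i + (ν + j))) := by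
  have h := integral_mul_pow_jacobiMeasure (a := a) (b := b) (μ := μ) (ν := ν) hC i j
    fun _ => (1 : ℝ)
  simp only [smul_eq_mul, mul_one] at h
  rw [h, integral_jacobiMeasure_eq hC]
  simp only [smul_eq_mul, mul_one]
  exact integral_jacobiDensity hab (by positivity) (by positivity)

theorem kummerF_eq_tsum (hμ : 0 < μ) (z : ℂ) : kummerF μ (μ + ν : ℝ) z
    = ∑' n : ℕ, z ^ n / n.factorial * (Real.Gamma (μ + ν) / Real.Gamma μ
      * (Real.Gamma (μ + n) / Real.Gamma (μ + n + ν)) : ℝ) := by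
  rw [kummerF, Complex.regularizedHGFun, Complex.regularizedHGFunSeries,
    ← FormalMultilinearSeries.ofScalarsSum, FormalMultilinearSeries.ofScalars_sum_eq, ← tsum_mul_left]
  refine tsum_congr fun n => ?_
  simp only [Complex.regularizedHGFunCoeff, Multiset.map_singleton, Multiset.prod_singleton]
  rw [eval_ascPochhammer_ofReal hμ, Complex.Gamma_ofReal, ← Complex.ofReal_natCast (n := n),
    ← Complex.ofReal_add, Complex.Gamma_ofReal, show μ + n + ν = μ + ν + n by ring, smul_eq_mul]
  push_cast
  ring

/-- The exponential is expanded about `a` and integrated termwise; the moments of `ω - a` are beta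
integrals and produce Kummer's series. Bounded support makes the norms summable. -/
theorem charFn_jacobiMeasure (hC : 0 < C₀) (hab : a < b) (hμ : 0 < μ) (hν : 0 < ν) (z : ℂ) :
    charFn (jacobiMeasure C₀ a b μ ν) z = jacobiS C₀ a b μ ν z := by
  have hba : 0 < b - a := by linarith
  set σ := jacobiMeasure C₀ a b μ ν with hσ
  set F : ℕ → ℝ → ℂ := fun n ω => (-Complex.I * z) ^ n / n.factorial * (((ω - a) ^ n : ℝ) : ℂ) with hF
  have hpow : ∀ n : ℕ, ∫ ω, (ω - a) ^ n ∂σ = C₀ * (b - a) ^ (μ + ν - 1) * (b - a) ^ n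
        * (Real.Gamma (μ + n) * Real.Gamma ν / Real.Gamma (μ + n + ν)) := fun n => by
    have h := integral_pow_jacobiMeasure hC hab hμ hν n 0
    simp only [pow_zero, mul_one, Nat.cast_zero, add_zero] at h
    rw [h, show μ + n + ν - 1 = μ + ν - 1 + n by ring, Real.rpow_add hba, Real.rpow_natCast]
    ring
  have hFi : ∀ n, Integrable (F n) σ := fun n =>
    integrable_jacobiMeasure hC hab hμ hν (by simp only [hF]; fun_prop)
  have hFn : ∀ n, ∫ ω, ‖F n ω‖ ∂σ ≤ (‖z‖ * (b - a)) ^ n / n.factorial * ∫ _, (1 : ℝ) ∂σ := by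
    intro n
    rw [← integral_const_mul]
    refine integral_mono_ae (hFi n).norm
      ((integrable_jacobiMeasure hC hab hμ hν continuous_const).const_mul _)
      (ae_jacobiMeasure_mem.mono fun ω hω => ?_)
    have h1 : 0 ≤ ω - a := by linarith [hω.1]
    simp only [hF, norm_mul, norm_div, norm_pow, norm_neg, Complex.norm_I, one_mul,
      Complex.norm_natCast, Complex.norm_real, Real.norm_of_nonneg h1, mul_one]
    rw [mul_pow, mul_div_right_comm]
    gcongr
    exact hω.2.le
  have hsum := hasSum_integral_of_summable_integral_norm hFi (Summable.of_nonneg_of_le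
    (fun n => integral_nonneg fun _ => norm_nonneg _) hFn
    ((Real.summable_pow_div_factorial _).mul_right _))
  have hts : ∀ ω : ℝ, ∑' n, F n ω = Complex.exp (-Complex.I * z * (ω - a)) := fun ω => by
    rw [Complex.exp_eq_exp_ℂ, NormedSpace.exp_eq_tsum_div]
    refine tsum_congr fun n => ?_
    simp only [hF]
    push_cast
    rw [mul_pow _ ((ω : ℂ) - a)]
    ring
  simp_rw [hts] at hsum
  have e : charFn σ z = Complex.exp (-Complex.I * a * z)
      * ∫ ω : ℝ, Complex.exp (-Complex.I * z * (ω - a)) ∂σ := by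
    rw [charFn, ← integral_const_mul]
    refine integral_congr_ae (ae_of_all _ fun ω => ?_)
    beta_reduce
    rw [← Complex.exp_add]
    congr 1
    ring
  rw [e, ← hsum.tsum_eq, jacobiS, ← Complex.ofReal_add, kummerF_eq_tsum hμ, ← tsum_mul_left,
    ← tsum_mul_left]
  refine tsum_congr fun n => ?_
  simp only [hF]
  rw [integral_const_mul, integral_complex_ofReal, hpow,
    show ((a : ℂ) - b) * Complex.I * z = -Complex.I * z * ((b - a : ℝ) : ℂ) by push_cast; ring,
    mul_pow (-Complex.I * z)]
  have h1 : (Real.Gamma μ : ℂ) ≠ 0 := by exact_mod_cast (Real.Gamma_pos_of_pos hμ).ne'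
  have h2 : (Real.Gamma (μ + ν) : ℂ) ≠ 0 := by
    exact_mod_cast (Real.Gamma_pos_of_pos (by positivity)).ne'
  push_cast
  field_simp

end Jacobi

/-! ### Jacobi case: Rodrigues polynomials and spectral solution -/

section Jacobi

open Polynomial

variable {C₀ a b b₂ μ ν : ℝ}

theorem quadPoly_jacobi_eval (ω : ℝ) :
    (quadPoly (-(b₂ * (a * b))) (b₂ * (a + b)) (-b₂)).eval ω = b₂ * ((ω - a) * (b - ω)) := by
  simp [quadPoly]
  ring

theorem quadPoly_jacobi : quadPoly ((-(b₂ * (a * b)) : ℝ) : ℂ) ((b₂ * (a + b) : ℝ) : ℂ)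
      ((-b₂ : ℝ) : ℂ) = C (b₂ : ℂ) * ((X - C (a : ℂ)) * (C (b : ℂ) - X)) := by
  simp only [quadPoly, Complex.ofReal_neg, Complex.ofReal_mul, Complex.ofReal_add, C_neg, C_mul,
    C_add]
  ring

theorem linPoly_jacobi : linPoly ((b₂ * (μ * b + ν * a) : ℝ) : ℂ) ((-(b₂ * (μ + ν)) : ℝ) : ℂ)
    = C (b₂ : ℂ) * (C (μ : ℂ) * (C (b : ℂ) - X) - C (ν : ℂ) * (X - C (a : ℂ))) := by
  simp only [linPoly, Complex.ofReal_neg, Complex.ofReal_mul, Complex.ofReal_add, C_neg, C_mul,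
    C_add]
  ring

/-- On the interval `s ρ` equals `b₂ C (ω-a)^μ (b-ω)^ν`, which is continuous and vanishes at both
endpoints since `μ, ν > 0`; so the total derivative integrates to zero. -/
theorem satisfiesPearson_jacobi (hC : 0 < C₀) (hab : a < b) (hμ : 0 < μ) (hν : 0 < ν) :
    SatisfiesPearson (jacobiMeasure C₀ a b μ ν) Set.univ
      (quadPoly ((-(b₂ * (a * b)) : ℝ) : ℂ) ((b₂ * (a + b) : ℝ) : ℂ) ((-b₂ : ℝ) : ℂ))
      (linPoly ((b₂ * (μ * b + ν * a) : ℝ) : ℂ) ((-(b₂ * (μ + ν)) : ℝ) : ℂ)) := by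
  intro z _ p
  rw [integral_jacobiMeasure_eq hC]
  simp_rw [Complex.real_smul]
  set u : ℝ → ℝ := fun ω => b₂ * (C₀ * ((ω - a) ^ μ * (b - ω) ^ ν)) with hu
  have hder : ∀ ω ∈ Set.Ioo a b, HasDerivAt (fun ω : ℝ =>
      Complex.exp (-Complex.I * z * ω) * p.eval (ω : ℂ) * u ω)
      (jacobiDensity C₀ a b μ ν ω * (Complex.exp (-Complex.I * z * ω)
        * (quadPoly ((-(b₂ * (a * b)) : ℝ) : ℂ) ((b₂ * (a + b) : ℝ) : ℂ) ((-b₂ : ℝ) : ℂ)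
          * twistedDeriv (-Complex.I * z) p
          + linPoly ((b₂ * (μ * b + ν * a) : ℝ) : ℂ) ((-(b₂ * (μ + ν)) : ℝ) : ℂ) * p).eval
            (ω : ℂ))) ω := fun ω hω => by
    have h1 : 0 < ω - a := by linarith [hω.1]
    have h2 : 0 < b - ω := by linarith [hω.2]
    have e1 : (ω - a) ^ μ = (ω - a) ^ (μ - 1) * (ω - a) := by
      rw [← Real.rpow_add_one h1.ne', sub_add_cancel]
    have e2 : (b - ω) ^ ν = (b - ω) ^ (ν - 1) * (b - ω) := by
      rw [← Real.rpow_add_one h2.ne', sub_add_cancel]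
    refine hasDerivAt_cexp_mul_eval_mul (v := ((b₂ * (μ * (b - ω) - ν * (ω - a))
      * jacobiDensity C₀ a b μ ν ω : ℝ) : ℂ)) ?_ ?_ ?_ (Complex.ofReal_im _) z p
    · rw [Complex.ofReal_re]
      have d1 : HasDerivAt (fun ω : ℝ => (ω - a) ^ μ) (μ * (ω - a) ^ (μ - 1)) ω := by
        have := ((hasDerivAt_id ω).sub_const a).rpow_const (p := μ) (Or.inl h1.ne')
        simpa using this
      have d2 : HasDerivAt (fun ω : ℝ => (b - ω) ^ ν) (-(ν * (b - ω) ^ (ν - 1))) ω := by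
        have := ((hasDerivAt_id ω).const_sub b).rpow_const (p := ν) (Or.inl h2.ne')
        simpa using this
      refine (((d1.mul d2).const_mul C₀).const_mul b₂).congr_deriv ?_
      rw [jacobiDensity, e1, e2]
      ring
    · rw [linPoly_jacobi]
      simp
    · rw [quadPoly_jacobi]
      simp only [hu, e1, e2, jacobiDensity, eval_mul, eval_sub, eval_X, eval_C]
      push_cast
      ring
  have hi : IntegrableOn (fun ω : ℝ => (jacobiDensity C₀ a b μ ν ω * (Complex.exp (-Complex.I * z * ω)
        * (quadPoly ((-(b₂ * (a * b)) : ℝ) : ℂ) ((b₂ * (a + b) : ℝ) : ℂ) ((-b₂ : ℝ) : ℂ)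
          * twistedDeriv (-Complex.I * z) p
          + linPoly ((b₂ * (μ * b + ν * a) : ℝ) : ℂ) ((-(b₂ * (μ + ν)) : ℝ) : ℂ) * p).eval
            (ω : ℂ)))) (Set.Ioo a b) := by
    have hc : Continuous fun ω : ℝ => Complex.exp (-Complex.I * z * ω)
        * (quadPoly ((-(b₂ * (a * b)) : ℝ) : ℂ) ((b₂ * (a + b) : ℝ) : ℂ) ((-b₂ : ℝ) : ℂ)
          * twistedDeriv (-Complex.I * z) p
          + linPoly ((b₂ * (μ * b + ν * a) : ℝ) : ℂ) ((-(b₂ * (μ + ν)) : ℝ) : ℂ) * p).eval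
            (ω : ℂ) :=
      Continuous.mul (by fun_prop) ((Polynomial.continuous _).comp Complex.continuous_ofReal)
    have := integrable_jacobiMeasure hC hab hμ hν hc
    rw [jacobiMeasure, integrable_weightMeasure_iff measurable_jacobiDensity measurableSet_Ioo
      fun ω hω => jacobiDensity_nonneg hC hω] at this
    simpa only [Complex.real_smul] using this
  rw [← integral_Ioc_eq_integral_Ioo, ← intervalIntegral.integral_of_le hab.le,
    intervalIntegral.integral_eq_sub_of_hasDerivAt_of_le hab.le ?_ hder
      ((intervalIntegrable_iff_integrableOn_Ioo_of_le hab.le).2 hi)]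
  · simp [hu, Real.zero_rpow hμ.ne', Real.zero_rpow hν.ne']
  · refine ((Continuous.mul (by fun_prop) (p.continuous.comp Complex.continuous_ofReal)).mul
      (Complex.continuous_ofReal.comp ?_)).continuousOn
    have c1 : Continuous fun ω : ℝ => (ω - a) ^ μ :=
      (by fun_prop : Continuous fun ω : ℝ => ω - a).rpow_const fun _ => Or.inr hμ.le
    have c2 : Continuous fun ω : ℝ => (b - ω) ^ ν :=
      (by fun_prop : Continuous fun ω : ℝ => b - ω).rpow_const fun _ => Or.inr hν.le
    fun_prop

/-- The terms in the explicit formula for the Rodrigues polynomials of the Jacobi case. -/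
noncomputable def jacobiTerm (a b b₂ μ ν : ℝ) (k j i : ℕ) : ℂ[X] :=
  C (((-1) ^ j * (Real.Gamma (μ + k + j + i) / Real.Gamma (μ + k + j))
    * (Real.Gamma (ν + k + i + j) / Real.Gamma (ν + k + i)) * b₂ ^ (j + i) : ℝ) : ℂ)
    * ((X - C (a : ℂ)) ^ j * (C (b : ℂ) - X) ^ i)

/-- With `x = ω - a` and `y = b - ω` one has `s = b₂xy`, `τ = b₂(μy - νx)`, and raising sends `x^j
y^i` to `b₂(μ+k+j) x^j y^{i+1} - b₂(ν+k+i) x^{j+1} y^i`. -/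
theorem rodrigues_jacobi (hμ : 0 < μ) (hν : 0 < ν) (n k : ℕ) :
    rodrigues (quadPoly ((-(b₂ * (a * b)) : ℝ) : ℂ) ((b₂ * (a + b) : ℝ) : ℂ) ((-b₂ : ℝ) : ℂ))
      (linPoly ((b₂ * (μ * b + ν * a) : ℝ) : ℂ) ((-(b₂ * (μ + ν)) : ℝ) : ℂ)) n k
      = ∑ ij ∈ Finset.HasAntidiagonal.antidiagonal n,
        (n.choose ij.1 : ℂ[X]) * jacobiTerm a b b₂ μ ν k ij.1 ij.2 := by
  refine rodrigues_eq_sum (fun k => ?_) (fun k j i => ?_) n k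
  · have h1 := (Real.Gamma_pos_of_pos (by positivity : 0 < μ + k)).ne'
    have h2 := (Real.Gamma_pos_of_pos (by positivity : 0 < ν + k)).ne'
    simp [jacobiTerm, h1, h2]
  · have e1 : b₂ * (μ + k + j) * ((-1) ^ j * (Real.Gamma (μ + (k + 1 : ℕ) + j + i)
        / Real.Gamma (μ + (k + 1 : ℕ) + j)) * (Real.Gamma (ν + (k + 1 : ℕ) + i + j)
        / Real.Gamma (ν + (k + 1 : ℕ) + i)) * b₂ ^ (j + i))
        = (-1) ^ j * (Real.Gamma (μ + k + j + (i + 1 : ℕ)) / Real.Gamma (μ + k + j))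
        * (Real.Gamma (ν + k + (i + 1 : ℕ) + j) / Real.Gamma (ν + k + (i + 1 : ℕ)))
        * b₂ ^ (j + (i + 1)) := by
      rw [← Gamma_mul_shift (by positivity : 0 < μ + k + j)]
      push_cast
      rw [show μ + (k + 1) + j + i = μ + k + j + (i + 1) by ring,
        show μ + (k + 1) + (j : ℝ) = μ + k + j + 1 by ring,
        show ν + (k + 1) + i + j = ν + k + (i + 1) + j by ring,
        show ν + (k + 1) + (i : ℝ) = ν + k + (i + 1) by ring]
      ring
    have e2 : -(b₂ * (ν + k + i)) * ((-1) ^ j * (Real.Gamma (μ + (k + 1 : ℕ) + j + i)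
        / Real.Gamma (μ + (k + 1 : ℕ) + j)) * (Real.Gamma (ν + (k + 1 : ℕ) + i + j)
        / Real.Gamma (ν + (k + 1 : ℕ) + i)) * b₂ ^ (j + i))
        = (-1) ^ (j + 1) * (Real.Gamma (μ + k + (j + 1 : ℕ) + i) / Real.Gamma (μ + k + (j + 1 : ℕ)))
        * (Real.Gamma (ν + k + i + (j + 1 : ℕ)) / Real.Gamma (ν + k + i))
        * b₂ ^ (j + 1 + i) := by
      rw [← Gamma_mul_shift (by positivity : 0 < ν + k + i)]
      push_cast
      rw [show μ + (k + 1) + (j : ℝ) + i = μ + k + (j + 1) + i by ring,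
        show μ + (k + 1) + (j : ℝ) = μ + k + (j + 1) by ring,
        show ν + (k + 1) + (i : ℝ) + j = ν + k + i + (j + 1) by ring,
        show ν + (k + 1) + (i : ℝ) = ν + k + i + 1 by ring]
      ring
    have e1' := congrArg (fun x : ℝ => (C (x : ℂ) : ℂ[X])) e1
    have e2' := congrArg (fun x : ℝ => (C (x : ℂ) : ℂ[X])) e2
    simp only [Complex.ofReal_mul _ (_ * _ * _ * _), C_mul (a := ((b₂ * _ : ℝ) : ℂ)),
      C_mul (a := ((-(b₂ * _) : ℝ) : ℂ))] at e1' e2'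
    rw [jacobiTerm, jacobiTerm, jacobiTerm, ← e1', ← e2']
    generalize ((-1) ^ j * (Real.Gamma (μ + (k + 1 : ℕ) + j + i)
        / Real.Gamma (μ + (k + 1 : ℕ) + j)) * (Real.Gamma (ν + (k + 1 : ℕ) + i + j)
        / Real.Gamma (ν + (k + 1 : ℕ) + i)) * b₂ ^ (j + i)) = G
    have hx : derivative (X - C (a : ℂ)) = 1 := by simp
    have hy : derivative (C (b : ℂ) - X) = -1 := by simp
    rw [quadPoly_jacobi, linPoly_jacobi]
    generalize X - C (a : ℂ) = x at *
    generalize C (b : ℂ) - X = y at *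
    have hdx : x * derivative (x ^ j) = (j : ℂ[X]) * x ^ j := by
      cases j with
      | zero => simp
      | succ j => rw [derivative_pow_succ, hx]; simp; ring
    have hdy : y * derivative (y ^ i) = -((i : ℂ[X]) * y ^ i) := by
      cases i with
      | zero => simp
      | succ i => rw [derivative_pow_succ, hy]; simp; ring
    rw [raising, derivative_C_mul, derivative_C_mul, derivative_mul, derivative_mul, hx, hy]
    push_cast
    simp only [C_mul, C_add, C_neg, map_natCast, pow_succ]
    linear_combination C (b₂ : ℂ) * C (G : ℂ) * (y * y ^ i) * hdx
      + C (b₂ : ℂ) * C (G : ℂ) * (x * x ^ j) * hdy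

theorem rodrigues_jacobi_eval (hμ : 0 < μ) (hν : 0 < ν) (n : ℕ) (x : ℂ) :
    (rodrigues (quadPoly ((-(b₂ * (a * b)) : ℝ) : ℂ) ((b₂ * (a + b) : ℝ) : ℂ) ((-b₂ : ℝ) : ℂ))
      (linPoly ((b₂ * (μ * b + ν * a) : ℝ) : ℂ) ((-(b₂ * (μ + ν)) : ℝ) : ℂ)) n 0).eval x
      = ∑ l ∈ Finset.range (n + 1), ((-b₂ : ℂ) ^ n * (n.choose l : ℂ) * (-1) ^ l
        * (Real.Gamma (μ + n) / Real.Gamma (μ + n - l) : ℝ)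
        * (Real.Gamma (ν + n) / Real.Gamma (ν + l) : ℝ)) * ((x - a) ^ (n - l) * (b - x) ^ l) := by
  rw [rodrigues_jacobi hμ hν, ← Finset.Nat.sum_antidiagonal_swap,
    Finset.Nat.sum_antidiagonal_eq_sum_range_succ_mk, eval_finsetSum]
  refine Finset.sum_congr rfl fun l hl => ?_
  have hl' : l ≤ n := by have := Finset.mem_range.1 hl; omega
  simp only [Prod.swap_prod_mk, jacobiTerm, eval_mul, eval_natCast, eval_C, eval_pow, eval_sub,
    eval_X]
  have hs : (-b₂ : ℂ) ^ n * (-1) ^ l = (-1) ^ (n - l) * (b₂ : ℂ) ^ n := by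
    rw [neg_pow, mul_right_comm, ← pow_add]
    congr 1
    rw [show n + l = n - l + 2 * l by omega, pow_add, pow_mul]
    simp
  rw [Nat.choose_symm hl', Nat.sub_add_cancel hl', Nat.cast_zero, add_zero, add_zero,
    Nat.cast_sub hl', show μ + (n - l : ℝ) + l = μ + n by ring,
    show ν + l + (n - l : ℝ) = ν + n by ring, ← add_sub_assoc]
  push_cast
  linear_combination (-((n.choose l : ℂ) * (Real.Gamma (μ + n) / Real.Gamma (μ + n - l))
    * (Real.Gamma (ν + n) / Real.Gamma (ν + l)) * ((x - a) ^ (n - l) * (b - x) ^ l))) * hs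

/-- Each product of powers of `ω - a` and `b - ω` only shifts `μ` and `ν`, so every term of the
double expansion is a characteristic function of the same family. -/
theorem jacobiSmn_eq (hC : 0 < C₀) (hab : a < b) (hμ : 0 < μ) (hν : 0 < ν) (m n : ℕ) (z : ℂ) :
    jacobiC C₀ a b b₂ μ ν m * jacobiC C₀ a b b₂ μ ν n * ∫ ω : ℝ, Complex.exp (-Complex.I * z * ω)
      * (rodrigues (quadPoly ((-(b₂ * (a * b)) : ℝ) : ℂ) ((b₂ * (a + b) : ℝ) : ℂ) ((-b₂ : ℝ) : ℂ))
        (linPoly ((b₂ * (μ * b + ν * a) : ℝ) : ℂ) ((-(b₂ * (μ + ν)) : ℝ) : ℂ)) m 0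
        * rodrigues (quadPoly ((-(b₂ * (a * b)) : ℝ) : ℂ) ((b₂ * (a + b) : ℝ) : ℂ) ((-b₂ : ℝ) : ℂ))
        (linPoly ((b₂ * (μ * b + ν * a) : ℝ) : ℂ) ((-(b₂ * (μ + ν)) : ℝ) : ℂ)) n 0).eval (ω : ℂ)
        ∂(jacobiMeasure C₀ a b μ ν)
      = jacobiSmn C₀ a b b₂ μ ν m n z := by
  have hi : ∀ i j : ℕ, Integrable (fun ω : ℝ => Complex.exp (-Complex.I * z * ω)
      * (((ω : ℂ) - a) ^ i * ((b : ℂ) - ω) ^ j)) (jacobiMeasure C₀ a b μ ν) := fun i j =>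
    integrable_jacobiMeasure hC hab hμ hν (by fun_prop)
  have hm : ∀ i j : ℕ, ∫ ω : ℝ, Complex.exp (-Complex.I * z * ω)
      * (((ω : ℂ) - a) ^ i * ((b : ℂ) - ω) ^ j) ∂(jacobiMeasure C₀ a b μ ν)
      = jacobiS C₀ a b (μ + i) (ν + j) z := fun i j => by
    rw [← charFn_jacobiMeasure hC hab (by positivity) (by positivity), charFn,
      ← integral_mul_pow_jacobiMeasure hC]
    refine integral_congr_ae (ae_of_all _ fun ω => ?_)
    beta_reduce
    rw [Complex.real_smul]
    push_cast
    ring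
  set A : ℕ → ℕ → ℂ := fun n l => (-b₂ : ℂ) ^ n * (n.choose l : ℂ) * (-1) ^ l
        * (Real.Gamma (μ + n) / Real.Gamma (μ + n - l) : ℝ)
        * (Real.Gamma (ν + n) / Real.Gamma (ν + l) : ℝ) with hA
  have e : ∀ ω : ℝ, Complex.exp (-Complex.I * z * ω)
      * (rodrigues (quadPoly ((-(b₂ * (a * b)) : ℝ) : ℂ) ((b₂ * (a + b) : ℝ) : ℂ) ((-b₂ : ℝ) : ℂ))
        (linPoly ((b₂ * (μ * b + ν * a) : ℝ) : ℂ) ((-(b₂ * (μ + ν)) : ℝ) : ℂ)) m 0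
        * rodrigues (quadPoly ((-(b₂ * (a * b)) : ℝ) : ℂ) ((b₂ * (a + b) : ℝ) : ℂ) ((-b₂ : ℝ) : ℂ))
        (linPoly ((b₂ * (μ * b + ν * a) : ℝ) : ℂ) ((-(b₂ * (μ + ν)) : ℝ) : ℂ)) n 0).eval (ω : ℂ)
      = ∑ k ∈ Finset.range (m + 1), ∑ l ∈ Finset.range (n + 1), (A m k * A n l)
        * (Complex.exp (-Complex.I * z * ω)
          * (((ω : ℂ) - a) ^ (m - k + (n - l)) * ((b : ℂ) - ω) ^ (k + l))) := fun ω => by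
    rw [eval_mul, rodrigues_jacobi_eval hμ hν, rodrigues_jacobi_eval hμ hν,
      Finset.sum_mul_sum, Finset.mul_sum]
    refine Finset.sum_congr rfl fun k _ => ?_
    rw [Finset.mul_sum]
    refine Finset.sum_congr rfl fun l _ => ?_
    simp only [hA, pow_add]
    ring
  simp_rw [e]
  rw [integral_finsetSum _ fun k _ => integrable_finsetSum _ fun l _ => (hi _ _).const_mul _]
  simp_rw [integral_finsetSum (Finset.range (n + 1)) fun l _ => (hi _ _).const_mul _,
    integral_const_mul, hm]
  rw [jacobiSmn, Finset.mul_sum, Finset.mul_sum]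
  refine Finset.sum_congr rfl fun k hk => ?_
  rw [Finset.mul_sum, Finset.mul_sum]
  refine Finset.sum_congr rfl fun l hl => ?_
  have hk' : k ≤ m := by have := Finset.mem_range.1 hk; omega
  have hl' : l ≤ n := by have := Finset.mem_range.1 hl; omega
  have e1 : μ + ((m - k + (n - l) : ℕ) : ℝ) = μ + m + n - k - l := by
    push_cast [Nat.cast_sub hk', Nat.cast_sub hl']; ring
  have e2 : ν + ((k + l : ℕ) : ℝ) = ν + k + l := by push_cast; ring
  rw [e1, e2]
  simp only [hA]
  push_cast
  rw [pow_add (-b₂ : ℂ), pow_add (-1 : ℂ)]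
  simp only [div_eq_mul_inv, mul_inv]
  ring

/-- The leading coefficients are products of consecutive shifts, so most factors telescope. The
factor `μ + ν + n - 1` stays on the left because it may be zero for `n = 0`. -/
theorem rodriguesLead_jacobi_succ (n : ℕ) :
    rodriguesLead (-b₂) (-(b₂ * (μ + ν))) (n + 1) 0 * (μ + ν + n - 1)
      = -b₂ * (μ + ν + 2 * n - 1) * (μ + ν + 2 * n)
        * rodriguesLead (-b₂) (-(b₂ * (μ + ν))) n 0 := by
  have h : ∀ n : ℕ, rodriguesLead (-b₂) (-(b₂ * (μ + ν))) n 0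
      = (-b₂) ^ n * ∏ j ∈ Finset.range n, (μ + ν + n + j - 1) := fun n => by
    rw [rodriguesLead_eq_prod, ← Finset.card_range n, ← Finset.prod_const, Finset.card_range,
      ← Finset.prod_mul_distrib]
    exact Finset.prod_congr rfl fun j _ => by push_cast; ring
  rw [h, h]
  have h2 : (∏ j ∈ Finset.range (n + 1), (μ + ν + (n + 1 : ℕ) + j - 1)) * (μ + ν + n - 1)
      = ∏ j ∈ Finset.range (n + 2), (μ + ν + n + j - 1) := by
    rw [Finset.prod_range_succ' _ (n + 1)]
    congr 1
    · exact Finset.prod_congr rfl fun j _ => by push_cast; ring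
    · push_cast; ring
  conv_rhs at h2 => rw [Finset.prod_range_succ, Finset.prod_range_succ]
  generalize ∏ j ∈ Finset.range (n + 1), (μ + ν + (n + 1 : ℕ) + j - 1) = P at h2 ⊢
  push_cast at h2 ⊢
  linear_combination (-b₂) ^ (n + 1) * h2

/-- Stated for degree `n + 1` so that all Gamma arguments are positive; in degree zero `Γ(μ + ν -
1)` would occur. -/
theorem rodriguesLead_jacobi (hμ : 0 < μ) (hν : 0 < ν) (n : ℕ) :
    rodriguesLead (-b₂) (-(b₂ * (μ + ν))) (n + 1) 0
      = (-b₂) ^ (n + 1) * (Real.Gamma (μ + ν + 2 * n + 1) / Real.Gamma (μ + ν + n)) := by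
  induction n with
  | zero =>
    have h1 := (Real.Gamma_pos_of_pos (by positivity : 0 < μ + ν)).ne'
    simp only [rodriguesLead, Nat.cast_zero, mul_zero, add_zero, zero_add, zero_mul]
    rw [Real.Gamma_add_one (by positivity)]
    field_simp
  | succ n ih =>
    have h := rodriguesLead_jacobi_succ (b₂ := b₂) (μ := μ) (ν := ν) (n + 1)
    rw [ih] at h
    push_cast at h ⊢
    have hp : 0 < μ + ν + n := by positivity
    refine mul_right_cancel₀ (b := μ + ν + (n + 1) - 1) (by linarith) ?_
    rw [h, show μ + ν + 2 * (n + 1 : ℝ) + 1 = μ + ν + 2 * n + 1 + 1 + 1 by ring,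
      Real.Gamma_add_one (s := μ + ν + 2 * n + 1 + 1) (by positivity),
      Real.Gamma_add_one (s := μ + ν + 2 * n + 1) (by positivity),
      show μ + ν + (n + 1 : ℝ) = μ + ν + n + 1 by ring, Real.Gamma_add_one hp.ne']
    have := (Real.Gamma_pos_of_pos hp).ne'
    field_simp
    ring

theorem jacobiOff_nonneg (n : ℕ) : 0 ≤ jacobiOff μ ν n := by
  unfold jacobiOff; split_ifs <;> positivity

theorem isSpectralSolution_jacobi (hC : 0 < C₀) (hab : a < b) (hb₂ : 0 < b₂) (hμ : 0 < μ)
    (hν : 0 < ν) :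
    IsSpectralSolution (jacobiH a b μ ν) (jacobiMeasure C₀ a b μ ν) Set.univ
      (jacobiS C₀ a b μ ν) (jacobiSn C₀ a b b₂ μ ν) (jacobiSmn C₀ a b b₂ μ ν) := by
  have hba : 0 < b - a := by linarith
  have gm : ∀ n : ℕ, 0 < Real.Gamma (μ + n) := fun n => Real.Gamma_pos_of_pos (by positivity)
  have gn : ∀ n : ℕ, 0 < Real.Gamma (ν + n) := fun n => Real.Gamma_pos_of_pos (by positivity)
  have gs : ∀ x : ℝ, 0 ≤ x → 0 < Real.Gamma (μ + ν + x) := fun x hx =>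
    Real.Gamma_pos_of_pos (by positivity)
  have hlead : ∀ n, 0 < (-1) ^ n * rodriguesLead (-b₂) (-(b₂ * (μ + ν))) n 0 := by
    rintro (_ | n)
    · simp [rodriguesLead]
    · have h1 := gs n (by positivity)
      have h2 := gs (2 * n + 1) (by positivity)
      rw [rodriguesLead_jacobi hμ hν, ← mul_assoc, ← mul_pow, add_assoc _ (2 * (n : ℝ))]
      simp only [neg_mul_neg, one_mul]
      positivity
  set I : ℕ → ℝ := fun n => b₂ ^ n * (C₀ * (b - a) ^ (μ + n + (ν + n) - 1)
        * (Real.Gamma (μ + n) * Real.Gamma (ν + n) / Real.Gamma (μ + n + (ν + n)))) with hI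
  set K : ℕ → ℝ := fun n => if n = 0 then
      C₀ * (b - a) ^ (μ + ν - 1) * (Real.Gamma μ * Real.Gamma ν / Real.Gamma (μ + ν))
    else
      C₀ * n.factorial * b₂ ^ (2 * n) * (b - a) ^ (μ + ν + 2 * n - 1)
        * (Real.Gamma (μ + n) * Real.Gamma (ν + n)
          / ((μ + ν + 2 * n - 1) * Real.Gamma (μ + ν + n - 1))) with hK
  have hKc : ∀ n, jacobiC C₀ a b b₂ μ ν n = (-1) ^ n * K n ^ (-(1 / 2) : ℝ) := fun n => rfl
  -- `K n` is the squared norm of the `n`-th Rodrigues polynomial, so the normalizing constant is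
  -- its inverse square root up to sign. Degree zero is separate because its formula uses `Γ(μ +
  -- ν)`.
  have hKI : ∀ n, (-1) ^ n * n.factorial * rodriguesLead (-b₂) (-(b₂ * (μ + ν))) n 0 * I n
      = K n := by
    rintro (_ | n)
    · simp [rodriguesLead, hI, hK]
    · have h1 := gs n (by positivity)
      simp only [hI, hK]
      rw [rodriguesLead_jacobi hμ hν, if_neg (by omega)]
      push_cast
      rw [show μ + (n + 1 : ℝ) + (ν + (n + 1)) = μ + ν + 2 * n + 1 + 1 by ring,
        Real.Gamma_add_one (s := μ + ν + 2 * n + 1) (by positivity),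
        show μ + ν + 2 * (n + 1 : ℝ) - 1 = μ + ν + 2 * n + 1 by ring,
        show μ + ν + (n + 1 : ℝ) - 1 = μ + ν + n by ring, add_sub_cancel_right, neg_pow b₂]
      have h2 := gs (2 * n + 1) (by positivity)
      rw [← add_assoc] at h2
      have hsq : ((-1 : ℝ) ^ (n + 1)) * (-1) ^ (n + 1) = 1 := by rw [← mul_pow]; simp
      field_simp
      rw [sq, hsq]
      ring
  have hIpos : ∀ n, 0 < I n := fun n => by
    have h1 := gm n
    have h2 := gn n
    have h3 := gs (2 * n) (by positivity)
    rw [show μ + ν + 2 * (n : ℝ) = μ + n + (ν + n) by ring] at h3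
    simp only [hI]
    positivity
  have hKpos : ∀ n, 0 < K n := fun n => by
    rw [← hKI, mul_right_comm _ (n.factorial : ℝ)]
    have := hlead n
    have := hIpos n
    positivity
  -- The recursion of `Γ` for consecutive integrals of `s^n`; with the ratio of leading coefficients
  -- it yields the square of the off-diagonal entry.
  have hIs : ∀ n : ℕ, (μ + ν + 2 * n) * (μ + ν + 2 * n + 1) * I (n + 1)
      = b₂ * (b - a) ^ 2 * (μ + n) * (ν + n) * I n := fun n => by
    simp only [hI]
    push_cast
    have h3 := gs (2 * n) (by positivity)
    rw [show μ + (n + 1 : ℝ) + (ν + (n + 1)) = μ + ν + 2 * n + 1 + 1 by ring,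
      Real.Gamma_add_one (by positivity), Real.Gamma_add_one (by positivity),
      show μ + (n : ℝ) + (ν + n) = μ + ν + 2 * n by ring, ← add_assoc μ, ← add_assoc ν,
      Real.Gamma_add_one (by positivity), Real.Gamma_add_one (by positivity),
      show μ + ν + 2 * (n : ℝ) + 1 + 1 - 1 = μ + ν + 2 * n - 1 + (2 : ℕ) by push_cast; ring,
      Real.rpow_add hba, Real.rpow_natCast]
    field_simp
    ring
  refine isSpectralSolution_of_pearson (s₀ := -(b₂ * (a * b))) (s₁ := b₂ * (a + b)) (s₂ := -b₂)
    (t₀ := b₂ * (μ * b + ν * a)) (t₁ := -(b₂ * (μ + ν))) (c := jacobiC C₀ a b b₂ μ ν) (I := I)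
    trivial (fun z _ => ⟨1, one_pos, fun t _ => integrable_jacobiMeasure hC hab hμ hν (by fun_prop)⟩)
    (satisfiesPearson_jacobi hC hab hμ hν) (fun j => ?_) (fun n => ?_)
    (fun n => ?_) (fun n => ?_) (isJacobiOperator_ladder _ _ _)
    (fun n => ?_)
    (fun n => ?_) (fun n => ?_) (fun z _ => charFn_jacobiMeasure hC hab hμ hν z) (fun n z _ => ?_)
    fun m n z _ => jacobiSmn_eq hC hab hμ hν m n z
  · have : 0 < b₂ * (μ + ν + j) := by positivity
    intro h
    linarith
  · simp_rw [eval_pow, quadPoly_jacobi_eval, mul_pow]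
    rw [integral_const_mul, integral_pow_jacobiMeasure hC hab hμ hν]
  · rw [hKc, mul_right_comm]
    exact mul_pos (hlead n) (Real.rpow_pos_of_pos (hKpos n) _)
  · rw [hKI, hKc]
    exact sq_mul_rpow_neg_half (by norm_num) (hKpos n) n
  · exact mul_nonneg hba.le (mul_nonneg (jacobiOff_nonneg n) (Real.sqrt_nonneg _))
  · rw [mul_pow, mul_pow, Real.sq_sqrt (by positivity)]
    have h1 := hIs n
    have h2 := rodriguesLead_jacobi_succ (b₂ := b₂) (μ := μ) (ν := ν) n
    rcases n with _ | n
    · rw [jacobiOff, if_pos rfl, Real.sq_sqrt (by positivity)]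
      simp only [rodriguesLead, Nat.cast_zero, mul_zero, add_zero, zero_add, zero_mul, mul_one,
        one_mul] at h1 h2 ⊢
      field_simp
      linear_combination h1
    · rw [jacobiOff, if_neg (by omega)]
      push_cast at h1 h2 ⊢
      have p1 : 0 < μ + ν + (n + 1 : ℝ) - 1 := by
        have : 0 ≤ (n : ℝ) := by positivity
        linarith
      have p2 : 0 < μ + ν + 2 * (n + 1 : ℝ) - 1 := by
        have : 0 ≤ (n : ℝ) := by positivity
        linarith
      rw [Real.sq_sqrt (by positivity)]
      generalize rodriguesLead (-b₂) (-(b₂ * (μ + ν))) (n + 1 + 1) 0 = L2 at *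
      generalize rodriguesLead (-b₂) (-(b₂ * (μ + ν))) (n + 1) 0 = L1 at *
      generalize I (n + 1 + 1) = I2 at *
      generalize I (n + 1) = I1 at *
      clear hK hI hKc hKI hlead gs gm gn hIs hIpos hKpos
      have p3 : μ + ν + 2 * (n + 1 : ℝ) ≠ 0 := by positivity
      have p4 : μ + ν + 2 * (n + 1 : ℝ) + 1 ≠ 0 := by positivity
      generalize μ + ν + 2 * (n + 1 : ℝ) = s at *
      have p2' := p2.ne'
      field_simp
      linear_combination ((b - a) ^ 2 * (μ + (n + 1)) * (ν + (n + 1)) * I1) * h2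
        + (s - 1) * s * L1 * h1
  · rcases n with _ | n
    · rw [jacobiDiag, if_pos rfl]
      simp only [Nat.cast_zero, mul_zero, zero_mul, zero_div, zero_add, add_zero, zero_sub]
      field_simp
    · rw [jacobiDiag, if_neg (by omega)]
      push_cast
      have e1 : -(b₂ * (μ + ν)) + (2 * (n + 1 : ℝ) - 2) * -b₂ = -(b₂ * (μ + ν + 2 * n)) := by ring
      have e2 : -(b₂ * (μ + ν)) + 2 * (n + 1 : ℝ) * -b₂ = -(b₂ * (μ + ν + 2 * (n + 1))) := by ring
      have e3 : μ + ν - 2 + 2 * (n + 1 : ℝ) = μ + ν + 2 * n := by ring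
      rw [e1, e2, e3]
      have p1 : 0 < μ + ν + 2 * (n : ℝ) := by positivity
      have p2 : 0 < μ + ν + 2 * (n + 1 : ℝ) := by positivity
      field_simp
      ring
  · have hs : ∀ ω : ℝ, (quadPoly ((-(b₂ * (a * b)) : ℝ) : ℂ) ((b₂ * (a + b) : ℝ) : ℂ)
        ((-b₂ : ℝ) : ℂ)).eval (ω : ℂ) = b₂ * (((ω - a) * (b - ω) : ℝ) : ℂ) := fun ω => by
      rw [quadPoly_jacobi]
      simp
    rw [jacobiSn, ← charFn_jacobiMeasure hC hab (by positivity) (by positivity), charFn,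
      ← integral_mul_pow_jacobiMeasure hC, mul_assoc, mul_assoc, mul_right_comm Complex.I,
      mul_pow _ (b₂ : ℂ), mul_assoc, ← integral_const_mul ((b₂ : ℂ) ^ n)]
    congr 2
    refine integral_congr_ae (ae_of_all _ fun ω => ?_)
    beta_reduce
    rw [eval_pow, hs, Complex.real_smul]
    push_cast
    rw [mul_pow, mul_pow]
    ring

end Jacobi

/-! ### Tricomi's integral: recurrences and limits -/

section Tricomi

variable {A B D x : ℝ}

/-- Tricomi's integral `Γ(A) U(A, A + B + 1, x)`. -/
noncomputable def tricomiInt (A B x : ℝ) : ℝ :=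
  ∫ t in Set.Ioi (0 : ℝ), t ^ (A - 1) * (1 + t) ^ B * Real.exp (-x * t)

theorem one_add_rpow_le {t : ℝ} (ht : 0 < t) (B : ℝ) :
    (1 + t) ^ B ≤ 2 ^ |B| * (1 + t ^ |B|) := by
  have h1 : (1 + t) ^ B ≤ (1 + t) ^ |B| :=
    Real.rpow_le_rpow_of_exponent_le (by linarith) (le_abs_self B)
  have h0 : (0 : ℝ) ≤ t ^ |B| := by positivity
  have h2 : (0 : ℝ) ≤ 2 ^ |B| := by positivity
  refine h1.trans ?_
  rcases le_total t 1 with h | h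
  · have : (1 + t) ^ |B| ≤ 2 ^ |B| :=
      Real.rpow_le_rpow (by linarith) (by linarith) (abs_nonneg _)
    nlinarith
  · have : (1 + t) ^ |B| ≤ (2 * t) ^ |B| :=
      Real.rpow_le_rpow (by linarith) (by linarith) (abs_nonneg _)
    rw [Real.mul_rpow (by norm_num) ht.le] at this
    nlinarith

theorem integrableOn_rpow_mul_exp (hA : 0 < A) (hx : 0 < x) :
    IntegrableOn (fun t : ℝ => t ^ (A - 1) * Real.exp (-x * t)) (Set.Ioi 0) := by
  simpa using integrableOn_rpow_mul_exp_neg_mul_rpow (s := A - 1) (by linarith) one_pos hx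

theorem integrableOn_tricomi (hA : 0 < A) (B : ℝ) (hx : 0 < x) :
    IntegrableOn (fun t : ℝ => t ^ (A - 1) * (1 + t) ^ B * Real.exp (-x * t)) (Set.Ioi 0) := by
  have h1 := integrableOn_rpow_mul_exp hA hx
  have h2 := integrableOn_rpow_mul_exp (add_pos_of_pos_of_nonneg hA (abs_nonneg B)) hx
  refine ((h1.add h2).const_mul (2 ^ |B|)).mono' (by fun_prop) ?_
  filter_upwards [ae_restrict_mem measurableSet_Ioi] with t ht
  have ht : 0 < t := ht
  have ht1 : 0 < 1 + t := by linarith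
  rw [Real.norm_of_nonneg (by positivity)]
  simp only [Pi.add_apply]
  rw [show A + |B| - 1 = A - 1 + |B| by ring, Real.rpow_add ht]
  calc t ^ (A - 1) * (1 + t) ^ B * Real.exp (-x * t)
      ≤ t ^ (A - 1) * (2 ^ |B| * (1 + t ^ |B|)) * Real.exp (-x * t) := by
        gcongr
        exact one_add_rpow_le ht B
    _ = _ := by ring

theorem tricomiInt_nonneg : 0 ≤ tricomiInt A B x :=
  setIntegral_nonneg measurableSet_Ioi fun t ht => by
    have ht : 0 < t := ht
    positivity

theorem hasDerivAt_tricomiInt (hA : 0 < A) (B : ℝ) (hx : 0 < x) :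
    HasDerivAt (tricomiInt A B) (-tricomiInt (A + 1) B x) x := by
  have h := (hasDerivAt_integral_of_dominated_loc_of_deriv_le (𝕜 := ℝ)
    (μ := volume.restrict (Set.Ioi (0 : ℝ)))
    (F := fun x t => t ^ (A - 1) * (1 + t) ^ B * Real.exp (-x * t))
    (F' := fun x t => -(t ^ (A + 1 - 1) * (1 + t) ^ B * Real.exp (-x * t)))
    (bound := fun t => t ^ (A + 1 - 1) * (1 + t) ^ B * Real.exp (-(x / 2) * t))
    (Ioi_mem_nhds (half_lt_self hx)) (Eventually.of_forall fun x => by fun_prop)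
    (integrableOn_tricomi hA B hx) (by fun_prop) ?_
    (integrableOn_tricomi (by linarith) B (half_pos hx)) ?_).2
  · rw [integral_neg] at h
    exact h
  · filter_upwards [ae_restrict_mem measurableSet_Ioi] with t ht y hy
    have ht : 0 < t := ht
    have hy : x / 2 < y := hy
    have ht1 : 0 < 1 + t := by linarith
    rw [norm_neg, Real.norm_of_nonneg (by positivity)]
    gcongr
  · filter_upwards [ae_restrict_mem measurableSet_Ioi] with t ht y hy
    have ht : 0 < t := ht
    have h := (((hasDerivAt_neg y).mul_const t).exp).const_mul (t ^ (A - 1) * (1 + t) ^ B)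
    refine h.congr_deriv ?_
    rw [add_sub_cancel_right, show t ^ A = t ^ (A - 1) * t by
      rw [← Real.rpow_add_one ht.ne', sub_add_cancel]]
    ring

/-- The derivative of `t^A (1+t)^B e^{-xt}` integrates to zero, both boundary values being zero. -/
theorem tricomiInt_parts (hA : 0 < A) (B : ℝ) (hx : 0 < x) :
    A * tricomiInt A B x + B * tricomiInt (A + 1) (B - 1) x = x * tricomiInt (A + 1) B x := by
  have i1 := (integrableOn_tricomi hA B hx).const_mul A
  have i2 := (integrableOn_tricomi (by linarith : 0 < A + 1) (B - 1) hx).const_mul B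
  have i3 := (integrableOn_tricomi (by linarith : 0 < A + 1) B hx).const_mul x
  have hd : ∀ t ∈ Set.Ioi (0 : ℝ), HasDerivAt
      (fun t : ℝ => t ^ (A + 1 - 1) * (1 + t) ^ B * Real.exp (-x * t))
      (A * (t ^ (A - 1) * (1 + t) ^ B * Real.exp (-x * t))
        + B * (t ^ (A + 1 - 1) * (1 + t) ^ (B - 1) * Real.exp (-x * t))
        - x * (t ^ (A + 1 - 1) * (1 + t) ^ B * Real.exp (-x * t))) t := fun t ht => by
    have ht : 0 < t := ht
    have h1 := Real.hasDerivAt_rpow_const (x := t) (p := A + 1 - 1) (Or.inl ht.ne')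
    have h2 := ((hasDerivAt_id t).const_add 1).rpow_const (p := B)
      (Or.inl (by simp only [id]; positivity))
    have h3 := ((hasDerivAt_id t).const_mul (-x)).exp
    refine ((h1.mul h2).mul h3).congr_deriv ?_
    simp only [id, Pi.mul_apply, add_sub_cancel_right]
    ring
  have hint := (i1.add i2).sub i3
  have h0 := tendsto_zero_of_hasDerivAt_of_integrableOn_Ioi hd hint
    (integrableOn_tricomi (by linarith : 0 < A + 1) B hx)
  have hc : ContinuousWithinAt (fun t : ℝ => t ^ (A + 1 - 1) * (1 + t) ^ B * Real.exp (-x * t))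
      (Set.Ici 0) 0 := by
    refine ContinuousAt.continuousWithinAt ?_
    refine (ContinuousAt.mul (Real.continuousAt_rpow_const _ _ (Or.inr (by linarith)))
      (ContinuousAt.rpow_const (by fun_prop) (Or.inl (by norm_num)))).mul (by fun_prop)
  have h := integral_Ioi_of_hasDerivAt_of_tendsto hc hd hint h0
  rw [integral_sub (by exact i1.add i2) i3, integral_add i1 i2, integral_const_mul,
    integral_const_mul, integral_const_mul, add_sub_cancel_right, Real.zero_rpow hA.ne'] at h
  simp only [tricomiInt, add_sub_cancel_right] at h ⊢
  linarith

theorem tricomiInt_succ_sub_one (hA : 0 < A) (B : ℝ) (hx : 0 < x) :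
    tricomiInt (A + 1) (B - 1) x = tricomiInt A B x - tricomiInt A (B - 1) x := by
  rw [tricomiInt, tricomiInt, tricomiInt, ← integral_sub (integrableOn_tricomi hA _ hx)
    (integrableOn_tricomi hA _ hx)]
  refine setIntegral_congr_fun measurableSet_Ioi fun t ht => ?_
  have ht : 0 < t := ht
  have h1 : t ^ (A + 1 - 1) = t ^ (A - 1) * t := by
    rw [← Real.rpow_add_one ht.ne']; congr 1; ring
  have h2 : (1 + t) ^ B = (1 + t) ^ (B - 1) * (1 + t) := by
    rw [← Real.rpow_add_one (by positivity), sub_add_cancel]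
  simp only [h1, h2]
  ring

theorem rpow_mul_tricomiInt (hx : 0 < x) :
    x ^ A * tricomiInt A B x
      = ∫ u in Set.Ioi (0 : ℝ), u ^ (A - 1) * (1 + x⁻¹ * u) ^ B * Real.exp (-u) := by
  have h := integral_comp_mul_left_Ioi
    (fun u : ℝ => u ^ (A - 1) * (1 + x⁻¹ * u) ^ B * Real.exp (-u)) 0 hx
  rw [mul_zero, smul_eq_mul, eq_inv_mul_iff_mul_eq₀ hx.ne'] at h
  rw [← h, tricomiInt, ← integral_const_mul, ← integral_const_mul]
  refine setIntegral_congr_fun measurableSet_Ioi fun t ht => ?_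
  have ht : 0 < t := ht
  rw [Real.mul_rpow hx.le ht.le, Real.rpow_sub_one hx.ne', inv_mul_cancel_left₀ hx.ne', neg_mul]
  field_simp

/-- Substituting `u = xt` leaves the integrand of `Γ(A)` with the extra factor `(1 + u/x)^B`, which
tends to `1` and is at most `(1+u)^{|B|}` for `x ≥ 1`. -/
theorem tendsto_rpow_mul_tricomiInt (hA : 0 < A) (B : ℝ) :
    Tendsto (fun x => x ^ A * tricomiInt A B x) atTop (𝓝 (Real.Gamma A)) := by
  have h : Tendsto (fun x : ℝ => ∫ u in Set.Ioi (0 : ℝ),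
      u ^ (A - 1) * (1 + x⁻¹ * u) ^ B * Real.exp (-u)) atTop
      (𝓝 (∫ u in Set.Ioi (0 : ℝ), Real.exp (-u) * u ^ (A - 1))) := by
    refine tendsto_integral_filter_of_dominated_convergence
      (fun u => u ^ (A - 1) * (1 + u) ^ |B| * Real.exp (-1 * u))
      (Eventually.of_forall fun x => by fun_prop) ?_ (integrableOn_tricomi hA |B| one_pos) ?_
    · filter_upwards [eventually_ge_atTop 1] with x hx
      filter_upwards [ae_restrict_mem measurableSet_Ioi] with u hu
      have hu : 0 < u := hu
      have hx0 : 0 < x := by linarith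
      rw [Real.norm_of_nonneg (by positivity), neg_one_mul]
      have h1 : x⁻¹ * u ≤ u := mul_le_of_le_one_left hu.le (inv_le_one_of_one_le₀ hx)
      have h2 : 0 < x⁻¹ * u := by positivity
      have h3 : (1 + x⁻¹ * u) ^ B ≤ (1 + u) ^ |B| :=
        (Real.rpow_le_rpow_of_exponent_le (by linarith) (le_abs_self B)).trans
          (Real.rpow_le_rpow (by linarith) (by linarith) (abs_nonneg _))
      gcongr
    · filter_upwards [ae_restrict_mem measurableSet_Ioi] with u hu
      have h1 : Tendsto (fun x : ℝ => 1 + x⁻¹ * u) atTop (𝓝 1) := by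
        simpa using (tendsto_inv_atTop_zero.mul_const u).const_add 1
      have h2 := ((h1.rpow_const (p := B) (Or.inl one_ne_zero)).const_mul
        (u ^ (A - 1))).mul_const (Real.exp (-u))
      rw [Real.one_rpow, mul_one, mul_comm] at h2
      exact h2
  rw [← Real.Gamma_eq_integral hA] at h
  refine h.congr' ?_
  filter_upwards [eventually_gt_atTop 0] with x hx
  exact (rpow_mul_tricomiInt hx).symm

theorem add_rpow_le_add {x u : ℝ} (hx : 0 < x) (hx1 : x ≤ 1) (hu : 0 < u) (B : ℝ) :
    (x + u) ^ B ≤ u ^ B + (1 + u) ^ B := by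
  have h0 : 0 ≤ u ^ B := by positivity
  have h1 : 0 ≤ (1 + u) ^ B := by positivity
  rcases le_total 0 B with h | h
  · have := Real.rpow_le_rpow (by positivity) (by linarith : x + u ≤ 1 + u) h
    linarith
  · have := Real.rpow_le_rpow_of_nonpos hu (by linarith : u ≤ x + u) h
    linarith

theorem rpow_add_mul_tricomiInt (hx : 0 < x) :
    x ^ (A + B) * tricomiInt A B x
      = ∫ u in Set.Ioi (0 : ℝ), u ^ (A - 1) * (x + u) ^ B * Real.exp (-u) := by
  rw [add_comm, Real.rpow_add hx, mul_assoc, rpow_mul_tricomiInt hx, ← integral_const_mul]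
  refine setIntegral_congr_fun measurableSet_Ioi fun t ht => ?_
  have ht : 0 < t := ht
  rw [show x + t = x * (1 + x⁻¹ * t) by field_simp, Real.mul_rpow hx.le (by positivity)]
  ring

/-- The same substitution, with a power of `x` absorbed into `(x + u)^B`. It supplies the one-sided
limits of the Jacobi weight at `y = 0`. -/
theorem tendsto_rpow_add_mul_tricomiInt (hA : 0 < A) (hAB : 0 < A + B) :
    Tendsto (fun x => x ^ (A + B) * tricomiInt A B x) (𝓝[>] 0) (𝓝 (Real.Gamma (A + B))) := by
  have h : Tendsto (fun x : ℝ => ∫ u in Set.Ioi (0 : ℝ),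
      u ^ (A - 1) * (x + u) ^ B * Real.exp (-u)) (𝓝[>] 0)
      (𝓝 (∫ u in Set.Ioi (0 : ℝ), Real.exp (-u) * u ^ (A + B - 1))) := by
    refine tendsto_integral_filter_of_dominated_convergence
      (fun u => u ^ (A + B - 1) * Real.exp (-1 * u) + u ^ (A - 1) * (1 + u) ^ B * Real.exp (-1 * u))
      (Eventually.of_forall fun x => by fun_prop) ?_
      ((integrableOn_rpow_mul_exp hAB one_pos).add (integrableOn_tricomi hA B one_pos)) ?_
    · filter_upwards [Ioc_mem_nhdsGT one_pos] with x hx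
      filter_upwards [ae_restrict_mem measurableSet_Ioi] with u hu
      have hu : 0 < u := hu
      have hx0 : 0 < x := hx.1
      rw [Real.norm_of_nonneg (by positivity), neg_one_mul, ← add_mul,
        show A + B - 1 = A - 1 + B by ring, Real.rpow_add hu, ← mul_add]
      gcongr
      exact add_rpow_le_add hx0 hx.2 hu B
    · filter_upwards [ae_restrict_mem measurableSet_Ioi] with u hu
      have hu : 0 < u := hu
      have h1 : Tendsto (fun x : ℝ => x + u) (𝓝[>] 0) (𝓝 u) := by
        have : Tendsto (fun x : ℝ => x + u) (𝓝 0) (𝓝 (0 + u)) := tendsto_id.add_const u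
        rw [zero_add] at this
        exact this.mono_left nhdsWithin_le_nhds
      have h2 := ((h1.rpow_const (p := B) (Or.inl hu.ne')).const_mul
        (u ^ (A - 1))).mul_const (Real.exp (-u))
      rw [← Real.rpow_add hu, mul_comm, show A - 1 + B = A + B - 1 by ring] at h2
      exact h2
  rw [← Real.Gamma_eq_integral hAB] at h
  refine h.congr' ?_
  filter_upwards [self_mem_nhdsWithin] with x hx
  exact (rpow_add_mul_tricomiInt hx).symm

end Tricomi

/-! ### Whittaker's function: uniqueness and Tricomi's representation -/

section Whittaker

theorem hasDerivAt_wronskian {q w₁ w₁' w₂ w₂' : ℝ → ℝ} {x : ℝ}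
    (h1 : HasDerivAt w₁ (w₁' x) x) (h1' : HasDerivAt w₁' (q x * w₁ x) x)
    (h2 : HasDerivAt w₂ (w₂' x) x) (h2' : HasDerivAt w₂' (q x * w₂ x) x) :
    HasDerivAt (fun x => w₁ x * w₂' x - w₁' x * w₂ x) 0 x :=
  ((h1.mul h2').sub (h1'.mul h2)).congr_deriv (by ring)

/-- Solutions of `w'' = q w` on `(0, ∞)` that agree near infinity agree everywhere. -/
theorem eq_of_eventuallyEq_of_second_order {q w₁ w₁' w₂ w₂' : ℝ → ℝ}
    (hq : ContinuousOn q (Set.Ioi 0))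
    (h1 : ∀ x > 0, HasDerivAt w₁ (w₁' x) x ∧ HasDerivAt w₁' (q x * w₁ x) x)
    (h2 : ∀ x > 0, HasDerivAt w₂ (w₂' x) x ∧ HasDerivAt w₂' (q x * w₂ x) x)
    (h : w₁ =ᶠ[atTop] w₂) {x : ℝ} (hx : 0 < x) : w₁ x = w₂ x := by
  obtain ⟨X, hX⟩ := eventually_atTop.1 h
  set t₀ : ℝ := max X x + 1 with ht₀
  have hXt : X < t₀ := by have := le_max_left X x; linarith
  have hxt : x < t₀ := by have := le_max_right X x; linarith
  have hw : w₁ t₀ = w₂ t₀ := hX _ hXt.le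
  have hw' : w₁' t₀ = w₂' t₀ := by
    have he : w₁ =ᶠ[𝓝 t₀] w₂ := by
      filter_upwards [Ioi_mem_nhds hXt] with t ht using hX t (le_of_lt ht)
    exact ((h1 t₀ (by linarith)).1).unique (((h2 t₀ (by linarith)).1).congr_of_eventuallyEq he)
  obtain ⟨Q, hQ⟩ := isCompact_Icc.exists_bound_of_continuousOn
    (hq.mono (show Set.Icc (x / 2) (t₀ + 1) ⊆ Set.Ioi 0 from
      fun t ht => lt_of_lt_of_le (half_pos hx) ht.1))
  have hQ0 : 0 ≤ max 1 Q := le_max_of_le_left zero_le_one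
  have hpos : ∀ t ∈ Set.Ioo (x / 2) (t₀ + 1), 0 < t := fun t ht => (half_pos hx).trans ht.1
  -- The equation as a first-order system for `(w, w')`, started at `t₀` where values and
  -- derivatives agree. On the compact interval `q` is bounded by `Q`, so `max 1 Q` is a Lipschitz
  -- constant for the maximum norm.
  have key := ODE_solution_unique_of_mem_Ioo (E := ℝ × ℝ) (a := x / 2) (b := t₀ + 1) (t₀ := t₀)
    (v := fun t p => (p.2, q t * p.1)) (s := fun _ => Set.univ) (K := (max 1 Q).toNNReal)
    (f := fun t => (w₁ t, w₁' t)) (g := fun t => (w₂ t, w₂' t))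
    (fun t ht => LipschitzWith.lipschitzOnWith (LipschitzWith.of_dist_le_mul fun p r => ?_))
    ⟨by linarith, by linarith⟩
    (fun t ht => ⟨(h1 t (hpos t ht)).1.prodMk (h1 t (hpos t ht)).2, trivial⟩)
    (fun t ht => ⟨(h2 t (hpos t ht)).1.prodMk (h2 t (hpos t ht)).2, trivial⟩)
    (by simp only [hw, hw'])
  · exact congrArg Prod.fst (key (show x ∈ Set.Ioo (x / 2) (t₀ + 1) from
      ⟨by linarith, by linarith⟩))
  · have hqt := hQ t ⟨ht.1.le, ht.2.le⟩
    rw [Real.norm_eq_abs] at hqt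
    rw [Prod.dist_eq, Prod.dist_eq, Real.coe_toNNReal _ hQ0]
    refine max_le ?_ ?_
    · calc dist p.2 r.2 ≤ 1 * max (dist p.1 r.1) (dist p.2 r.2) := by
            rw [one_mul]; exact le_max_right _ _
        _ ≤ _ := by gcongr; exact le_max_left _ _
    · rw [Real.dist_eq, ← mul_sub, abs_mul, ← Real.dist_eq]
      gcongr
      · exact hqt.trans (le_max_right _ _)
      · exact le_max_left _ _

theorem tendsto_exp_neg_half_mul_rpow (κ : ℝ) :
    Tendsto (fun x : ℝ => Real.exp (-x / 2) * x ^ κ) atTop (𝓝 0) := by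
  have h := tendsto_rpow_mul_exp_neg_mul_atTop_nhds_zero κ (1 / 2) (by norm_num)
  refine h.congr fun x => ?_
  rw [mul_comm]
  congr 2
  ring

namespace PolyHam.IsWhittakerW

variable {κ m : ℝ} {w w₁ w₂ : ℝ → ℝ}

theorem eventually_pos (h : IsWhittakerW κ m w) : ∀ᶠ x in atTop, 0 < w x := by
  filter_upwards [h.2.eventually (lt_mem_nhds one_pos), eventually_gt_atTop 0] with x hx hx0
  exact (div_pos_iff_of_pos_right (by positivity)).1 hx

theorem tendsto_zero (h : IsWhittakerW κ m w) : Tendsto w atTop (𝓝 0) := by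
  have := h.2.mul (tendsto_exp_neg_half_mul_rpow κ)
  rw [mul_zero] at this
  refine this.congr' ?_
  filter_upwards [eventually_gt_atTop 0] with x hx0
  field_simp

theorem tendsto_div (h₁ : IsWhittakerW κ m w₁) (h₂ : IsWhittakerW κ m w₂) :
    Tendsto (fun x => w₂ x / w₁ x) atTop (𝓝 1) := by
  have := h₂.2.div h₁.2 one_ne_zero
  rw [div_one] at this
  refine this.congr' ?_
  filter_upwards [eventually_gt_atTop 0] with x hx0
  simp only [Pi.div_apply]
  field_simp

/-- Whittaker's function is unique on `(0, ∞)`. -/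
theorem eq_of_pos (h₁ : IsWhittakerW κ m w₁) (h₂ : IsWhittakerW κ m w₂) {x : ℝ} (hx : 0 < x) :
    w₁ x = w₂ x := by
  obtain ⟨w₁', d₁⟩ := h₁.1
  obtain ⟨w₂', d₂⟩ := h₂.1
  set q : ℝ → ℝ := fun x => 1 / 4 - κ / x + (m ^ 2 - 1 / 4) / x ^ 2 with hq
  have hqc : ContinuousOn q (Set.Ioi 0) := fun t ht => by
    have ht : t ≠ 0 := (ne_of_gt ht)
    have : t ^ 2 ≠ 0 := by positivity
    exact ContinuousAt.continuousWithinAt (by fun_prop (disch := assumption))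
  refine eq_of_eventuallyEq_of_second_order hqc d₁ d₂ ?_ hx
  -- The Wronskian is a constant `c`, and where `w₁ > 0` the quotient `w₂ / w₁` has derivative `c /
  -- w₁²`.
  obtain ⟨c, hc⟩ := isOpen_Ioi.exists_is_const_of_deriv_eq_zero
    (𝕜 := ℝ) (s := Set.Ioi (0 : ℝ)) isPreconnected_Ioi
    (f := fun x => w₁ x * w₂' x - w₁' x * w₂ x)
    (fun t ht => (hasDerivAt_wronskian (q := q) (d₁ t ht).1 (d₁ t ht).2 (d₂ t ht).1
      (d₂ t ht).2).differentiableAt.differentiableWithinAt)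
    (fun t ht => (hasDerivAt_wronskian (q := q) (d₁ t ht).1 (d₁ t ht).2 (d₂ t ht).1 (d₂ t ht).2).deriv)
  obtain ⟨X, hX⟩ := eventually_atTop.1 ((h₁.eventually_pos.and
    (h₁.tendsto_zero.eventually (gt_mem_nhds one_pos))).and (eventually_gt_atTop 0))
  have hr : ∀ t ≥ X, HasDerivAt (fun x => w₂ x / w₁ x) (c / w₁ t ^ 2) t := fun t ht => by
    obtain ⟨⟨p, -⟩, t0⟩ := hX t ht
    refine ((d₂ t t0).1.div (d₁ t t0).1 p.ne').congr_deriv ?_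
    rw [← hc t t0]
    ring
  have hlim := h₁.tendsto_div h₂
  -- Eventually `0 < w₁ < 1`, so for `c ≠ 0` the quotient would change by at least `|c|` over every
  -- unit interval far out, although it converges to `1`.
  have hc0 : c = 0 := by
    by_contra hne
    have hd : Tendsto (fun x => w₂ (x + 1) / w₁ (x + 1) - w₂ x / w₁ x) atTop (𝓝 0) := by
      have := (hlim.comp (tendsto_atTop_add_const_right _ 1 tendsto_id)).sub hlim
      rwa [sub_self] at this
    obtain ⟨t, ht, htX⟩ := ((hd.abs.eventually
      (gt_mem_nhds (by rw [abs_zero]; exact abs_pos.2 hne))).and (eventually_ge_atTop X)).exists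
    obtain ⟨s, hs, hs'⟩ := exists_hasDerivAt_eq_slope (fun x => w₂ x / w₁ x)
      (fun t => c / w₁ t ^ 2) (lt_add_one t)
      (fun s hs => (hr s (htX.trans hs.1)).continuousAt.continuousWithinAt)
      (fun s hs => hr s (htX.trans hs.1.le))
    obtain ⟨⟨p, p1⟩, -⟩ := hX s (htX.trans hs.1.le)
    rw [add_sub_cancel_left, div_one] at hs'
    rw [← hs', abs_div, abs_of_pos (by positivity : 0 < w₁ s ^ 2), div_lt_iff₀ (by positivity)] at ht
    have : w₁ s ^ 2 ≤ 1 := pow_le_one₀ p.le p1.le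
    nlinarith [abs_nonneg c]
  have hconst : ∀ t > X, w₂ t / w₁ t = 1 := fun t ht => by
    obtain ⟨e, he⟩ := isOpen_Ioi.exists_is_const_of_deriv_eq_zero
      (𝕜 := ℝ) (s := Set.Ioi X) isPreconnected_Ioi (f := fun x => w₂ x / w₁ x)
      (fun s hs => (hr s (le_of_lt hs)).differentiableAt.differentiableWithinAt)
      (fun s hs => by rw [(hr s (le_of_lt hs)).deriv, hc0, zero_div]; rfl)
    have : Tendsto (fun x => w₂ x / w₁ x) atTop (𝓝 e) := by
      refine tendsto_const_nhds.congr' ?_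
      filter_upwards [eventually_gt_atTop X] with s hs using (he s hs).symm
    rw [he t ht, tendsto_nhds_unique this hlim]
  filter_upwards [eventually_gt_atTop X] with t ht
  have := hconst t ht
  rw [div_eq_one_iff_eq (hX t (le_of_lt ht)).1.1.ne'] at this
  exact this.symm

/-- The choice operator returns a genuine solution as soon as one is exhibited, here by means of
Tricomi's function. -/
theorem whittakerW (h : IsWhittakerW κ m w) : IsWhittakerW κ m (PolyHam.whittakerW κ m) :=
  Classical.epsilon_spec (p := IsWhittakerW κ m) ⟨w, h⟩

theorem whittakerW_eq (h : IsWhittakerW κ m w) {x : ℝ} (hx : 0 < x) :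
    PolyHam.whittakerW κ m x = w x :=
  h.whittakerW.eq_of_pos h hx

end PolyHam.IsWhittakerW

variable {A B x : ℝ}

/-- Tricomi's function `U(A, A + B + 1, x)`, for `A > -1`. -/
noncomputable def tricomiU (A B x : ℝ) : ℝ :=
  (x * tricomiInt (A + 1) B x - B * tricomiInt (A + 1) (B - 1) x) / Real.Gamma (A + 1)

/-- The formula for `tricomiU` is the integral for `U` after one integration by parts, so it makes
sense for `A > -1`. Its derivative is `-A U(A+1, ·)`, by the same integration by parts at `A + 1`.
-/
theorem hasDerivAt_tricomiU (hA : -1 < A) (B : ℝ) (hx : 0 < x) :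
    HasDerivAt (tricomiU A B) (-(A * tricomiInt (A + 1) B x / Real.Gamma (A + 1))) x := by
  have hA' : 0 < A + 1 := by linarith
  have h := (((hasDerivAt_id x).mul (hasDerivAt_tricomiInt hA' B hx)).sub
    ((hasDerivAt_tricomiInt hA' (B - 1) hx).const_mul B)).div_const (Real.Gamma (A + 1))
  refine h.congr_deriv ?_
  have := tricomiInt_parts hA' B hx
  simp only [id]
  rw [← neg_div]
  congr 1
  linear_combination this

theorem tendsto_rpow_mul_tricomiU (hA : -1 < A) (B : ℝ) :
    Tendsto (fun x => x ^ A * tricomiU A B x) atTop (𝓝 1) := by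
  have hA' : 0 < A + 1 := by linarith
  have hG := (Real.Gamma_pos_of_pos hA').ne'
  have h1 := tendsto_rpow_mul_tricomiInt hA' B
  have h2 := ((tendsto_rpow_mul_tricomiInt hA' (B - 1)).mul tendsto_inv_atTop_zero).const_mul B
  have h := (h1.sub h2).div_const (Real.Gamma (A + 1))
  rw [mul_zero, mul_zero, sub_zero, div_self hG] at h
  refine h.congr' ?_
  filter_upwards [eventually_gt_atTop 0] with x hx
  rw [tricomiU, Real.rpow_add_one hx.ne']
  field_simp

/-- With `p = (A+B+1)/2` one has `m² - 1/4 = p² - p` and `κ = p - A`, and removing the factor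
`e^{-x/2} x^p` turns Whittaker's equation into the recurrence from `tricomiInt_parts`. Only `m²`
enters, so the sign of `m` is free. -/
theorem isWhittakerW_tricomi (hA : -1 < A) {κ m : ℝ} (hκ : κ = (B + 1 - A) / 2)
    (hm : m ^ 2 = ((A + B) / 2) ^ 2) :
    IsWhittakerW κ m fun x => Real.exp (-x / 2) * x ^ ((A + B + 1) / 2) * tricomiU A B x := by
  have hA' : 0 < A + 1 := by linarith
  have hG := (Real.Gamma_pos_of_pos hA').ne'
  set p := (A + B + 1) / 2 with hp
  refine ⟨⟨fun x => Real.exp (-x / 2) * x ^ p * ((-1 / 2 + p / x) * tricomiU A B x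
    + -(A * tricomiInt (A + 1) B x / Real.Gamma (A + 1))), fun x hx => ?_⟩, ?_⟩
  · have hx' : 0 < x := hx
    have hg : HasDerivAt (fun x : ℝ => Real.exp (-x / 2) * x ^ p)
        (Real.exp (-x / 2) * x ^ p * (-1 / 2 + p / x)) x := by
      refine ((((hasDerivAt_neg x).div_const 2).exp).mul
        (Real.hasDerivAt_rpow_const (Or.inl hx'.ne'))).congr_deriv ?_
      rw [Real.rpow_sub_one hx'.ne']
      ring
    have hJ := hasDerivAt_tricomiU hA B hx'
    refine ⟨(hg.mul hJ).congr_deriv (by ring), ?_⟩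
    have hl : HasDerivAt (fun x : ℝ => -1 / 2 + p / x) (-(p / x ^ 2)) x := by
      refine (((hasDerivAt_inv hx'.ne').const_mul p).const_add (-1 / 2)).congr_deriv ?_
      ring
    have hT := ((hasDerivAt_tricomiInt hA' B hx').const_mul A).div_const (Real.Gamma (A + 1))
    refine (hg.mul ((hl.mul hJ).add hT.neg)).congr_deriv ?_
    have h3 := tricomiInt_parts hA' B hx'
    rw [tricomiInt_succ_sub_one hA' B hx'] at h3
    simp only [Pi.mul_apply, Pi.add_apply, Pi.neg_apply, tricomiU]
    generalize tricomiInt (A + 1 + 1) B x = T2 at *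
    generalize tricomiInt (A + 1) B x = T1 at *
    generalize tricomiInt (A + 1) (B - 1) x = T0 at *
    generalize Real.exp (-x / 2) * x ^ p = g
    have hm' : m ^ 2 - 1 / 4 = p ^ 2 - p := by rw [hm, hp]; ring
    have hκ' : κ = p - A := by rw [hκ, hp]; ring
    rw [hm', hκ']
    field_simp
    have h4 : x * T2 = 2 * p * T1 - B * T0 := by rw [hp]; linear_combination -h3
    linear_combination (16 * g * x * A) * h4
  · refine (tendsto_rpow_mul_tricomiU hA B).congr' ?_
    filter_upwards [eventually_gt_atTop 0] with x hx
    have : x ^ p = x ^ κ * x ^ A := by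
      rw [← Real.rpow_add hx]; congr 1; rw [hκ, hp]; ring
    rw [this]
    field_simp

/-- Tricomi's function is positive on `(0, ∞)` for `A ≥ 0`. -/
theorem tricomiU_pos (hA : 0 ≤ A) (B : ℝ) (hx : 0 < x) : 0 < tricomiU A B x := by
  have hA' : -1 < A := by linarith
  -- The asymptotics give positivity far out, and since `A ≥ 0` the function is nonincreasing, so
  -- positivity propagates to the left.
  have h := (tendsto_rpow_mul_tricomiU hA' B).eventually (lt_mem_nhds one_pos)
  obtain ⟨y, hy, hxy⟩ := (h.and (eventually_gt_atTop x)).exists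
  have hy0 : 0 < y := hx.trans hxy
  have hpos : 0 < tricomiU A B y := (pos_iff_pos_of_mul_pos hy).1 (by positivity)
  refine hpos.trans_le ?_
  refine antitoneOn_of_deriv_nonpos (convex_Ioi 0)
    (fun t ht => (hasDerivAt_tricomiU hA' B ht).continuousAt.continuousWithinAt)
    (fun t ht => ?_) (fun t ht => ?_) hx hy0 hxy.le
  · rw [interior_Ioi] at ht
    exact (hasDerivAt_tricomiU hA' B ht).differentiableAt.differentiableWithinAt
  · rw [interior_Ioi] at ht
    rw [(hasDerivAt_tricomiU hA' B ht).deriv, neg_nonpos]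
    have := tricomiInt_nonneg (A := A + 1) (B := B) (x := t)
    have := Real.Gamma_pos_of_pos (by linarith : 0 < A + 1)
    positivity

end Whittaker

/-! ### Reciprocal beta densities as two-sided Laplace transforms -/

section TricomiLaplace

variable {A D s : ℝ}

theorem moebius_integrand (hs : s ∈ Set.Ioo (0 : ℝ) 1) {t : ℝ} (ht : 0 < t) :
    |(1 - s) * s / (s + t) ^ 2| • (((1 - s) * t / (s + t)) ^ (A - 1)
      * (1 - (1 - s) * t / (s + t)) ^ (D - 1))
      = ((1 - s) ^ A * s ^ D) * (t ^ (A - 1) * (1 + t) ^ (D - 1) * (s + t) ^ (-(A + D))) := by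
  have h0 := hs.1
  have h1 : 0 < 1 - s := by linarith [hs.2]
  have hst : 0 < s + t := by positivity
  have h1t : 0 < 1 + t := by positivity
  rw [abs_of_pos (by positivity), smul_eq_mul,
    show 1 - (1 - s) * t / (s + t) = s * (1 + t) / (s + t) by field_simp; ring,
    Real.div_rpow (by positivity) hst.le, Real.div_rpow (by positivity) hst.le,
    Real.mul_rpow h1.le ht.le, Real.mul_rpow h0.le h1t.le, Real.rpow_sub_one h1.ne',
    Real.rpow_sub_one h0.ne', Real.rpow_neg hst.le, Real.rpow_add hst,
    Real.rpow_sub_one hst.ne' A, Real.rpow_sub_one hst.ne' D]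
  field_simp

theorem moebius_image (hs : s ∈ Set.Ioo (0 : ℝ) 1) :
    (fun t => (1 - s) * t / (s + t)) '' Set.Ioi 0 = Set.Ioo 0 (1 - s) := by
  have h0 := hs.1
  have h1 : 0 < 1 - s := by linarith [hs.2]
  ext u
  simp only [Set.mem_image, Set.mem_Ioi, Set.mem_Ioo]
  constructor
  · rintro ⟨t, ht, rfl⟩
    have hst : 0 < s + t := by positivity
    exact ⟨by positivity, by rw [div_lt_iff₀ hst]; nlinarith [mul_pos h1 h0]⟩
  · rintro ⟨hu, hu1⟩
    have : 0 < 1 - s - u := by linarith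
    refine ⟨s * u / (1 - s - u), by positivity, ?_⟩
    have h2 : s + s * u / (1 - s - u) = s * (1 - s) / (1 - s - u) := by field_simp; ring
    rw [h2]
    field_simp

theorem hasDerivAt_moebius (hs : 0 < s) {t : ℝ} (ht : 0 < t) :
    HasDerivAt (fun t => (1 - s) * t / (s + t)) ((1 - s) * s / (s + t) ^ 2) t := by
  have hst : s + t ≠ 0 := by positivity
  refine (((hasDerivAt_id t).const_mul (1 - s)).div ((hasDerivAt_id t).const_add s)
    hst).congr_deriv ?_
  simp only [id]
  ring

theorem moebius_injOn (hs : s ∈ Set.Ioo (0 : ℝ) 1) :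
    Set.InjOn (fun t => (1 - s) * t / (s + t)) (Set.Ioi 0) := fun x hx y hy h => by
  have hx : 0 < x := hx
  have hy : 0 < y := hy
  have h0 := hs.1
  have h1 : 0 < 1 - s := by linarith [hs.2]
  have hsx : s + x ≠ 0 := by positivity
  have hsy : s + y ≠ 0 := by positivity
  simp only [div_eq_div_iff hsx hsy] at h
  refine mul_left_cancel₀ (mul_pos h1 h0).ne' ?_
  linear_combination h

/-- The substitution `u = (1 - s) t / (s + t)` turns an incomplete beta integral into an integral
over the half line. -/
theorem integral_moebius (hA : 0 < A) (hD : 0 < D) (hs : s ∈ Set.Ioo (0 : ℝ) 1) :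
    IntegrableOn (fun t : ℝ => t ^ (A - 1) * (1 + t) ^ (D - 1) * (s + t) ^ (-(A + D))) (Set.Ioi 0)
    ∧ ∫ t in Set.Ioi (0 : ℝ), t ^ (A - 1) * (1 + t) ^ (D - 1) * (s + t) ^ (-(A + D))
      = s ^ (-D) * (1 - s) ^ (-A) * ∫ u in Set.Ioo 0 (1 - s), u ^ (A - 1) * (1 - u) ^ (D - 1) := by
  have h0 := hs.1
  have h1 : 0 < 1 - s := by linarith [hs.2]
  have hd : ∀ t ∈ Set.Ioi (0 : ℝ), HasDerivWithinAt (fun t => (1 - s) * t / (s + t))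
      ((1 - s) * s / (s + t) ^ 2) (Set.Ioi 0) t := fun t ht =>
    (hasDerivAt_moebius h0 ht).hasDerivWithinAt
  have hc : (1 - s) ^ A * s ^ D ≠ 0 := by positivity
  have hi := (integrableOn_image_iff_integrableOn_abs_deriv_smul measurableSet_Ioi hd
    (moebius_injOn hs) (fun u => u ^ (A - 1) * (1 - u) ^ (D - 1))).1 (by
      rw [moebius_image hs]
      exact (integrableOn_beta hA hD).mono_set (Set.Ioo_subset_Ioo_right (by linarith)))
  have he := integral_image_eq_integral_abs_deriv_smul measurableSet_Ioi hd
    (moebius_injOn hs) (fun u => u ^ (A - 1) * (1 - u) ^ (D - 1))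
  rw [moebius_image hs] at he
  constructor
  · have := (hi.congr_fun (fun t ht => moebius_integrand hs ht) measurableSet_Ioi).const_mul
      ((1 - s) ^ A * s ^ D)⁻¹
    simp only [inv_mul_cancel_left₀ hc] at this
    exact this
  · rw [he, setIntegral_congr_fun measurableSet_Ioi (fun t ht => moebius_integrand hs ht),
      integral_const_mul, Real.rpow_neg h0.le, Real.rpow_neg h1.le]
    field_simp

/-- The reflection `u ↦ 1 - u` turns the second integral into the missing piece over `(1 - s, 1)`.
-/
theorem incomplete_beta_add (hA : 0 < A) (hD : 0 < D) (hs : s ∈ Set.Ioo (0 : ℝ) 1) :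
    (∫ u in Set.Ioo 0 (1 - s), u ^ (A - 1) * (1 - u) ^ (D - 1))
      + ∫ u in Set.Ioo 0 s, u ^ (D - 1) * (1 - u) ^ (A - 1)
      = Real.Gamma A * Real.Gamma D / Real.Gamma (A + D) := by
  have h0 := hs.1
  have h1 : 0 < 1 - s := by linarith [hs.2]
  have hi := (intervalIntegrable_iff_integrableOn_Ioo_of_le zero_le_one).2 (integrableOn_beta hA hD)
  rw [← integral_beta hA hD, ← integral_Ioc_eq_integral_Ioo, ← integral_Ioc_eq_integral_Ioo,
    ← integral_Ioc_eq_integral_Ioo, ← intervalIntegral.integral_of_le h1.le,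
    ← intervalIntegral.integral_of_le h0.le, ← intervalIntegral.integral_of_le zero_le_one]
  have h := intervalIntegral.integral_comp_sub_left (a := 0) (b := s)
    (fun u : ℝ => u ^ (A - 1) * (1 - u) ^ (D - 1)) 1
  simp only [sub_sub_cancel, sub_zero] at h
  rw [← intervalIntegral.integral_add_adjacent_intervals (a := 0) (b := 1 - s) (c := 1)
    (hi.mono_set (by rw [Set.uIcc_of_le h1.le, Set.uIcc_of_le zero_le_one]
                     exact Set.Icc_subset_Icc_right (by linarith)))
    (hi.mono_set (by rw [Set.uIcc_of_le (by linarith), Set.uIcc_of_le zero_le_one]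
                     exact Set.Icc_subset_Icc_left h1.le)), ← h]
  simp_rw [mul_comm]

/-- Integrating over `x` first gives `Γ(A+D) (s+t)^{-(A+D)}`; what remains is the integral over `t`
treated by the Möbius substitution. Positivity justifies the exchange. -/
theorem laplace_tricomiInt (hA : 0 < A) (hD : 0 < D) (hs : s ∈ Set.Ioo (0 : ℝ) 1) :
    IntegrableOn (fun x : ℝ => Real.exp (-(s * x)) * (x ^ (A + D - 1) * tricomiInt A (D - 1) x))
      (Set.Ioi 0)
    ∧ ∫ x in Set.Ioi (0 : ℝ), Real.exp (-(s * x)) * (x ^ (A + D - 1) * tricomiInt A (D - 1) x)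
      = Real.Gamma (A + D) * (s ^ (-D) * (1 - s) ^ (-A)
        * ∫ u in Set.Ioo 0 (1 - s), u ^ (A - 1) * (1 - u) ^ (D - 1)) := by
  have h0 := hs.1
  set f : ℝ → ℝ → ℝ := fun t x => t ^ (A - 1) * (1 + t) ^ (D - 1)
    * (x ^ (A + D - 1) * Real.exp (-((s + t) * x))) with hf
  have hx : ∀ t ∈ Set.Ioi (0 : ℝ), ∫ x in Set.Ioi (0 : ℝ), f t x
      = Real.Gamma (A + D) * (t ^ (A - 1) * (1 + t) ^ (D - 1) * (s + t) ^ (-(A + D))) :=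
    fun t ht => by
      have ht : 0 < t := ht
      rw [hf, integral_const_mul, Real.integral_rpow_mul_exp_neg_mul_Ioi (by positivity)
        (by positivity), one_div, Real.inv_rpow (by positivity), Real.rpow_neg (by positivity)]
      ring
  have hpos : ∀ t ∈ Set.Ioi (0 : ℝ), ∀ x ∈ Set.Ioi (0 : ℝ), 0 ≤ f t x := fun t ht x hx => by
    have ht : 0 < t := ht
    have hx : 0 < x := hx
    simp only [hf]
    positivity
  have hprod : Integrable (Function.uncurry f)
      ((volume.restrict (Set.Ioi (0 : ℝ))).prod (volume.restrict (Set.Ioi (0 : ℝ)))) := by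
    refine (integrable_prod_iff (by fun_prop)).2 ⟨?_, ?_⟩
    · filter_upwards [ae_restrict_mem measurableSet_Ioi] with t ht
      have ht : 0 < t := ht
      have := integrableOn_rpow_mul_exp (A := A + D) (x := s + t) (by positivity) (by positivity)
      simp only [neg_mul] at this
      exact Integrable.const_mul this (t ^ (A - 1) * (1 + t) ^ (D - 1))
    · refine ((integral_moebius hA hD hs).1.const_mul (Real.Gamma (A + D))).congr ?_
      filter_upwards [ae_restrict_mem measurableSet_Ioi] with t ht
      rw [← hx t ht]
      exact setIntegral_congr_fun measurableSet_Ioi fun x hx =>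
        (Real.norm_of_nonneg (hpos t ht x hx)).symm
  have hin : ∀ x : ℝ, ∫ t in Set.Ioi (0 : ℝ), f t x
      = Real.exp (-(s * x)) * (x ^ (A + D - 1) * tricomiInt A (D - 1) x) := fun x => by
    rw [tricomiInt, ← integral_const_mul, ← integral_const_mul]
    refine integral_congr_ae (ae_of_all _ fun t => ?_)
    simp only [hf]
    rw [show -((s + t) * x) = -(s * x) + -x * t by ring, Real.exp_add]
    ring
  constructor
  · have := hprod.integral_prod_right
    simp only [Function.uncurry] at this
    simp only [hin] at this
    exact this
  · have := integral_integral_swap hprod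
    simp only [hin] at this
    rw [← this, setIntegral_congr_fun measurableSet_Ioi hx, integral_const_mul,
      (integral_moebius hA hD hs).2]

/-- The two-sided Laplace transform of `k₁(x)` (`x > 0`), `k₂(-x)` (`x < 0`), suitably rescaled, is
the reciprocal of the density of the beta distribution. -/
def IsBetaLaplacePair (A D : ℝ) (k₁ k₂ : ℝ → ℝ) : Prop :=
  ∀ s ∈ Set.Ioo (0 : ℝ) 1,
    IntegrableOn (fun x => Real.exp (-(s * x)) * k₁ x) (Set.Ioi 0) ∧
    IntegrableOn (fun x => Real.exp (-((1 - s) * x)) * k₂ x) (Set.Ioi 0) ∧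
    (∫ x in Set.Ioi (0 : ℝ), Real.exp (-(s * x)) * k₁ x)
      + ∫ x in Set.Ioi (0 : ℝ), Real.exp (-((1 - s) * x)) * k₂ x = s ^ (-D) * (1 - s) ^ (-A)

namespace IsBetaLaplacePair

variable {k₁ k₂ l₁ l₂ : ℝ → ℝ}

theorem symm (h : IsBetaLaplacePair A D k₁ k₂) : IsBetaLaplacePair D A k₂ k₁ := fun s hs => by
  obtain ⟨h1, h2, h3⟩ := h (1 - s) ⟨by linarith [hs.2], by linarith [hs.1]⟩
  rw [sub_sub_cancel] at h2 h3
  exact ⟨h2, h1, by rw [add_comm, h3, mul_comm]⟩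

theorem congr (h : IsBetaLaplacePair A D k₁ k₂) (h₁ : ∀ x > 0, l₁ x = k₁ x)
    (h₂ : ∀ x > 0, l₂ x = k₂ x) : IsBetaLaplacePair A D l₁ l₂ := fun s hs => by
  obtain ⟨i1, i2, i3⟩ := h s hs
  have e1 : Set.EqOn (fun x => Real.exp (-(s * x)) * k₁ x)
    (fun x => Real.exp (-(s * x)) * l₁ x) (Set.Ioi 0) := fun x hx => by simp only [h₁ x hx]
  have e2 : Set.EqOn (fun x => Real.exp (-((1 - s) * x)) * k₂ x)
    (fun x => Real.exp (-((1 - s) * x)) * l₂ x) (Set.Ioi 0) := fun x hx => by simp only [h₂ x hx]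
  exact ⟨i1.congr_fun e1 measurableSet_Ioi, i2.congr_fun e2 measurableSet_Ioi, by
    rw [← setIntegral_congr_fun measurableSet_Ioi e1, ← setIntegral_congr_fun measurableSet_Ioi e2,
      i3]⟩

/-- Multiplying `s^{-D} (1-s)^{-(A+1)}` by `1 - s` subtracts the same expression with `D - 1`. This
lowers `A` by one, past the range where the integral representation converges. -/
theorem sub (h : IsBetaLaplacePair (A + 1) D k₁ k₂) (h' : IsBetaLaplacePair (A + 1) (D - 1) l₁ l₂) :
    IsBetaLaplacePair A D (fun x => k₁ x - l₁ x) fun x => k₂ x - l₂ x := fun s hs => by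
  obtain ⟨i1, i2, i3⟩ := h s hs
  obtain ⟨j1, j2, j3⟩ := h' s hs
  have h0 : s ≠ 0 := hs.1.ne'
  have h1 : 1 - s ≠ 0 := by linarith [hs.2]
  simp only [mul_sub]
  refine ⟨i1.sub j1, i2.sub j2, ?_⟩
  rw [integral_sub i1 j1, integral_sub i2 j2]
  have e1 : s ^ (-(D - 1)) = s ^ (-D) * s := by rw [← Real.rpow_add_one h0]; congr 1; ring
  have e2 : (1 - s) ^ (-A) = (1 - s) ^ (-(A + 1)) * (1 - s) := by
    rw [← Real.rpow_add_one h1]; congr 1; ring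
  rw [e1] at j3
  rw [e2]
  linear_combination i3 - j3

end IsBetaLaplacePair

/-- The two half-line transforms are incomplete beta integrals with the common prefactor `Γ(A+D)
s^{-D} (1-s)^{-A}`. They add up to the complete integral, and all Gamma factors cancel. -/
theorem isBetaLaplacePair_tricomiInt (hA : 0 < A) (hD : 0 < D) :
    IsBetaLaplacePair A D
      (fun x => x ^ (A + D - 1) * tricomiInt A (D - 1) x / (Real.Gamma A * Real.Gamma D))
      (fun x => x ^ (D + A - 1) * tricomiInt D (A - 1) x / (Real.Gamma D * Real.Gamma A)) :=
  fun s hs => by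
    have hs' : 1 - s ∈ Set.Ioo (0 : ℝ) 1 := ⟨by linarith [hs.2], by linarith [hs.1]⟩
    obtain ⟨i1, e1⟩ := laplace_tricomiInt hA hD hs
    obtain ⟨i2, e2⟩ := laplace_tricomiInt hD hA hs'
    simp only [← mul_div_assoc]
    refine ⟨i1.div_const _, i2.div_const _, ?_⟩
    rw [integral_div, integral_div, e1, e2, sub_sub_cancel]
    have h := incomplete_beta_add hA hD hs
    have g1 := Real.Gamma_pos_of_pos hA
    have g2 := Real.Gamma_pos_of_pos hD
    have g3 := Real.Gamma_pos_of_pos (by positivity : 0 < A + D)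
    rw [eq_div_iff g3.ne'] at h
    rw [add_comm D A]
    field_simp
    linear_combination (s ^ (-D) * (1 - s) ^ (-A)) * h

/-- At `D = 1` the convention `1 / Γ(0) = 0` is the right one: both sides vanish. -/
theorem sub_one_div_Gamma (D : ℝ) : (D - 1) / Real.Gamma D = 1 / Real.Gamma (D - 1) := by
  rcases eq_or_ne D 1 with rfl | h
  · simp
  · have h1 : D - 1 ≠ 0 := sub_ne_zero.2 h
    have := Real.Gamma_add_one h1
    rw [sub_add_cancel] at this
    rw [this, div_mul_eq_div_div, div_self h1]

/-- The reproducing weight of the beta distribution on the half line `x > 0`, up to scaling. -/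
noncomputable def tricomiKernel (A D x : ℝ) : ℝ :=
  x ^ (A + D - 1) * tricomiU A (D - 1) x / Real.Gamma D

theorem tricomiKernel_of_pos (hA : 0 < A) {x : ℝ} (hx : 0 < x) : tricomiKernel A D x
    = x ^ (A + D - 1) * tricomiInt A (D - 1) x / (Real.Gamma A * Real.Gamma D) := by
  have := tricomiInt_parts hA (D - 1) hx
  rw [tricomiKernel, tricomiU, ← this, add_sub_cancel_right, Real.Gamma_add_one hA.ne',
    mul_div_mul_left _ _ hA.ne']
  ring

/-- The two terms in the definition of `tricomiU` are the kernels for `(A+1, D)` and `(A+1, D-1)`,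
so the kernel has the shape required by `IsBetaLaplacePair.sub`. -/
theorem tricomiKernel_eq_sub (A D : ℝ) {x : ℝ} (hx : 0 < x) : tricomiKernel A D x
    = x ^ (A + 1 + D - 1) * tricomiInt (A + 1) (D - 1) x / (Real.Gamma (A + 1) * Real.Gamma D)
    - x ^ (A + 1 + (D - 1) - 1) * tricomiInt (A + 1) (D - 1 - 1) x
      / (Real.Gamma (A + 1) * Real.Gamma (D - 1)) := by
  have h := sub_one_div_Gamma D
  rw [tricomiKernel, tricomiU, show A + 1 + D - 1 = A + D - 1 + 1 by ring,
    show A + 1 + (D - 1) - 1 = A + D - 1 by ring, Real.rpow_add_one hx.ne']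
  simp only [div_eq_mul_inv, mul_inv] at h ⊢
  linear_combination (-(x ^ (A + D - 1) * tricomiInt (A + 1) (D - 1 - 1) x
    * (Real.Gamma (A + 1))⁻¹)) * h

/-- The companion on the other half line. Here the first parameters `D` and `D - 1` are positive,
and the identity is an integration by parts. -/
theorem tricomiKernel_eq_sub' (A : ℝ) (hD : 1 < D) {x : ℝ} (hx : 0 < x) : tricomiKernel D A x
    = x ^ (D + (A + 1) - 1) * tricomiInt D (A + 1 - 1) x / (Real.Gamma D * Real.Gamma (A + 1))
    - x ^ (D - 1 + (A + 1) - 1) * tricomiInt (D - 1) (A + 1 - 1) x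
      / (Real.Gamma (D - 1) * Real.Gamma (A + 1)) := by
  have hD1 : 0 < D - 1 := by linarith
  have h := tricomiInt_parts hD1 A hx
  have h1 := sub_one_div_Gamma (A + 1)
  have h2 := sub_one_div_Gamma D
  rw [add_sub_cancel_right] at h1
  rw [sub_add_cancel] at h
  rw [tricomiKernel_of_pos (by linarith) hx, show D + (A + 1) - 1 = D + A - 1 + 1 by ring,
    show D - 1 + (A + 1) - 1 = D + A - 1 by ring, Real.rpow_add_one hx.ne', add_sub_cancel_right]
  simp only [div_eq_mul_inv, mul_inv, one_mul] at h1 h2 ⊢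
  rw [← h1, ← h2]
  linear_combination (x ^ (D + A - 1) * (Real.Gamma D)⁻¹ * (Real.Gamma (A + 1))⁻¹) * h

/-- If `A ≤ 0` then `A + D > 1` forces `D > 1`, and the difference identity applies; `D ≤ 0` is
symmetric, and for `A, D > 0` the integral representation holds directly. -/
theorem isBetaLaplacePair_tricomiKernel (hA : -1 < A) (hD : -1 < D) (hAD : 1 < A + D) :
    IsBetaLaplacePair A D (tricomiKernel A D) (tricomiKernel D A) := by
  have key : ∀ A D : ℝ, -1 < A → 1 < D → 1 < A + D →
      IsBetaLaplacePair A D (tricomiKernel A D) (tricomiKernel D A) := fun A D hA hD hAD =>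
    ((isBetaLaplacePair_tricomiInt (by linarith : 0 < A + 1) (by linarith : 0 < D)).sub
      (isBetaLaplacePair_tricomiInt (by linarith : 0 < A + 1) (by linarith : 0 < D - 1))).congr
      (fun x hx => tricomiKernel_eq_sub A D hx) fun x hx => tricomiKernel_eq_sub' A hD hx
  rcases le_or_gt A 0 with h | h
  · exact key A D hA (by linarith) hAD
  rcases le_or_gt D 0 with h' | h'
  · exact (key D A hD (by linarith) (by linarith)).symm
  · exact (isBetaLaplacePair_tricomiInt h h').congr (fun x hx => tricomiKernel_of_pos h hx)
      fun x hx => tricomiKernel_of_pos h' hx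

end TricomiLaplace

/-! ### The Jacobi weight -/

section JacobiWeight

variable {C₀ a b μ ν : ℝ}

theorem PolyHam.IsPiecewiseContinuous.of_continuousOn_Ioi_Iio {w f g : ℝ → ℝ} {l r : ℝ}
    (hf : ∀ y > 0, w y = f y) (hg : ∀ y < 0, w y = g y) (hfc : ContinuousOn f (Set.Ioi 0))
    (hgc : ContinuousOn g (Set.Iio 0)) (hr : Tendsto f (𝓝[>] 0) (𝓝 r))
    (hl : Tendsto g (𝓝[<] 0) (𝓝 l)) : IsPiecewiseContinuous w Set.univ := by
  have hc : ∀ y ≠ 0, ContinuousAt w y := fun y hy => by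
    rcases lt_or_gt_of_ne hy with h | h
    · refine (hgc.continuousAt (Iio_mem_nhds h)).congr ?_
      filter_upwards [Iio_mem_nhds h] with z hz using (hg z hz).symm
    · refine (hfc.continuousAt (Ioi_mem_nhds h)).congr ?_
      filter_upwards [Ioi_mem_nhds h] with z hz using (hf z hz).symm
  refine ⟨fun K _ _ => (Set.finite_singleton (0 : ℝ)).subset fun y hy => ?_, fun y _ => ?_⟩
  · by_contra h
    exact hy.2 (hc y h)
  · rcases eq_or_ne y 0 with rfl | h
    · refine ⟨⟨l, hl.congr' ?_⟩, ⟨r, hr.congr' ?_⟩⟩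
      · filter_upwards [self_mem_nhdsWithin] with z hz using (hg z hz).symm
      · filter_upwards [self_mem_nhdsWithin] with z hz using (hf z hz).symm
    · exact ⟨⟨w y, (hc y h).tendsto.mono_left nhdsWithin_le_nhds⟩,
        ⟨w y, (hc y h).tendsto.mono_left nhdsWithin_le_nhds⟩⟩

theorem jacobi_weight_const (hC : 0 < C₀) {ω : ℝ} (hω : ω ∈ Set.Ioo a b) :
    jacobiDensity C₀ a b μ ν ω * (2 / C₀ * (b - a) ^ (3 - μ - ν) * (1 / (2 * (b - a))
      * (((b - ω) / (b - a)) ^ (-(ν - 1)) * (1 - (b - ω) / (b - a)) ^ (-(μ - 1))))) = 1 := by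
  have h1 : 0 < b - ω := by linarith [hω.2]
  have h2 : 0 < ω - a := by linarith [hω.1]
  have h3 : 0 < b - a := by linarith
  have e : 1 - (b - ω) / (b - a) = (ω - a) / (b - a) := by field_simp; ring
  rw [e, jacobiDensity, Real.div_rpow h1.le h3.le, Real.div_rpow h2.le h3.le,
    Real.rpow_neg h1.le, Real.rpow_neg h2.le, Real.rpow_neg h3.le, Real.rpow_neg h3.le,
    show 3 - μ - ν = 1 - (μ - 1) - (ν - 1) by ring, Real.rpow_sub h3, Real.rpow_sub h3,
    Real.rpow_one]
  field_simp

/-- Split at `y = 0` and put `x = 2(b-a)|y|`, `s = (b-ω)/(b-a)`. Then `2yω - 2by = -sx` for `y > 0`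
and `2yω - 2ay = -(1-s)x` for `y < 0`, and the sum of both transforms is `1/ρ` up to the explicit
constant. -/
theorem IsBetaLaplacePair.solvesWeightEq {k₁ k₂ w : ℝ → ℝ}
    (h : IsBetaLaplacePair (μ - 1) (ν - 1) k₁ k₂) (hC : 0 < C₀) (hab : a < b)
    (h₁ : ∀ y > 0, w y = 2 / C₀ * (b - a) ^ (3 - μ - ν)
      * (Real.exp (-(2 * b * y)) * k₁ (2 * (b - a) * y)))
    (h₂ : ∀ y < 0, w y = 2 / C₀ * (b - a) ^ (3 - μ - ν)
      * (Real.exp (-(2 * a * y)) * k₂ (-(2 * (b - a) * y)))) :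
    SolvesWeightEq (jacobiDensity C₀ a b μ ν) (Set.Ioo a b) Set.univ w := by
  intro ω hω
  have h3 : 0 < b - a := by linarith
  have h3' : 0 < 1 / (2 * (b - a)) := by positivity
  set s := (b - ω) / (b - a) with hs
  obtain ⟨i1, i2, e⟩ := h s ⟨div_pos (by linarith [hω.2]) h3,
    (div_lt_one h3).2 (by linarith [hω.1])⟩
  set c := 2 / C₀ * (b - a) ^ (3 - μ - ν) with hc
  have p1 : Set.EqOn (fun x => w (1 / (2 * (b - a)) * x + 0)
      * Real.exp (2 * (1 / (2 * (b - a)) * x + 0) * ω))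
      (fun x => c * (Real.exp (-(s * x)) * k₁ x)) (Set.Ioi 0) := fun x hx => by
    have hx : 0 < x := hx
    simp only
    rw [h₁ _ (by positivity), show 2 * (b - a) * (1 / (2 * (b - a)) * x + 0) = x by field_simp; ring,
      show -(s * x) = -(2 * b * (1 / (2 * (b - a)) * x + 0))
        + 2 * (1 / (2 * (b - a)) * x + 0) * ω by rw [hs]; field_simp; ring, Real.exp_add]
    ring
  have p2 : Set.EqOn (fun x => w (-(1 / (2 * (b - a))) * x + 0)
      * Real.exp (2 * (-(1 / (2 * (b - a))) * x + 0) * ω))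
      (fun x => c * (Real.exp (-((1 - s) * x)) * k₂ x)) (Set.Ioi 0) := fun x hx => by
    have hx : 0 < x := hx
    simp only
    rw [h₂ _ (by nlinarith [mul_pos h3' hx]),
      show -(2 * (b - a) * (-(1 / (2 * (b - a))) * x + 0)) = x by field_simp; ring,
      show -((1 - s) * x) = -(2 * a * (-(1 / (2 * (b - a))) * x + 0))
        + 2 * (-(1 / (2 * (b - a))) * x + 0) * ω by rw [hs]; field_simp; ring, Real.exp_add]
    ring
  have j1 : IntegrableOn (fun y => w y * Real.exp (2 * y * ω)) (Set.Ioi 0) := by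
    rw [← image_affine_Ioi_zero_of_pos h3', integrableOn_image_affine h3'.ne' measurableSet_Ioi]
    exact IntegrableOn.congr_fun (Integrable.const_mul i1 c) p1.symm measurableSet_Ioi
  have j2 : IntegrableOn (fun y => w y * Real.exp (2 * y * ω)) (Set.Iio 0) := by
    rw [← image_affine_Ioi_zero_of_neg (neg_lt_zero.2 h3'),
      integrableOn_image_affine (neg_lt_zero.2 h3').ne measurableSet_Ioi]
    exact IntegrableOn.congr_fun (Integrable.const_mul i2 c) p2.symm measurableSet_Ioi
  have j2' : IntegrableOn (fun y => w y * Real.exp (2 * y * ω)) (Set.Iic 0) :=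
    (integrableOn_Iic_iff_integrableOn_Iio (by simp)).2 j2
  have q1 : ∫ y in Set.Ioi (0 : ℝ), w y * Real.exp (2 * y * ω)
      = 1 / (2 * (b - a)) * (c * ∫ x in Set.Ioi (0 : ℝ), Real.exp (-(s * x)) * k₁ x) := by
    rw [← image_affine_Ioi_zero_of_pos h3', setIntegral_image_affine h3'.ne' measurableSet_Ioi,
      integral_smul, setIntegral_congr_fun measurableSet_Ioi p1, integral_const_mul, abs_of_pos h3',
      smul_eq_mul, image_affine_Ioi_zero_of_pos h3']
  have q2 : ∫ y in Set.Iic (0 : ℝ), w y * Real.exp (2 * y * ω)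
      = 1 / (2 * (b - a)) * (c * ∫ x in Set.Ioi (0 : ℝ), Real.exp (-((1 - s) * x)) * k₂ x) := by
    rw [integral_Iic_eq_integral_Iio, ← image_affine_Ioi_zero_of_neg (neg_lt_zero.2 h3'),
      setIntegral_image_affine (neg_lt_zero.2 h3').ne measurableSet_Ioi, integral_smul,
      setIntegral_congr_fun measurableSet_Ioi p2, integral_const_mul, abs_neg, abs_of_pos h3',
      smul_eq_mul]
  refine ⟨?_, ?_⟩
  · rw [← Set.Iic_union_Ioi (a := (0 : ℝ))]
    exact j2'.union j1
  · rw [Measure.restrict_univ, ← intervalIntegral.integral_Iic_add_Ioi j2' j1, q1, q2, ← mul_add,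
      ← mul_add, add_comm (∫ x in Set.Ioi (0 : ℝ), _), e]
    refine Eq.trans ?_ (jacobi_weight_const hC hω (μ := μ) (ν := ν))
    rw [hc]
    ring

theorem isWhittakerW_jacobi (hμ : 0 < μ) (ν : ℝ) :
    IsWhittakerW ((ν - μ) / 2) (3 / 2 - (μ + ν) / 2) fun x =>
      Real.exp (-x / 2) * x ^ ((μ - 1 + (ν - 1 - 1) + 1) / 2) * tricomiU (μ - 1) (ν - 1 - 1) x :=
  isWhittakerW_tricomi (by linarith) (by ring) (by ring)

theorem jacobiWeight_factor (hab : a < b) (hμ : 0 < μ) {x : ℝ} (hx : 0 < x) :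
    (b - a) ^ (1 - (μ + ν) / 2) / Real.Gamma (ν - 1) * (x / (b - a)) ^ ((μ + ν) / 2 - 2)
      * whittakerW ((ν - μ) / 2) (3 / 2 - (μ + ν) / 2) x
      = (b - a) ^ (3 - μ - ν) * (Real.exp (-x / 2) * tricomiKernel (μ - 1) (ν - 1) x) := by
  have h3 : 0 < b - a := by linarith
  rw [(isWhittakerW_jacobi hμ ν).whittakerW_eq hx, tricomiKernel, Real.div_rpow hx.le h3.le,
    show 3 - μ - ν = 1 - (μ + ν) / 2 - ((μ + ν) / 2 - 2) by ring, Real.rpow_sub h3 _ (_ - 2),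
    show μ - 1 + (ν - 1) - 1 = (μ + ν) / 2 - 2 + (μ - 1 + (ν - 1 - 1) + 1) / 2 by ring,
    Real.rpow_add hx]
  ring

theorem jacobiWeight_of_pos (hab : a < b) (hμ : 0 < μ) {y : ℝ} (hy : 0 < y) :
    jacobiWeight C₀ a b μ ν y = 2 / C₀ * (b - a) ^ (3 - μ - ν)
      * (Real.exp (-(2 * b * y)) * tricomiKernel (μ - 1) (ν - 1) (2 * (b - a) * y)) := by
  have h3 : 0 < b - a := by linarith
  have h := jacobiWeight_factor (ν := ν) hab hμ (by positivity : 0 < 2 * (b - a) * y)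
  rw [show 2 * (b - a) * y / (b - a) = 2 * y by field_simp] at h
  rw [jacobiWeight, if_pos hy, show -(2 * b * y) = -((b + a) * y) + -(2 * (b - a) * y) / 2 by ring,
    Real.exp_add]
  linear_combination (2 / C₀ * Real.exp (-((b + a) * y))) * h

theorem jacobiWeight_of_neg (hab : a < b) (hν : 0 < ν) {y : ℝ} (hy : y < 0) :
    jacobiWeight C₀ a b μ ν y = 2 / C₀ * (b - a) ^ (3 - μ - ν)
      * (Real.exp (-(2 * a * y)) * tricomiKernel (ν - 1) (μ - 1) (-(2 * (b - a) * y))) := by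
  have h3 : 0 < b - a := by linarith
  have hy' : 0 < -y := by linarith
  have h := jacobiWeight_factor (ν := μ) hab hν
    (by nlinarith [mul_pos h3 hy'] : 0 < -(2 * (b - a) * y))
  rw [show -(2 * (b - a) * y) / (b - a) = -(2 * y) by field_simp, add_comm ν μ,
    show 3 - ν - μ = 3 - μ - ν by ring] at h
  rw [jacobiWeight, if_neg hy.not_gt, if_pos hy,
    show -(2 * a * y) = -((b + a) * y) + - -(2 * (b - a) * y) / 2 by ring, Real.exp_add]
  linear_combination (2 / C₀ * Real.exp (-((b + a) * y))) * h

theorem continuousOn_tricomiKernel {A : ℝ} (hA : -1 < A) (D : ℝ) :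
    ContinuousOn (tricomiKernel A D) (Set.Ioi 0) := fun x hx => by
  have hx : 0 < x := hx
  refine ContinuousAt.continuousWithinAt (ContinuousAt.div_const (ContinuousAt.mul
    (Real.continuousAt_rpow_const _ _ (Or.inl hx.ne')) ?_) _)
  exact (hasDerivAt_tricomiU hA _ hx).continuousAt

/-- The difference form is used because `A` may be nonpositive. Its terms have finite limits since
the exponents `A + D` and `A + D - 1` are positive; for the weight this is the condition `μ + ν >
3`. -/
theorem tendsto_tricomiKernel_zero {A D : ℝ} (hA : -1 < A) (hAD : 1 < A + D) :
    ∃ l, Tendsto (tricomiKernel A D) (𝓝[>] 0) (𝓝 l) := by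
  have hA' : 0 < A + 1 := by linarith
  have h1 := (tendsto_rpow_add_mul_tricomiInt (B := D - 1) hA' (by linarith)).div_const
    (Real.Gamma (A + 1) * Real.Gamma D)
  have h2 := (tendsto_rpow_add_mul_tricomiInt (B := D - 1 - 1) hA' (by linarith)).div_const
    (Real.Gamma (A + 1) * Real.Gamma (D - 1))
  refine ⟨_, (h1.sub h2).congr' ?_⟩
  filter_upwards [self_mem_nhdsWithin] with x hx
  rw [tricomiKernel_eq_sub A D hx, show A + 1 + D - 1 = A + 1 + (D - 1) by ring,
    show A + 1 + (D - 1 - 1) = A + 1 + (D - 1) - 1 by ring]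

theorem tricomiKernel_nonneg {A D x : ℝ} (hA : 0 ≤ A) (hD : 0 ≤ D) (hx : 0 < x) :
    0 ≤ tricomiKernel A D x := by
  have := tricomiU_pos hA (D - 1) hx
  have := Real.Gamma_nonneg_of_nonneg hD
  unfold tricomiKernel
  positivity

theorem isPiecewiseContinuous_jacobiWeight (hab : a < b) (hμ : 0 < μ) (hν : 0 < ν)
    (hμν : 3 < μ + ν) : IsPiecewiseContinuous (jacobiWeight C₀ a b μ ν) Set.univ := by
  have h3 : 0 < b - a := by linarith
  obtain ⟨r, hr⟩ := tendsto_tricomiKernel_zero (A := μ - 1) (D := ν - 1) (by linarith) (by linarith)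
  obtain ⟨l, hl⟩ := tendsto_tricomiKernel_zero (A := ν - 1) (D := μ - 1) (by linarith) (by linarith)
  have m1 : Tendsto (fun y : ℝ => 2 * (b - a) * y) (𝓝[>] 0) (𝓝[>] 0) := by
    refine tendsto_nhdsWithin_iff.2 ⟨?_, ?_⟩
    · exact Continuous.tendsto' (by fun_prop) _ _ (by simp) |>.mono_left nhdsWithin_le_nhds
    · filter_upwards [self_mem_nhdsWithin] with y hy
      have hy : 0 < y := hy
      exact (by positivity : 0 < 2 * (b - a) * y)
  have m2 : Tendsto (fun y : ℝ => -(2 * (b - a) * y)) (𝓝[<] 0) (𝓝[>] 0) := by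
    refine tendsto_nhdsWithin_iff.2 ⟨?_, ?_⟩
    · exact Continuous.tendsto' (by fun_prop) _ _ (by simp) |>.mono_left nhdsWithin_le_nhds
    · filter_upwards [self_mem_nhdsWithin] with y hy
      have hy : y < 0 := hy
      exact neg_pos.2 (mul_neg_of_pos_of_neg (by positivity) hy)
  have ht : ∀ (c : ℝ) (F : Filter ℝ), F ≤ 𝓝 0 →
      Tendsto (fun y : ℝ => Real.exp (-(2 * c * y))) F (𝓝 1) := fun c F hF =>
    (Continuous.tendsto' (by fun_prop) _ _ (by simp)).mono_left hF
  refine IsPiecewiseContinuous.of_continuousOn_Ioi_Iio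
    (fun y hy => jacobiWeight_of_pos hab hμ hy) (fun y hy => jacobiWeight_of_neg hab hν hy)
    (continuousOn_const.mul ((by fun_prop : Continuous fun y : ℝ =>
      Real.exp (-(2 * b * y))).continuousOn.mul ?_))
    (continuousOn_const.mul ((by fun_prop : Continuous fun y : ℝ =>
      Real.exp (-(2 * a * y))).continuousOn.mul ?_))
    (((ht b _ nhdsWithin_le_nhds).mul (hr.comp m1)).const_mul _)
    (((ht a _ nhdsWithin_le_nhds).mul (hl.comp m2)).const_mul _)
  · refine (continuousOn_tricomiKernel (by linarith) _).comp (by fun_prop) fun y hy => ?_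
    have hy : 0 < y := hy
    exact (by positivity : 0 < 2 * (b - a) * y)
  · refine (continuousOn_tricomiKernel (by linarith) _).comp (by fun_prop) fun y hy => ?_
    have hy : y < 0 := hy
    exact neg_pos.2 (mul_neg_of_pos_of_neg (by positivity) hy)

theorem solvesWeightEq_jacobiWeight (hC : 0 < C₀) (hab : a < b) (hμ : 0 < μ) (hν : 0 < ν)
    (hμν : 3 < μ + ν) :
    SolvesWeightEq (jacobiDensity C₀ a b μ ν) (Set.Ioo a b) Set.univ (jacobiWeight C₀ a b μ ν) :=
  (isBetaLaplacePair_tricomiKernel (by linarith) (by linarith) (by linarith)).solvesWeightEq hC hab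
    (fun _ hy => jacobiWeight_of_pos hab hμ hy) fun _ hy => jacobiWeight_of_neg hab hν hy

theorem isTheWeight_jacobi (hC : 0 < C₀) (hab : a < b) (hμ : 0 < μ) (hν : 0 < ν)
    (hμν : 3 < μ + ν) :
    IsTheWeight (jacobiDensity C₀ a b μ ν) (Set.Ioo a b) Set.univ (jacobiWeight C₀ a b μ ν) :=
  isTheWeight_of_solves (c := (a + b) / 2) (δ := (b - a) / 2) (by linarith)
    (Set.Ioo_subset_Ioo (by linarith) (by linarith)) isOpen_univ
    (isPiecewiseContinuous_jacobiWeight hab hμ hν hμν)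
    (solvesWeightEq_jacobiWeight hC hab hμ hν hμν)

theorem isReproducing_jacobi_of_solves (hC : 0 < C₀) (hab : a < b) (hμ : 0 < μ) (hν : 0 < ν)
    {w : ℝ → ℝ} (hw : SolvesWeightEq (jacobiDensity C₀ a b μ ν) (Set.Ioo a b) Set.univ w)
    (hw0 : ∀ y, 0 ≤ w y) : IsReproducing (jacobiMeasure C₀ a b μ ν) Set.univ w := by
  have := isReproducing_of_solves measurable_jacobiDensity measurableSet_Ioo
    (fun ω hω => jacobiDensity_nonneg hC hω) MeasurableSet.univ hw (Set.nonempty_Ioo.2 hab)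
    (fun y _ => hw0 y) fun y _ => integrable_jacobiMeasure hC hab hμ hν (by fun_prop)
  simpa [jacobiMeasure] using this

/-- Only the sign of the weight is at issue: `μ, ν ≥ 1` makes both kernel parameters nonnegative,
where Tricomi's function is positive and the Gamma factors are nonnegative. -/
theorem isReproducing_jacobiWeight (hC : 0 < C₀) (hab : a < b) (hμν : 3 < μ + ν) (hμ : 1 ≤ μ)
    (hν : 1 ≤ ν) : IsReproducing (jacobiMeasure C₀ a b μ ν) Set.univ (jacobiWeight C₀ a b μ ν) := by
  have h3 : 0 < b - a := by linarith
  have hμ0 : 0 < μ := by linarith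
  have hν0 : 0 < ν := by linarith
  refine isReproducing_jacobi_of_solves hC hab hμ0 hν0
    (solvesWeightEq_jacobiWeight hC hab hμ0 hν0 hμν) fun y => ?_
  rcases lt_trichotomy y 0 with hy | rfl | hy
  · have hy' : 0 < -(2 * (b - a) * y) := neg_pos.2 (mul_neg_of_pos_of_neg (by positivity) hy)
    have := tricomiKernel_nonneg (sub_nonneg.2 hν) (sub_nonneg.2 hμ) hy'
    rw [jacobiWeight_of_neg hab hν0 hy]
    positivity
  · simp [jacobiWeight]
  · have := tricomiKernel_nonneg (x := 2 * (b - a) * y) (sub_nonneg.2 hμ) (sub_nonneg.2 hν)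
      (by positivity)
    rw [jacobiWeight_of_pos hab hμ0 hy]
    positivity

end JacobiWeight

/-! ### The modified Bessel function as a Whittaker function -/

section Bessel

variable {α x : ℝ}

theorem cosh_eq_one_add_sinh_sq (t : ℝ) : Real.cosh t = 1 + 2 * Real.sinh (t / 2) ^ 2 := by
  have h := Real.cosh_two_mul (t / 2)
  rw [mul_div_cancel₀ t two_ne_zero, Real.cosh_sq] at h
  linarith

theorem one_add_sq_le_cosh (t : ℝ) : 1 + t ^ 2 / 2 ≤ Real.cosh t := by
  rw [cosh_eq_one_add_sinh_sq]
  have h : (t / 2) ^ 2 ≤ Real.sinh (t / 2) ^ 2 := by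
    rcases le_total 0 (t / 2) with h | h
    · exact pow_le_pow_left₀ h (Real.self_le_sinh_iff.2 h) 2
    · have := Real.self_le_sinh_iff.2 (neg_nonneg.2 h)
      rw [Real.sinh_neg] at this
      nlinarith
  linarith

theorem cosh_le_exp_abs (t : ℝ) : Real.cosh t ≤ Real.exp |t| := by
  rw [← Real.cosh_abs, Real.cosh_eq]
  have : Real.exp (-|t|) ≤ Real.exp |t| := Real.exp_le_exp.2 (by linarith [abs_nonneg t])
  linarith

theorem abs_sinh_le_exp_abs (t : ℝ) : |Real.sinh t| ≤ Real.exp |t| := by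
  refine le_trans ?_ (cosh_le_exp_abs t)
  rw [abs_le]
  have h1 := Real.exp_pos t
  have h2 := Real.exp_pos (-t)
  constructor <;> rw [Real.sinh_eq, Real.cosh_eq] <;> linarith

/-- Continuous functions of at most exponential growth on the half line. -/
def IsExpBounded (g : ℝ → ℝ) : Prop :=
  Continuous g ∧ ∃ M c : ℝ, ∀ t > 0, |g t| ≤ M * Real.exp (c * t)

namespace IsExpBounded

variable {g h : ℝ → ℝ}

theorem mul (hg : IsExpBounded g) (hh : IsExpBounded h) : IsExpBounded fun t => g t * h t := by
  obtain ⟨cg, M, c, hM⟩ := hg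
  obtain ⟨ch, N, d, hN⟩ := hh
  refine ⟨cg.mul ch, M * N, c + d, fun t ht => ?_⟩
  rw [abs_mul, add_mul, Real.exp_add, mul_mul_mul_comm]
  exact mul_le_mul (hM t ht) (hN t ht) (abs_nonneg _) ((abs_nonneg _).trans (hM t ht))

theorem cosh_mul (α : ℝ) : IsExpBounded fun t => Real.cosh (α * t) := by
  refine ⟨by fun_prop, 1, |α|, fun t ht => ?_⟩
  rw [one_mul, abs_of_pos (Real.cosh_pos _), ← abs_of_pos ht, ← abs_mul, abs_of_pos ht]
  exact cosh_le_exp_abs _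

theorem sinh_mul (α : ℝ) : IsExpBounded fun t => Real.sinh (α * t) := by
  refine ⟨by fun_prop, 1, |α|, fun t ht => ?_⟩
  rw [one_mul, ← abs_of_pos ht, ← abs_mul, abs_of_pos ht]
  exact abs_sinh_le_exp_abs _

theorem cosh : IsExpBounded Real.cosh := by simpa using cosh_mul 1

theorem sinh : IsExpBounded Real.sinh := by simpa using sinh_mul 1

theorem integrableOn_gaussian {ε : ℝ} (hε : 0 < ε) (hg : IsExpBounded g) :
    IntegrableOn (fun t => g t * Real.exp (-(ε * t ^ 2))) (Set.Ioi 0) := by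
  obtain ⟨cg, M, c, hM⟩ := hg
  have hM0 : 0 ≤ M := by
    have := (abs_nonneg _).trans (hM 1 one_pos)
    exact nonneg_of_mul_nonneg_left this (Real.exp_pos _)
  -- The constant comes from completing the square: `(c+1)t - εt² ≤ (c+1)²/(4ε)`, which leaves a
  -- factor `e^{-t}`.
  refine ((integrableOn_exp_neg_Ioi 0).const_mul
    (M * Real.exp ((c + 1) ^ 2 / (4 * ε)))).mono' (by fun_prop) ?_
  filter_upwards [ae_restrict_mem measurableSet_Ioi] with t ht
  rw [norm_mul, Real.norm_eq_abs, Real.norm_of_nonneg (Real.exp_pos _).le]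
  calc |g t| * Real.exp (-(ε * t ^ 2)) ≤ M * Real.exp (c * t) * Real.exp (-(ε * t ^ 2)) := by
        gcongr
        exact hM t ht
    _ ≤ M * Real.exp ((c + 1) ^ 2 / (4 * ε)) * Real.exp (-t) := by
        rw [mul_assoc, mul_assoc, ← Real.exp_add, ← Real.exp_add]
        refine mul_le_mul_of_nonneg_left (Real.exp_le_exp.2 ?_) hM0
        have : 0 ≤ (2 * ε * t - (c + 1)) ^ 2 / (4 * ε) := by positivity
        have e : (2 * ε * t - (c + 1)) ^ 2 / (4 * ε)
            = ε * t ^ 2 - (c + 1) * t + (c + 1) ^ 2 / (4 * ε) := by field_simp; ring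
        linarith

theorem integrableOn (hg : IsExpBounded g) (hx : 0 < x) :
    IntegrableOn (fun t => g t * Real.exp (-x * Real.cosh t)) (Set.Ioi 0) := by
  have hc := hg.1
  refine Integrable.mono (hg.integrableOn_gaussian (half_pos hx)) (by fun_prop) (ae_of_all _ fun t => ?_)
  rw [norm_mul, norm_mul, Real.norm_of_nonneg (Real.exp_pos _).le,
    Real.norm_of_nonneg (Real.exp_pos _).le]
  gcongr
  have := one_add_sq_le_cosh t
  nlinarith

theorem hasDerivAt (hg : IsExpBounded g) (hx : 0 < x) :
    HasDerivAt (fun x => ∫ t in Set.Ioi (0 : ℝ), g t * Real.exp (-x * Real.cosh t))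
      (-∫ t in Set.Ioi (0 : ℝ), g t * Real.cosh t * Real.exp (-x * Real.cosh t)) x := by
  have hc := hg.1
  have hi := ((hg.mul cosh).integrableOn (half_pos hx)).norm
  have h := (hasDerivAt_integral_of_dominated_loc_of_deriv_le (𝕜 := ℝ)
    (μ := volume.restrict (Set.Ioi (0 : ℝ)))
    (F := fun x t => g t * Real.exp (-x * Real.cosh t))
    (F' := fun x t => -(g t * Real.cosh t * Real.exp (-x * Real.cosh t)))
    (bound := fun t => ‖g t * Real.cosh t * Real.exp (-(x / 2) * Real.cosh t)‖)
    (Ioi_mem_nhds (half_lt_self hx)) (Eventually.of_forall fun x => by fun_prop)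
    (hg.integrableOn hx) (by fun_prop) ?_ hi ?_).2
  · rw [integral_neg] at h
    exact h
  · refine ae_of_all _ fun t y hy => ?_
    have hy : x / 2 < y := hy
    rw [norm_neg, norm_mul, norm_mul _ (Real.exp _), Real.norm_of_nonneg (Real.exp_pos _).le,
      Real.norm_of_nonneg (Real.exp_pos _).le]
    have := Real.cosh_pos t
    gcongr
  · refine ae_of_all _ fun t y hy => ?_
    refine ((((hasDerivAt_neg y).mul_const (Real.cosh t)).exp).const_mul (g t)).congr_deriv ?_
    ring

end IsExpBounded

theorem besselK_nonneg (α x : ℝ) : 0 ≤ besselK α x :=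
  setIntegral_nonneg measurableSet_Ioi fun t _ => by
    have := Real.cosh_pos (α * t)
    positivity

theorem besselK_eq (α x : ℝ) :
    besselK α x = ∫ t in Set.Ioi (0 : ℝ), Real.cosh (α * t) * Real.exp (-x * Real.cosh t) := by
  simp_rw [besselK, mul_comm]

/-- Bessel's differential equation. -/
theorem besselK_parts (α : ℝ) (hx : 0 < x) :
    x ^ 2 * (∫ t in Set.Ioi (0 : ℝ),
      Real.cosh (α * t) * Real.cosh t * Real.cosh t * Real.exp (-x * Real.cosh t))
      = (x ^ 2 + α ^ 2) * besselK α x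
        + x * ∫ t in Set.Ioi (0 : ℝ), Real.cosh (α * t) * Real.cosh t
          * Real.exp (-x * Real.cosh t) := by
  have i0 := (IsExpBounded.cosh_mul α).integrableOn hx
  have i1 := ((IsExpBounded.cosh_mul α).mul IsExpBounded.cosh).integrableOn hx
  have i2 := (((IsExpBounded.cosh_mul α).mul IsExpBounded.cosh).mul IsExpBounded.cosh).integrableOn hx
  have j1 := ((IsExpBounded.cosh_mul α).mul IsExpBounded.sinh).integrableOn hx
  have j2 := (IsExpBounded.sinh_mul α).integrableOn hx
  -- The antiderivative is chosen so that its derivative is Bessel's equation under the integral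
  -- sign; it vanishes at `t = 0` because of the hyperbolic sines.
  have hd : ∀ t ∈ Set.Ioi (0 : ℝ), HasDerivAt
      (fun t => -x * (Real.cosh (α * t) * Real.sinh t * Real.exp (-x * Real.cosh t))
        - α * (Real.sinh (α * t) * Real.exp (-x * Real.cosh t)))
      (x ^ 2 * (Real.cosh (α * t) * Real.cosh t * Real.cosh t * Real.exp (-x * Real.cosh t))
        - ((x ^ 2 + α ^ 2) * (Real.cosh (α * t) * Real.exp (-x * Real.cosh t))
        + x * (Real.cosh (α * t) * Real.cosh t * Real.exp (-x * Real.cosh t)))) t := fun t _ => by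
    have hα := (hasDerivAt_id t).const_mul α
    have hE := ((Real.hasDerivAt_cosh t).const_mul (-x)).exp
    have h1 := (((hα.cosh).mul (Real.hasDerivAt_sinh t)).mul hE).const_mul (-x)
    have h2 := ((hα.sinh).mul hE).const_mul α
    refine (h1.sub h2).congr_deriv ?_
    simp only [id, Pi.mul_apply]
    linear_combination (-x ^ 2 * Real.cosh (α * t) * Real.exp (-x * Real.cosh t)) * Real.cosh_sq t
  have hint := (i2.const_mul (x ^ 2)).sub ((i0.const_mul (x ^ 2 + α ^ 2)).add (i1.const_mul x))
  have h0 := tendsto_zero_of_hasDerivAt_of_integrableOn_Ioi hd hint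
    ((j1.const_mul (-x)).sub (j2.const_mul α))
  have h := integral_Ioi_of_hasDerivAt_of_tendsto
    (Continuous.continuousWithinAt (by fun_prop)) hd hint h0
  rw [integral_sub (i2.const_mul _) (by exact (i0.const_mul (x ^ 2 + α ^ 2)).add (i1.const_mul x)),
    integral_add (i0.const_mul _) (i1.const_mul _), integral_const_mul, integral_const_mul,
    integral_const_mul] at h
  simp only [mul_zero, Real.sinh_zero, zero_mul, sub_zero] at h
  rw [besselK_eq]
  linarith

theorem tendsto_mul_cosh_sub_one (u : ℝ) :
    Tendsto (fun z : ℝ => z * (Real.cosh ((√z)⁻¹ * u) - 1)) atTop (𝓝 (u ^ 2 / 2)) := by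
  have hd : HasDerivAt (fun r : ℝ => Real.sinh (r * (u / 2))) (u / 2) 0 := by
    refine ((hasDerivAt_mul_const (u / 2)).sinh).congr_deriv ?_
    simp
  have hr : Tendsto (fun z : ℝ => (√z)⁻¹) atTop (𝓝[≠] 0) := by
    refine tendsto_nhdsWithin_iff.2 ⟨tendsto_inv_atTop_zero.comp Real.tendsto_sqrt_atTop, ?_⟩
    filter_upwards [eventually_gt_atTop 0] with z hz
    exact (inv_pos.2 (Real.sqrt_pos.2 hz)).ne'
  have h := ((hd.tendsto_slope_zero.comp hr).pow 2).const_mul 2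
  rw [show 2 * (u / 2) ^ 2 = u ^ 2 / 2 by ring] at h
  refine h.congr' ?_
  filter_upwards [eventually_gt_atTop 0] with z hz
  have hs : 0 < √z := Real.sqrt_pos.2 hz
  simp only [Function.comp, zero_add, zero_mul, Real.sinh_zero, sub_zero, inv_inv, smul_eq_mul]
  rw [cosh_eq_one_add_sinh_sq, mul_pow, Real.sq_sqrt hz.le, mul_div_assoc]
  ring

/-- Laplace's method: with `t = u/√z` the exponent tends to `-u²/2`, and `cosh t ≥ 1 + t²/2` gives a
Gaussian majorant. -/
theorem sqrt_mul_exp_mul_besselK (α : ℝ) {z : ℝ} (hz : 0 < z) :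
    √z * Real.exp z * besselK α z = ∫ u in Set.Ioi (0 : ℝ),
      Real.cosh (α * ((√z)⁻¹ * u)) * Real.exp (-(z * (Real.cosh ((√z)⁻¹ * u) - 1))) := by
  have hs : 0 < √z := Real.sqrt_pos.2 hz
  have h := integral_comp_mul_left_Ioi (fun t : ℝ => Real.cosh (α * t)
    * Real.exp (-(z * (Real.cosh t - 1)))) 0 (inv_pos.2 hs)
  rw [mul_zero, inv_inv, smul_eq_mul] at h
  rw [h, besselK_eq, mul_assoc, ← integral_const_mul]
  congr 1
  refine integral_congr_ae (ae_of_all _ fun t => ?_)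
  simp only
  rw [show -(z * (Real.cosh t - 1)) = z + -z * Real.cosh t by ring, Real.exp_add]
  ring

theorem tendsto_sqrt_mul_exp_mul_besselK (α : ℝ) :
    Tendsto (fun z => √z * Real.exp z * besselK α z) atTop (𝓝 √(Real.pi / 2)) := by
  have h : Tendsto (fun z : ℝ => ∫ u in Set.Ioi (0 : ℝ),
      Real.cosh (α * ((√z)⁻¹ * u)) * Real.exp (-(z * (Real.cosh ((√z)⁻¹ * u) - 1)))) atTop
      (𝓝 (∫ u in Set.Ioi (0 : ℝ), Real.exp (-(1 / 2) * u ^ 2))) := by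
    refine tendsto_integral_filter_of_dominated_convergence
      (fun u => Real.cosh (α * u) * Real.exp (-(1 / 2 * u ^ 2)))
      (Eventually.of_forall fun x => by fun_prop) ?_
      ((IsExpBounded.cosh_mul α).integrableOn_gaussian one_half_pos) ?_
    · filter_upwards [eventually_ge_atTop 1] with z hz
      refine ae_of_all _ fun u => ?_
      have hz0 : 0 < z := by linarith
      have hs : 1 ≤ √z := Real.one_le_sqrt.2 hz
      have hs0 : 0 < √z := by linarith
      rw [Real.norm_of_nonneg (by have := Real.cosh_pos (α * ((√z)⁻¹ * u)); positivity)]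
      have h1 : Real.cosh (α * ((√z)⁻¹ * u)) ≤ Real.cosh (α * u) := by
        rw [Real.cosh_le_cosh, mul_left_comm, abs_mul, abs_of_pos (inv_pos.2 hs0)]
        exact mul_le_of_le_one_left (abs_nonneg _) (inv_le_one_of_one_le₀ hs)
      have h2 : 1 / 2 * u ^ 2 ≤ z * (Real.cosh ((√z)⁻¹ * u) - 1) := by
        have h3 := one_add_sq_le_cosh ((√z)⁻¹ * u)
        have h4 : z * (((√z)⁻¹ * u) ^ 2 / 2) = 1 / 2 * u ^ 2 := by
          rw [mul_pow, inv_pow, Real.sq_sqrt hz0.le]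
          field_simp
        rw [← h4]
        gcongr
        linarith
      have := Real.cosh_pos (α * u)
      gcongr
    · refine ae_of_all _ fun u => ?_
      have h1 : Tendsto (fun z : ℝ => Real.cosh (α * ((√z)⁻¹ * u))) atTop (𝓝 1) := by
        have h2 : Tendsto (fun z : ℝ => α * ((√z)⁻¹ * u)) atTop (𝓝 0) := by
          simpa using (((tendsto_inv_atTop_zero.comp Real.tendsto_sqrt_atTop).mul_const u).const_mul
            α)
        exact (Real.continuous_cosh.tendsto' 0 1 Real.cosh_zero).comp h2
      have h2 := h1.mul ((Real.continuous_exp.tendsto _).comp (tendsto_mul_cosh_sub_one u).neg)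
      rw [one_mul, show -(u ^ 2 / 2) = -(1 / 2) * u ^ 2 by ring] at h2
      exact h2
  rw [integral_gaussian_Ioi, show Real.pi / (1 / 2) = 2 ^ 2 * (Real.pi / 2) by ring,
    Real.sqrt_mul (by norm_num), Real.sqrt_sq (by norm_num), mul_div_cancel_left₀ _ two_ne_zero] at h
  refine h.congr' ?_
  filter_upwards [eventually_gt_atTop 0] with z hz
  exact (sqrt_mul_exp_mul_besselK α hz).symm

/-- The factor `√x` and the argument `x/2` turn Bessel's equation into Whittaker's with `κ = 0`. The
division by `√π` adjusts the leading asymptotics to `e^{-x/2}`. -/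
theorem isWhittakerW_besselK (α : ℝ) :
    IsWhittakerW 0 α fun x => √x * besselK α (x / 2) / √Real.pi := by
  have hpi : 0 < √Real.pi := Real.sqrt_pos.2 Real.pi_pos
  set K1 : ℝ → ℝ := fun x => ∫ t in Set.Ioi (0 : ℝ), Real.cosh (α * t) * Real.cosh t
    * Real.exp (-x * Real.cosh t) with hK1
  -- `K1` is minus the derivative of the Bessel function, so this is the product rule with `1/(2√x)`
  -- rewritten as `√x/(2x)`.
  refine ⟨⟨fun x => √x * (besselK α (x / 2) / (2 * x) - K1 (x / 2) / 2) / √Real.pi,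
    fun x hx => ?_⟩, ?_⟩
  · have hx : 0 < x := hx
    have hs : 0 < √x := Real.sqrt_pos.2 hx
    have hh : HasDerivAt (fun x : ℝ => x / 2) (1 / 2) x := (hasDerivAt_id x).div_const 2
    have d0 : HasDerivAt (fun x => besselK α (x / 2)) (-K1 (x / 2) * (1 / 2)) x := by
      have := (IsExpBounded.cosh_mul α).hasDerivAt (half_pos hx)
      simp only [← besselK_eq] at this
      exact HasDerivAt.comp x this hh
    have d1 := HasDerivAt.comp x
      (((IsExpBounded.cosh_mul α).mul IsExpBounded.cosh).hasDerivAt (half_pos hx)) hh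
    have hp := besselK_parts α (half_pos hx)
    have ds := Real.hasDerivAt_sqrt hx.ne'
    have hsx : √x * √x = x := Real.mul_self_sqrt hx.le
    have e : 1 / (2 * √x) = √x / (2 * x) := by
      rw [div_eq_div_iff (by positivity) (by positivity)]
      linear_combination (-2) * hsx
    rw [e] at ds
    constructor
    · refine ((ds.mul d0).div_const _).congr_deriv ?_
      field_simp
      ring
    · have d2 := ((d0.div ((hasDerivAt_id x).const_mul 2) (by simp only [id]; positivity)).sub
        (d1.div_const 2))
      refine ((ds.mul d2).div_const _).congr_deriv ?_
      simp only [Function.comp, id, Pi.sub_apply, Pi.div_apply] at hp ⊢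
      rw [show (∫ t in Set.Ioi (0 : ℝ), Real.cosh (α * t) * Real.cosh t
        * Real.exp (-(x / 2) * Real.cosh t)) = K1 (x / 2) from rfl] at hp ⊢
      generalize K1 (x / 2) = k1 at *
      generalize besselK α (x / 2) = k0 at *
      generalize (∫ t in Set.Ioi (0 : ℝ), Real.cosh (α * t) * Real.cosh t * Real.cosh t
        * Real.exp (-(x / 2) * Real.cosh t)) = k2 at *
      field_simp at hp ⊢
      linear_combination 4 * hp
  · have h := ((tendsto_sqrt_mul_exp_mul_besselK α).comp
      (tendsto_id.atTop_div_const two_pos)).const_mul (√2 / √Real.pi)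
    rw [Real.sqrt_div Real.pi_pos.le, div_mul_div_cancel₀ hpi.ne', div_self (by positivity)] at h
    refine h.congr' ?_
    filter_upwards [eventually_gt_atTop 0] with x hx
    simp only [Function.comp, id]
    rw [Real.rpow_zero, mul_one, Real.sqrt_div hx.le, neg_div, Real.exp_neg]
    field_simp

end Bessel

/-! ### The Gegenbauer weight and the proof of the theorem -/

section Gegenbauer

variable {C₀ a b μ ν : ℝ}

/-- Both expressions give the Whittaker function with `κ = 0` and index `μ - 3/2`, which is unique
on `(0, ∞)`. -/
theorem besselK_eq_tricomiU (hμ : 0 < μ) {x : ℝ} (hx : 0 < x) :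
    besselK (μ - 3 / 2) (x / 2) = √Real.pi * x ^ (-(1 / 2) : ℝ)
      * (Real.exp (-x / 2) * x ^ (μ - 1) * tricomiU (μ - 1) (μ - 1 - 1) x) := by
  have hpi : 0 < √Real.pi := Real.sqrt_pos.2 Real.pi_pos
  have hW := isWhittakerW_tricomi (A := μ - 1) (B := μ - 1 - 1) (by linarith) (κ := 0)
    (m := μ - 3 / 2) (by ring) (by ring)
  have h := (isWhittakerW_besselK (μ - 3 / 2)).eq_of_pos hW hx
  rw [show (μ - 1 + (μ - 1 - 1) + 1) / 2 = μ - 1 by ring, Real.sqrt_eq_rpow x] at h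
  have hs : x ^ (1 / 2 : ℝ) ≠ 0 := by positivity
  rw [← h, Real.rpow_neg hx.le]
  field_simp

theorem gegenbauerWeight_eq (hab : a < b) (hμ : 0 < μ) {y : ℝ} (hy : y ≠ 0) :
    gegenbauerWeight C₀ a b μ y = 2 / C₀ * (b - a) ^ (3 - μ - μ) * (Real.exp (-((b + a) * y))
      * Real.exp (-(2 * (b - a) * |y|) / 2)
      * tricomiKernel (μ - 1) (μ - 1) (2 * (b - a) * |y|)) := by
  have h3 : 0 < b - a := by linarith
  have hy' : 0 < |y| := abs_pos.2 hy
  have hpi : 0 < √Real.pi := Real.sqrt_pos.2 Real.pi_pos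
  have hx : 0 < 2 * (b - a) * |y| := by positivity
  have hK := besselK_eq_tricomiU hμ hx
  rw [gegenbauerWeight, show (b - a) * |y| = 2 * (b - a) * |y| / 2 by ring, hK,
    show 2 * |y| / (b - a) = 2 * (b - a) * |y| / (b - a) ^ (2 : ℝ) by
      rw [Real.rpow_two]; field_simp]
  generalize 2 * (b - a) * |y| = x at *
  rw [tricomiKernel, Real.div_rpow hx.le (by positivity), ← Real.rpow_mul h3.le,
    show 3 - μ - μ = -(2 * (μ - 3 / 2)) by ring, Real.rpow_neg h3.le,
    show μ - 1 + (μ - 1) - 1 = μ - 3 / 2 + -(1 / 2) + (μ - 1) by ring, Real.rpow_add hx,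
    Real.rpow_add hx]
  field_simp

theorem gegenbauerWeight_of_pos (hab : a < b) (hμ : 0 < μ) {y : ℝ} (hy : 0 < y) :
    gegenbauerWeight C₀ a b μ y = 2 / C₀ * (b - a) ^ (3 - μ - μ)
      * (Real.exp (-(2 * b * y)) * tricomiKernel (μ - 1) (μ - 1) (2 * (b - a) * y)) := by
  rw [gegenbauerWeight_eq hab hμ hy.ne', ← Real.exp_add, abs_of_pos hy]
  congr 4
  ring

theorem gegenbauerWeight_of_neg (hab : a < b) (hμ : 0 < μ) {y : ℝ} (hy : y < 0) :
    gegenbauerWeight C₀ a b μ y = 2 / C₀ * (b - a) ^ (3 - μ - μ)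
      * (Real.exp (-(2 * a * y)) * tricomiKernel (μ - 1) (μ - 1) (-(2 * (b - a) * y))) := by
  rw [gegenbauerWeight_eq hab hμ hy.ne, ← Real.exp_add, abs_of_neg hy, mul_neg]
  congr 4
  ring

theorem jacobiWeight_eq_gegenbauerWeight (hab : a < b) (hμ : 0 < μ) {y : ℝ} (hy : y ≠ 0) :
    jacobiWeight C₀ a b μ μ y = gegenbauerWeight C₀ a b μ y := by
  rcases lt_or_gt_of_ne hy with h | h
  · rw [jacobiWeight_of_neg hab hμ h, gegenbauerWeight_of_neg hab hμ h]
  · rw [jacobiWeight_of_pos hab hμ h, gegenbauerWeight_of_pos hab hμ h]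

/-- For `μ = ν > 1` both parameters `μ - 1` are positive, so the integral representation applies
directly. The difference identity and its condition `μ + ν > 3` are not needed. -/
theorem solvesWeightEq_gegenbauerWeight (hC : 0 < C₀) (hab : a < b) (hμ : 1 < μ) :
    SolvesWeightEq (jacobiDensity C₀ a b μ μ) (Set.Ioo a b) Set.univ
      (gegenbauerWeight C₀ a b μ) := by
  have h1 : 0 < μ - 1 := by linarith
  have hμ0 : 0 < μ := by linarith
  exact ((isBetaLaplacePair_tricomiInt h1 h1).congr (fun x hx => tricomiKernel_of_pos h1 hx)
    fun x hx => tricomiKernel_of_pos h1 hx).solvesWeightEq hC hab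
    (fun _ hy => gegenbauerWeight_of_pos hab hμ0 hy) fun _ hy => gegenbauerWeight_of_neg hab hμ0 hy

theorem gegenbauerWeight_nonneg (hC : 0 < C₀) (hab : a < b) (hμ : 1 < μ) (y : ℝ) :
    0 ≤ gegenbauerWeight C₀ a b μ y := by
  have h3 : 0 < b - a := by linarith
  have := besselK_nonneg (μ - 3 / 2) ((b - a) * |y|)
  have := Real.Gamma_pos_of_pos (by linarith : 0 < μ - 1)
  unfold gegenbauerWeight
  positivity

theorem jacobi_case {b₂ : ℝ} (hC : 0 < C₀) (hab : a < b) (hb₂ : 0 < b₂) (hμ : 0 < μ)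
    (hν : 0 < ν) :
    IsSpectralSolution (jacobiH a b μ ν) (jacobiMeasure C₀ a b μ ν) Set.univ
        (jacobiS C₀ a b μ ν) (jacobiSn C₀ a b b₂ μ ν) (jacobiSmn C₀ a b b₂ μ ν) ∧
      coherentDomain (jacobiMeasure C₀ a b μ ν) = Set.univ ∧
      (3 < μ + ν →
        IsWhittakerW ((ν - μ) / 2) (3 / 2 - (μ + ν) / 2)
          (whittakerW ((ν - μ) / 2) (3 / 2 - (μ + ν) / 2)) ∧
        IsWhittakerW ((μ - ν) / 2) (3 / 2 - (μ + ν) / 2)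
          (whittakerW ((μ - ν) / 2) (3 / 2 - (μ + ν) / 2)) ∧
        IsTheWeight (jacobiDensity C₀ a b μ ν) (Set.Ioo a b) Set.univ (jacobiWeight C₀ a b μ ν) ∧
        (1 ≤ μ → 1 ≤ ν →
          IsReproducing (jacobiMeasure C₀ a b μ ν) Set.univ (jacobiWeight C₀ a b μ ν))) := by
  refine ⟨isSpectralSolution_jacobi hC hab hb₂ hμ hν, coherentDomain_eq_univ fun t =>
    integrable_jacobiMeasure hC hab hμ hν (by fun_prop), fun h => ⟨(isWhittakerW_jacobi hμ ν).whittakerW,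
    ?_, isTheWeight_jacobi hC hab hμ hν h, isReproducing_jacobiWeight hC hab h⟩⟩
  rw [add_comm μ ν]
  exact (isWhittakerW_jacobi hν μ).whittakerW

theorem gegenbauer_case (hC : 0 < C₀) (hab : a < b) (hμ : 1 < μ) :
    SolvesWeightEq (jacobiDensity C₀ a b μ μ) (Set.Ioo a b) Set.univ (gegenbauerWeight C₀ a b μ) ∧
      IsReproducing (jacobiMeasure C₀ a b μ μ) Set.univ (gegenbauerWeight C₀ a b μ) ∧
      (3 / 2 < μ → ∀ y : ℝ, y ≠ 0 →
        jacobiWeight C₀ a b μ μ y = gegenbauerWeight C₀ a b μ y) :=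
  have hμ0 : 0 < μ := by linarith
  have hw := solvesWeightEq_gegenbauerWeight hC hab hμ
  ⟨hw, isReproducing_jacobi_of_solves hC hab hμ0 hμ0 hw (gegenbauerWeight_nonneg hC hab hμ),
    fun _ _ hy => jacobiWeight_eq_gegenbauerWeight hab hμ0 hy⟩

end Gegenbauer

theorem mainTheorem5 :
    -- Hermite case
    (∀ C a₀ a₁ b₀ : ℝ, 0 < C → a₁ / b₀ < 0 →
      IsSpectralSolution (hermiteH a₀ a₁ b₀) (hermiteMeasure C a₀ a₁ b₀) Set.univ
        (hermiteS C a₀ a₁ b₀) (hermiteSn C a₀ a₁ b₀) (hermiteSmn a₀ a₁ b₀) ∧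
      coherentDomain (hermiteMeasure C a₀ a₁ b₀) = Set.univ ∧
      IsTheWeight (hermiteDensity C a₀ a₁ b₀) Set.univ Set.univ (hermiteWeight C a₀ a₁ b₀) ∧
      IsReproducing (hermiteMeasure C a₀ a₁ b₀) Set.univ (hermiteWeight C a₀ a₁ b₀)) ∧
    -- Laguerre case
    (∀ C a₀ a₁ b₀ b₁ μ : ℝ, 0 < C → a₁ / b₁ < 0 →
      μ = (a₀ * b₁ - b₀ * a₁) / b₁ ^ 2 → 0 < μ →
      IsSpectralSolution (laguerreH a₁ b₀ b₁ μ) (laguerreMeasure C a₁ b₀ b₁ μ)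
        {z : ℂ | z.im < -(a₁ / b₁)}
        (laguerreS C a₁ b₀ b₁ μ) (laguerreSn C a₁ b₀ b₁ μ) (laguerreSmn C a₁ b₀ b₁ μ) ∧
      coherentDomain (laguerreMeasure C a₁ b₀ b₁ μ) = {z : ℂ | z.im < -(a₁ / (2 * b₁))} ∧
      (1 < μ →
        IsTheWeight (laguerreDensity C a₁ b₀ b₁ μ) (Set.Ioi (-(b₀ / b₁)))
          (Set.Iio (-(a₁ / (2 * b₁)))) (laguerreWeight C a₁ b₀ b₁ μ) ∧
        IsReproducing (laguerreMeasure C a₁ b₀ b₁ μ) {z : ℂ | z.im < -(a₁ / (2 * b₁))}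
          (laguerreWeight C a₁ b₀ b₁ μ))) ∧
    -- Jacobi case
    (∀ C a b a₀ a₁ b₂ μ ν : ℝ, 0 < C → a < b → 0 < b₂ →
      μ = (a * a₁ + a₀) / (b₂ * (b - a)) → ν = (b * a₁ + a₀) / (b₂ * (a - b)) →
      0 < μ → 0 < ν →
      IsSpectralSolution (jacobiH a b μ ν) (jacobiMeasure C a b μ ν) Set.univ
        (jacobiS C a b μ ν) (jacobiSn C a b b₂ μ ν) (jacobiSmn C a b b₂ μ ν) ∧
      coherentDomain (jacobiMeasure C a b μ ν) = Set.univ ∧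
      (3 < μ + ν →
        -- the Whittaker functions in the weight are the genuine ones
        IsWhittakerW ((ν - μ) / 2) (3 / 2 - (μ + ν) / 2)
          (whittakerW ((ν - μ) / 2) (3 / 2 - (μ + ν) / 2)) ∧
        IsWhittakerW ((μ - ν) / 2) (3 / 2 - (μ + ν) / 2)
          (whittakerW ((μ - ν) / 2) (3 / 2 - (μ + ν) / 2)) ∧
        IsTheWeight (jacobiDensity C a b μ ν) (Set.Ioo a b) Set.univ (jacobiWeight C a b μ ν) ∧
        (1 ≤ μ → 1 ≤ ν →
          IsReproducing (jacobiMeasure C a b μ ν) Set.univ (jacobiWeight C a b μ ν))) ∧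
      -- Gegenbauer case
      (μ = ν → 1 < μ →
        SolvesWeightEq (jacobiDensity C a b μ μ) (Set.Ioo a b) Set.univ
          (gegenbauerWeight C a b μ) ∧
        IsReproducing (jacobiMeasure C a b μ μ) Set.univ (gegenbauerWeight C a b μ) ∧
        (3 / 2 < μ → ∀ y : ℝ, y ≠ 0 →
          jacobiWeight C a b μ μ y = gegenbauerWeight C a b μ y))) :=
  ⟨fun _ _ _ _ hC h => hermite_case hC h,
    fun _ _ _ _ _ _ hC h hμ hμ0 => laguerre_case hC h hμ hμ0,
    fun _ _ _ _ _ _ _ _ hC hab hb₂ _ _ hμ hν =>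
      have h := jacobi_case hC hab hb₂ hμ hν
      ⟨h.1, h.2.1, h.2.2, fun _ hμ1 => gegenbauer_case hC hab hμ1⟩⟩
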